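/- **Notation.** Let $1\le k\le n$. For an $n\times n$ complex matrix $A$ let $\delta_kA$ be obtained from $A$ by keeping the upper left $k\times k$ block and the diagonal and replacing all other entries by $0$; let $A^{[k]}$ be the upper left $k\times k$ submatrix, and $\mathcal D_k(A)=\{\lambda-\lambda' : \lambda,\lambda' \text{ eigenvalues of } A^{[k]}\}$ (so $\mathcal D_0(A)=\emptyset$). For $\mathcal S\subseteq\mathbb C$ put $m\mathcal S=\{d_1+\dots+d_m : d_i\in\mathcal S\}$, $0\mathcal S=\{0\}$. Write $z^{\mathrm{ad}X}Y=z^XYz^{-X}$, $[X,Y]=\mathrm{ad}_XY=XY-YX$, and let $\|\cdot\|$ be the operator norm for the Euclidean norm. Put $u_0=0$, $u_i=\sum_{l=1}^{i}z_1z_2\cdots z_l$, $u=\mathrm{diag}(u_1,\dots,u_n)$, and $(\mathrm{ad}_u^{-1}A)_{ij}=A_{ij}/(u_i-u_j)$ for $i\ne j$, $(\mathrm{ad}_u^{-1}A)_{ii}=0$. For $0\le k\le n$ the *$(k,n)$-equation* is $$\frac{\partial\Phi_k}{\partial z_j}=\big[(\mathrm{ad}_u^{-1}\mathrm{ad}_{\partial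 u/\partial z_j}-z_j^{-1})\,\delta_k\Phi_k,\ \Phi_k\big],\qquad j=1,\dots,k,$$ for a holomorphic $n\times n$ matrix valued function $\Phi_k(z_1,\dots,z_k)$, at points where $z_1,\dots,z_k\neq0$ and $u_1,\dots,u_k$ are pairwise distinct (only $u_1,\dots,u_k$ enter it; for $k=0$, $\Phi_0$ is a constant matrix). **Theorem.** Let $1\le k\le n$, let $\varepsilon>0$, and let $\Phi_{k-1}$ be a solution of the $(k-1,n)$-equation on an open set $W\subseteq\mathbb C^{k-1}$ such that $|\mathrm{Re}\,d|<1-\varepsilon$ for all $z\in W$ and $d\in\mathcal D_{k-1}(\Phi_{k-1}(z))$. Then the $(k,n)$-equation has a solution $$\Phi_k(z_1,\dots,z_k)=\sum_{m=0}^\infty z_k^{-m}\phi_{k,m}(z_k;z_1,\dots,z_{k-1}),\qquad \phi_{k,0}=z_k^{-\mathrm{ad}\,\delta_{k-1}\Phi_{k-1}}\Phi_{k-1},$$ where each $\phi_{k,m}$ is holomorphic for $(z_1,\dots,z_{k-1})\in W$ and $z_k$ in the Riemann surface of the logarithm, with the following properties. 1. *Structure.* For all $m\ge0$, $\delta_{k-1}\phi_{k,m}$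 and $z_k^{\mathrm{ad}\,\delta_{k-1}\Phi_{k-1}}\phi_{k,m}$ are finite sums $$\sum_{d\in m\mathcal D_{k-1}(\Phi_{k-1})}\ \sum_{t=0}^{2(\nu-1)m} c_{d,t}(z_1,\dots,z_{k-1})\,z_k^{d}(\ln z_k)^{t}$$ with matrix coefficients independent of $z_k$, where $\nu$ is the nilpotency index of the nilpotent part $\mathcal N$ of $\delta_{k-1}\Phi_{k-1}$ (the least $\nu$ with $\mathcal N^\nu=0$). 2. *Convergence.* Let $\delta_{k-1}\Phi_{k-1}=\mathcal S+\mathcal N$ be the Jordan–Chevalley decomposition and $\mathcal S=\sum_{i=1}^n\lambda_iP_i$ any spectral decomposition (the $P_i$ are mutually orthogonal idempotents, possibly $0$, with $\sum_iP_i=I$) in which, for $j\ge k$, $P_j=E_j$ is the diagonal matrix unit and $\lambda_j=(\Phi_{k-1})_{jj}$. Let $M>\mathrm e^{2(\nu-1)}$ and $$\varepsilon_0=(1-\varepsilon)-\max|\mathrm{Re}\,\mathcal D_{k-1}(\Phi_{k-1})|,\qquad R=\Big(\sum_{i=1}^n\|P_i\|\Big)^2\Big(\nu-\tfrac12\Big)\Big(1+(4\nu\|\mathcal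 N\|)^{2(\nu-1)}\Big)\frac1{1-\frac{2(\nu-1)}{\ln M}},$$ (for $k=1$ the maximum over the empty set is $0$), and let $U_{(k)}$ be the diagonal matrix with $i$-th entry $\frac{u_{k-1}-u_i}{u_{k-1}-u_{k-2}}$ for $1\le i\le k-2$ and $0$ for $i\ge k-1$. Then the series converges absolutely at every $z_k$ with $$|z_k|^\varepsilon>\max\Big\{2\|U_{(k)}\|\Big(1+\Big(\frac{2RB_\theta}{\varepsilon^\nu\varepsilon_0^{\nu-1}}\Big)^2\Big)\Big(1+\frac1{RB_\theta}\Big),\,M\Big\},\qquad \theta=\arg z_k,\quad B_\theta=\big\|\mathrm e^{-\mathrm i\theta\,\mathrm{ad}\,\delta_{k-1}\Phi_{k-1}}\Phi_{k-1}\big\|$$ (so $B_0=\|\Phi_{k-1}\|$; if $B_\theta=0$, read $1/(RB_\theta)$ as $0$). 3. *Solution.* The set of all $(z_1,\dots,z_{k-1},\ln z_k)$ that satisfy the condition in 2 for some choice of the $P_i$, $\lambda_i$ and $M$ is open in $W\times\mathbb C$, and on this whole set $\Phi_k$, with any continuous branch of $\ln z_k$, solves the $(k,n)$-equation in all the variables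 $z_1,\dots,z_k$. -/

import Mathlib

open scoped Matrix.Norms.L2Operator

noncomputable section

namespace Isomonodromy

/-- Complex `n × n` matrices; `‖·‖` is the operator norm for the Euclidean norm. Rows and columns
are numbered `0, …, n - 1`. -/
abbrev Mat (n : ℕ) : Type := Matrix (Fin n) (Fin n) ℂ

/-- `δ_k A`: the upper left `k × k` block of `A` together with the diagonal of `A`. -/
def delta {n : ℕ} (k : ℕ) (A : Mat n) : Mat n :=
  Matrix.of fun i j => if (i.val < k ∧ j.val < k) ∨ i = j then A i j else 0

/-- The upper left `k × k` submatrix of `A`. -/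
def upperLeft {n : ℕ} (k : ℕ) (A : Mat n) :
    Matrix {i : Fin n // i.val < k} {i : Fin n // i.val < k} ℂ :=
  A.submatrix Subtype.val Subtype.val

/-- `D_k(A)`: the set of differences of eigenvalues of the upper left `k × k` submatrix. -/
def eigDiff {n : ℕ} (k : ℕ) (A : Mat n) : Set ℂ :=
  {d | ∃ a ∈ spectrum ℂ (upperLeft k A), ∃ b ∈ spectrum ℂ (upperLeft k A), d = a - b}

/-- `m S = {d_1 + ⋯ + d_m | d_1, …, d_m ∈ S}`; in particular `0 S = {0}`. -/
def sumSet (m : ℕ) (S : Set ℂ) : Set ℂ :=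
  {x | ∃ d : Fin m → ℂ, (∀ i, d i ∈ S) ∧ x = ∑ i, d i}

/-- `ad_A X = A X - X A`. -/
def ad {n : ℕ} (A X : Mat n) : Mat n := A * X - X * A

/-- `ad_u⁻¹ A` for the diagonal matrix with entries `u`. -/
def adInv {n : ℕ} (u : Fin n → ℂ) (A : Mat n) : Mat n :=
  Matrix.of fun i j => if i = j then 0 else A i j / (u i - u j)

/-- `z ^ (ad X) Y = z ^ X Y z ^ (-X)` at a point `z` of the Riemann surface of the logarithm,
given by `w = ln z`. -/
def powAd {n : ℕ} (w : ℂ) (X Y : Mat n) : Mat n :=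
  NormedSpace.exp (w • X) * Y * NormedSpace.exp (-(w • X))

/-- The coordinates `u` as functions of `z`: with everything numbered from `0`,
`u_i = ∑_{l ≤ i} z_0 z_1 ⋯ z_l`. Only the values with `i < k` are ever used: the entries that
involve other indices are removed by `δ_k`. -/
def uCoord {k : ℕ} (z : Fin k → ℂ) (i : ℕ) : ℂ :=
  ∑ l : Fin k with l.val ≤ i, ∏ m ∈ Finset.Iic l, z m

/-- `∂u_i/∂z_j`. -/
def uCoordDeriv {k : ℕ} (z : Fin k → ℂ) (j : Fin k) (i : ℕ) : ℂ :=
  deriv (fun t => uCoord (Function.update z j t) i) (z j)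

/-- The points at which the `(k,n)`-equation makes sense: `z_j ≠ 0` and `u_1, …, u_k` distinct. -/
def Admissible {k : ℕ} (z : Fin k → ℂ) : Prop :=
  (∀ j, z j ≠ 0) ∧ ∀ i l : ℕ, i < k → l < k → i ≠ l → uCoord z i ≠ uCoord z l

/-- The operator `(ad_u⁻¹ ad_{∂u/∂z_j} - z_j⁻¹) δ_k`. -/
def opT {n k : ℕ} (z : Fin k → ℂ) (j : Fin k) (X : Mat n) : Mat n :=
  adInv (fun i => uCoord z i.val)
      (ad (Matrix.diagonal fun i => uCoordDeriv z j i.val) (delta k X))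
    - (z j)⁻¹ • delta k X

/-- `Φ` is a (holomorphic) solution of the `(k,n)`-equation on the open set `V` of points
`(z_1, …, z_k)`. For `k = 0` there are no variables and `Φ` is a constant matrix. -/
structure IsSolution (n k : ℕ) (V : Set (Fin k → ℂ)) (Φ : (Fin k → ℂ) → Mat n) : Prop where
  isOpen : IsOpen V
  admissible : ∀ z ∈ V, Admissible z
  holomorphic : DifferentiableOn ℂ Φ V
  equation : ∀ z ∈ V, ∀ j : Fin k,
    HasDerivAt (fun t => Φ (Function.update z j t)) (ad (opT z j (Φ z)) (Φ z)) (z j)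

/-- `f(z) = ∑_{d} ∑_{t = 0}^{T} c_{d,t} z ^ d (ln z) ^ t`, a finite sum with exponents `d ∈ S`
and constant matrices `c_{d,t}`, as a function of `w = ln z`. -/
def HasLogExpansion {n : ℕ} (S : Set ℂ) (T : ℕ) (f : ℂ → Mat n) : Prop :=
  ∃ s : Finset ℂ, (s : Set ℂ) ⊆ S ∧ ∃ c : ℂ → ℕ → Mat n, ∀ w : ℂ,
    f w = ∑ d ∈ s, ∑ t ∈ Finset.range (T + 1), (Complex.exp (d * w) * w ^ t) • c d t

/-- A Jordan–Chevalley decomposition `A = S + N` of `A = δ_k Φ`, with a spectral decomposition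
`S = λ_1 P_1 + ⋯ + λ_n P_n` in which `P_j = E_j` and `λ_j = A_{jj}` for the indices outside the
upper left `k × k` block. The matrices `S` and `N` are determined by `A`. -/
structure IsSpectralData {n : ℕ} (k : ℕ) (A : Mat n) (lam : Fin n → ℂ) (P : Fin n → Mat n)
    (N : Mat n) : Prop where
  orthogonal : ∀ i j, P i * P j = if i = j then P i else 0
  sum_eq_one : ∑ i, P i = 1
  decomposition : A = ∑ i, lam i • P i + N
  nilpotent : IsNilpotent N
  commute : Commute (∑ i, lam i • P i) N
  tail : ∀ j : Fin n, k ≤ j.val → P j = Matrix.single j j 1 ∧ lam j = A j j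

/-- The diagonal matrix `U_{(k+1)}`, a function of `z_1, …, z_k`: in the numbering from `1`, its
`i`-th entry is `(u_k - u_i) / (u_k - u_{k-1})` for `1 ≤ i ≤ k - 1`, and `0` for `i ≥ k`. -/
def matU (n : ℕ) {k : ℕ} (z : Fin k → ℂ) : Mat n :=
  Matrix.diagonal fun i =>
    if i.val + 1 < k then
      (uCoord z (k - 1) - uCoord z i.val) / (uCoord z (k - 1) - uCoord z (k - 2))
    else 0

/-- `ε₀ = (1 - ε) - max |Re D_k(A)|` (the maximum over the empty set, for `k = 0`, is read as `0`;
in that case `ν = 1` and `ε₀` enters only through `ε₀ ^ (ν - 1) = 1`). -/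
def eps0 {n : ℕ} (k : ℕ) (ε : ℝ) (A : Mat n) : ℝ :=
  (1 - ε) - sSup ((fun d : ℂ => |d.re|) '' eigDiff k A)

/-- The constant `R`, with `ν` the nilpotency of `N`. -/
def constR {n : ℕ} (P : Fin n → Mat n) (N : Mat n) (M : ℝ) : ℝ :=
  (∑ i, ‖P i‖) ^ 2 * ((nilpotencyClass N : ℝ) - 1 / 2)
    * (1 + (4 * (nilpotencyClass N : ℝ) * ‖N‖) ^ (2 * (nilpotencyClass N - 1)))
    * (1 / (1 - 2 * ((nilpotencyClass N : ℝ) - 1) / Real.log M))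

/-- The explicit bound for `|z_{k+1}| ^ ε`: here `R`, `ν`, `ε₀` are the constants above, `U` is the
norm of `U_{(k+1)}` and `B` the norm of the initial value. -/
def radiusBound (ε ε₀ R M U B : ℝ) (ν : ℕ) : ℝ :=
  max (2 * U * (1 + (2 * R * B / (ε ^ ν * ε₀ ^ (ν - 1))) ^ 2) * (1 + 1 / (R * B))) M

/-- The explicit region of convergence, in the variables `z = (z_1, …, z_k) ∈ W` and
`w = ln z_{k+1}`. The initial value on the ray `arg z_{k+1} = θ = Im w` is
`e ^ (-i θ ad δ_k Φ(z)) Φ(z)`, which is `Φ(z)` for `θ = 0`. -/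
def convRegion (n k : ℕ) (W : Set (Fin k → ℂ)) (Φ : (Fin k → ℂ) → Mat n) (ε : ℝ) :
    Set ((Fin k → ℂ) × ℂ) :=
  {q | q.1 ∈ W ∧ ∃ (lam : Fin n → ℂ) (P : Fin n → Mat n) (N : Mat n) (M : ℝ),
    IsSpectralData k (delta k (Φ q.1)) lam P N ∧
    Real.exp (2 * ((nilpotencyClass N : ℝ) - 1)) < M ∧
    radiusBound ε (eps0 k ε (Φ q.1)) (constR P N M) M ‖matU n q.1‖
        ‖powAd (-((q.2.im : ℂ) * Complex.I)) (delta k (Φ q.1)) (Φ q.1)‖ (nilpotencyClass N)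
      < Real.exp (ε * q.2.re)}

end Isomonodromy

end

noncomputable section
namespace Isomonodromy
open Filter Topology

variable {n : ℕ}

/-! ### The conjugation flow `powAd` -/

/-! Put x = 1/z_{k+1}, w = ln z_{k+1}, A = δ_kΦ, U = `matU`, Q = `projQ` (the first k coordinates)
and e = `unitE` (the diagonal unit of the next index). In the numbering from 1, u_{k+1} - u_i =
z_1⋯z_k (z_{k+1} + a_i), where a is the diagonal of U (`uCoord_last_sub`). Hence the equation in the
new variable is dΨ/dw = [-δ_kΨ + HΨe + eΨH, Ψ] with H = (1 + xU)⁻¹ - 1. In an old variable z_j the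
generator is TΨ + KΨe + eΨK, where T is the operator of the (k,n)-equation and K = xU'(1 + xU)⁻¹
with U' = ∂U/∂z_j (`opT_last`, `opT_castSucc`).

Coefficients. Insert Ψ = ∑ φ_m(w) x^m. The commutator with HΨe + eΨH meets the block only in [H,
QΨeΨQ] (`lmap_delta_comm`), so δ_kΨ satisfies dX/dw = [H, QΨeΨQ], and its coefficient of order m is
determined by the φ_j with j < m. What remains is φ_m' = mφ_m - [A, φ_m] + (known terms);
conjugation by z^A turns this into y' = my + h with h an exponential polynomial in w. The exponents
of h are sums of m eigenvalue differences and have real part below m. So there is no resonance, and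
exactly one solution has e^{-mw}y → 0; it is again an exponential polynomial (`IsDecaying.unique`,
`structure_all`). The same uniqueness shows that the X constructed first really is δ_k of the series
(`delta_phi`).

Old variables. The values of Φ are locally conjugate by block matrices (`exists_similarity`), so the
exponents are locally constant and the coefficients of the exponential polynomials are holomorphic.
The two generators are flat (`Multiplier.curvature`), so the defect ∂_jΨ - [S_j, Ψ], S_j being the
generator in direction z_j, solves the linearized equation in w. It vanishes in order 0, and its
exponents exclude the homogeneous solution e^{mw} in order m; hence it vanishes
(`coeff_eq_zero_of_hasTheta`, `hasTheta_ser_curve`).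

Convergence. On a ray arg z_{k+1} = θ the conjugated coefficients are bounded by B c^m α_m e^{(1-ε)m
Re w}, where α_m are the Taylor coefficients of (1 - x)^{-1/2} (`norm_powAd_phi_le`). The square of
this function is the geometric series and the partial sums of the α_b are 2mα_m; integrating y' = my
+ h gains 1/(εm), which cancels the factor m and closes the quadratic recursion. The constant c is
bounded by the explicit radius in `exists_blockBounds`. The spectral data can be transported by the
conjugating matrices, so the bound is locally uniform (`eventually_convRegion`). Termwise
differentiation then turns the formal identities into differential equations
(`isSolution_nextBranch`). -/

theorem exp_smul_add (a b : ℂ) (A : Mat n) :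
    NormedSpace.exp ((a + b) • A) = NormedSpace.exp (a • A) * NormedSpace.exp (b • A) := by
  rw [add_smul]
  exact Matrix.exp_add_of_commute _ _ (((Commute.refl A).smul_left a).smul_right b)

theorem exp_neg_mul_exp (a : ℂ) (A : Mat n) :
    NormedSpace.exp (-(a • A)) * NormedSpace.exp (a • A) = 1 := by
  have := exp_smul_add (-a) a A
  simpa using this.symm

theorem exp_mul_exp_neg (a : ℂ) (A : Mat n) :
    NormedSpace.exp (a • A) * NormedSpace.exp (-(a • A)) = 1 := by
  have := exp_smul_add a (-a) A
  simpa using this.symm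

@[simp] theorem powAd_zero_left (A Y : Mat n) : powAd 0 A Y = Y := by
  simp [powAd]

@[simp] theorem powAd_zero (w : ℂ) (A : Mat n) : powAd w A 0 = 0 := by
  simp [powAd]

theorem powAd_add (w : ℂ) (A X Y : Mat n) : powAd w A (X + Y) = powAd w A X + powAd w A Y := by
  simp [powAd, mul_add, add_mul]

theorem powAd_neg (w : ℂ) (A X : Mat n) : powAd w A (-X) = -powAd w A X := by
  simp [powAd]

theorem powAd_sub (w : ℂ) (A X Y : Mat n) : powAd w A (X - Y) = powAd w A X - powAd w A Y := by
  simp [powAd, mul_sub, sub_mul]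

theorem powAd_smul (w c : ℂ) (A X : Mat n) : powAd w A (c • X) = c • powAd w A X := by
  simp [powAd]

theorem powAd_sum {ι : Type*} (s : Finset ι) (w : ℂ) (A : Mat n) (f : ι → Mat n) :
    powAd w A (∑ i ∈ s, f i) = ∑ i ∈ s, powAd w A (f i) := by
  simp [powAd, Finset.mul_sum, Finset.sum_mul]

theorem powAd_mul (w : ℂ) (A X Y : Mat n) : powAd w A (X * Y) = powAd w A X * powAd w A Y := by
  have h := exp_neg_mul_exp w A
  calc powAd w A (X * Y)
      = NormedSpace.exp (w • A) * X * 1 * Y * NormedSpace.exp (-(w • A)) := by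
        simp [powAd, mul_assoc]
    _ = powAd w A X * powAd w A Y := by rw [← h]; simp [powAd, mul_assoc]

theorem powAd_powAd (a b : ℂ) (A X : Mat n) :
    powAd a A (powAd b A X) = powAd (a + b) A X := by
  have h1 := exp_smul_add a b A
  have h2 := exp_smul_add (-b) (-a) A
  have h3 : -b + -a = -(a + b) := by ring
  rw [h3] at h2
  simp only [neg_smul] at h2
  simp only [powAd, h1, h2, mul_assoc]

theorem powAd_commute {w : ℂ} {A X : Mat n} (h : Commute A X) : powAd w A X = X := by
  have : Commute (NormedSpace.exp (w • A)) X := (h.smul_left w).exp_left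
  rw [powAd, this.eq, mul_assoc, exp_mul_exp_neg, mul_one]

theorem powAd_neg_powAd (w : ℂ) (A X : Mat n) : powAd (-w) A (powAd w A X) = X := by
  simp [powAd_powAd]

theorem powAd_powAd_neg (w : ℂ) (A X : Mat n) : powAd w A (powAd (-w) A X) = X := by
  simp [powAd_powAd]

theorem powAd_ad (w : ℂ) (A X Y : Mat n) :
    powAd w A (ad X Y) = ad (powAd w A X) (powAd w A Y) := by
  simp [ad, powAd_sub, powAd_mul]

theorem hasDerivAt_exp_smul (A : Mat n) (w : ℂ) :
    HasDerivAt (fun w : ℂ => NormedSpace.exp (w • A)) (A * NormedSpace.exp (w • A)) w :=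
  hasDerivAt_exp_smul_const' A w

theorem hasDerivAt_exp_neg_smul (A : Mat n) (w : ℂ) :
    HasDerivAt (fun w : ℂ => NormedSpace.exp (-(w • A)))
      (-(NormedSpace.exp (-(w • A)) * A)) w := by
  have := hasDerivAt_exp_smul_const (-A) w
  simpa using this

/-- The derivative of `w ↦ powAd w A (f w)`. -/
theorem HasDerivAt.powAd {f : ℂ → Mat n} {f' : Mat n} {w : ℂ} (A : Mat n)
    (hf : HasDerivAt f f' w) :
    HasDerivAt (fun w => powAd w A (f w)) (powAd w A (ad A (f w) + f')) w := by
  have h := ((hasDerivAt_exp_smul A w).mul hf).mul (hasDerivAt_exp_neg_smul A w)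
  refine h.congr_deriv ?_
  have hc : A * NormedSpace.exp (w • A) = NormedSpace.exp (w • A) * A :=
    (((Commute.refl A).smul_right w).exp_right).eq
  have hc' : NormedSpace.exp (-(w • A)) * A = A * NormedSpace.exp (-(w • A)) :=
    (((Commute.refl A).smul_right w).neg_right.exp_right).eq.symm
  simp only [Isomonodromy.powAd, ad, hc, hc', mul_add, add_mul, mul_sub, sub_mul, mul_neg]
  simp only [mul_assoc, Pi.mul_apply]
  abel

theorem HasDerivAt.powAd_neg {f : ℂ → Mat n} {f' : Mat n} {w : ℂ} (A : Mat n)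
    (hf : HasDerivAt f f' w) :
    HasDerivAt (fun w => Isomonodromy.powAd (-w) A (f w))
      (Isomonodromy.powAd (-w) A (f' - ad A (f w))) w := by
  have h := HasDerivAt.powAd (-A) hf
  simp only [Isomonodromy.powAd, ad, smul_neg, neg_smul] at h ⊢
  refine h.congr_deriv ?_
  simp only [neg_mul, mul_neg]
  congr 2
  abel

/-- Along a curve with `A' = [τ, A]`, the exponential satisfies the same equation. -/
theorem hasDerivAt_exp_comp {A : ℂ → Mat n} {τ : Mat n} {x : ℂ}
    (hA : HasDerivAt A (ad τ (A x)) x) :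
    HasDerivAt (fun t => NormedSpace.exp (A t)) (ad τ (NormedSpace.exp (A x))) x := by
  have hd : DifferentiableAt ℂ (NormedSpace.exp : Mat n → Mat n) (A x) :=
    (NormedSpace.exp_analytic (𝕂 := ℂ) (A x)).differentiableAt
  have h1 : HasDerivAt (fun t => NormedSpace.exp (A t))
      (fderiv ℂ NormedSpace.exp (A x) (ad τ (A x))) x := hd.hasFDerivAt.comp_hasDerivAt x hA
  -- The derivative of exp ∘ A depends only on the value and the velocity of A at x. So the curve
  -- may be replaced by the conjugation orbit of A x, on which exp commutes with the motion.
  have hc : HasDerivAt (fun t : ℂ => powAd t τ (A x)) (ad τ (A x)) 0 := by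
    have := HasDerivAt.powAd τ (hasDerivAt_const (0 : ℂ) (A x))
    simpa using this
  have hd' : DifferentiableAt ℂ (NormedSpace.exp : Mat n → Mat n) (powAd 0 τ (A x)) := by
    simpa using hd
  have h2 : HasDerivAt (fun t : ℂ => NormedSpace.exp (powAd t τ (A x)))
      (fderiv ℂ NormedSpace.exp (A x) (ad τ (A x))) 0 := by
    have := hd'.hasFDerivAt.comp_hasDerivAt (0 : ℂ) hc
    rw [powAd_zero_left] at this
    exact this
  have h3 : HasDerivAt (fun t : ℂ => powAd t τ (NormedSpace.exp (A x)))
      (ad τ (NormedSpace.exp (A x))) 0 := by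
    have := HasDerivAt.powAd τ (hasDerivAt_const (0 : ℂ) (NormedSpace.exp (A x)))
    simpa using this
  have heq : (fun t : ℂ => NormedSpace.exp (powAd t τ (A x)))
      = fun t : ℂ => powAd t τ (NormedSpace.exp (A x)) := by
    funext t
    have hu : NormedSpace.exp (t • τ) * NormedSpace.exp (-(t • τ)) = 1 := exp_mul_exp_neg t τ
    have hu' := exp_neg_mul_exp t τ
    have := Matrix.exp_units_conj ⟨_, _, hu, hu'⟩ (A x)
    simpa [powAd] using this
  rw [heq] at h2
  rw [h2.unique h3] at h1
  exact h1

/-! ### Block matrices -/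

/-- The projection onto the first `k` coordinates. -/
def projQ (n k : ℕ) : Mat n := Matrix.diagonal fun i => if i.val < k then 1 else 0

/-- The diagonal matrix unit with (zero based) index `k`. -/
def unitE (n k : ℕ) : Mat n := Matrix.diagonal fun i => if i.val = k then 1 else 0

theorem projQ_mul_self (k : ℕ) : projQ n k * projQ n k = projQ n k := by
  simp [projQ]

theorem unitE_mul_self (k : ℕ) : unitE n k * unitE n k = unitE n k := by
  simp [unitE]

theorem projQ_mul_unitE (k : ℕ) : projQ n k * unitE n k = 0 := by
  rw [projQ, unitE, Matrix.diagonal_mul_diagonal, Matrix.diagonal_eq_zero]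
  funext i
  by_cases h : i.val = k <;> simp [h]

theorem unitE_mul_projQ (k : ℕ) : unitE n k * projQ n k = 0 := by
  rw [projQ, unitE, Matrix.diagonal_mul_diagonal, Matrix.diagonal_eq_zero]
  funext i
  by_cases h : i.val = k <;> simp [h]

theorem projQ_mul_apply (k : ℕ) (X : Mat n) (i j : Fin n) :
    (projQ n k * X) i j = if i.val < k then X i j else 0 := by
  simp [projQ, Matrix.diagonal_mul]

theorem mul_projQ_apply (k : ℕ) (X : Mat n) (i j : Fin n) :
    (X * projQ n k) i j = if j.val < k then X i j else 0 := by
  simp [projQ, Matrix.mul_diagonal]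

theorem unitE_mul_apply (k : ℕ) (X : Mat n) (i j : Fin n) :
    (unitE n k * X) i j = if i.val = k then X i j else 0 := by
  simp [unitE, Matrix.diagonal_mul]

theorem mul_unitE_apply (k : ℕ) (X : Mat n) (i j : Fin n) :
    (X * unitE n k) i j = if j.val = k then X i j else 0 := by
  simp [unitE, Matrix.mul_diagonal]

theorem norm_diagonal_le {v : Fin n → ℂ} {C : ℝ} (hC : 0 ≤ C) (h : ∀ i, ‖v i‖ ≤ C) :
    ‖(Matrix.diagonal v : Mat n)‖ ≤ C := by
  rw [Matrix.l2_opNorm_diagonal]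
  exact (pi_norm_le_iff_of_nonneg hC).2 h

theorem norm_projQ_le (k : ℕ) : ‖projQ n k‖ ≤ 1 := by
  refine norm_diagonal_le zero_le_one fun i => ?_
  split_ifs <;> simp

theorem norm_unitE_le (k : ℕ) : ‖unitE n k‖ ≤ 1 := by
  refine norm_diagonal_le zero_le_one fun i => ?_
  split_ifs <;> simp

theorem delta_apply (k : ℕ) (X : Mat n) (i j : Fin n) :
    delta k X i j = if (i.val < k ∧ j.val < k) ∨ i = j then X i j else 0 := rfl

/-- `delta k` as a continuous linear map. -/
def deltaL (n k : ℕ) : Mat n →L[ℂ] Mat n :=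
  LinearMap.toContinuousLinearMap
    { toFun := delta k
      map_add' := fun X Y => by ext i j; simp only [delta_apply, Matrix.add_apply]; split_ifs <;> simp
      map_smul' := fun c X => by
        ext i j; simp only [delta_apply, Matrix.smul_apply, RingHom.id_apply]; split_ifs <;> simp }

@[simp] theorem deltaL_apply (k : ℕ) (X : Mat n) : deltaL n k X = delta k X := rfl

theorem delta_add (k : ℕ) (X Y : Mat n) : delta k (X + Y) = delta k X + delta k Y :=
  (deltaL n k).map_add X Y

theorem delta_sub (k : ℕ) (X Y : Mat n) : delta k (X - Y) = delta k X - delta k Y :=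
  (deltaL n k).map_sub X Y

theorem delta_neg (k : ℕ) (X : Mat n) : delta k (-X) = -delta k X :=
  (deltaL n k).map_neg X

theorem delta_smul (k : ℕ) (c : ℂ) (X : Mat n) : delta k (c • X) = c • delta k X :=
  (deltaL n k).map_smul c X

@[simp] theorem delta_zero (k : ℕ) : delta k (0 : Mat n) = 0 := (deltaL n k).map_zero

theorem delta_sum {ι : Type*} (s : Finset ι) (k : ℕ) (f : ι → Mat n) :
    delta k (∑ i ∈ s, f i) = ∑ i ∈ s, delta k (f i) := map_sum (deltaL n k) f s

@[simp] theorem delta_delta (k : ℕ) (X : Mat n) : delta k (delta k X) = delta k X := by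
  ext i j; simp only [delta_apply]; split_ifs <;> simp

/-- The matrices in the image of `delta k`. -/
def IsBlock (k : ℕ) (X : Mat n) : Prop := delta k X = X

theorem isBlock_delta (k : ℕ) (X : Mat n) : IsBlock k (delta k X) := delta_delta k X

theorem IsBlock.apply {k : ℕ} {X : Mat n} (h : IsBlock k X) {i j : Fin n}
    (hij : ¬((i.val < k ∧ j.val < k) ∨ i = j)) : X i j = 0 := by
  rw [← h, delta_apply, if_neg hij]

/-- Block matrices are those preserving the splitting into the span of the first k coordinates and
the remaining coordinate lines, and δ_k is the projection onto this algebra, hence a bimodule map.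
This is what allows δ_k to pass through commutators and exponentials of block matrices. -/
theorem IsBlock.delta_mul {k : ℕ} {X : Mat n} (h : IsBlock k X) (Y : Mat n) :
    delta k (X * Y) = X * delta k Y := by
  ext i j
  rw [delta_apply, Matrix.mul_apply, Matrix.mul_apply]
  by_cases hi : i.val < k
  · by_cases hij : (i.val < k ∧ j.val < k) ∨ i = j
    · rw [if_pos hij]
      refine Finset.sum_congr rfl fun l _ => ?_
      by_cases hl : (i.val < k ∧ l.val < k) ∨ i = l
      · have hj : j.val < k := by
          rcases hij with h | h
          · exact h.2
          · exact h ▸ hi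
        have hl' : l.val < k := by
          rcases hl with h | h
          · exact h.2
          · exact h ▸ hi
        rw [delta_apply, if_pos (Or.inl ⟨hl', hj⟩)]
      · rw [h.apply hl]; simp
    · rw [if_neg hij]
      refine (Finset.sum_eq_zero fun l _ => ?_).symm
      by_cases hl : (i.val < k ∧ l.val < k) ∨ i = l
      · have hl' : l.val < k := by
          rcases hl with h | h
          · exact h.2
          · exact h ▸ hi
        rw [delta_apply, if_neg, mul_zero]
        rintro (h | h)
        · exact hij (Or.inl ⟨hi, h.2⟩)
        · exact hij (Or.inl ⟨hi, h ▸ hl'⟩)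
      · rw [h.apply hl]; simp
  · have hX : ∀ l, l ≠ i → X i l = 0 := fun l hl => h.apply (by
      rintro (h | h)
      · exact hi h.1
      · exact hl h.symm)
    rw [Finset.sum_eq_single i (fun l _ hl => by rw [hX l hl, zero_mul]) (by simp),
      Finset.sum_eq_single i (fun l _ hl => by rw [hX l hl, zero_mul]) (by simp), delta_apply]
    split_ifs <;> simp

theorem delta_transpose (k : ℕ) (X : Mat n) : delta k X.transpose = (delta k X).transpose := by
  ext i j
  simp only [delta_apply, Matrix.transpose_apply]
  congr 1
  simp only [eq_comm, and_comm]

theorem IsBlock.transpose {k : ℕ} {X : Mat n} (h : IsBlock k X) : IsBlock k X.transpose := by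
  rw [IsBlock, delta_transpose, h]

theorem IsBlock.delta_mul' {k : ℕ} {X : Mat n} (h : IsBlock k X) (Y : Mat n) :
    delta k (Y * X) = delta k Y * X := by
  have := h.transpose.delta_mul Y.transpose
  rw [← Matrix.transpose_mul, delta_transpose, delta_transpose, ← Matrix.transpose_mul] at this
  exact Matrix.transpose_injective this

theorem IsBlock.mul {k : ℕ} {X Y : Mat n} (h : IsBlock k X) (h' : IsBlock k Y) :
    IsBlock k (X * Y) := by
  rw [IsBlock, h.delta_mul, h']

theorem IsBlock.add {k : ℕ} {X Y : Mat n} (h : IsBlock k X) (h' : IsBlock k Y) :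
    IsBlock k (X + Y) := by
  rw [IsBlock, delta_add, h, h']

theorem IsBlock.sub {k : ℕ} {X Y : Mat n} (h : IsBlock k X) (h' : IsBlock k Y) :
    IsBlock k (X - Y) := by
  rw [IsBlock, delta_sub, h, h']

theorem IsBlock.neg {k : ℕ} {X : Mat n} (h : IsBlock k X) : IsBlock k (-X) := by
  rw [IsBlock, delta_neg, h]

theorem IsBlock.smul {k : ℕ} {X : Mat n} (c : ℂ) (h : IsBlock k X) : IsBlock k (c • X) := by
  rw [IsBlock, delta_smul, h]

theorem isBlock_diagonal (k : ℕ) (v : Fin n → ℂ) : IsBlock k (Matrix.diagonal v : Mat n) := by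
  ext i j
  rw [delta_apply]
  split_ifs with h
  · rfl
  · rw [Matrix.diagonal_apply_ne]
    exact fun hij => h (Or.inr hij)

theorem isBlock_one (k : ℕ) : IsBlock k (1 : Mat n) := by
  rw [← Matrix.diagonal_one]; exact isBlock_diagonal k _

theorem isBlock_zero (k : ℕ) : IsBlock k (0 : Mat n) := delta_zero k

theorem IsBlock.ad {k : ℕ} {X Y : Mat n} (h : IsBlock k X) (h' : IsBlock k Y) :
    IsBlock k (ad X Y) := (h.mul h').sub (h'.mul h)

theorem IsBlock.pow {k : ℕ} {X : Mat n} (h : IsBlock k X) (p : ℕ) : IsBlock k (X ^ p) := by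
  induction p with
  | zero => simpa using isBlock_one k
  | succ p ih => rw [pow_succ]; exact ih.mul h

theorem IsBlock.delta_ad {k : ℕ} {X : Mat n} (h : IsBlock k X) (Y : Mat n) :
    delta k (Isomonodromy.ad X Y) = Isomonodromy.ad X (delta k Y) := by
  rw [Isomonodromy.ad, delta_sub, h.delta_mul, h.delta_mul', Isomonodromy.ad]

theorem IsBlock.exp {k : ℕ} {X : Mat n} (h : IsBlock k X) : IsBlock k (NormedSpace.exp X) := by
  have hs := NormedSpace.exp_series_hasSum_exp' (𝕂 := ℂ) X
  have hs' := (deltaL n k).hasSum hs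
  have : (fun m : ℕ => deltaL n k ((m.factorial⁻¹ : ℂ) • X ^ m))
      = fun m : ℕ => (m.factorial⁻¹ : ℂ) • X ^ m := by
    funext m
    exact (h.pow m).smul _
  rw [this] at hs'
  exact hs'.unique hs

theorem IsBlock.delta_powAd {k : ℕ} {A : Mat n} (h : IsBlock k A) (w : ℂ) (X : Mat n) :
    delta k (Isomonodromy.powAd w A X) = Isomonodromy.powAd w A (delta k X) := by
  rw [Isomonodromy.powAd, (h.smul w).neg.exp.delta_mul', (h.smul w).exp.delta_mul,
    Isomonodromy.powAd]

theorem IsBlock.commute_projQ {k : ℕ} {A : Mat n} (h : IsBlock k A) :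
    Commute A (projQ n k) := by
  ext i j
  rw [mul_projQ_apply, projQ_mul_apply]
  by_cases hij : (i.val < k ∧ j.val < k) ∨ i = j
  · rcases hij with h | h
    · simp [h.1, h.2]
    · subst h; rfl
  · simp [h.apply hij]

theorem IsBlock.commute_unitE {k : ℕ} {A : Mat n} (h : IsBlock k A) :
    Commute A (unitE n k) := by
  ext i j
  rw [mul_unitE_apply, unitE_mul_apply]
  by_cases hij : (i.val < k ∧ j.val < k) ∨ i = j
  · rcases hij with h | h
    · simp [h.1.ne, h.2.ne]
    · subst h; rfl
  · simp [h.apply hij]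

theorem projQ_mul_delta (k : ℕ) (X : Mat n) :
    projQ n k * delta k X = projQ n k * X * projQ n k := by
  ext i j
  rw [mul_projQ_apply, projQ_mul_apply, projQ_mul_apply, delta_apply]
  by_cases hi : i.val < k <;> by_cases hj : j.val < k <;> simp [hi, hj]
  rintro rfl
  exact absurd hi hj

theorem isBlock_projQ_mul_mul (k : ℕ) (X : Mat n) : IsBlock k (projQ n k * X * projQ n k) := by
  ext i j
  rw [delta_apply, mul_projQ_apply, projQ_mul_apply]
  by_cases hi : i.val < k <;> by_cases hj : j.val < k <;> simp [hi, hj]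

end Isomonodromy
end

noncomputable section
namespace Isomonodromy
open Filter Topology
open scoped Pointwise

variable {n : ℕ} {Z : Type*} [NormedAddCommGroup Z] [NormedSpace ℂ Z]

/-! ### Exponential polynomials depending holomorphically on parameters -/

/-- `c` is holomorphic in a neighbourhood of `z₀`. -/
def HolNear {F : Type*} [NormedAddCommGroup F] [NormedSpace ℂ F] (z₀ : Z) (c : Z → F) : Prop :=
  ∀ᶠ z in 𝓝 z₀, DifferentiableAt ℂ c z

/-- For `z` near `z₀`, the function `f z` is a finite sum of terms `e ^ (d w) w ^ t c(z)` with
`d ∈ S`, `t ≤ T` and `c` holomorphic. -/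
def LogExp (z₀ : Z) (S : Set ℂ) (T : ℕ) (f : Z → ℂ → Mat n) : Prop :=
  ∃ (ι : Type) (_ : Fintype ι) (d : ι → ℂ) (t : ι → ℕ) (c : ι → Z → Mat n),
    (∀ i, d i ∈ S) ∧ (∀ i, t i ≤ T) ∧ (∀ i, HolNear z₀ (c i)) ∧
    ∀ᶠ z in 𝓝 z₀, ∀ w, f z w = ∑ i, (Complex.exp (d i * w) * w ^ t i) • c i z

namespace LogExp

variable {z₀ : Z} {S S' : Set ℂ} {T T' : ℕ} {f g : Z → ℂ → Mat n}

theorem congr (hf : LogExp z₀ S T f) (h : ∀ᶠ z in 𝓝 z₀, ∀ w, g z w = f z w) :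
    LogExp z₀ S T g := by
  obtain ⟨ι, _, d, t, c, hd, ht, hc, he⟩ := hf
  refine ⟨ι, inferInstance, d, t, c, hd, ht, hc, ?_⟩
  filter_upwards [h, he] with z h1 h2 w
  rw [h1, h2]

theorem mono (hf : LogExp z₀ S T f) (hS : S ⊆ S') (hT : T ≤ T') : LogExp z₀ S' T' f := by
  obtain ⟨ι, _, d, t, c, hd, ht, hc, he⟩ := hf
  exact ⟨ι, inferInstance, d, t, c, fun i => hS (hd i), fun i => (ht i).trans hT, hc, he⟩

theorem term {d : ℂ} {t : ℕ} {c : Z → Mat n} (hd : d ∈ S) (ht : t ≤ T) (hc : HolNear z₀ c) :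
    LogExp z₀ S T (fun z w => (Complex.exp (d * w) * w ^ t) • c z) :=
  ⟨Unit, inferInstance, fun _ => d, fun _ => t, fun _ => c, fun _ => hd, fun _ => ht, fun _ => hc,
    Eventually.of_forall fun z w => by simp⟩

theorem const {c : Z → Mat n} (hc : HolNear z₀ c) : LogExp z₀ {0} 0 (fun z _ => c z) := by
  refine (term (S := {0}) (d := 0) (t := 0) (T := 0) rfl le_rfl hc).congr ?_
  exact Eventually.of_forall fun z w => by simp

theorem zero : LogExp z₀ S T (fun _ _ => (0 : Mat n)) :=
  ⟨Empty, inferInstance, Empty.elim, Empty.elim, Empty.elim, fun i => i.elim, fun i => i.elim,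
    fun i => i.elim, Eventually.of_forall fun z w => by simp⟩

theorem add (hf : LogExp z₀ S T f) (hg : LogExp z₀ S T g) :
    LogExp z₀ S T (fun z w => f z w + g z w) := by
  obtain ⟨ι, _, d, t, c, hd, ht, hc, he⟩ := hf
  obtain ⟨ι', _, d', t', c', hd', ht', hc', he'⟩ := hg
  refine ⟨ι ⊕ ι', inferInstance, Sum.elim d d', Sum.elim t t', Sum.elim c c', ?_, ?_, ?_, ?_⟩
  · rintro (i | i); exacts [hd i, hd' i]
  · rintro (i | i); exacts [ht i, ht' i]
  · rintro (i | i); exacts [hc i, hc' i]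
  · filter_upwards [he, he'] with z h1 h2 w
    rw [h1, h2, Fintype.sum_sum_type]
    rfl

theorem sum {ι : Type*} (s : Finset ι) {f : ι → Z → ℂ → Mat n}
    (hf : ∀ i ∈ s, LogExp z₀ S T (f i)) : LogExp z₀ S T (fun z w => ∑ i ∈ s, f i z w) := by
  classical
  induction s using Finset.induction_on with
  | empty => simpa using zero
  | insert i s hi ih =>
    have := (hf i (Finset.mem_insert_self i s)).add
      (ih fun j hj => hf j (Finset.mem_insert_of_mem hj))
    refine this.congr (Eventually.of_forall fun z w => ?_)
    rw [Finset.sum_insert hi]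

theorem mul (hf : LogExp z₀ S T f) (hg : LogExp z₀ S' T' g) :
    LogExp z₀ (S + S') (T + T') (fun z w => f z w * g z w) := by
  obtain ⟨ι, _, d, t, c, hd, ht, hc, he⟩ := hf
  obtain ⟨ι', _, d', t', c', hd', ht', hc', he'⟩ := hg
  refine ⟨ι × ι', inferInstance, fun i => d i.1 + d' i.2, fun i => t i.1 + t' i.2,
    fun i z => c i.1 z * c' i.2 z, fun i => Set.add_mem_add (hd i.1) (hd' i.2),
    fun i => add_le_add (ht i.1) (ht' i.2), fun i => ?_, ?_⟩
  · filter_upwards [hc i.1, hc' i.2] with z h1 h2 using h1.mul h2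
  · filter_upwards [he, he'] with z h1 h2 w
    rw [h1, h2, Finset.sum_mul_sum, Fintype.sum_prod_type]
    refine Finset.sum_congr rfl fun i _ => Finset.sum_congr rfl fun j _ => ?_
    rw [smul_mul_smul_comm, add_mul, Complex.exp_add, pow_add]
    congr 1
    ring

theorem map (L : Mat n →L[ℂ] Mat n) (hf : LogExp z₀ S T f) :
    LogExp z₀ S T (fun z w => L (f z w)) := by
  obtain ⟨ι, _, d, t, c, hd, ht, hc, he⟩ := hf
  refine ⟨ι, inferInstance, d, t, fun i z => L (c i z), hd, ht, fun i => ?_, ?_⟩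
  · filter_upwards [hc i] with z h1 using L.differentiableAt.comp z h1
  · filter_upwards [he] with z h1 w
    rw [h1, map_sum]
    simp

theorem neg (hf : LogExp z₀ S T f) : LogExp z₀ S T (fun z w => -f z w) := by
  simpa using hf.map (-(ContinuousLinearMap.id ℂ (Mat n)))

theorem sub (hf : LogExp z₀ S T f) (hg : LogExp z₀ S T g) :
    LogExp z₀ S T (fun z w => f z w - g z w) := by
  simpa [sub_eq_add_neg] using hf.add hg.neg

theorem const_mul {c : Z → Mat n} (hc : HolNear z₀ c) (hf : LogExp z₀ S T f) :
    LogExp z₀ S T (fun z w => c z * f z w) :=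
  ((const hc).mul hf).mono (by simp) (by simp)

theorem mul_const {c : Z → Mat n} (hc : HolNear z₀ c) (hf : LogExp z₀ S T f) :
    LogExp z₀ S T (fun z w => f z w * c z) :=
  (hf.mul (const hc)).mono (by simp) (by simp)

theorem ad (hf : LogExp z₀ S T f) (hg : LogExp z₀ S' T' g) :
    LogExp z₀ (S + S') (T + T') (fun z w => ad (f z w) (g z w)) :=
  (hf.mul hg).sub ((hg.mul hf).mono (by rw [add_comm]) (by rw [add_comm]))

/-- The index type of `LogExp` may repeat a pair (d, t), which makes sums and products painless;
here the coefficients over each pair are collected. -/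
theorem hasLogExpansion (hf : LogExp z₀ S T f) : HasLogExpansion S T (f z₀) := by
  classical
  obtain ⟨ι, _, d, t, c, hd, ht, hc, he⟩ := hf
  refine ⟨Finset.univ.image d, ?_, fun e u => ∑ i with d i = e ∧ t i = u, c i z₀, fun w => ?_⟩
  · intro x hx
    simp only [Finset.coe_image, Finset.coe_univ, Set.image_univ, Set.mem_range] at hx
    obtain ⟨i, rfl⟩ := hx
    exact hd i
  · rw [he.self_of_nhds w]
    have h1 : ∀ i : ι, (Complex.exp (d i * w) * w ^ t i) • c i z₀
        = ∑ e ∈ Finset.univ.image d, ∑ u ∈ Finset.range (T + 1),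
          if d i = e ∧ t i = u then (Complex.exp (e * w) * w ^ u) • c i z₀ else 0 := by
      intro i
      rw [Finset.sum_eq_single (d i), Finset.sum_eq_single (t i)]
      · simp
      · intro u _ hu
        rw [if_neg]
        exact fun h => hu h.2.symm
      · intro h
        exact absurd (Finset.mem_range.2 (Nat.lt_succ_of_le (ht i))) h
      · intro e _ he'
        refine Finset.sum_eq_zero fun u _ => ?_
        rw [if_neg]
        exact fun h => he' h.1.symm
      · intro h
        exact absurd (Finset.mem_image_of_mem d (Finset.mem_univ i)) h
    rw [Finset.sum_congr rfl fun i _ => h1 i, Finset.sum_comm]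
    refine Finset.sum_congr rfl fun e _ => ?_
    rw [Finset.sum_comm]
    refine Finset.sum_congr rfl fun u _ => ?_
    rw [Finset.smul_sum, Finset.sum_filter]

theorem differentiableAt (hf : LogExp z₀ S T f) (w : ℂ) :
    DifferentiableAt ℂ (fun q : Z × ℂ => f q.1 q.2) (z₀, w) := by
  obtain ⟨ι, _, d, t, c, hd, ht, hc, he⟩ := hf
  have h1 : (fun q : Z × ℂ => f q.1 q.2) =ᶠ[𝓝 (z₀, w)]
      fun q => ∑ i, (Complex.exp (d i * q.2) * q.2 ^ t i) • c i q.1 := by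
    rw [nhds_prod_eq]
    filter_upwards [he.prod_inl (𝓝 w)] with q hq using hq q.2
  refine DifferentiableAt.congr_of_eventuallyEq ?_ h1
  refine DifferentiableAt.fun_sum fun i _ => ?_
  have h2 : DifferentiableAt ℂ (fun q : Z × ℂ => c i q.1) (z₀, w) :=
    DifferentiableAt.comp (z₀, w) (g := c i) (hc i).self_of_nhds differentiableAt_fst
  have h3 : DifferentiableAt ℂ (fun q : Z × ℂ => Complex.exp (d i * q.2) * q.2 ^ t i) (z₀, w) := by
    fun_prop
  exact h3.fun_smul h2

/-- The gap m - Re d > 0 leaves an exponential factor that beats the power of w. -/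
theorem tendsto_term {d : ℂ} (m : ℕ) (hd : d.re < m) (t : ℕ) (w₀ : ℂ) :
    Tendsto (fun s : ℝ => Complex.exp (-(m * s)) *
      (Complex.exp (d * (w₀ + s)) * (w₀ + s) ^ t)) atTop (𝓝 0) := by
  have hb : 0 < (m : ℝ) - d.re := by linarith
  have h1 : Tendsto (fun s : ℝ => s ^ t * Real.exp (-((m - d.re) * s))) atTop (𝓝 0) := by
    have := Real.tendsto_pow_mul_exp_neg_atTop_nhds_zero t
    have h2 : Tendsto (fun s : ℝ => ((m : ℝ) - d.re) * s) atTop atTop :=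
      tendsto_id.const_mul_atTop hb
    have h3 := (this.comp h2).const_mul (((m : ℝ) - d.re) ^ t)⁻¹
    rw [mul_zero] at h3
    refine h3.congr fun s => ?_
    simp only [Function.comp, mul_pow]
    field_simp
  have h2 : Tendsto (fun s : ℝ => ‖Complex.exp (d * w₀)‖ * (2 ^ t *
      (s ^ t * Real.exp (-((m - d.re) * s))))) atTop (𝓝 0) := by
    simpa using (h1.const_mul (2 ^ t)).const_mul ‖Complex.exp (d * w₀)‖
  refine squeeze_zero_norm' ?_ h2
  filter_upwards [eventually_ge_atTop (max 0 ‖w₀‖)] with s hs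
  have hs0 : 0 ≤ s := (le_max_left _ _).trans hs
  have hs1 : ‖w₀‖ ≤ s := (le_max_right _ _).trans hs
  have h3 : ‖w₀ + s‖ ≤ 2 * s := by
    refine (norm_add_le _ _).trans ?_
    rw [Complex.norm_real, Real.norm_of_nonneg hs0]
    linarith
  have h4 : ‖w₀ + s‖ ^ t ≤ 2 ^ t * s ^ t := by
    rw [← mul_pow]
    exact pow_le_pow_left₀ (norm_nonneg _) h3 t
  have h5 : Complex.exp (-(m * s)) * (Complex.exp (d * (w₀ + s)) * (w₀ + s) ^ t)
      = Complex.exp (d * w₀) * (Complex.exp (-(m * s) + d * s) * (w₀ + s) ^ t) := by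
    rw [mul_add, Complex.exp_add, Complex.exp_add]; ring
  rw [h5, norm_mul, norm_mul, norm_pow]
  refine mul_le_mul_of_nonneg_left ?_ (norm_nonneg _)
  have h6 : ‖Complex.exp (-(m * s) + d * s)‖ = Real.exp (-((m - d.re) * s)) := by
    rw [Complex.norm_exp]
    congr 1
    simp
    ring
  rw [h6]
  calc _ ≤ Real.exp (-((m - d.re) * s)) * (2 ^ t * s ^ t) :=
        mul_le_mul_of_nonneg_left h4 (Real.exp_pos _).le
    _ = _ := by ring

theorem tendsto (hf : LogExp z₀ S T f) (m : ℕ) (hS : ∀ d ∈ S, d.re < m) :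
    ∀ᶠ z in 𝓝 z₀, ∀ w₀ : ℂ,
      Tendsto (fun s : ℝ => Complex.exp (-(m * s)) • f z (w₀ + s)) atTop (𝓝 0) := by
  obtain ⟨ι, _, d, t, c, hd, ht, hc, he⟩ := hf
  filter_upwards [he] with z hz w₀
  have h1 : ∀ i ∈ Finset.univ, Tendsto (fun s : ℝ => (Complex.exp (-(m * s)) *
      (Complex.exp (d i * (w₀ + s)) * (w₀ + s) ^ t i)) • c i z) atTop (𝓝 0) := fun i _ => by
    simpa using (tendsto_term m (hS _ (hd i)) (t i) w₀).smul_const (c i z)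
  have h2 := tendsto_finsetSum _ h1
  rw [Finset.sum_const_zero] at h2
  refine h2.congr fun s => ?_
  rw [hz, Finset.smul_sum]
  simp only [smul_smul]

theorem hasDerivAt_term (d : ℂ) (t : ℕ) (w : ℂ) :
    HasDerivAt (fun w : ℂ => Complex.exp (d * w) * w ^ t)
      (d * (Complex.exp (d * w) * w ^ t) + t * (Complex.exp (d * w) * w ^ (t - 1))) w := by
  have h1 : HasDerivAt (fun w : ℂ => Complex.exp (d * w)) (Complex.exp (d * w) * d) w := by
    simpa using ((hasDerivAt_id w).const_mul d).cexp
  refine (h1.mul (hasDerivAt_pow t w)).congr_deriv ?_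
  ring

/-- Derivatives of an exponential polynomial along a curve in the parameter space; they commute
with derivatives in `w`. -/
theorem exists_hasDerivAt_curve (hf : LogExp z₀ S T f) {γ : ℂ → Z} {v : Z} {x : ℂ}
    (hγ : HasDerivAt γ v x) (hx : γ x = z₀) :
    ∃ g : ℂ → Mat n, LogExp z₀ S T (fun _ => g) ∧
      (∀ w, HasDerivAt (fun t => f (γ t) w) (g w) x) ∧
      ∀ h : Z → ℂ → Mat n, (∀ᶠ z in 𝓝 z₀, ∀ w, HasDerivAt (f z) (h z w) w) →
        ∀ w, ∃ h', HasDerivAt (fun t => h (γ t) w) h' x ∧ HasDerivAt g h' w := by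
  obtain ⟨ι, _, d, t, c, hd, ht, hc, he⟩ := hf
  have hγc : Tendsto γ (𝓝 x) (𝓝 z₀) := hx ▸ hγ.continuousAt
  have hci : ∀ i, HasDerivAt (fun t => c i (γ t)) (fderiv ℂ (c i) z₀ v) x := fun i => by
    have h1 := (hc i).self_of_nhds.hasFDerivAt
    rw [← hx] at h1 ⊢
    exact h1.comp_hasDerivAt x hγ
  refine ⟨fun w => ∑ i, (Complex.exp (d i * w) * w ^ t i) • fderiv ℂ (c i) z₀ v,
    ⟨ι, inferInstance, d, t, fun i _ => fderiv ℂ (c i) z₀ v, hd, ht,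
      fun i => Eventually.of_forall fun z => differentiableAt_const _,
      Eventually.of_forall fun z w => rfl⟩, fun w => ?_, fun h hh w => ?_⟩
  · refine HasDerivAt.congr_of_eventuallyEq ?_ ((hγc.eventually he).mono fun t ht => ht w)
    exact HasDerivAt.fun_sum fun i _ => (hci i).fun_const_smul _
  · refine ⟨∑ i, (d i * (Complex.exp (d i * w) * w ^ t i)
      + t i * (Complex.exp (d i * w) * w ^ (t i - 1))) • fderiv ℂ (c i) z₀ v, ?_, ?_⟩
    -- Uniqueness of derivatives identifies h with the termwise derivative for all parameters near
    -- z₀, so h can in turn be differentiated along γ.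
    · have hh' : ∀ᶠ z in 𝓝 z₀, h z w = ∑ i, (d i * (Complex.exp (d i * w) * w ^ t i)
          + t i * (Complex.exp (d i * w) * w ^ (t i - 1))) • c i z := by
        filter_upwards [hh, he] with z h1 h2
        refine (h1 w).unique ?_
        rw [show f z = fun w => ∑ i, (Complex.exp (d i * w) * w ^ t i) • c i z from funext h2]
        exact HasDerivAt.fun_sum fun i _ => (hasDerivAt_term _ _ _).smul_const _
      refine HasDerivAt.congr_of_eventuallyEq ?_ (hγc.eventually hh')
      exact HasDerivAt.fun_sum fun i _ => (hci i).fun_const_smul _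
    · exact HasDerivAt.fun_sum fun i _ => (hasDerivAt_term _ _ _).smul_const _

/-- Exponential polynomial solutions of `f' = m f + B f + h` when the operators `d - m - B` with
`d ∈ S` are invertible on the range of a projection `p`. -/
theorem exists_solution {p : Mat n →L[ℂ] Mat n} (hpp' : ∀ C, p (p C) = p C)
    {B : Z → Mat n →L[ℂ] Mat n} (m : ℂ)
    (hR : ∀ d ∈ S, ∃ R : Z → Mat n →L[ℂ] Mat n, HolNear z₀ R ∧
      ∀ᶠ z in 𝓝 z₀, ∀ C, (d - m) • R z C - B z (R z C) = p C ∧ p (R z C) = R z C)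
    {h : Z → ℂ → Mat n} (hh : LogExp z₀ S T h) (hp : ∀ᶠ z in 𝓝 z₀, ∀ w, p (h z w) = h z w) :
    ∃ f : Z → ℂ → Mat n, LogExp z₀ S T f ∧
      ∀ᶠ z in 𝓝 z₀, ∀ w, HasDerivAt (f z) (m • f z w + B z (f z w) + h z w) w := by
  have key : ∀ d ∈ S, ∀ t ≤ T, ∀ c : Z → Mat n, HolNear z₀ c → (∀ᶠ z in 𝓝 z₀, p (c z) = c z) →
      ∃ f : Z → ℂ → Mat n, LogExp z₀ S T f ∧ ∀ᶠ z in 𝓝 z₀, ∀ w, HasDerivAt (f z)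
        (m • f z w + B z (f z w) + (Complex.exp (d * w) * w ^ t) • c z) w := by
    intro d hd t
    obtain ⟨R, hRh, hRe⟩ := hR d hd
    induction t with
    | zero =>
      intro _ c hc hpc
      have hRc : HolNear z₀ (fun z => R z (c z)) := by
        filter_upwards [hRh, hc] with z h1 h2 using h1.clm_apply h2
      refine ⟨_, term hd (Nat.zero_le T) hRc, ?_⟩
      filter_upwards [hRe, hpc] with z h1 h2 w
      refine ((hasDerivAt_term d 0 w).smul_const (R z (c z))).congr_deriv ?_
      have h3 := (h1 (c z)).1
      rw [h2, sub_eq_iff_eq_add] at h3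
      have h4 : d • R z (c z) = m • R z (c z) + (c z + B z (R z (c z))) := by
        rw [← h3]; module
      simp only [map_smul]
      rw [show (d * (Complex.exp (d * w) * w ^ 0) + ((0 : ℕ) : ℂ) *
        (Complex.exp (d * w) * w ^ (0 - 1))) • R z (c z)
        = (Complex.exp (d * w) * w ^ 0) • (d • R z (c z)) by simp; module, h4]
      module
    | succ t ih =>
      intro ht c hc hpc
      have hRc : HolNear z₀ (fun z => R z (c z)) := by
        filter_upwards [hRh, hc] with z h1 h2 using h1.clm_apply h2
      obtain ⟨f, hf, hfe⟩ := ih (by omega) (fun z => R z (c z)) hRc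
        (hRe.mono fun z hz => (hz (c z)).2)
      -- Differentiating e^{dw} w^{t+1} R c leaves the extra term (t+1) e^{dw} w^t R c, which is
      -- cancelled by (t+1) times the solution for the lower power.
      refine ⟨_, (term hd ht hRc).sub (hf.map ((t + 1 : ℂ) • ContinuousLinearMap.id ℂ _)), ?_⟩
      filter_upwards [hRe, hpc, hfe] with z h1 h2 h5 w
      have h6 := ((hasDerivAt_term d (t + 1) w).smul_const (R z (c z))).sub
        ((h5 w).const_smul (t + 1 : ℂ))
      refine h6.congr_deriv ?_
      have h3 := (h1 (c z)).1
      rw [h2, sub_eq_iff_eq_add] at h3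
      have h4 : d • R z (c z) = m • R z (c z) + (c z + B z (R z (c z))) := by
        rw [← h3]; module
      simp only [map_smul, map_sub, smul_apply, ContinuousLinearMap.id_apply]
      rw [show (d * (Complex.exp (d * w) * w ^ (t + 1)) + ((t + 1 : ℕ) : ℂ) *
        (Complex.exp (d * w) * w ^ (t + 1 - 1))) • R z (c z)
        = (Complex.exp (d * w) * w ^ (t + 1)) • (d • R z (c z))
          + ((t + 1 : ℂ) * (Complex.exp (d * w) * w ^ t)) • R z (c z) by
          rw [Nat.add_sub_cancel]; push_cast; module, h4]
      module
  obtain ⟨ι, _, d, t, c, hd, ht, hc, he⟩ := hh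
  -- Only the whole sum h is known to be fixed by p, not its individual coefficients; they are
  -- projected first, which does not change the sum.
  have hpc : ∀ i, HolNear z₀ (fun z => p (c i z)) := fun i => by
    filter_upwards [hc i] with z h1 using p.differentiableAt.comp z h1
  have hpp : ∀ i, ∀ᶠ z in 𝓝 z₀, p (p (c i z)) = p (c i z) := fun i => by
    exact Eventually.of_forall fun z => hpp' _
  choose F hF hFe using fun i => key (d i) (hd i) (t i) (ht i) _ (hpc i) (hpp i)
  refine ⟨fun z w => ∑ i, F i z w, sum _ fun i _ => hF i, ?_⟩
  filter_upwards [he, hp, eventually_all.2 hFe] with z h1 h2 h3 w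
  refine (HasDerivAt.fun_sum fun i _ => h3 i w).congr_deriv ?_
  rw [← h2 w, h1, map_sum, map_sum, Finset.smul_sum, ← Finset.sum_add_distrib,
    ← Finset.sum_add_distrib]
  simp

end LogExp

end Isomonodromy
end

noncomputable section
namespace Isomonodromy
open Filter Topology Polynomial
open Finset.HasAntidiagonal (antidiagonal mem_antidiagonal)
open scoped Pointwise

variable {n : ℕ} {Z : Type*} [NormedAddCommGroup Z] [NormedSpace ℂ Z]

/-! ### Exponentials of matrices annihilated by a polynomial with known roots -/

/-- After e^{dw} is split off, A - d is nilpotent on the columns of M, so the exponential series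
stops. -/
theorem exp_smul_mul_of_pow_mul_eq_zero {A M : Mat n} {d : ℂ} {ν : ℕ}
    (h : (A - d • (1 : Mat n)) ^ ν * M = 0) (w : ℂ) :
    NormedSpace.exp (w • A) * M = ∑ t ∈ Finset.range ν,
      (Complex.exp (d * w) * w ^ t) • ((t.factorial⁻¹ : ℂ) • ((A - d • (1 : Mat n)) ^ t * M)) := by
  have h1 : NormedSpace.exp (w • A)
      = Complex.exp (d * w) • NormedSpace.exp (w • (A - d • (1 : Mat n))) := by
    have h2 : w • A = algebraMap ℂ (Mat n) (d * w) + w • (A - d • (1 : Mat n)) := by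
      rw [Algebra.algebraMap_eq_smul_one]; module
    rw [h2, Matrix.exp_add_of_commute _ _ (Algebra.commute_algebraMap_left (d * w) _),
      ← NormedSpace.algebraMap_exp_comm, ← Algebra.smul_def, Complex.exp_eq_exp_ℂ]
  have hz : ∀ t, ν ≤ t → (A - d • (1 : Mat n)) ^ t * M = 0 := fun t ht => by
    obtain ⟨r, rfl⟩ := Nat.exists_eq_add_of_le' ht
    rw [pow_add, mul_assoc, h, mul_zero]
  have h3 := (NormedSpace.exp_series_hasSum_exp' (𝕂 := ℂ) (w • (A - d • (1 : Mat n)))).mul_right M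
  have h5 : ∀ t ∉ Finset.range ν,
      ((t.factorial⁻¹ : ℂ) • (w • (A - d • (1 : Mat n))) ^ t) * M = 0 := by
    intro t ht
    rw [_root_.smul_pow, smul_mul_assoc, smul_mul_assoc, hz t (by simpa using ht)]
    simp
  have h4 : HasSum (fun t : ℕ => ((t.factorial⁻¹ : ℂ) • (w • (A - d • (1 : Mat n))) ^ t) * M)
      (∑ t ∈ Finset.range ν, ((t.factorial⁻¹ : ℂ) • (w • (A - d • (1 : Mat n))) ^ t) * M) :=
    hasSum_sum_of_ne_finset_zero h5
  rw [h1, smul_mul_assoc, h3.unique h4, Finset.smul_sum]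
  refine Finset.sum_congr rfl fun t _ => ?_
  rw [_root_.smul_pow, smul_mul_assoc, smul_mul_assoc]
  module

/-- The polynomial `∏_{d ∈ s} (X - d) ^ ν`. -/
def rootPoly (s : Finset ℂ) (ν : ℕ) : ℂ[X] := ∏ d ∈ s, (X - C d) ^ ν

theorem isCoprime_X_sub_C_pow {a b : ℂ} (h : a ≠ b) (ν ν' : ℕ) :
    IsCoprime ((X - C a : ℂ[X]) ^ ν) ((X - C b) ^ ν') :=
  (isCoprime_X_sub_C_of_isUnit_sub (sub_ne_zero.2 h).isUnit).pow

/-- The Chinese remainder theorem. The values q_d(A) play the role of spectral projections; as the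
polynomials are fixed, they depend holomorphically on A without any choice of eigenvectors. -/
theorem exists_partition_polynomials {s : Finset ℂ} (hs : s.Nonempty) (ν : ℕ) :
    ∃ q : ℂ → ℂ[X], ∑ d ∈ s, q d = 1 ∧ ∀ d ∈ s, rootPoly s ν ∣ (X - C d) ^ ν * q d := by
  have h := (exists_sum_eq_one_iff_pairwise_coprime (R := ℂ[X]) (I := ℂ)
    (s := fun d => (X - C d) ^ ν) (t := s) hs).2 (by
      intro a b hab
      exact isCoprime_X_sub_C_pow (fun h => hab (Subtype.ext h)) ν ν)
  obtain ⟨μ, hμ⟩ := h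
  refine ⟨_, hμ, fun d hd => ⟨μ d, ?_⟩⟩
  rw [rootPoly, ← Finset.prod_sdiff (Finset.singleton_subset_iff.2 hd), Finset.prod_singleton]
  ring

theorem HolNear.aeval {z₀ : Z} {A : Z → Mat n} (hA : HolNear z₀ A) (q : ℂ[X]) :
    HolNear z₀ (fun z => Polynomial.aeval (A z) q) := by
  filter_upwards [hA] with z hz
  simp only [aeval_eq_sum_range]
  exact DifferentiableAt.fun_sum fun i _ => (hz.fun_pow i).fun_const_smul _

/-- If `∏ (A(z) - d) ^ ν Q = 0`, then `e ^ (w A(z)) Q` is an exponential polynomial with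
holomorphic coefficients. -/
theorem LogExp.exp_mul {z₀ : Z} {A : Z → Mat n} (hA : HolNear z₀ A) {s : Finset ℂ} {ν : ℕ}
    (hν : 1 ≤ ν) (Q : Mat n)
    (h : ∀ᶠ z in 𝓝 z₀, Polynomial.aeval (A z) (rootPoly s ν) * Q = 0) :
    LogExp z₀ s (ν - 1) (fun z w => NormedSpace.exp (w • A z) * Q) := by
  rcases s.eq_empty_or_nonempty with rfl | hs
  · refine LogExp.zero.congr ?_
    filter_upwards [h] with z hz w
    have : Q = 0 := by simpa [rootPoly] using hz
    simp [this]
  obtain ⟨q, hq1, hq2⟩ := exists_partition_polynomials hs ν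
  have h1 : ∀ d ∈ s, ∀ t ∈ Finset.range ν, LogExp z₀ (s : Set ℂ) (ν - 1)
      (fun z w => (Complex.exp (d * w) * w ^ t) • ((t.factorial⁻¹ : ℂ) •
        ((A z - d • (1 : Mat n)) ^ t * (Polynomial.aeval (A z) (q d) * Q)))) := by
    intro d hd t ht
    refine LogExp.term (Finset.mem_coe.2 hd) (by have := Finset.mem_range.1 ht; omega) ?_
    filter_upwards [hA, hA.aeval (q d)] with z h1 h2
    exact (((h1.sub_const _).fun_pow t).fun_mul (h2.mul_const Q)).fun_const_smul _
  refine (LogExp.sum s fun d hd => LogExp.sum (Finset.range ν) fun t ht => h1 d hd t ht).congr ?_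
  filter_upwards [h] with z hz w
  have h2 : NormedSpace.exp (w • A z) * Q
      = ∑ d ∈ s, NormedSpace.exp (w • A z) * (Polynomial.aeval (A z) (q d) * Q) := by
    rw [← Finset.mul_sum, ← Finset.sum_mul, ← map_sum, hq1, map_one, one_mul]
  rw [h2]
  refine Finset.sum_congr rfl fun d hd => ?_
  refine exp_smul_mul_of_pow_mul_eq_zero ?_ w
  have h3 : (A z - d • (1 : Mat n)) ^ ν * Polynomial.aeval (A z) (q d)
      = Polynomial.aeval (A z) ((X - C d) ^ ν * q d) := by
    simp [Algebra.algebraMap_eq_smul_one]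
  obtain ⟨r, hr⟩ := hq2 d hd
  rw [← mul_assoc, h3, hr, mul_comm, map_mul, mul_assoc, hz, mul_zero]

theorem LogExp.comp_neg {z₀ : Z} {S : Set ℂ} {T : ℕ} {f : Z → ℂ → Mat n}
    (hf : LogExp z₀ S T f) : LogExp z₀ (-S) T (fun z w => f z (-w)) := by
  obtain ⟨ι, _, d, t, c, hd, ht, hc, he⟩ := hf
  refine ⟨ι, inferInstance, fun i => -d i, t, fun i z => ((-1 : ℂ) ^ t i) • c i z,
    fun i => by simpa using hd i, ht, fun i => ?_, ?_⟩
  · filter_upwards [hc i] with z hz using hz.fun_const_smul _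
  · filter_upwards [he] with z hz w
    rw [hz]
    refine Finset.sum_congr rfl fun i _ => ?_
    rw [neg_pow w (t i), smul_smul]
    congr 1
    rw [mul_neg, neg_mul]
    ring

/-! ### Sets of exponents -/

/-- The set of differences of elements of `s`. -/
def diffSet (s : Finset ℂ) : Set ℂ := {d | ∃ a ∈ s, ∃ b ∈ s, d = a - b}

theorem sumSet_zero (S : Set ℂ) : sumSet 0 S = {0} := by
  ext x
  simp [sumSet]

theorem subset_sumSet_one (S : Set ℂ) : S ⊆ sumSet 1 S := fun x hx =>
  ⟨fun _ => x, fun _ => hx, by simp⟩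

theorem sumSet_add_subset (a b : ℕ) (S : Set ℂ) : sumSet a S + sumSet b S ⊆ sumSet (a + b) S := by
  rintro _ ⟨_, ⟨d, hd, rfl⟩, _, ⟨e, he, rfl⟩, rfl⟩
  refine ⟨Fin.append d e, fun i => ?_, ?_⟩
  · refine Fin.addCases (fun i => ?_) (fun i => ?_) i
    · simpa using hd i
    · simpa using he i
  · simp [Fin.sum_univ_add]

theorem zero_mem_diffSet {s : Finset ℂ} {x : ℂ} (hx : x ∈ diffSet s) : (0 : ℂ) ∈ diffSet s := by
  obtain ⟨a, ha, _⟩ := hx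
  exact ⟨a, ha, a, ha, by simp⟩

/-- Sums are padded with the difference 0 = a - a. The condition 1 ≤ j supplies an element, since
for empty s there is no such 0. -/
theorem sumSet_mono {s : Finset ℂ} {j m : ℕ} (hj : 1 ≤ j) (hm : j ≤ m) :
    sumSet j (diffSet s) ⊆ sumSet m (diffSet s) := by
  rintro x ⟨d, hd, rfl⟩
  have h0 : (0 : ℂ) ∈ diffSet s := zero_mem_diffSet (hd ⟨0, hj⟩)
  obtain ⟨r, rfl⟩ := Nat.exists_eq_add_of_le hm
  refine sumSet_add_subset j r _ ⟨_, ⟨d, hd, rfl⟩, 0, ⟨fun _ => 0, fun _ => h0, by simp⟩, by simp⟩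

/-- The nonresonance condition: it makes d - m invertible in order m, and it makes e^{-mw} times an
exponential polynomial with these exponents decay. The condition 1 ≤ m is needed for the empty sum.
-/
theorem sumSet_re_lt {S : Set ℂ} (hS : ∀ d ∈ S, d.re < 1) {j m : ℕ} (hj : j ≤ m) (hm : 1 ≤ m) :
    ∀ d ∈ sumSet j S, d.re < m := by
  rintro _ ⟨d, hd, rfl⟩
  rw [Complex.re_sum]
  rcases Nat.eq_zero_or_pos j with rfl | hj'
  · simpa using Nat.lt_of_lt_of_le Nat.zero_lt_one hm
  · calc ∑ i, (d i).re < ∑ i : Fin j, (1 : ℝ) :=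
        Finset.sum_lt_sum_of_nonempty ⟨⟨0, hj'⟩, Finset.mem_univ _⟩ fun i _ => hS _ (hd i)
      _ = j := by simp
      _ ≤ m := by exact_mod_cast hj

/-! ### The decaying solution of `f' = m f + h` -/

/-- `f` solves `f' = m f + h` and `e ^ (-m w) f(w)` tends to `0` as `w → +∞`. -/
def IsDecaying (m : ℕ) (h f : ℂ → Mat n) : Prop :=
  (∀ w, HasDerivAt f ((m : ℂ) • f w + h w) w) ∧
    Tendsto (fun s : ℝ => Complex.exp (-(m * s)) • f s) atTop (𝓝 0)

open Classical in
/-- The decaying solution of `f' = m f + h`. -/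
def decaySol (m : ℕ) (h : ℂ → Mat n) : ℂ → Mat n :=
  if H : ∃ f, IsDecaying m h f then H.choose else 0

theorem eq_of_hasDerivAt_smul {m : ℂ} {f : ℂ → Mat n} (hf : ∀ w, HasDerivAt f (m • f w) w) (w : ℂ) :
    Complex.exp (-(m * w)) • f w = f 0 := by
  have h1 : ∀ w, HasDerivAt (fun w => Complex.exp (-(m * w)) • f w) 0 w := fun w => by
    have h2 : HasDerivAt (fun w : ℂ => Complex.exp (-(m * w))) (Complex.exp (-(m * w)) * -m) w := by
      simpa using ((hasDerivAt_id w).const_mul m).neg.cexp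
    refine (h2.smul (hf w)).congr_deriv ?_
    module
  have h3 := is_const_of_deriv_eq_zero (fun w => (h1 w).differentiableAt)
    (fun w => (h1 w).deriv) w 0
  simpa using h3

/-- Two solutions differ by a constant multiple of e^{mw}, and decay forces the constant to be zero.
-/
theorem IsDecaying.unique {m : ℕ} {h f g : ℂ → Mat n} (hf : IsDecaying m h f)
    (hg : IsDecaying m h g) : f = g := by
  have h1 : ∀ w, HasDerivAt (fun w => f w - g w) ((m : ℂ) • (f w - g w)) w := fun w => by
    refine ((hf.1 w).sub (hg.1 w)).congr_deriv ?_
    module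
  have h2 : Tendsto (fun s : ℝ => Complex.exp (-(m * s)) • (f s - g s)) atTop (𝓝 0) := by
    simpa [smul_sub] using hf.2.sub hg.2
  have h3 : f 0 - g 0 = 0 := by
    refine tendsto_nhds_unique (tendsto_const_nhds.congr fun s : ℝ => ?_) h2
    exact (eq_of_hasDerivAt_smul h1 s).symm
  funext w
  have h4 := eq_of_hasDerivAt_smul h1 w
  rw [h3, smul_eq_zero] at h4
  exact sub_eq_zero.1 (h4.resolve_left (Complex.exp_ne_zero _))

theorem IsDecaying.decaySol_eq {m : ℕ} {h f : ℂ → Mat n} (hf : IsDecaying m h f) :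
    decaySol m h = f := by
  have H : ∃ f, IsDecaying m h f := ⟨f, hf⟩
  rw [decaySol, dif_pos H]
  exact H.choose_spec.unique hf

/-! ### The recursion for the coefficients -/

/-- The coefficients of `(1 + x U)⁻¹ - 1 = ∑_{p ≥ 1} (-U) ^ p x ^ p`. -/
def coefH (U : Mat n) (p : ℕ) : Mat n := if p = 0 then 0 else (-U) ^ p

/-- The coefficients of the product of the `k`-th column and the `k`-th row. -/
def coefV (k : ℕ) (φ : ℕ → ℂ → Mat n) (j : ℕ) (w : ℂ) : Mat n :=
  ∑ x ∈ antidiagonal j, projQ n k * φ x.1 w * unitE n k * φ x.2 w * projQ n k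

/-- The coefficients of `δ_k Φ_{k+1}`. -/
def coefX (k : ℕ) (A U : Mat n) (φ : ℕ → ℂ → Mat n) (m : ℕ) (w : ℂ) : Mat n :=
  if m = 0 then A
  else ∑ x ∈ antidiagonal m, ad (coefH U x.1) (decaySol m (coefV k φ x.2) w)

/-- The coefficients of the positive order part of the generator in the direction `z_{k+1}`. -/
def coefS (k : ℕ) (A U : Mat n) (φ : ℕ → ℂ → Mat n) (a : ℕ) (w : ℂ) : Mat n :=
  if a = 0 then 0
  else -coefX k A U φ a w + ∑ x ∈ antidiagonal a,
    (coefH U x.1 * φ x.2 w * unitE n k + unitE n k * φ x.2 w * coefH U x.1)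

/-- The inhomogeneity in the equation for the coefficient of order `m`. -/
def coefRhs (k : ℕ) (A U : Mat n) (φ : ℕ → ℂ → Mat n) (m : ℕ) (w : ℂ) : Mat n :=
  ∑ x ∈ antidiagonal m, ad (coefS k A U φ x.1 w) (φ x.2 w)

/-- One step of the recursion. -/
def coefStep (k : ℕ) (A U Φ₀ : Mat n) (φ : ℕ → ℂ → Mat n) (m : ℕ) (w : ℂ) : Mat n :=
  powAd (-w) A (if m = 0 then Φ₀
    else decaySol m (fun w => powAd w A (coefRhs k A U φ m w)) w)

/-- The coefficients `φ_m` as functions of `w = ln z_{k+1}`. -/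
def coefPhi (k : ℕ) (A U Φ₀ : Mat n) : ℕ → ℂ → Mat n
  | m => coefStep k A U Φ₀ (fun j => if _h : j < m then coefPhi k A U Φ₀ j else 0) m

section congr

variable {k : ℕ} {A U : Mat n} {φ φ' : ℕ → ℂ → Mat n}

@[simp] theorem coefH_zero : coefH U 0 = 0 := rfl

theorem coefH_of_pos {p : ℕ} (hp : 1 ≤ p) : coefH U p = (-U) ^ p := if_neg (by omega)

theorem coefV_congr {j : ℕ} (h : ∀ i ≤ j, φ i = φ' i) : coefV k φ j = coefV k φ' j := by
  funext w
  refine Finset.sum_congr rfl fun x hx => ?_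
  rw [mem_antidiagonal] at hx
  rw [h x.1 (by omega), h x.2 (by omega)]

theorem coefX_congr {m : ℕ} (h : ∀ i < m, φ i = φ' i) : coefX k A U φ m = coefX k A U φ' m := by
  funext w
  rw [coefX, coefX]
  split_ifs with hm
  · rfl
  refine Finset.sum_congr rfl fun x hx => ?_
  rw [mem_antidiagonal] at hx
  rcases Nat.eq_zero_or_pos x.1 with h0 | h0
  · simp [h0, ad]
  · rw [coefV_congr fun i hi => h i (by omega)]

theorem coefS_congr {m : ℕ} (h : ∀ i < m, φ i = φ' i) : coefS k A U φ m = coefS k A U φ' m := by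
  funext w
  rw [coefS, coefS, coefX_congr h]
  split_ifs with hm
  · rfl
  congr 1
  refine Finset.sum_congr rfl fun x hx => ?_
  rw [mem_antidiagonal] at hx
  rcases Nat.eq_zero_or_pos x.1 with h0 | h0
  · simp [h0]
  · rw [h x.2 (by omega)]

/-- Both `coefH` and `coefS` vanish in order 0, so order m involves only smaller orders. This is why
cutting off the family in the definition of `coefPhi` is harmless. -/
theorem coefRhs_congr {m : ℕ} (h : ∀ i < m, φ i = φ' i) :
    coefRhs k A U φ m = coefRhs k A U φ' m := by
  funext w
  refine Finset.sum_congr rfl fun x hx => ?_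
  rw [mem_antidiagonal] at hx
  rcases Nat.eq_zero_or_pos x.1 with h0 | h0
  · simp [h0, coefS, ad]
  · rw [coefS_congr fun i hi => h i (by omega), h x.2 (by omega)]

end congr

theorem coefPhi_eq (k : ℕ) (A U Φ₀ : Mat n) (m : ℕ) (w : ℂ) :
    coefPhi k A U Φ₀ m w = coefStep k A U Φ₀ (coefPhi k A U Φ₀) m w := by
  rw [coefPhi, coefStep, coefStep, coefRhs_congr (φ' := coefPhi k A U Φ₀)]
  intro i hi
  rw [dif_pos hi]

theorem coefPhi_zero (k : ℕ) (A U Φ₀ : Mat n) (w : ℂ) :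
    coefPhi k A U Φ₀ 0 w = powAd (-w) A Φ₀ := by
  rw [coefPhi_eq, coefStep, if_pos rfl]

theorem powAd_coefPhi (k : ℕ) (A U Φ₀ : Mat n) {m : ℕ} (hm : 1 ≤ m) (w : ℂ) :
    powAd w A (coefPhi k A U Φ₀ m w)
      = decaySol m (fun w => powAd w A (coefRhs k A U (coefPhi k A U Φ₀) m w)) w := by
  rw [coefPhi_eq, coefStep, if_neg (by omega), powAd_powAd_neg]

end Isomonodromy
end

noncomputable section
namespace Isomonodromy
open Filter Topology Polynomial
open Finset.HasAntidiagonal (antidiagonal mem_antidiagonal)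
open scoped Pointwise

variable {n : ℕ} {Z : Type*} [NormedAddCommGroup Z] [NormedSpace ℂ Z]

/-! ### The Sylvester operator on the block -/

/-- `ad` as a bilinear continuous map. -/
def adL (n : ℕ) : Mat n →L[ℂ] Mat n →L[ℂ] Mat n :=
  ContinuousLinearMap.mul ℂ (Mat n) - (ContinuousLinearMap.mul ℂ (Mat n)).flip

@[simp] theorem adL_apply (A C : Mat n) : adL n A C = ad A C := by
  simp [adL, ad]

/-- The projection `C ↦ Q C Q` onto the upper left block. -/
def blockL (n k : ℕ) : Mat n →L[ℂ] Mat n :=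
  (ContinuousLinearMap.mul ℂ (Mat n) (projQ n k)).comp
    ((ContinuousLinearMap.mul ℂ (Mat n)).flip (projQ n k))

@[simp] theorem blockL_apply (k : ℕ) (C : Mat n) :
    blockL n k C = projQ n k * C * projQ n k := by
  simp [blockL, mul_assoc]

theorem blockL_blockL (k : ℕ) (C : Mat n) : blockL n k (blockL n k C) = blockL n k C := by
  have h := projQ_mul_self (n := n) k
  simp only [blockL_apply]
  calc _ = (projQ n k * projQ n k) * C * (projQ n k * projQ n k) := by simp only [mul_assoc]
    _ = _ := by rw [h]

theorem blockL_ad {k : ℕ} {A : Mat n} (hA : Commute A (projQ n k)) (C : Mat n) :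
    blockL n k (ad A C) = ad A (blockL n k C) := by
  simp only [blockL_apply, ad, mul_sub, sub_mul]
  congr 1
  · rw [← mul_assoc, ← hA.eq]; simp only [mul_assoc]
  · simp only [mul_assoc]; rw [hA.eq]

theorem SemiconjBy.aeval {C x y : Mat n} (h : SemiconjBy C x y) (q : ℂ[X]) :
    SemiconjBy C (Polynomial.aeval x q) (Polynomial.aeval y q) := by
  induction q using Polynomial.induction_on' with
  | add p q hp hq => simpa using hp.add_right hq
  | monomial i a =>
    simp only [aeval_monomial]
    exact SemiconjBy.mul_right (Algebra.commutes a C).symm (h.pow_right i)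

/-- Sylvester's argument: C intertwines A + μ with A, so C p(A + μ) = p(A) C = 0 for the
annihilating polynomial p of the block, and also C p(A) Q = 0. If μ is not a difference of roots,
p(X + μ) and p are coprime, and C = CQ vanishes. -/
theorem eq_zero_of_smul_eq_ad {k : ℕ} {A C : Mat n} {s : Finset ℂ} {ν : ℕ}
    (h : Polynomial.aeval A (rootPoly s ν) * projQ n k = 0) {μ : ℂ} (hμ : μ ∉ diffSet s)
    (hC : projQ n k * C * projQ n k = C) (hAC : μ • C = ad A C) : C = 0 := by
  have hQ := projQ_mul_self (n := n) k
  have hC1 : projQ n k * C = C := by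
    rw [← hC]; simp only [← mul_assoc, hQ]
  have hC2 : C * projQ n k = C := by
    rw [← hC]; simp only [mul_assoc, hQ]
  have hs : SemiconjBy C (A + algebraMap ℂ (Mat n) μ) A := by
    rw [SemiconjBy, mul_add, ← Algebra.commutes, ← Algebra.smul_def, hAC, ad]
    abel
  have h1 := (SemiconjBy.aeval hs (rootPoly s ν)).eq
  have h2 : Polynomial.aeval A (rootPoly s ν) * C = 0 := by
    rw [← hC1, ← mul_assoc, h, zero_mul]
  have h3 : Polynomial.aeval (A + algebraMap ℂ (Mat n) μ) (rootPoly s ν)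
      = Polynomial.aeval A ((rootPoly s ν).comp (X + Polynomial.C μ)) := by
    rw [aeval_comp]; simp
  have h4 : IsCoprime ((rootPoly s ν).comp (X + Polynomial.C μ)) (rootPoly s ν) := by
    rw [rootPoly, prod_comp]
    refine IsCoprime.prod_left fun a ha => IsCoprime.prod_right fun b hb => ?_
    have : ((X - Polynomial.C a : ℂ[X]) ^ ν).comp (X + Polynomial.C μ)
        = (X - Polynomial.C (a - μ)) ^ ν := by
      simp only [pow_comp, sub_comp, X_comp, C_comp, map_sub]
      ring
    rw [this]
    refine isCoprime_X_sub_C_pow (fun hab => hμ ⟨a, ha, b, hb, ?_⟩) _ _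
    rw [← hab]; ring
  obtain ⟨a, b, hab⟩ := h4
  rw [h3, h2] at h1
  calc C = C * (Polynomial.aeval A (1 : ℂ[X]) * projQ n k) := by simp [hC2]
    _ = C * Polynomial.aeval A ((rootPoly s ν).comp (X + Polynomial.C μ)) *
          Polynomial.aeval A a * projQ n k
        + C * (Polynomial.aeval A b * (Polynomial.aeval A (rootPoly s ν) * projQ n k)) := by
        rw [← hab, mul_comm a]
        simp only [map_add, map_mul, add_mul, mul_add, mul_assoc]
    _ = 0 := by rw [h1, h]; simp

theorem exists_resolvent {k : ℕ} {A : Z → Mat n} {z₀ : Z} (hA : HolNear z₀ A)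
    (hAQ : ∀ᶠ z in 𝓝 z₀, Commute (A z) (projQ n k)) {s : Finset ℂ} {ν : ℕ}
    (h : ∀ᶠ z in 𝓝 z₀, Polynomial.aeval (A z) (rootPoly s ν) * projQ n k = 0) {μ : ℂ}
    (hμ : μ ∉ diffSet s) :
    ∃ R : Z → Mat n →L[ℂ] Mat n, HolNear z₀ R ∧ ∀ᶠ z in 𝓝 z₀, ∀ C,
      μ • R z C - adL n (A z) (R z C) = blockL n k C ∧ blockL n k (R z C) = R z C := by
  -- The operator μ - ad A on the block, completed by the identity on the complement of the corner.
  -- It is then invertible on all matrices, and its inverse depends holomorphically on z.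
  set O : Z → Mat n →L[ℂ] Mat n := fun z =>
    μ • blockL n k - (adL n (A z)).comp (blockL n k) + (1 - blockL n k) with hO
  have hOh : HolNear z₀ O := by
    filter_upwards [hA] with z hz
    have h1 : DifferentiableAt ℂ (fun z => (adL n (A z)).comp (blockL n k)) z :=
      ((adL n).differentiableAt.comp z hz).clm_comp (differentiableAt_const _)
    exact (h1.const_sub _).add_const _
  have hOu : ∀ᶠ z in 𝓝 z₀, IsUnit (O z) ∧
      ∀ C, blockL n k (O z C) = O z C → blockL n k C = C := by
    filter_upwards [hAQ, h] with z h1 h2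
    have key : ∀ C, blockL n k (O z C) = O z C → blockL n k C = C := by
      intro C hC
      have h3 : O z C = μ • blockL n k C - ad (A z) (blockL n k C) + (C - blockL n k C) := by
        simp [hO]
      rw [h3, map_add, map_sub, map_sub, map_smul, blockL_ad h1, blockL_blockL, sub_self,
        add_zero] at hC
      exact (sub_eq_zero.1 (left_eq_add.1 hC)).symm
    have hinj : Function.Injective (O z) := by
      rw [injective_iff_map_eq_zero]
      intro C hC
      have h4 : blockL n k C = C := key C (by rw [hC, map_zero])
      have h3 : O z C = μ • blockL n k C - ad (A z) (blockL n k C) + (C - blockL n k C) := by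
        simp [hO]
      rw [hC, h4, sub_self, add_zero, eq_comm, sub_eq_zero] at h3
      exact eq_zero_of_smul_eq_ad h2 hμ (by simpa using h4) h3
    refine ⟨?_, key⟩
    have hu : IsUnit ((O z : Mat n →L[ℂ] Mat n) : Mat n →ₗ[ℂ] Mat n) := by
      rw [LinearMap.isUnit_iff_ker_eq_bot, LinearMap.ker_eq_bot]
      exact hinj
    exact hu.map (Module.End.toContinuousLinearMap (𝕜 := ℂ) (Mat n))
  refine ⟨fun z => (Ring.inverse (O z)).comp (blockL n k), ?_, ?_⟩
  · filter_upwards [hOh, hOu] with z h1 h2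
    have h3 : DifferentiableAt ℂ (fun z => Ring.inverse (O z)) z :=
      DifferentiableAt.inverse (𝕜 := ℂ) (R := Mat n →L[ℂ] Mat n) h1 h2.1
    exact h3.clm_comp (differentiableAt_const _)
  · filter_upwards [hOu, hAQ] with z h1 hc C
    have h2 : O z (Ring.inverse (O z) (blockL n k C)) = blockL n k C := by
      have := Ring.mul_inverse_cancel _ h1.1
      exact congrArg (fun F : Mat n →L[ℂ] Mat n => F (blockL n k C)) this
    set Y := Ring.inverse (O z) (blockL n k C) with hY
    have h3 : blockL n k Y = Y := h1.2 Y (by rw [h2, blockL_blockL])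
    have h4 : O z Y = μ • blockL n k Y - ad (A z) (blockL n k Y) + (Y - blockL n k Y) := by
      simp [hO]
    rw [h2, h3, sub_self, add_zero] at h4
    refine ⟨?_, h3⟩
    rw [ContinuousLinearMap.comp_apply, ← hY, adL_apply, h4]

end Isomonodromy
end

noncomputable section
namespace Isomonodromy
open Filter Topology Polynomial
open Finset.HasAntidiagonal (antidiagonal mem_antidiagonal)
open scoped Pointwise

variable {n : ℕ} {Z : Type*} [NormedAddCommGroup Z] [NormedSpace ℂ Z]

/-! ### Structure of the coefficients -/

/-- Local hypotheses on the data `A = δ_k Φ₀` and `U` near `z₀`: the upper left block of `A(z)` is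
annihilated by a polynomial with roots in `s` of multiplicity `ν`. -/
structure BlockData (k : ℕ) (s : Finset ℂ) (ν : ℕ) (A U Φ₀ : Z → Mat n) (z₀ : Z) : Prop where
  one_le : 1 ≤ ν
  holA : HolNear z₀ A
  holU : HolNear z₀ U
  holΦ : HolNear z₀ Φ₀
  delta_eq : ∀ᶠ z in 𝓝 z₀, delta k (Φ₀ z) = A z
  proj_mul : ∀ᶠ z in 𝓝 z₀, projQ n k * U z = U z
  mul_proj : ∀ᶠ z in 𝓝 z₀, U z * projQ n k = U z
  annih : ∀ᶠ z in 𝓝 z₀, Polynomial.aeval (A z) (rootPoly s ν) * projQ n k = 0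
  re_lt : ∀ d ∈ diffSet s, d.re < 1

theorem HolNear.const {F : Type*} [NormedAddCommGroup F] [NormedSpace ℂ F] {z₀ : Z} (c : F) :
    HolNear z₀ (fun _ => c) := Eventually.of_forall fun _ => differentiableAt_const _

theorem HolNear.coefH {z₀ : Z} {U : Z → Mat n} (hU : HolNear z₀ U) (p : ℕ) :
    HolNear z₀ (fun z => coefH (U z) p) := by
  rcases Nat.eq_zero_or_pos p with rfl | hp
  · simpa using HolNear.const (0 : Mat n)
  · simp only [coefH_of_pos hp]
    filter_upwards [hU] with z hz using hz.fun_neg.fun_pow p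

theorem diffSet_eq_add (s : Finset ℂ) : (s : Set ℂ) + -(s : Set ℂ) = diffSet s := by
  ext x
  constructor
  · rintro ⟨a, ha, b, hb, rfl⟩
    exact ⟨a, ha, -b, hb, by simp⟩
  · rintro ⟨a, ha, b, hb, rfl⟩
    exact ⟨a, ha, -b, by simpa using hb, by simp [sub_eq_add_neg]⟩

theorem neg_diffSet (s : Finset ℂ) : -diffSet s = diffSet s := by
  ext x
  constructor
  · rintro ⟨a, ha, b, hb, h⟩
    exact ⟨b, hb, a, ha, by rw [← neg_neg x, h]; ring⟩
  · rintro ⟨a, ha, b, hb, rfl⟩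
    exact ⟨b, hb, a, ha, by ring⟩

namespace BlockData

variable {k : ℕ} {s : Finset ℂ} {ν : ℕ} {A U Φ₀ : Z → Mat n} {z₀ : Z}

theorem isBlock (H : BlockData k s ν A U Φ₀ z₀) : ∀ᶠ z in 𝓝 z₀, IsBlock k (A z) :=
  H.delta_eq.mono fun _ hz => hz ▸ isBlock_delta k _

/-- On the corner only e^{±wA}Q enters, whose exponents lie in ±s and whose degree is ν - 1. So one
conjugation, in either direction, costs one eigenvalue difference and 2(ν - 1) powers of w. -/
theorem powAd_logExp (H : BlockData k s ν A U Φ₀ z₀) {S : Set ℂ} {T : ℕ} {g : Z → ℂ → Mat n}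
    (hg : LogExp z₀ S T g)
    (hb : ∀ᶠ z in 𝓝 z₀, ∀ w, projQ n k * g z w * projQ n k = g z w) :
    LogExp z₀ (diffSet s + S) (2 * (ν - 1) + T) (fun z w => powAd w (A z) (g z w)) ∧
      LogExp z₀ (diffSet s + S) (2 * (ν - 1) + T) (fun z w => powAd (-w) (A z) (g z w)) := by
  have h1 := LogExp.exp_mul H.holA H.one_le (projQ n k) H.annih
  have h2 := h1.comp_neg
  constructor
  · refine ((h1.mul hg).mul h2).congr ?_ |>.mono ?_ ?_
    · filter_upwards [H.isBlock, hb] with z hz h3 w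
      have h4 := (((hz.commute_projQ).smul_left (-w)).exp_left).eq
      have h5 : ∀ E E' : Mat n, E * projQ n k * g z w * (projQ n k * E') = E * g z w * E' := by
        intro E E'
        conv_rhs => rw [← h3 w]
        simp only [mul_assoc]
      rw [h4, h5, powAd, neg_smul]
    · rw [add_right_comm, diffSet_eq_add]
    · omega
  · refine ((h2.mul hg).mul h1).congr ?_ |>.mono ?_ ?_
    · filter_upwards [H.isBlock, hb] with z hz h3 w
      have h4 := (((hz.commute_projQ).smul_left w).exp_left).eq
      have h5 : ∀ E E' : Mat n, E * projQ n k * g z w * (projQ n k * E') = E * g z w * E' := by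
        intro E E'
        conv_rhs => rw [← h3 w]
        simp only [mul_assoc]
      rw [h4, h5, powAd, neg_smul, neg_neg]
    · rw [add_right_comm, add_comm (-(s : Set ℂ)), diffSet_eq_add]
    · omega


theorem _root_.Isomonodromy.projQ_coefH {U : Mat n} (h1 : projQ n k * U = U)
    (h2 : U * projQ n k = U) (p : ℕ) :
    projQ n k * coefH U p = coefH U p ∧ coefH U p * projQ n k = coefH U p := by
  rcases p with _ | p
  · simp
  · rw [coefH_of_pos (by omega)]
    constructor
    · rw [pow_succ', ← mul_assoc, mul_neg, h1]
    · rw [pow_succ, mul_assoc, neg_mul, h2]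

theorem coefH_block (H : BlockData k s ν A U Φ₀ z₀) (p : ℕ) :
    ∀ᶠ z in 𝓝 z₀, projQ n k * coefH (U z) p * projQ n k = coefH (U z) p := by
  filter_upwards [H.proj_mul, H.mul_proj] with z h1 h2
  obtain ⟨h3, h4⟩ := projQ_coefH h1 h2 p
  rw [h3, h4]

theorem powAd_coefH (H : BlockData k s ν A U Φ₀ z₀) (p : ℕ) :
    LogExp z₀ (diffSet s) (2 * (ν - 1)) (fun z w => powAd w (A z) (coefH (U z) p)) := by
  have h := (H.powAd_logExp (LogExp.const (H.holU.coefH p))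
    ((H.coefH_block p).mono fun z hz _ => hz)).1
  exact h.mono (by simp) (by simp)

/-- The coefficients as functions of the parameters. -/
abbrev phi (k : ℕ) (A U Φ₀ : Z → Mat n) (z : Z) : ℕ → ℂ → Mat n :=
  coefPhi k (A z) (U z) (Φ₀ z)

/-- The structure of `powAd w A φ_m`. -/
def Structure (k : ℕ) (s : Finset ℂ) (ν : ℕ) (A U Φ₀ : Z → Mat n) (z₀ : Z) (m : ℕ) : Prop :=
  LogExp z₀ (sumSet m (diffSet s)) (2 * (ν - 1) * m)
    (fun z w => powAd w (A z) (phi k A U Φ₀ z m w))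

theorem diffSet_add_sumSet_subset (a : ℕ) : diffSet s + sumSet a (diffSet s) ⊆
    sumSet (1 + a) (diffSet s) :=
  (Set.add_subset_add_right (subset_sumSet_one _)).trans (sumSet_add_subset 1 a _)

theorem powAd_coefV {A : Mat n} (hA : IsBlock k A) (φ : ℕ → ℂ → Mat n) (j : ℕ) (w w' : ℂ) :
    powAd w A (coefV k φ j w') = ∑ x ∈ antidiagonal j,
      projQ n k * powAd w A (φ x.1 w') * unitE n k * powAd w A (φ x.2 w') * projQ n k := by
  have h1 : powAd w A (projQ n k) = projQ n k := powAd_commute hA.commute_projQ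
  have h2 : powAd w A (unitE n k) = unitE n k := powAd_commute hA.commute_unitE
  simp only [coefV, powAd_sum, powAd_mul, h1, h2]

theorem coefV_block (φ : ℕ → ℂ → Mat n) (j : ℕ) (w : ℂ) :
    projQ n k * coefV k φ j w * projQ n k = coefV k φ j w := by
  simp only [coefV, Finset.mul_sum, Finset.sum_mul, mul_assoc, projQ_mul_self]
  simp only [← mul_assoc, projQ_mul_self]

theorem logExp_powAd_coefV (H : BlockData k s ν A U Φ₀ z₀) {j : ℕ}
    (hY : ∀ a ≤ j, Structure k s ν A U Φ₀ z₀ a) :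
    LogExp z₀ (sumSet j (diffSet s)) (2 * (ν - 1) * j)
      (fun z w => powAd w (A z) (coefV k (phi k A U Φ₀ z) j w)) := by
  have h1 : ∀ x ∈ antidiagonal j, LogExp z₀ (sumSet j (diffSet s)) (2 * (ν - 1) * j)
      (fun z w => projQ n k * powAd w (A z) (phi k A U Φ₀ z x.1 w) * unitE n k *
        powAd w (A z) (phi k A U Φ₀ z x.2 w) * projQ n k) := by
    intro x hx
    rw [mem_antidiagonal] at hx
    have h2 := ((((hY x.1 (by omega)).const_mul (HolNear.const (projQ n k))).mul_const
      (HolNear.const (unitE n k))).mul (hY x.2 (by omega))).mul_const (HolNear.const (projQ n k))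
    refine h2.mono ?_ ?_
    · rw [← hx]; exact sumSet_add_subset _ _ _
    · rw [← hx]; ring_nf; rfl
  refine (LogExp.sum _ h1).congr ?_
  filter_upwards [H.isBlock] with z hz w
  rw [powAd_coefV hz]

/-- The decaying primitive of the quadratic term. -/
theorem decaySol_coefV (H : BlockData k s ν A U Φ₀ z₀) {j m : ℕ} (hjm : j < m)
    (hY : ∀ a ≤ j, Structure k s ν A U Φ₀ z₀ a) :
    (LogExp z₀ (sumSet j (diffSet s)) (2 * (ν - 1) * j)
      (fun z w => powAd w (A z) (decaySol m (coefV k (phi k A U Φ₀ z) j) w))) ∧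
    (LogExp z₀ (sumSet (j + 1) (diffSet s)) (2 * (ν - 1) * (j + 1))
      (fun z w => decaySol m (coefV k (phi k A U Φ₀ z) j) w)) ∧
    ∀ᶠ z in 𝓝 z₀, IsDecaying m (coefV k (phi k A U Φ₀ z) j)
        (decaySol m (coefV k (phi k A U Φ₀ z) j)) ∧
      ∀ w, projQ n k * decaySol m (coefV k (phi k A U Φ₀ z) j) w * projQ n k
        = decaySol m (coefV k (phi k A U Φ₀ z) j) w := by
  have hcomm : ∀ᶠ z in 𝓝 z₀, Commute (A z) (projQ n k) := H.isBlock.mono fun z hz => hz.commute_projQ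
  have hV := H.logExp_powAd_coefV hY
  have hp : ∀ᶠ z in 𝓝 z₀, ∀ w, blockL n k (powAd w (A z) (coefV k (phi k A U Φ₀ z) j w))
      = powAd w (A z) (coefV k (phi k A U Φ₀ z) j w) := by
    filter_upwards [H.isBlock] with z hz w
    have h1 : powAd w (A z) (projQ n k) = projQ n k := powAd_commute hz.commute_projQ
    conv_rhs => rw [← coefV_block, powAd_mul, powAd_mul, h1]
    simp
  have hR : ∀ d ∈ sumSet j (diffSet s), ∃ R : Z → Mat n →L[ℂ] Mat n, HolNear z₀ R ∧
      ∀ᶠ z in 𝓝 z₀, ∀ C, (d - m) • R z C - adL n (A z) (R z C) = blockL n k C ∧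
        blockL n k (R z C) = R z C := by
    intro d hd
    -- If d - m were a difference, then m = d - (d - m) would be a sum of j + 1 ≤ m differences,
    -- contradicting the bound on real parts.
    refine exists_resolvent H.holA hcomm H.annih fun hdm => ?_
    have h1 : d - (d - m) ∈ sumSet (j + 1) (diffSet s) := by
      refine sumSet_add_subset j 1 _ ⟨d, hd, -(d - m), subset_sumSet_one _ ?_, by ring⟩
      rw [← neg_diffSet]
      simpa using hdm
    have h2 := sumSet_re_lt H.re_lt (j := j + 1) (m := m) (by omega) (by omega) _ h1
    simp at h2
  -- The conjugated unknown g = z^{ad A} f is sought: it satisfies g' = mg + [A, g] + z^{ad A} V.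
  -- This keeps the exponents in j D; the passage back to f costs one more difference.
  obtain ⟨g, hg, hge⟩ := LogExp.exists_solution (blockL_blockL (n := n) k) (m : ℂ) hR hV hp
  have hg' := hg.map (blockL n k)
  have hgp : ∀ᶠ z in 𝓝 z₀, ∀ w, projQ n k * blockL n k (g z w) * projQ n k = blockL n k (g z w) :=
    Eventually.of_forall fun z w => by
      rw [← blockL_apply, blockL_blockL]
  have hf := ((H.powAd_logExp hg' hgp).2).mono (diffSet_add_sumSet_subset j) le_rfl
  have hdec := hf.tendsto m (sumSet_re_lt H.re_lt (by omega) (by omega))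
  have hsol : ∀ᶠ z in 𝓝 z₀, IsDecaying m (coefV k (phi k A U Φ₀ z) j)
      (fun w => powAd (-w) (A z) (blockL n k (g z w))) := by
    filter_upwards [hdec, hge, hcomm, hp] with z h1 h2 h3 h5
    refine ⟨fun w => ?_, by simpa using h1 0⟩
    have h4 := HasDerivAt.powAd_neg (A z)
      ((blockL n k).hasFDerivAt.comp_hasDerivAt w (h2 w))
    refine h4.congr_deriv ?_
    rw [Function.comp_apply, map_add, map_add, map_smul, adL_apply, blockL_ad h3, h5 w,
      ← powAd_smul]
    rw [show (m : ℂ) • (blockL n k) (g z w) + ad (A z) ((blockL n k) (g z w)) +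
      powAd w (A z) (coefV k (phi k A U Φ₀ z) j w) - ad (A z) ((blockL n k) (g z w))
      = (m : ℂ) • (blockL n k) (g z w) + powAd w (A z) (coefV k (phi k A U Φ₀ z) j w) by abel,
      powAd_add, powAd_neg_powAd]
  refine ⟨hg'.congr ?_, (hf.congr ?_).mono (by rw [add_comm]) (by rw [mul_add]; omega), ?_⟩
  · filter_upwards [hsol] with z hz w
    rw [hz.decaySol_eq, powAd_powAd_neg]
  · filter_upwards [hsol] with z hz w
    rw [hz.decaySol_eq]
  · filter_upwards [hsol, H.isBlock] with z hz hb
    rw [hz.decaySol_eq]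
    refine ⟨hz, fun w => ?_⟩
    have h1 : powAd (-w) (A z) (projQ n k) = projQ n k := powAd_commute hb.commute_projQ
    conv_lhs => rw [← h1]
    rw [← powAd_mul, ← powAd_mul, ← blockL_apply, blockL_blockL]

end BlockData
end Isomonodromy
end

/-! ### Exponents and differential equations of the coefficients φ_m -/

noncomputable section
namespace Isomonodromy
open Filter Topology Polynomial
open Finset.HasAntidiagonal (antidiagonal mem_antidiagonal)
open scoped Pointwise

variable {n : ℕ} {Z : Type*} [NormedAddCommGroup Z] [NormedSpace ℂ Z]

namespace BlockData

variable {k : ℕ} {s : Finset ℂ} {ν : ℕ} {A U Φ₀ : Z → Mat n} {z₀ : Z}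

/-- Bookkeeping: a conjugated power U^p with p ≥ 1 costs a single difference and T = 2(ν - 1)
logarithms, whatever p is, so order p + j leaves enough room for 1 + j. -/
theorem logExp_mono {f : Z → ℂ → Mat n} {j m T : ℕ} (hjm : 1 + j ≤ m)
    (hf : LogExp z₀ (diffSet s + sumSet j (diffSet s)) (T + T * j) f) :
    LogExp z₀ (sumSet m (diffSet s)) (T * m) f := by
  refine hf.mono ((diffSet_add_sumSet_subset j).trans (sumSet_mono (by omega) hjm)) ?_
  calc T + T * j = T * (1 + j) := by ring
    _ ≤ T * m := Nat.mul_le_mul_left _ hjm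

theorem logExp_powAd_coefX (H : BlockData k s ν A U Φ₀ z₀) {m : ℕ} (hm : 1 ≤ m)
    (hY : ∀ a < m, Structure k s ν A U Φ₀ z₀ a) :
    LogExp z₀ (sumSet m (diffSet s)) (2 * (ν - 1) * m)
      (fun z w => powAd w (A z) (coefX k (A z) (U z) (phi k A U Φ₀ z) m w)) := by
  have h1 : ∀ x ∈ antidiagonal m, LogExp z₀ (sumSet m (diffSet s)) (2 * (ν - 1) * m)
      (fun z w => powAd w (A z) (ad (coefH (U z) x.1)
        (decaySol m (coefV k (phi k A U Φ₀ z) x.2) w))) := by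
    intro x hx
    rw [mem_antidiagonal] at hx
    rcases Nat.eq_zero_or_pos x.1 with h0 | h0
    · simpa [h0, ad] using LogExp.zero
    · simp only [powAd_ad]
      exact logExp_mono (by omega) ((H.powAd_coefH x.1).ad
        (H.decaySol_coefV (m := m) (by omega) fun a ha => hY a (by omega)).1)
  refine (LogExp.sum _ h1).congr (Eventually.of_forall fun z w => ?_)
  rw [coefX, if_neg (by omega), powAd_sum]

/-- Without conjugation the powers of U are constant and cost nothing, whereas the decaying
primitive costs the additional difference; the total 1 + j is the same as in the conjugated case. -/
theorem logExp_coefX (H : BlockData k s ν A U Φ₀ z₀) {m : ℕ} (hm : 1 ≤ m)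
    (hY : ∀ a < m, Structure k s ν A U Φ₀ z₀ a) :
    LogExp z₀ (sumSet m (diffSet s)) (2 * (ν - 1) * m)
      (fun z w => coefX k (A z) (U z) (phi k A U Φ₀ z) m w) := by
  have h1 : ∀ x ∈ antidiagonal m, LogExp z₀ (sumSet m (diffSet s)) (2 * (ν - 1) * m)
      (fun z w => ad (coefH (U z) x.1) (decaySol m (coefV k (phi k A U Φ₀ z) x.2) w)) := by
    intro x hx
    rw [mem_antidiagonal] at hx
    rcases Nat.eq_zero_or_pos x.1 with h0 | h0
    · simpa [h0, ad] using LogExp.zero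
    · refine ((LogExp.const (H.holU.coefH x.1)).ad (H.decaySol_coefV (m := m) (by omega)
        fun a ha => hY a (by omega)).2.1).mono ?_ ?_
      · rw [Set.singleton_zero, zero_add]
        exact sumSet_mono (by omega) (by omega)
      · rw [zero_add]
        exact Nat.mul_le_mul_left _ (by omega)
  refine (LogExp.sum _ h1).congr (Eventually.of_forall fun z w => ?_)
  rw [coefX, if_neg (by omega)]

theorem powAd_coefE {A : Mat n} (hA : IsBlock k A) (C Y : Mat n) (w : ℂ) :
    powAd w A (C * Y * unitE n k + unitE n k * Y * C)
      = powAd w A C * powAd w A Y * unitE n k + unitE n k * powAd w A Y * powAd w A C := by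
  have h2 : powAd w A (unitE n k) = unitE n k := powAd_commute hA.commute_unitE
  simp only [powAd_add, powAd_mul, h2]

theorem logExp_powAd_coefS (H : BlockData k s ν A U Φ₀ z₀) {m : ℕ} (hm : 1 ≤ m)
    (hY : ∀ a < m, Structure k s ν A U Φ₀ z₀ a) :
    LogExp z₀ (sumSet m (diffSet s)) (2 * (ν - 1) * m)
      (fun z w => powAd w (A z) (coefS k (A z) (U z) (phi k A U Φ₀ z) m w)) := by
  have h1 : ∀ x ∈ antidiagonal m, LogExp z₀ (sumSet m (diffSet s)) (2 * (ν - 1) * m)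
      (fun z w => powAd w (A z) (coefH (U z) x.1) * powAd w (A z) (phi k A U Φ₀ z x.2 w) *
        unitE n k + unitE n k * powAd w (A z) (phi k A U Φ₀ z x.2 w) *
        powAd w (A z) (coefH (U z) x.1)) := by
    intro x hx
    rw [mem_antidiagonal] at hx
    rcases Nat.eq_zero_or_pos x.1 with h0 | h0
    · simpa [h0] using LogExp.zero
    · have h2 := H.powAd_coefH x.1
      have h3 := hY x.2 (by omega)
      refine LogExp.add (logExp_mono (by omega)
        ((h2.mul h3).mul_const (HolNear.const (unitE n k)))) (logExp_mono (j := x.2) (by omega) ?_)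
      exact ((h3.const_mul (HolNear.const (unitE n k))).mul h2).mono
        (by rw [add_comm]) (by rw [add_comm])
  refine ((H.logExp_powAd_coefX hm hY).neg.add (LogExp.sum _ h1)).congr ?_
  filter_upwards [H.isBlock] with z hz w
  rw [coefS, if_neg (by omega), powAd_add, powAd_neg, powAd_sum]
  simp only [powAd_coefE hz]

theorem logExp_powAd_coefRhs (H : BlockData k s ν A U Φ₀ z₀) {m : ℕ}
    (hY : ∀ a < m, Structure k s ν A U Φ₀ z₀ a) :
    LogExp z₀ (sumSet m (diffSet s)) (2 * (ν - 1) * m)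
      (fun z w => powAd w (A z) (coefRhs k (A z) (U z) (phi k A U Φ₀ z) m w)) := by
  have h1 : ∀ x ∈ antidiagonal m, LogExp z₀ (sumSet m (diffSet s)) (2 * (ν - 1) * m)
      (fun z w => powAd w (A z) (ad (coefS k (A z) (U z) (phi k A U Φ₀ z) x.1 w)
        (phi k A U Φ₀ z x.2 w))) := by
    intro x hx
    rw [mem_antidiagonal] at hx
    rcases Nat.eq_zero_or_pos x.1 with h0 | h0
    · simpa [h0, ad, coefS] using LogExp.zero
    · simp only [powAd_ad]
      refine ((H.logExp_powAd_coefS h0 fun a ha => hY a (by omega)).ad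
        (hY x.2 (by omega))).mono ?_ ?_
      · rw [← hx]; exact sumSet_add_subset _ _ _
      · rw [← hx, mul_add]
  refine (LogExp.sum _ h1).congr (Eventually.of_forall fun z w => ?_)
  rw [coefRhs, powAd_sum]

/-- Conjugation by z^A removes the term [A, φ_m], so the equation is scalar and its resolvent is
division by d - m, without any condition on the position of eigenvalues beyond d ≠ m. -/
theorem structure_step (H : BlockData k s ν A U Φ₀ z₀) {m : ℕ} (hm : 1 ≤ m)
    (hY : ∀ a < m, Structure k s ν A U Φ₀ z₀ a) :
    Structure k s ν A U Φ₀ z₀ m ∧ ∀ᶠ z in 𝓝 z₀,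
      IsDecaying m (fun w => powAd w (A z) (coefRhs k (A z) (U z) (phi k A U Φ₀ z) m w))
        (fun w => powAd w (A z) (phi k A U Φ₀ z m w)) := by
  have hR : ∀ d ∈ sumSet m (diffSet s), ∃ R : Z → Mat n →L[ℂ] Mat n, HolNear z₀ R ∧
      ∀ᶠ z in 𝓝 z₀, ∀ C, (d - m) • R z C - (0 : Mat n →L[ℂ] Mat n) (R z C)
          = ContinuousLinearMap.id ℂ (Mat n) C ∧
        ContinuousLinearMap.id ℂ (Mat n) (R z C) = R z C := by
    intro d hd
    have h2 := sumSet_re_lt H.re_lt (j := m) (m := m) le_rfl hm _ hd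
    have h3 : d - m ≠ 0 := fun h => by
      rw [sub_eq_zero.1 h] at h2
      simp at h2
    refine ⟨fun _ => (d - m)⁻¹ • ContinuousLinearMap.id ℂ (Mat n), HolNear.const _,
      Eventually.of_forall fun z C => ?_⟩
    simp [smul_smul, h3]
  obtain ⟨g, hg, hge⟩ := LogExp.exists_solution (fun C => rfl) (m : ℂ) hR
    (H.logExp_powAd_coefRhs hY) (Eventually.of_forall fun z w => rfl)
  have hsol : ∀ᶠ z in 𝓝 z₀,
      IsDecaying m (fun w => powAd w (A z) (coefRhs k (A z) (U z) (phi k A U Φ₀ z) m w)) (g z) := by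
    filter_upwards [hg.tendsto m (sumSet_re_lt H.re_lt le_rfl hm), hge] with z h1 h2
    exact ⟨fun w => by simpa using h2 w, by simpa using h1 0⟩
  have heq : ∀ᶠ z in 𝓝 z₀, ∀ w, powAd w (A z) (phi k A U Φ₀ z m w) = g z w := by
    filter_upwards [hsol] with z hz w
    rw [phi, powAd_coefPhi _ _ _ _ hm, hz.decaySol_eq]
  refine ⟨hg.congr heq, ?_⟩
  filter_upwards [hsol, heq] with z h1 h2
  rwa [funext h2]

theorem structure_all (H : BlockData k s ν A U Φ₀ z₀) (m : ℕ) :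
    Structure k s ν A U Φ₀ z₀ m := by
  induction m using Nat.strong_induction_on with
  | _ m ih =>
    rcases Nat.eq_zero_or_pos m with rfl | hm
    · refine (LogExp.const H.holΦ).mono (by simp [sumSet_zero]) (by simp) |>.congr ?_
      refine Eventually.of_forall fun z w => ?_
      rw [phi, coefPhi_zero, powAd_powAd_neg]
    · exact (H.structure_step hm ih).1

/-- The differential equation for the coefficients of positive order. -/
theorem isDecaying_phi (H : BlockData k s ν A U Φ₀ z₀) {m : ℕ} (hm : 1 ≤ m) : ∀ᶠ z in 𝓝 z₀,
    IsDecaying m (fun w => powAd w (A z) (coefRhs k (A z) (U z) (phi k A U Φ₀ z) m w))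
      (fun w => powAd w (A z) (phi k A U Φ₀ z m w)) :=
  (H.structure_step hm fun a _ => H.structure_all a).2

theorem isDecaying_coefV (H : BlockData k s ν A U Φ₀ z₀) {j m : ℕ} (hjm : j < m) :
    ∀ᶠ z in 𝓝 z₀, IsDecaying m (coefV k (phi k A U Φ₀ z) j)
        (decaySol m (coefV k (phi k A U Φ₀ z) j)) ∧
      ∀ w, projQ n k * decaySol m (coefV k (phi k A U Φ₀ z) j) w * projQ n k
        = decaySol m (coefV k (phi k A U Φ₀ z) j) w :=
  (H.decaySol_coefV hjm fun a _ => H.structure_all a).2.2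

theorem hasDerivAt_phi (H : BlockData k s ν A U Φ₀ z₀) (m : ℕ) : ∀ᶠ z in 𝓝 z₀, ∀ w,
    HasDerivAt (phi k A U Φ₀ z m) ((m : ℂ) • phi k A U Φ₀ z m w
      + (coefRhs k (A z) (U z) (phi k A U Φ₀ z) m w - ad (A z) (phi k A U Φ₀ z m w))) w := by
  rcases Nat.eq_zero_or_pos m with rfl | hm
  · refine Eventually.of_forall fun z w => ?_
    have h1 := HasDerivAt.powAd_neg (A z) (hasDerivAt_const w (Φ₀ z))
    have h2 : phi k A U Φ₀ z 0 = fun w => powAd (-w) (A z) (Φ₀ z) :=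
      funext fun w => coefPhi_zero _ _ _ _ _
    rw [h2]
    refine h1.congr_deriv ?_
    have h3 : powAd (-w) (A z) (A z) = A z := powAd_commute (Commute.refl _)
    simp [coefRhs, coefS, ad, powAd_sub, powAd_mul, h3]
  · filter_upwards [H.isDecaying_phi hm] with z hz w
    have h1 := HasDerivAt.powAd_neg (A z) (hz.1 w)
    simp only [powAd_neg_powAd] at h1
    refine h1.congr_deriv ?_
    have h3 : powAd (-w) (A z) (A z) = A z := powAd_commute (Commute.refl _)
    rw [powAd_sub, powAd_add, powAd_smul, powAd_neg_powAd, powAd_neg_powAd, powAd_ad, h3,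
      powAd_neg_powAd]
    abel

theorem hasDerivAt_coefX (H : BlockData k s ν A U Φ₀ z₀) {m : ℕ} (hm : 1 ≤ m) :
    ∀ᶠ z in 𝓝 z₀, ∀ w, HasDerivAt (coefX k (A z) (U z) (phi k A U Φ₀ z) m)
      ((m : ℂ) • coefX k (A z) (U z) (phi k A U Φ₀ z) m w + ∑ x ∈ antidiagonal m,
        ad (coefH (U z) x.1) (coefV k (phi k A U Φ₀ z) x.2 w)) w := by
  have h1 : ∀ᶠ z in 𝓝 z₀, ∀ j ∈ Finset.range m, IsDecaying m (coefV k (phi k A U Φ₀ z) j)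
        (decaySol m (coefV k (phi k A U Φ₀ z) j)) := by
    rw [Finset.eventually_all]
    exact fun j hj => (H.isDecaying_coefV (Finset.mem_range.1 hj)).mono fun z hz => hz.1
  filter_upwards [h1] with z hz w
  have h2 : coefX k (A z) (U z) (phi k A U Φ₀ z) m = fun w => ∑ x ∈ antidiagonal m,
      adL n (coefH (U z) x.1) (decaySol m (coefV k (phi k A U Φ₀ z) x.2) w) := by
    funext w
    rw [coefX, if_neg (by omega)]
    simp only [adL_apply]
  rw [h2, Finset.smul_sum, ← Finset.sum_add_distrib]
  refine HasDerivAt.fun_sum fun x hx => ?_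
  rw [mem_antidiagonal] at hx
  rcases Nat.eq_zero_or_pos x.1 with h0 | h0
  · simpa [h0, ad] using hasDerivAt_const w (0 : Mat n)
  · have h3 := (adL n (coefH (U z) x.1)).hasFDerivAt.comp_hasDerivAt w
      ((hz x.2 (Finset.mem_range.2 (by omega))).1 w)
    refine h3.congr_deriv ?_
    rw [map_add, map_smul, adL_apply, adL_apply]

end BlockData
end Isomonodromy
end

noncomputable section
namespace Isomonodromy
open Filter Topology
open Finset.HasAntidiagonal (antidiagonal mem_antidiagonal)

variable {n : ℕ}

/-! ### Power series with matrix coefficients -/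

/-- The commutator in a ring. -/
def comm {R : Type*} [Ring R] (x y : R) : R := x * y - y * x

theorem comm_sub {R : Type*} [Ring R] (x y z : R) : comm x (y - z) = comm x y - comm x z := by
  simp only [comm]; noncomm_ring

theorem add_comm' {R : Type*} [Ring R] (x y z : R) : comm (x + y) z = comm x z + comm y z := by
  simp only [comm]; noncomm_ring

theorem comm_self {R : Type*} [Ring R] (x : R) : comm x x = 0 := sub_self _

open PowerSeries in
theorem coeff_comm (m : ℕ) (f g : PowerSeries (Mat n)) :
    coeff m (comm f g) = ∑ x ∈ antidiagonal m, ad (coeff x.1 f) (coeff x.2 g) := by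
  rw [comm, map_sub, coeff_mul, coeff_mul, ← Finset.Nat.sum_antidiagonal_swap (f := fun x =>
    coeff x.1 g * coeff x.2 f), ← Finset.sum_sub_distrib]
  rfl

/-- Application of a linear map to the coefficients. -/
def lmap (L : Mat n →L[ℂ] Mat n) (f : PowerSeries (Mat n)) : PowerSeries (Mat n) :=
  PowerSeries.mk fun m => L (PowerSeries.coeff m f)

@[simp] theorem coeff_lmap (L : Mat n →L[ℂ] Mat n) (f : PowerSeries (Mat n)) (m : ℕ) :
    PowerSeries.coeff m (lmap L f) = L (PowerSeries.coeff m f) := by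
  simp [lmap]

theorem lmap_add (L : Mat n →L[ℂ] Mat n) (f g : PowerSeries (Mat n)) :
    lmap L (f + g) = lmap L f + lmap L g := by
  ext1 m; simp

theorem lmap_sub (L : Mat n →L[ℂ] Mat n) (f g : PowerSeries (Mat n)) :
    lmap L (f - g) = lmap L f - lmap L g := by
  ext1 m; simp

theorem lmap_neg (L : Mat n →L[ℂ] Mat n) (f : PowerSeries (Mat n)) :
    lmap L (-f) = -lmap L f := by
  ext1 m; simp

/-- All coefficients are in the image of `delta k`. -/
def IsBlockSeries (k : ℕ) (f : PowerSeries (Mat n)) : Prop :=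
  ∀ m, IsBlock k (PowerSeries.coeff m f)

theorem IsBlockSeries.lmap_mul {k : ℕ} {f : PowerSeries (Mat n)} (hf : IsBlockSeries k f)
    (g : PowerSeries (Mat n)) : lmap (deltaL n k) (f * g) = f * lmap (deltaL n k) g := by
  ext1 m
  simp only [coeff_lmap, PowerSeries.coeff_mul, deltaL_apply, delta_sum]
  exact Finset.sum_congr rfl fun x _ => (hf x.1).delta_mul _

theorem IsBlockSeries.lmap_mul' {k : ℕ} {f : PowerSeries (Mat n)} (hf : IsBlockSeries k f)
    (g : PowerSeries (Mat n)) : lmap (deltaL n k) (g * f) = lmap (deltaL n k) g * f := by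
  ext1 m
  simp only [coeff_lmap, PowerSeries.coeff_mul, deltaL_apply, delta_sum]
  exact Finset.sum_congr rfl fun x _ => (hf x.2).delta_mul' _

theorem IsBlockSeries.lmap_comm {k : ℕ} {f : PowerSeries (Mat n)} (hf : IsBlockSeries k f)
    (g : PowerSeries (Mat n)) : lmap (deltaL n k) (comm f g) = comm f (lmap (deltaL n k) g) := by
  rw [comm, lmap_sub, hf.lmap_mul, hf.lmap_mul', comm]

theorem isBlockSeries_lmap (k : ℕ) (f : PowerSeries (Mat n)) :
    IsBlockSeries k (lmap (deltaL n k) f) := fun m => by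
  rw [coeff_lmap]; exact isBlock_delta k _

theorem IsBlockSeries.commute {k : ℕ} {f : PowerSeries (Mat n)} (hf : IsBlockSeries k f)
    {C : Mat n} (hC : ∀ X : Mat n, IsBlock k X → Commute X C) :
    Commute f (PowerSeries.C C) := by
  ext1 m
  rw [PowerSeries.coeff_mul_C, PowerSeries.coeff_C_mul]
  exact (hC _ (hf m)).eq

/-- Besides the block, δ_k keeps the diagonal entries outside it; they sit in the two corners
assumed to be zero. -/
theorem delta_eq_of_corner {k : ℕ} {M : Mat n} (h1 : unitE n k * M * unitE n k = 0)
    (h2 : (1 - projQ n k - unitE n k) * M * (1 - projQ n k - unitE n k) = 0) :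
    delta k M = projQ n k * M * projQ n k := by
  have h3 : ∀ i : Fin n, k ≤ i.val → M i i = 0 := by
    intro i hi
    by_cases h : i.val = k
    · have := congrFun (congrFun h1 i) i
      rw [mul_unitE_apply, unitE_mul_apply, if_pos h, if_pos h] at this
      simpa using this
    · have := congrFun (congrFun h2 i) i
      have h0 : ¬ i.val < k := by omega
      simp only [sub_mul, mul_sub, one_mul, mul_one, Matrix.sub_apply, mul_unitE_apply,
        unitE_mul_apply, mul_projQ_apply, projQ_mul_apply, if_neg h, if_neg h0, sub_zero,
        Matrix.zero_apply] at this
      exact this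
  ext i j
  rw [delta_apply, mul_projQ_apply, projQ_mul_apply]
  by_cases hi : i.val < k <;> by_cases hj : j.val < k <;> simp [hi, hj]
  · rintro rfl; exact absurd hi hj
  · rintro rfl; exact absurd hj hi
  · rintro rfl; exact h3 i (by omega)

/-- The corners of the commutator of `H Ψ e + e Ψ H` with `Ψ`. -/
theorem comm_corner {R : Type*} [Ring R] {Q e H F Y : R} (he : e * e = e)
    (hQe : Q * e = 0) (heQ : e * Q = 0) (hHQ : H * Q = H) (hQH : Q * H = H)
    (hF : F = 1 - Q - e) :
    e * comm (H * Y * e + e * Y * H) Y * e = 0 ∧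
    F * comm (H * Y * e + e * Y * H) Y * F = 0 ∧
    Q * comm (H * Y * e + e * Y * H) Y * Q = comm H (Q * Y * e * Y * Q) := by
  have heH : e * H = 0 := by rw [← hQH, ← mul_assoc, heQ, zero_mul]
  have hHe : H * e = 0 := by rw [← hHQ, mul_assoc, hQe, mul_zero]
  have hFH : F * H = 0 := by rw [hF, sub_mul, sub_mul, one_mul, hQH, heH]; simp
  have hHF : H * F = 0 := by rw [hF, mul_sub, mul_sub, mul_one, hHQ, hHe]; simp
  have hFe : F * e = 0 := by rw [hF, sub_mul, sub_mul, one_mul, hQe, he]; simp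
  have heF : e * F = 0 := by rw [hF, mul_sub, mul_sub, mul_one, heQ, he]; simp
  have r1 : ∀ x, e * (H * x) = 0 := fun x => by rw [← mul_assoc, heH, zero_mul]
  have r2 : ∀ x, F * (H * x) = 0 := fun x => by rw [← mul_assoc, hFH, zero_mul]
  have r3 : ∀ x, F * (e * x) = 0 := fun x => by rw [← mul_assoc, hFe, zero_mul]
  have r4 : ∀ x, e * (e * x) = e * x := fun x => by rw [← mul_assoc, he]
  have r5 : ∀ x, Q * (H * x) = H * x := fun x => by rw [← mul_assoc, hQH]
  have r6 : ∀ x, Q * (e * x) = 0 := fun x => by rw [← mul_assoc, hQe, zero_mul]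
  have r7 : ∀ x, H * (Q * x) = H * x := fun x => by rw [← mul_assoc, hHQ]
  refine ⟨?_, ?_, ?_⟩ <;>
  simp only [comm, mul_add, add_mul, mul_sub, sub_mul, mul_assoc, r1, r2, r3, r4, r5, r6, r7, he,
    hHe, hHF, hHQ, heF, heQ, hQH, mul_zero, zero_mul, add_zero, zero_add, sub_self]

/-- The term HYe + eYH lives in one column and one row, so its commutator with Y reaches the block
only through the product of this column and row of Y. This makes the equation for δ_kΨ free of δ_kΨ
on the right. -/
theorem lmap_delta_comm {k : ℕ} {H Y : PowerSeries (Mat n)}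
    (hHQ : H * PowerSeries.C (projQ n k) = H) (hQH : PowerSeries.C (projQ n k) * H = H) :
    lmap (deltaL n k) (comm (H * Y * PowerSeries.C (unitE n k)
      + PowerSeries.C (unitE n k) * Y * H) Y)
      = comm H (PowerSeries.C (projQ n k) * Y * PowerSeries.C (unitE n k) * Y *
          PowerSeries.C (projQ n k)) := by
  obtain ⟨h1, h2, h3⟩ := comm_corner (Q := PowerSeries.C (projQ n k))
    (e := PowerSeries.C (unitE n k)) (H := H)
    (F := PowerSeries.C (1 - projQ n k - unitE n k)) (Y := Y)
    (by rw [← map_mul, unitE_mul_self])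
    (by rw [← map_mul, projQ_mul_unitE, map_zero]) (by rw [← map_mul, unitE_mul_projQ, map_zero])
    hHQ hQH (by simp)
  rw [← h3]
  ext1 m
  have h4 := congrArg (PowerSeries.coeff m) h1
  have h5 := congrArg (PowerSeries.coeff m) h2
  rw [PowerSeries.coeff_mul_C, PowerSeries.coeff_C_mul, map_zero] at h4 h5
  rw [coeff_lmap, deltaL_apply, delta_eq_of_corner h4 h5, PowerSeries.coeff_mul_C,
    PowerSeries.coeff_C_mul]

/-! ### The equation for the formal series -/

/-- The formal series `∑ φ_m x ^ m`. -/
def serPhi (k : ℕ) (A U Φ₀ : Mat n) (w : ℂ) : PowerSeries (Mat n) :=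
  PowerSeries.mk fun m => coefPhi k A U Φ₀ m w

/-- The formal series of `δ_k φ_m`. -/
def serX (k : ℕ) (A U Φ₀ : Mat n) (w : ℂ) : PowerSeries (Mat n) :=
  PowerSeries.mk fun m => coefX k A U (coefPhi k A U Φ₀) m w

/-- The formal series `(1 + x U)⁻¹ - 1`. -/
def serH (U : Mat n) : PowerSeries (Mat n) := PowerSeries.mk (coefH U)

/-- The operator `Y ↦ H Y e + e Y H`. -/
def serE (k : ℕ) (H Y : PowerSeries (Mat n)) : PowerSeries (Mat n) :=
  H * Y * PowerSeries.C (unitE n k) + PowerSeries.C (unitE n k) * Y * H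

/-- The product of the `k`-th column and the `k`-th row. -/
def serV (k : ℕ) (Y : PowerSeries (Mat n)) : PowerSeries (Mat n) :=
  PowerSeries.C (projQ n k) * Y * PowerSeries.C (unitE n k) * Y * PowerSeries.C (projQ n k)

theorem coeff_serE (k : ℕ) (H Y : PowerSeries (Mat n)) (m : ℕ) :
    PowerSeries.coeff m (serE k H Y) = ∑ x ∈ antidiagonal m,
      (PowerSeries.coeff x.1 H * PowerSeries.coeff x.2 Y * unitE n k
        + unitE n k * PowerSeries.coeff x.2 Y * PowerSeries.coeff x.1 H) := by
  rw [serE, map_add, PowerSeries.coeff_mul_C, PowerSeries.coeff_mul, PowerSeries.coeff_mul,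
    ← Finset.Nat.sum_antidiagonal_swap (f := fun x =>
      PowerSeries.coeff x.1 (PowerSeries.C (unitE n k) * Y) * PowerSeries.coeff x.2 H),
    Finset.sum_mul, ← Finset.sum_add_distrib]
  simp [PowerSeries.coeff_C_mul]

theorem coeff_serV (k : ℕ) (A U Φ₀ : Mat n) (w : ℂ) (m : ℕ) :
    PowerSeries.coeff m (serV k (serPhi k A U Φ₀ w)) = coefV k (coefPhi k A U Φ₀) m w := by
  rw [serV, PowerSeries.coeff_mul_C, PowerSeries.coeff_mul, coefV, Finset.sum_mul]
  simp only [PowerSeries.coeff_mul_C, PowerSeries.coeff_C_mul, serPhi, PowerSeries.coeff_mk]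

/-- The generator `S_z = -δ_kΨ + H Ψ e + e Ψ H`. -/
def serS (k : ℕ) (A U Φ₀ : Mat n) (w : ℂ) : PowerSeries (Mat n) :=
  -serX k A U Φ₀ w + serE k (serH U) (serPhi k A U Φ₀ w)

theorem coeff_zero_serS (k : ℕ) (A U Φ₀ : Mat n) (w : ℂ) :
    PowerSeries.coeff 0 (serS k A U Φ₀ w) = -A := by
  rw [serS, map_add, coeff_serE]
  simp [serX, coefX, serH]

theorem coeff_serS (k : ℕ) (A U Φ₀ : Mat n) (w : ℂ) {m : ℕ} (hm : 1 ≤ m) :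
    PowerSeries.coeff m (serS k A U Φ₀ w) = coefS k A U (coefPhi k A U Φ₀) m w := by
  rw [serS, map_add, coeff_serE, coefS, if_neg (by omega)]
  simp [serX, serH, serPhi]

theorem coeff_comm_serS (k : ℕ) (A U Φ₀ : Mat n) (w : ℂ) (m : ℕ) :
    PowerSeries.coeff m (comm (serS k A U Φ₀ w) (serPhi k A U Φ₀ w))
      = coefRhs k A U (coefPhi k A U Φ₀) m w - ad A (coefPhi k A U Φ₀ m w) := by
  have h0 : (0, m) ∈ antidiagonal m := by simp
  rw [coeff_comm, coefRhs, ← Finset.add_sum_erase _ _ h0, ← Finset.add_sum_erase _ _ h0,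
    coeff_zero_serS]
  have h1 : ad (-A) (PowerSeries.coeff m (serPhi k A U Φ₀ w)) = -ad A (coefPhi k A U Φ₀ m w) := by
    simp only [ad, serPhi, PowerSeries.coeff_mk, neg_mul, mul_neg]; abel
  have h2 : ad (coefS k A U (coefPhi k A U Φ₀) 0 w) (coefPhi k A U Φ₀ m w) = 0 := by
    simp [coefS, ad]
  rw [h1, h2, zero_add, add_comm, sub_eq_add_neg]
  congr 1
  refine Finset.sum_congr rfl fun x hx => ?_
  rw [Finset.mem_erase, mem_antidiagonal] at hx
  have h3 : 1 ≤ x.1 := by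
    rcases Nat.eq_zero_or_pos x.1 with h | h
    · exact absurd (Prod.ext h (by simpa [h] using hx.2)) hx.1
    · exact h
  rw [coeff_serS _ _ _ _ _ h3, serPhi, PowerSeries.coeff_mk]

theorem serH_mul_projQ {k : ℕ} {U : Mat n} (h1 : projQ n k * U = U) (h2 : U * projQ n k = U) :
    serH U * PowerSeries.C (projQ n k) = serH U ∧
      PowerSeries.C (projQ n k) * serH U = serH U := by
  constructor <;> ext1 m
  · rw [PowerSeries.coeff_mul_C, serH, PowerSeries.coeff_mk, (projQ_coefH h1 h2 m).2]
  · rw [PowerSeries.coeff_C_mul, serH, PowerSeries.coeff_mk, (projQ_coefH h1 h2 m).1]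

theorem isBlock_of_corner {k : ℕ} {X : Mat n} (h : projQ n k * X * projQ n k = X) :
    IsBlock k X := h ▸ isBlock_projQ_mul_mul k X

/-- Solutions of `f' = m f - [A, f]` which decay after conjugation vanish. -/
theorem eq_zero_of_hasDerivAt_ad {m : ℂ} {A : Mat n} {f : ℂ → Mat n}
    (hf : ∀ w, HasDerivAt f (m • f w - ad A (f w)) w)
    (h0 : Tendsto (fun s : ℝ => Complex.exp (-(m * s)) • powAd s A (f s)) atTop (𝓝 0)) (w : ℂ) :
    f w = 0 := by
  have h1 : ∀ w, HasDerivAt (fun w => powAd w A (f w)) (m • powAd w A (f w)) w := fun w => by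
    refine (HasDerivAt.powAd A (hf w)).congr_deriv ?_
    rw [add_sub_cancel, powAd_smul]
  have h2 : f 0 = 0 := by
    refine tendsto_nhds_unique (tendsto_const_nhds.congr fun s : ℝ => ?_) h0
    have := eq_of_hasDerivAt_smul h1 s
    rw [powAd_zero_left] at this
    exact this.symm
  have h3 := eq_of_hasDerivAt_smul h1 w
  rw [powAd_zero_left, h2, smul_eq_zero] at h3
  have h4 := h3.resolve_left (Complex.exp_ne_zero _)
  rw [← powAd_neg_powAd w A (f w), h4, powAd_zero]

namespace BlockData
open Polynomial

variable {Z : Type*} [NormedAddCommGroup Z] [NormedSpace ℂ Z]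
variable {k : ℕ} {s : Finset ℂ} {ν : ℕ} {A U Φ₀ : Z → Mat n} {z₀ : Z}

theorem isBlock_coefX (H : BlockData k s ν A U Φ₀ z₀) (m : ℕ) (w : ℂ) :
    IsBlock k (coefX k (A z₀) (U z₀) (phi k A U Φ₀ z₀) m w) := by
  rw [coefX]
  split_ifs with hm
  · exact H.isBlock.self_of_nhds
  refine Finset.sum_induction _ (IsBlock k) (fun _ _ => IsBlock.add) (isBlock_zero k) fun x hx => ?_
  rw [mem_antidiagonal] at hx
  rcases Nat.eq_zero_or_pos x.1 with h0 | h0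
  · simpa [h0, ad] using isBlock_zero k
  · exact (isBlock_of_corner (H.coefH_block x.1).self_of_nhds).ad
      (isBlock_of_corner ((H.isDecaying_coefV (m := m) (j := x.2) (by omega)).self_of_nhds.2 w))

/-- The series `serX` consists of the block parts of the coefficients. -/
theorem delta_phi (H : BlockData k s ν A U Φ₀ z₀) (m : ℕ) (w : ℂ) :
    delta k (phi k A U Φ₀ z₀ m w) = coefX k (A z₀) (U z₀) (phi k A U Φ₀ z₀) m w := by
  have hA := H.isBlock.self_of_nhds
  have hΦ := H.delta_eq.self_of_nhds
  have hQ := serH_mul_projQ H.proj_mul.self_of_nhds H.mul_proj.self_of_nhds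
  induction m using Nat.strong_induction_on generalizing w with
  | _ m ih =>
  rcases Nat.eq_zero_or_pos m with rfl | hm
  · rw [phi, coefPhi_zero, hA.delta_powAd, hΦ, coefX, if_pos rfl]
    exact powAd_commute (Commute.refl _)
  set f : ℂ → Mat n := fun w => delta k (phi k A U Φ₀ z₀ m w)
    - coefX k (A z₀) (U z₀) (phi k A U Φ₀ z₀) m w with hf
  -- Since [X, X] = 0, the part of the generator coming from X contributes -[X, δ_kΨ - X]. By
  -- induction the lower coefficients of δ_kΨ - X vanish, so in order m only -[A, f] survives.
  have hser : ∀ w, PowerSeries.coeff m (lmap (deltaL n k)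
        (comm (serS k (A z₀) (U z₀) (Φ₀ z₀) w) (serPhi k (A z₀) (U z₀) (Φ₀ z₀) w)))
      = -ad (A z₀) (f w) + ∑ x ∈ antidiagonal m,
        ad (coefH (U z₀) x.1) (coefV k (phi k A U Φ₀ z₀) x.2 w) := by
    intro w
    set Y := serPhi k (A z₀) (U z₀) (Φ₀ z₀) w
    set X := serX k (A z₀) (U z₀) (Φ₀ z₀) w with hX
    have hXb : IsBlockSeries k X := fun i => by
      rw [hX, serX, PowerSeries.coeff_mk]; exact H.isBlock_coefX i w
    have h1 : lmap (deltaL n k) (comm (serS k (A z₀) (U z₀) (Φ₀ z₀) w) Y)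
        = -comm X (lmap (deltaL n k) Y - X) + comm (serH (U z₀)) (serV k Y) := by
      rw [serS, add_comm', lmap_add, serE, lmap_delta_comm hQ.1 hQ.2, comm_sub, comm_self, sub_zero,
        ← hXb.lmap_comm, ← lmap_neg, serV]
      congr 2
      simp only [comm]; noncomm_ring
    rw [h1, map_add, map_neg, coeff_comm, coeff_comm]
    congr 1
    · congr 1
      rw [Finset.sum_eq_single (0, m)]
      · simp [hX, serX, coefX, hf, Y, serPhi, phi]
      · intro x hx hne
        rw [mem_antidiagonal] at hx
        have h2 : x.2 < m := by
          rcases Nat.eq_zero_or_pos x.1 with h | h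
          · exact absurd (Prod.ext h (by simpa [h] using hx)) hne
          · omega
        have h3 := ih x.2 h2 w
        have h4 : PowerSeries.coeff x.2 (lmap (deltaL n k) Y - X) = 0 := by
          rw [map_sub, coeff_lmap, deltaL_apply, hX, serX, PowerSeries.coeff_mk, ← h3, sub_eq_zero]
          simp [Y, serPhi, phi]
        rw [h4]
        simp [ad]
      · intro h
        exact absurd (by simp) h
    · refine Finset.sum_congr rfl fun x _ => ?_
      rw [coeff_serV, serH, PowerSeries.coeff_mk]
  have hd : ∀ w, HasDerivAt f ((m : ℂ) • f w - ad (A z₀) (f w)) w := by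
    intro w
    have h1 := (deltaL n k).hasFDerivAt.comp_hasDerivAt w ((H.hasDerivAt_phi m).self_of_nhds w)
    have h2 := (H.hasDerivAt_coefX hm).self_of_nhds w
    refine (h1.sub h2).congr_deriv ?_
    have h3 := hser w
    rw [coeff_lmap, coeff_comm_serS] at h3
    rw [map_add, h3, map_smul, hf]
    simp only [deltaL_apply, smul_sub]
    abel
  -- After conjugation both terms of f have exponents in m D, so the homogeneous solution f is
  -- excluded.
  have hlim : Tendsto (fun s : ℝ => Complex.exp (-(m * s)) • powAd s (A z₀) (f s))
      atTop (𝓝 0) := by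
    have h1 := ((H.structure_all m).map (deltaL n k)).sub
      (H.logExp_powAd_coefX hm fun a _ => H.structure_all a)
    have h2 := (h1.tendsto m (sumSet_re_lt H.re_lt le_rfl hm)).self_of_nhds 0
    refine h2.congr fun s => ?_
    simp only [zero_add, deltaL_apply, hf, powAd_sub, hA.delta_powAd]
  exact sub_eq_zero.1 (eq_zero_of_hasDerivAt_ad hd hlim w)

end BlockData
end Isomonodromy
end

noncomputable section
namespace Isomonodromy
open Filter Topology
open Finset.HasAntidiagonal (antidiagonal mem_antidiagonal)

variable {n : ℕ}

/-! ### Curvature -/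

/-- Multiply [u, X'] = [u', X] by N on both sides, and use Nu = uN = 1 - N and Nu' = u'N = K. It is
applied with u = xU, so N - 1 = H. -/
theorem comm_resolvent {R : Type*} [Ring R] {u u' N K X X' : R} (h1 : N * (1 + u) = 1)
    (h2 : (1 + u) * N = 1) (hK : K = N * u') (hK' : K = u' * N) (h : comm u X' = comm u' X) :
    comm (N - 1) X' + comm K X + K * X * (N - 1) - (N - 1) * X * K = 0 := by
  have h3 : comm (N - 1) X' = -(N * comm u X' * N) := by
    have e1 : N * u = 1 - N := by rw [← h1]; noncomm_ring
    have e2 : u * N = 1 - N := by rw [← h2]; noncomm_ring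
    have : N * comm u X' * N = (N * u) * X' * N - N * X' * (u * N) := by
      simp only [comm]; noncomm_ring
    rw [this, e1, e2]
    simp only [comm]; noncomm_ring
  have h4 : N * comm u' X * N = K * X * N - N * X * K := by
    nth_rewrite 1 [hK]
    rw [hK']
    simp only [comm]; noncomm_ring
  rw [h3, h, h4]
  simp only [comm]; noncomm_ring

/-- The zero curvature identity of the generators -X + HYe + eYH and X' + KYe + eYK as an identity
in a ring. The last two hypotheses are the relation of `comm_resolvent` for the pairs (X, X') and
(V, V'). -/
theorem curvature_aux {R : Type*} [Ring R] {Q e H K Y X X' V V' : R} (he : e * e = e)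
    (hQe : Q * e = 0) (heQ : e * Q = 0) (hHQ : H * Q = H) (hQH : Q * H = H) (hKQ : K * Q = K)
    (hQK : Q * K = K) (hHK : H * K = K * H) (hXe : X * e = e * X) (hXe' : X' * e = e * X')
    (hY : Q * Y * Q = Q * X * Q) (hV : V = Q * Y * e * Y * Q)
    (hX : comm H X' + comm K X + K * X * H - H * X * K = 0)
    (hVV : comm H V' + comm K V + K * V * H - H * V * K = 0) :
    (-(comm X' X + comm K V) + (H * comm (X' + (K * Y * e + e * Y * K)) Y * e
        + e * comm (X' + (K * Y * e + e * Y * K)) Y * H))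
      - (comm H V' + (K * comm (-X + (H * Y * e + e * Y * H)) Y * e
        + e * comm (-X + (H * Y * e + e * Y * H)) Y * K))
      + comm (-X + (H * Y * e + e * Y * H)) (X' + (K * Y * e + e * Y * K)) = 0 := by
  have heH : e * H = 0 := by rw [← hQH, ← mul_assoc, heQ, zero_mul]
  have hHe : H * e = 0 := by rw [← hHQ, mul_assoc, hQe, mul_zero]
  have heK : e * K = 0 := by rw [← hQK, ← mul_assoc, heQ, zero_mul]
  have hKe : K * e = 0 := by rw [← hKQ, mul_assoc, hQe, mul_zero]
  -- Between H and K only QYQ is visible, and there Y agrees with its block part X.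
  have hHYK : H * Y * K = H * X * K := by
    calc H * Y * K = H * (Q * Y * Q) * K := by
          rw [← mul_assoc, ← mul_assoc, hHQ, mul_assoc _ Q K, hQK]
      _ = H * X * K := by rw [hY, ← mul_assoc, ← mul_assoc, hHQ, mul_assoc _ Q K, hQK]
  have hKYH : K * Y * H = K * X * H := by
    calc K * Y * H = K * (Q * Y * Q) * H := by
          rw [← mul_assoc, ← mul_assoc, hKQ, mul_assoc _ Q H, hQH]
      _ = K * X * H := by rw [hY, ← mul_assoc, ← mul_assoc, hKQ, mul_assoc _ Q H, hQH]
  have hHVK : H * V * K = H * Y * e * Y * K := by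
    rw [hV]
    calc _ = (H * Q) * Y * e * Y * (Q * K) := by noncomm_ring
      _ = _ := by rw [hHQ, hQK]
  have hKVH : K * V * H = K * Y * e * Y * H := by
    rw [hV]
    calc _ = (K * Q) * Y * e * Y * (Q * H) := by noncomm_ring
      _ = _ := by rw [hKQ, hQH]
  rw [hHVK, hKVH] at hVV
  have hX1 := congrArg (fun t => t * Y * e) hX
  have hX2 := congrArg (fun t => e * Y * t) hX
  rw [← hHYK, ← hKYH] at hX1 hX2
  have r1 : ∀ x, e * (H * x) = 0 := fun x => by rw [← mul_assoc, heH, zero_mul]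
  have r2 : ∀ x, e * (K * x) = 0 := fun x => by rw [← mul_assoc, heK, zero_mul]
  have r3 : ∀ x, H * (e * x) = 0 := fun x => by rw [← mul_assoc, hHe, zero_mul]
  have r4 : ∀ x, K * (e * x) = 0 := fun x => by rw [← mul_assoc, hKe, zero_mul]
  have r5 : ∀ x, e * (e * x) = e * x := fun x => by rw [← mul_assoc, he]
  have r6 : ∀ x, H * (K * x) = K * (H * x) := fun x => by rw [← mul_assoc, hHK, mul_assoc]
  have r7 : ∀ x, X * (e * x) = e * (X * x) := fun x => by rw [← mul_assoc, hXe, mul_assoc]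
  have r8 : ∀ x, X' * (e * x) = e * (X' * x) := fun x => by rw [← mul_assoc, hXe', mul_assoc]
  simp only [comm, mul_add, add_mul, mul_sub, sub_mul, mul_assoc, r1, r2, r3, r4, r5, r6, r7, r8,
    he, hXe, hXe', hHK, heH, hHe, heK, hKe, mul_zero, zero_mul, add_zero, zero_add,
    mul_neg, neg_mul] at hX1 hX2 hVV ⊢
  rw [← sub_eq_zero] at hX1 hX2 hVV ⊢
  simp only [sub_zero] at hX1 hX2 hVV ⊢
  -- The curvature equals hX multiplied by Ye on the right, plus hX multiplied by eY on the left,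
  -- minus the relation for V.
  rw [← sub_eq_zero_of_eq (congrArg₂ (· + ·) hX1 (hX2.trans hVV.symm))]
  abel

/-! ### Multipliers -/

/-- The properties of the operator `(ad_u⁻¹ ad_{∂u} - z_j⁻¹) δ_k` in relation to the diagonal matrix
`U` and its derivative `U'`. -/
structure Multiplier (k : ℕ) (T : Mat n →L[ℂ] Mat n) (U U' : Mat n) : Prop where
  delta : ∀ X, T (delta k X) = T X
  block : ∀ X, IsBlock k (T X)
  ad_eq : ∀ X, IsBlock k X → ad U (T X) = ad U' X
  map_ad : ∀ p X, T (ad (coefH U p) X) = ad (coefH U p) (T X)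
  commute : Commute U U'
  proj_mul : projQ n k * U' = U'
  mul_proj : U' * projQ n k = U'

/-- The coefficients of `x U' (1 + x U)⁻¹`. -/
def coefK (U U' : Mat n) (p : ℕ) : Mat n := if p = 0 then 0 else U' * (-U) ^ (p - 1)

/-- The formal series `x U' (1 + x U)⁻¹`. -/
def serK (U U' : Mat n) : PowerSeries (Mat n) := PowerSeries.mk (coefK U U')

theorem one_add_serH_mul (U : Mat n) :
    (1 + serH U) * (1 + PowerSeries.C U * PowerSeries.X) = 1 := by
  have h0 : ∀ m, PowerSeries.coeff m (1 + serH U) = (-U) ^ m := fun m => by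
    rcases m with _ | m <;> simp [serH, coefH, PowerSeries.coeff_one]
  rw [mul_add, mul_one, ← mul_assoc]
  ext1 m
  rcases m with _ | m
  · rw [map_add, h0, PowerSeries.coeff_zero_mul_X]; simp
  · rw [map_add, h0, PowerSeries.coeff_succ_mul_X, PowerSeries.coeff_mul_C, h0,
      PowerSeries.coeff_one, if_neg (by omega), pow_succ]
    simp

theorem mul_one_add_serH (U : Mat n) :
    (1 + PowerSeries.C U * PowerSeries.X) * (1 + serH U) = 1 := by
  have h0 : ∀ m, PowerSeries.coeff m (1 + serH U) = (-U) ^ m := fun m => by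
    rcases m with _ | m <;> simp [serH, coefH, PowerSeries.coeff_one]
  rw [add_mul, one_mul, mul_assoc]
  ext1 m
  rcases m with _ | m
  · rw [map_add, h0, PowerSeries.coeff_C_mul, PowerSeries.coeff_zero_X_mul]; simp
  · rw [map_add, h0, PowerSeries.coeff_C_mul, PowerSeries.coeff_succ_X_mul, h0,
      PowerSeries.coeff_one, if_neg (by omega), pow_succ']
    simp

theorem serK_eq (U U' : Mat n) :
    serK U U' = PowerSeries.C U' * PowerSeries.X * (1 + serH U) := by
  have h0 : ∀ m, PowerSeries.coeff m (1 + serH U) = (-U) ^ m := fun m => by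
    rcases m with _ | m <;> simp [serH, coefH, PowerSeries.coeff_one]
  ext1 m
  rw [mul_assoc]
  rcases m with _ | m
  · rw [PowerSeries.coeff_C_mul, PowerSeries.coeff_zero_X_mul]; simp [serK, coefK]
  · rw [PowerSeries.coeff_C_mul, PowerSeries.coeff_succ_X_mul, h0]; simp [serK, coefK]

theorem serK_eq' {U U' : Mat n} (h : Commute U U') :
    serK U U' = (1 + serH U) * (PowerSeries.C U' * PowerSeries.X) := by
  have h0 : ∀ m, PowerSeries.coeff m (1 + serH U) = (-U) ^ m := fun m => by
    rcases m with _ | m <;> simp [serH, coefH, PowerSeries.coeff_one]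
  ext1 m
  rw [← mul_assoc]
  rcases m with _ | m
  · rw [PowerSeries.coeff_zero_mul_X]; simp [serK, coefK]
  · rw [PowerSeries.coeff_succ_mul_X, PowerSeries.coeff_mul_C, h0, (h.neg_left.pow_left m).eq]
    simp [serK, coefK]

theorem serK_mul_projQ {k : ℕ} {U U' : Mat n} (hU : U * projQ n k = U)
    (h1 : projQ n k * U' = U') (h2 : U' * projQ n k = U') :
    serK U U' * PowerSeries.C (projQ n k) = serK U U' ∧
      PowerSeries.C (projQ n k) * serK U U' = serK U U' := by
  constructor <;> ext1 m
  · rw [PowerSeries.coeff_mul_C, serK, PowerSeries.coeff_mk, coefK]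
    split_ifs
    · simp
    · rcases m - 1 with _ | p
      · simpa using h2
      · rw [pow_succ, mul_assoc, mul_assoc, neg_mul, hU]
  · rw [PowerSeries.coeff_C_mul, serK, PowerSeries.coeff_mk, coefK]
    split_ifs
    · simp
    · rw [← mul_assoc, h1]

/-- The generator `Y ↦ T Y + K Y e + e Y K`. -/
def serGen (k : ℕ) (T : Mat n →L[ℂ] Mat n) (K Y : PowerSeries (Mat n)) : PowerSeries (Mat n) :=
  lmap T Y + serE k K Y

theorem serE_add (k : ℕ) (K Y Y' : PowerSeries (Mat n)) :
    serE k K (Y + Y') = serE k K Y + serE k K Y' := by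
  simp only [serE]; noncomm_ring

theorem serGen_add (k : ℕ) (T : Mat n →L[ℂ] Mat n) (K Y Y' : PowerSeries (Mat n)) :
    serGen k T K (Y + Y') = serGen k T K Y + serGen k T K Y' := by
  rw [serGen, lmap_add, serE_add, serGen, serGen]; abel

theorem comm_C_mul_X (U : Mat n) (f : PowerSeries (Mat n)) :
    comm (PowerSeries.C U * PowerSeries.X) f
      = PowerSeries.mk (fun m => ad U (PowerSeries.coeff m f)) * PowerSeries.X := by
  have h : comm (PowerSeries.C U * PowerSeries.X) f
      = (PowerSeries.C U * f - f * PowerSeries.C U) * PowerSeries.X := by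
    rw [comm, mul_assoc, PowerSeries.X_mul, sub_mul]
    simp only [mul_assoc]
  rw [h]
  congr 1
  ext1 m
  simp [ad, PowerSeries.coeff_C_mul, PowerSeries.coeff_mul_C]

namespace Multiplier

variable {k : ℕ} {T : Mat n →L[ℂ] Mat n} {U U' : Mat n}

theorem star (hT : Multiplier k T U U') {f : PowerSeries (Mat n)} (hf : IsBlockSeries k f) :
    comm (serH U) (lmap T f) + comm (serK U U') f + serK U U' * f * serH U
      - serH U * f * serK U U' = 0 := by
  have := comm_resolvent (one_add_serH_mul U) (mul_one_add_serH U) (serK_eq' hT.commute)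
    (serK_eq U U') (X := f) (X' := lmap T f) ?_
  · simpa only [add_sub_cancel_left] using this
  · rw [comm_C_mul_X, comm_C_mul_X]
    congr 2
    funext m
    rw [coeff_lmap, hT.ad_eq _ (hf m)]

theorem lmap_delta (hT : Multiplier k T U U') (f : PowerSeries (Mat n)) :
    lmap T (lmap (deltaL n k) f) = lmap T f := by
  ext1 m
  simp [hT.delta]

theorem lmap_comm (hT : Multiplier k T U U') (f : PowerSeries (Mat n)) :
    lmap T (comm (serH U) f) = comm (serH U) (lmap T f) := by
  ext1 m
  simp only [coeff_lmap, coeff_comm, map_sum, serH, PowerSeries.coeff_mk, hT.map_ad]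

theorem isBlockSeries (hT : Multiplier k T U U') (f : PowerSeries (Mat n)) :
    IsBlockSeries k (lmap T f) := fun m => by
  rw [coeff_lmap]; exact hT.block _

theorem delta_comm_gen {H Y : PowerSeries (Mat n)} {L : Mat n →L[ℂ] Mat n}
    (hL : ∀ X, IsBlock k (L X))
    (hHQ : H * PowerSeries.C (projQ n k) = H) (hQH : PowerSeries.C (projQ n k) * H = H) :
    lmap (deltaL n k) (comm (serGen k L H Y) Y)
      = comm (lmap L Y) (lmap (deltaL n k) Y) + comm H (serV k Y) := by
  have hb : IsBlockSeries k (lmap L Y) := fun m => by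
    rw [coeff_lmap]; exact hL _
  rw [serGen, add_comm', lmap_add, serE, lmap_delta_comm hHQ hQH, hb.lmap_comm, serV]

/-- Flatness with the generators differentiated only through Y. The derivatives of H along z_j and
of K along w are left out because they coincide: both are `serL`, and they cancel. -/
theorem curvature (hT : Multiplier k T U U') (h1 : projQ n k * U = U) (h2 : U * projQ n k = U)
    (Y : PowerSeries (Mat n)) :
    serGen k (-deltaL n k) (serH U) (comm (serGen k T (serK U U') Y) Y)
      - serGen k T (serK U U') (comm (serGen k (-deltaL n k) (serH U) Y) Y)
      + comm (serGen k (-deltaL n k) (serH U) Y) (serGen k T (serK U U') Y) = 0 := by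
  have hH := serH_mul_projQ h1 h2
  have hK := serK_mul_projQ h2 hT.proj_mul hT.mul_proj
  have hneg : ∀ f : PowerSeries (Mat n), lmap (-deltaL n k) f = -lmap (deltaL n k) f := fun f => by
    ext1 m; simp
  have hVb : IsBlockSeries k (serV k Y) := fun m => by
    rw [serV, PowerSeries.coeff_mul_C, mul_assoc, mul_assoc, PowerSeries.coeff_C_mul]
    exact isBlock_projQ_mul_mul k _
  have e1 := delta_comm_gen (Y := Y) (L := T) hT.block hK.1 hK.2
  have e2 := delta_comm_gen (Y := Y) (L := -deltaL n k) (k := k)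
    (fun X => (isBlock_delta k X).neg) hH.1 hH.2
  -- T sees only the block part, which for the generator in w is -[δY, δY] + [H, V]; the first
  -- bracket is zero, and T commutes with ad of the diagonal coefficients of H.
  have e3 : lmap T (comm (serGen k (-deltaL n k) (serH U) Y) Y)
      = comm (serH U) (lmap T (serV k Y)) := by
    rw [← hT.lmap_delta, e2, hneg, ← hT.lmap_comm]
    congr 1
    simp only [comm]; noncomm_ring
  have hC : ∀ f, IsBlockSeries k f → f * PowerSeries.C (unitE n k) = PowerSeries.C (unitE n k) * f :=
    fun f hf => (hf.commute fun X hX => hX.commute_unitE).eq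
  have key := curvature_aux (Q := PowerSeries.C (projQ n k)) (e := PowerSeries.C (unitE n k))
    (H := serH U) (K := serK U U') (Y := Y) (X := lmap (deltaL n k) Y) (X' := lmap T Y)
    (V := serV k Y) (V' := lmap T (serV k Y))
    (by rw [← map_mul, unitE_mul_self]) (by rw [← map_mul, projQ_mul_unitE, map_zero])
    (by rw [← map_mul, unitE_mul_projQ, map_zero]) hH.1 hH.2 hK.1 hK.2
    (by
      have hc : Commute (1 + serH U) (PowerSeries.C U' * PowerSeries.X) := by
        rw [Commute, SemiconjBy, ← serK_eq, serK_eq' hT.commute]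
      have : Commute (serH U) (1 + serH U) := (Commute.one_right _).add_right (Commute.refl _)
      have h3 : Commute (serH U) (PowerSeries.C U' * PowerSeries.X) := by
        have := hc.sub_left (Commute.one_left _)
        simpa using this
      rw [serK_eq]
      exact h3.mul_right this)
    (hC _ (isBlockSeries_lmap k Y)) (hC _ (hT.isBlockSeries Y))
    (by
      ext1 m
      simp only [PowerSeries.coeff_mul_C, PowerSeries.coeff_C_mul, coeff_lmap, deltaL_apply]
      rw [projQ_mul_delta, mul_assoc _ (projQ n k) (projQ n k), projQ_mul_self])
    rfl
    (by
      have := hT.star (isBlockSeries_lmap k Y)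
      rwa [hT.lmap_delta] at this)
    (hT.star hVb)
  have hg : ∀ (L : Mat n →L[ℂ] Mat n) (K Z : PowerSeries (Mat n)),
      serGen k L K Z = lmap L Z + (K * Z * PowerSeries.C (unitE n k)
        + PowerSeries.C (unitE n k) * Z * K) := fun _ _ _ => rfl
  rw [← key, hg _ _ (comm (serGen k T (serK U U') Y) Y),
    hg _ _ (comm (serGen k (-deltaL n k) (serH U) Y) Y), hneg, e1, e3, hg, hg, hneg]

end Multiplier
end Isomonodromy
end

noncomputable section
namespace Isomonodromy
open Filter Topology
open Finset.HasAntidiagonal (antidiagonal mem_antidiagonal)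
open scoped Pointwise

variable {n : ℕ}

/-! ### Derivations of power series -/

/-- `f'` is the image of `f` under the derivation `d/dt - c x d/dx`, where `x` is the formal
variable. -/
def HasTheta (c : ℂ) (f : ℂ → PowerSeries (Mat n)) (f' : PowerSeries (Mat n)) (t₀ : ℂ) : Prop :=
  ∀ m : ℕ, HasDerivAt (fun t => PowerSeries.coeff m (f t))
    (PowerSeries.coeff m f' + (c * m) • PowerSeries.coeff m (f t₀)) t₀

namespace HasTheta

variable {c t₀ : ℂ} {f g : ℂ → PowerSeries (Mat n)} {f' g' : PowerSeries (Mat n)}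

theorem add (hf : HasTheta c f f' t₀) (hg : HasTheta c g g' t₀) :
    HasTheta c (fun t => f t + g t) (f' + g') t₀ := fun m => by
  simp only [map_add]
  refine ((hf m).add (hg m)).congr_deriv ?_
  module

theorem sub (hf : HasTheta c f f' t₀) (hg : HasTheta c g g' t₀) :
    HasTheta c (fun t => f t - g t) (f' - g') t₀ := fun m => by
  simp only [map_sub]
  refine ((hf m).sub (hg m)).congr_deriv ?_
  module

theorem mul (hf : HasTheta c f f' t₀) (hg : HasTheta c g g' t₀) :
    HasTheta c (fun t => f t * g t) (f' * g t₀ + f t₀ * g') t₀ := fun m => by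
  simp only [PowerSeries.coeff_mul, map_add]
  refine (HasDerivAt.fun_sum fun x _ => (hf x.1).mul (hg x.2)).congr_deriv ?_
  rw [Finset.smul_sum, ← Finset.sum_add_distrib, ← Finset.sum_add_distrib]
  refine Finset.sum_congr rfl fun x hx => ?_
  rw [mem_antidiagonal] at hx
  rw [← hx]
  simp only [add_mul, mul_add, smul_mul_assoc, mul_smul_comm, Nat.cast_add]
  module

theorem lmap (L : Mat n →L[ℂ] Mat n) (hf : HasTheta c f f' t₀) :
    HasTheta c (fun t => lmap L (f t)) (Isomonodromy.lmap L f') t₀ := fun m => by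
  simp only [coeff_lmap]
  refine (L.hasFDerivAt.comp_hasDerivAt t₀ (hf m)).congr_deriv ?_
  simp

theorem const_C (M : Mat n) : HasTheta c (fun _ => PowerSeries.C M) 0 t₀ := fun m => by
  refine (hasDerivAt_const t₀ _).congr_deriv ?_
  rcases m with _ | m <;> simp [PowerSeries.coeff_C]

theorem comm (hf : HasTheta c f f' t₀) (hg : HasTheta c g g' t₀) :
    HasTheta c (fun t => comm (f t) (g t)) (comm f' (g t₀) + Isomonodromy.comm (f t₀) g') t₀ := by
  have h := (hf.mul hg).sub (hg.mul hf)
  have e : f' * g t₀ + f t₀ * g' - (g' * f t₀ + g t₀ * f')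
      = Isomonodromy.comm f' (g t₀) + Isomonodromy.comm (f t₀) g' := by
    simp only [Isomonodromy.comm]; abel
  rwa [e] at h

theorem serE (k : ℕ) (hf : HasTheta c f f' t₀) (hg : HasTheta c g g' t₀) :
    HasTheta c (fun t => serE k (f t) (g t)) (serE k f' (g t₀) + Isomonodromy.serE k (f t₀) g')
      t₀ := by
  have h := ((hf.mul hg).mul (const_C (unitE n k))).add
    (((const_C (unitE n k)).mul hg).mul hf)
  have e : (f' * g t₀ + f t₀ * g') * PowerSeries.C (unitE n k) + f t₀ * g t₀ * 0
      + ((0 * g t₀ + PowerSeries.C (unitE n k) * g') * f t₀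
        + PowerSeries.C (unitE n k) * g t₀ * f')
      = Isomonodromy.serE k f' (g t₀) + Isomonodromy.serE k (f t₀) g' := by
    simp only [Isomonodromy.serE]; noncomm_ring
  rwa [e] at h

theorem serGen (k : ℕ) (L : Mat n →L[ℂ] Mat n) (hf : HasTheta c f f' t₀)
    (hg : HasTheta c g g' t₀) :
    HasTheta c (fun t => serGen k L (f t) (g t))
      (serGen k L (f t₀) g' + Isomonodromy.serE k f' (g t₀)) t₀ := by
  have h := (hg.lmap L).add (hf.serE k hg)
  have e : Isomonodromy.lmap L g' + (Isomonodromy.serE k f' (g t₀) + Isomonodromy.serE k (f t₀) g')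
      = Isomonodromy.serGen k L (f t₀) g' + Isomonodromy.serE k f' (g t₀) := by
    rw [Isomonodromy.serGen]; abel
  rwa [e] at h

end HasTheta

/-! ### Curves of matrices -/

/-- In the frame moving with A, conjugation by e^{cA} is constant. So ad τ is applied after the
conjugation and subtracted from Y' before it. -/
theorem hasDerivAt_powAd_curve {A Y : ℂ → Mat n} {τ Y' : Mat n} {x : ℂ} (c : ℂ)
    (hA : HasDerivAt A (ad τ (A x)) x) (hY : HasDerivAt Y Y' x) :
    HasDerivAt (fun t => powAd c (A t) (Y t))
      (ad τ (powAd c (A x) (Y x)) + powAd c (A x) (Y' - ad τ (Y x))) x := by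
  have h1 : HasDerivAt (fun t => NormedSpace.exp (c • A t))
      (ad τ (NormedSpace.exp (c • A x))) x :=
    hasDerivAt_exp_comp (A := fun t => c • A t) ((hA.const_smul c).congr_deriv (by
      simp [ad, smul_sub]))
  have h2 : HasDerivAt (fun t => NormedSpace.exp (-(c • A t)))
      (ad τ (NormedSpace.exp (-(c • A x)))) x :=
    hasDerivAt_exp_comp (A := fun t => -(c • A t)) ((hA.const_smul c).neg.congr_deriv (by
      simp only [ad, smul_sub, mul_neg, neg_mul, mul_smul_comm, smul_mul_assoc]; abel))
  refine ((h1.mul hY).mul h2).congr_deriv ?_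
  simp only [powAd, ad, Pi.mul_apply]
  noncomm_ring

/-! ### Orders of exponential polynomials -/

/-- `f` is an exponential polynomial with exponents in `⋃ j ≤ m, j D`. -/
def OrdLE (D : Set ℂ) (m : ℕ) (f : ℂ → Mat n) : Prop :=
  ∃ T, LogExp (0 : ℂ) (⋃ j ≤ m, sumSet j D) T (fun _ => f)

namespace OrdLE

variable {D : Set ℂ} {m m' : ℕ} {f g : ℂ → Mat n}

theorem _root_.Isomonodromy.LogExp.ordLE {Z : Type*} [NormedAddCommGroup Z] [NormedSpace ℂ Z]
    {z₀ : Z} {T : ℕ} {f : Z → ℂ → Mat n} (hf : LogExp z₀ (sumSet m D) T f) :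
    OrdLE D m (f z₀) := by
  obtain ⟨ι, _, d, t, c, hd, ht, hc, he⟩ := hf
  refine ⟨T, ι, inferInstance, d, t, fun i _ => c i z₀, fun i => ?_, ht,
    fun i => HolNear.const _, Eventually.of_forall fun z w => he.self_of_nhds w⟩
  exact Set.mem_iUnion₂.2 ⟨m, le_rfl, hd i⟩

theorem mono (hf : OrdLE D m f) (h : m ≤ m') : OrdLE D m' f := by
  obtain ⟨T, hf⟩ := hf
  exact ⟨T, hf.mono (Set.biUnion_subset_biUnion_left fun j hj => le_trans hj h) le_rfl⟩

theorem congr (hf : OrdLE D m f) (h : ∀ w, g w = f w) : OrdLE D m g := by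
  rwa [show g = f from funext h]

theorem add (hf : OrdLE D m f) (hg : OrdLE D m g) : OrdLE D m (fun w => f w + g w) := by
  obtain ⟨T, hf⟩ := hf
  obtain ⟨T', hg⟩ := hg
  exact ⟨max T T', (hf.mono le_rfl (le_max_left _ _)).add (hg.mono le_rfl (le_max_right _ _))⟩

theorem neg (hf : OrdLE D m f) : OrdLE D m (fun w => -f w) := hf.imp fun _ h => h.neg

theorem sub (hf : OrdLE D m f) (hg : OrdLE D m g) : OrdLE D m (fun w => f w - g w) := by
  simpa only [sub_eq_add_neg] using hf.add hg.neg

theorem map (L : Mat n →L[ℂ] Mat n) (hf : OrdLE D m f) : OrdLE D m (fun w => L (f w)) :=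
  hf.imp fun _ h => h.map L

theorem const (C : Mat n) : OrdLE D m (fun _ => C) :=
  ⟨0, (LogExp.const (HolNear.const C)).mono (by
    rw [← sumSet_zero D]
    exact fun x hx => Set.mem_iUnion₂.2 ⟨0, Nat.zero_le m, hx⟩)
    le_rfl⟩

theorem mul (hf : OrdLE D m f) (hg : OrdLE D m' g) : OrdLE D (m + m') (fun w => f w * g w) := by
  obtain ⟨T, hf⟩ := hf
  obtain ⟨T', hg⟩ := hg
  refine ⟨T + T', (hf.mul hg).mono ?_ le_rfl⟩
  rintro _ ⟨a, ha, b, hb, rfl⟩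
  simp only [Set.mem_iUnion] at ha hb ⊢
  obtain ⟨i, hi, ha⟩ := ha
  obtain ⟨j, hj, hb⟩ := hb
  exact ⟨i + j, by omega, sumSet_add_subset _ _ _ ⟨a, ha, b, hb, rfl⟩⟩

theorem ad (hf : OrdLE D m f) (hg : OrdLE D m' g) :
    OrdLE D (m + m') (fun w => ad (f w) (g w)) :=
  (hf.mul hg).sub ((hg.mul hf).mono (by omega))

theorem sum {ι : Type*} (s : Finset ι) {f : ι → ℂ → Mat n} (hf : ∀ i ∈ s, OrdLE D m (f i)) :
    OrdLE D m (fun w => ∑ i ∈ s, f i w) := by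
  classical
  induction s using Finset.induction_on with
  | empty => simpa using const (m := m) (D := D) (0 : Mat n)
  | insert i s hi ih =>
    refine ((hf i (Finset.mem_insert_self i s)).add
      (ih fun j hj => hf j (Finset.mem_insert_of_mem hj))).congr fun w => ?_
    rw [Finset.sum_insert hi]

theorem tendsto (hf : OrdLE D m f) (hm : 1 ≤ m) (hD : ∀ d ∈ D, d.re < 1) :
    Tendsto (fun s : ℝ => Complex.exp (-(m * s)) • f s) atTop (𝓝 0) := by
  obtain ⟨T, hf⟩ := hf
  have := (hf.tendsto m fun d hd => ?_).self_of_nhds 0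
  · simpa using this
  · simp only [Set.mem_iUnion] at hd
    obtain ⟨j, hj, hd⟩ := hd
    exact sumSet_re_lt hD hj hm d hd

end OrdLE

theorem ad_pow (B C : Mat n) (p : ℕ) :
    ad (B ^ p) C = ∑ i ∈ Finset.range p, B ^ i * ad B C * B ^ (p - 1 - i) := by
  induction p with
  | zero => simp [ad]
  | succ p ih =>
    have h : ad (B ^ (p + 1)) C = ad (B ^ p) C * B + B ^ p * ad B C := by
      simp only [ad, pow_succ]; noncomm_ring
    rw [h, ih, Finset.sum_range_succ, Finset.sum_mul]
    congr 1
    · refine Finset.sum_congr rfl fun i hi => ?_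
      rw [Finset.mem_range] at hi
      rw [mul_assoc, ← pow_succ]
      congr 2
      omega
    · simp

end Isomonodromy
end

/-! ### Derivatives of the formal series along curves in the parameter space -/

noncomputable section
namespace Isomonodromy
open Filter Topology
open Finset.HasAntidiagonal (antidiagonal mem_antidiagonal)

variable {n : ℕ}

theorem hasDerivAt_neg_pow {U : ℂ → Mat n} {U' : Mat n} {x : ℂ} (hU : HasDerivAt U U' x)
    (hc : Commute (U x) U') (p : ℕ) :
    HasDerivAt (fun t => (-U t) ^ p) (-(p : ℂ) • (U' * (-U x) ^ (p - 1))) x := by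
  induction p with
  | zero => simpa using hasDerivAt_const x (1 : Mat n)
  | succ p ih =>
    have h := ih.mul hU.neg
    simp only [pow_succ]
    refine h.congr_deriv ?_
    have h1 : (-U x) ^ p * U' = U' * (-U x) ^ p := (hc.neg_left.pow_left p).eq
    rcases p with _ | p
    · simp
    · rw [mul_neg, h1, smul_mul_assoc, mul_assoc]
      simp only [add_tsub_cancel_right, pow_succ, Pi.neg_apply]
      push_cast
      module

/-- The derivative of `serH U`. -/
def serL (U U' : Mat n) : PowerSeries (Mat n) :=
  PowerSeries.mk fun p => -(p : ℂ) • coefK U U' p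

theorem hasTheta_serH {U : ℂ → Mat n} {U' : Mat n} {x : ℂ} (hU : HasDerivAt U U' x)
    (hc : Commute (U x) U') : HasTheta 0 (fun t => serH (U t)) (serL (U x) U') x := fun m => by
  simp only [serH, serL, PowerSeries.coeff_mk, zero_mul, zero_smul, add_zero, coefH, coefK]
  split_ifs with h
  · simpa using hasDerivAt_const x (0 : Mat n)
  · exact hasDerivAt_neg_pow hU hc m

/-- K depends on w only through x = e^{-w}, so its derivative is -x dK/dx, which has the same
coefficients as the derivative of H in the direction U'. -/
theorem hasTheta_serK (U U' : Mat n) (w : ℂ) :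
    HasTheta 1 (fun _ => serK U U') (serL U U') w := fun m => by
  refine (hasDerivAt_const w _).congr_deriv ?_
  simp only [serK, serL, PowerSeries.coeff_mk]
  module

namespace BlockData

variable {Z : Type*} [NormedAddCommGroup Z] [NormedSpace ℂ Z]
variable {k : ℕ} {s : Finset ℂ} {ν : ℕ} {A U Φ₀ : Z → Mat n} {z₀ : Z}

theorem eventually (H : BlockData k s ν A U Φ₀ z₀) :
    ∀ᶠ z in 𝓝 z₀, BlockData k s ν A U Φ₀ z := by
  filter_upwards [H.holA.eventually_nhds, H.holU.eventually_nhds, H.holΦ.eventually_nhds,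
    H.delta_eq.eventually_nhds, H.proj_mul.eventually_nhds, H.mul_proj.eventually_nhds,
    H.annih.eventually_nhds] with z h1 h2 h3 h4 h5 h6 h7
  exact ⟨H.one_le, h1, h2, h3, h4, h5, h6, h7, H.re_lt⟩

/-- The formal series of the coefficients at a point of the parameter space. -/
abbrev ser (k : ℕ) (A U Φ₀ : Z → Mat n) (z : Z) (w : ℂ) : PowerSeries (Mat n) :=
  serPhi k (A z) (U z) (Φ₀ z) w

theorem serX_eq (H : BlockData k s ν A U Φ₀ z₀) (w : ℂ) :
    serX k (A z₀) (U z₀) (Φ₀ z₀) w = lmap (deltaL n k) (ser k A U Φ₀ z₀ w) := by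
  ext1 m
  rw [coeff_lmap, serX, ser, serPhi, PowerSeries.coeff_mk, PowerSeries.coeff_mk, deltaL_apply]
  exact (H.delta_phi m w).symm

theorem hasTheta_ser (H : BlockData k s ν A U Φ₀ z₀) (w : ℂ) :
    HasTheta 1 (ser k A U Φ₀ z₀) (comm (serGen k (-deltaL n k) (serH (U z₀)) (ser k A U Φ₀ z₀ w))
      (ser k A U Φ₀ z₀ w)) w := by
  have h1 : serGen k (-deltaL n k) (serH (U z₀)) (ser k A U Φ₀ z₀ w)
      = serS k (A z₀) (U z₀) (Φ₀ z₀) w := by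
    rw [serS, H.serX_eq, serGen]
    congr 1
  intro m
  rw [h1, coeff_comm_serS]
  have h2 := (H.hasDerivAt_phi m).self_of_nhds w
  simp only [ser, serPhi, PowerSeries.coeff_mk, one_mul]
  exact h2.congr_deriv (add_comm _ _)

variable {T : Mat n →L[ℂ] Mat n} {U' : Mat n} {γ : ℂ → Z} {v : Z} {x : ℂ}

theorem hasDerivAt_delta_curve (H : BlockData k s ν A U Φ₀ z₀) (hγ : HasDerivAt γ v x)
    (hx : γ x = z₀)
    (hΦ : HasDerivAt (fun t => Φ₀ (γ t)) (ad (T (Φ₀ z₀)) (Φ₀ z₀)) x)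
    (hT : Multiplier k T (U z₀) U') :
    HasDerivAt (fun t => A (γ t)) (ad (T (Φ₀ z₀)) (A z₀)) x := by
  have hγc : Tendsto γ (𝓝 x) (𝓝 z₀) := hx ▸ hγ.continuousAt
  have h1 := (deltaL n k).hasFDerivAt.comp_hasDerivAt x hΦ
  have h2 : ad (T (Φ₀ z₀)) (A z₀) = deltaL n k (ad (T (Φ₀ z₀)) (Φ₀ z₀)) := by
    rw [deltaL_apply, (hT.block _).delta_ad, H.delta_eq.self_of_nhds]
  rw [h2]
  refine h1.congr_of_eventuallyEq ?_
  filter_upwards [hγc.eventually H.delta_eq] with t ht using ht.symm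

/-- The derivative g of the series along γ exists coefficientwise, because the conjugated
coefficients have constant exponents and holomorphic coefficients. It satisfies the differentiated
equation in w, since the two derivatives commute. After subtraction of [T(Φ₀), φ_m], the
infinitesimal motion of A, its exponents are as controlled as those of φ_m. -/
theorem exists_deriv_ser (H : BlockData k s ν A U Φ₀ z₀) (hγ : HasDerivAt γ v x) (hx : γ x = z₀)
    (hU : HasDerivAt (fun t => U (γ t)) U' x)
    (hΦ : HasDerivAt (fun t => Φ₀ (γ t)) (ad (T (Φ₀ z₀)) (Φ₀ z₀)) x)
    (hT : Multiplier k T (U z₀) U') :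
    ∃ g : ℕ → ℂ → Mat n,
      (∀ w, HasTheta 0 (fun t => ser k A U Φ₀ (γ t) w) (PowerSeries.mk fun m => g m w) x) ∧
      (∀ w, HasTheta 1 (fun w => PowerSeries.mk fun m => g m w)
        (comm (serGen k (-deltaL n k) (serH (U z₀)) (PowerSeries.mk fun m => g m w)
            + serE k (serL (U z₀) U') (ser k A U Φ₀ z₀ w)) (ser k A U Φ₀ z₀ w)
          + comm (serGen k (-deltaL n k) (serH (U z₀)) (ser k A U Φ₀ z₀ w))
            (PowerSeries.mk fun m => g m w)) w) ∧
      (∀ m, OrdLE (diffSet s) m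
        (fun w => powAd w (A z₀) (g m w - ad (T (Φ₀ z₀)) (phi k A U Φ₀ z₀ m w)))) ∧
      (∀ m, 1 ≤ m → OrdLE (diffSet s) m (fun w => delta k (g m w))) ∧
      ∀ w, g 0 w = ad (T (Φ₀ z₀)) (phi k A U Φ₀ z₀ 0 w) := by
  set τ := T (Φ₀ z₀) with hτ
  have hγc : Tendsto γ (𝓝 x) (𝓝 z₀) := hx ▸ hγ.continuousAt
  have hA : HasDerivAt (fun t => A (γ t)) (ad τ (A (γ x))) x := by
    rw [hx]; exact H.hasDerivAt_delta_curve hγ hx hΦ hT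
  choose G hG1 hG2 hG3 using fun m => (H.structure_all m).exists_hasDerivAt_curve hγ hx
  -- Exponents are known for z^{ad A}φ_m, so the derivative G of that function is taken first and
  -- then transported back to φ_m in the moving frame of A.
  set g : ℕ → ℂ → Mat n := fun m w => ad τ (phi k A U Φ₀ z₀ m w)
    + powAd (-w) (A z₀) (G m w - ad τ (powAd w (A z₀) (phi k A U Φ₀ z₀ m w))) with hg
  have hφ : ∀ m w, HasDerivAt (fun t => phi k A U Φ₀ (γ t) m w) (g m w) x := by
    intro m w
    have h1 := hasDerivAt_powAd_curve (-w) hA (hG2 m w)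
    simp only [powAd_neg_powAd, hx] at h1
    exact h1
  have hθ0 : ∀ w, HasTheta 0 (fun t => ser k A U Φ₀ (γ t) w) (PowerSeries.mk fun m => g m w) x := by
    intro w m
    simpa only [ser, serPhi, PowerSeries.coeff_mk, zero_mul, zero_smul, add_zero] using hφ m w
  have hGg : ∀ m w, G m w - ad τ (powAd w (A z₀) (phi k A U Φ₀ z₀ m w))
      = powAd w (A z₀) (g m w - ad τ (phi k A U Φ₀ z₀ m w)) := by
    intro m w
    rw [hg]
    simp only [add_sub_cancel_left, powAd_powAd_neg]
  refine ⟨g, hθ0, ?_, ?_, ?_, ?_⟩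
  · intro w m
    set D : Z → ℂ → Mat n := fun z w => PowerSeries.coeff m
      (comm (serGen k (-deltaL n k) (serH (U z)) (ser k A U Φ₀ z w)) (ser k A U Φ₀ z w))
      + (1 * m : ℂ) • phi k A U Φ₀ z m w with hD
    have hDz : ∀ᶠ z in 𝓝 z₀, ∀ w, HasDerivAt (phi k A U Φ₀ z m) (D z w) w := by
      filter_upwards [H.eventually] with z hz w
      have h1 := hz.hasTheta_ser w m
      have h2 : (fun w => PowerSeries.coeff m (ser k A U Φ₀ z w)) = phi k A U Φ₀ z m :=
        funext fun w => PowerSeries.coeff_mk _ _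
      rw [h2] at h1
      refine h1.congr_deriv ?_
      simp only [hD, ser, serPhi, PowerSeries.coeff_mk]
    have hYz : ∀ᶠ z in 𝓝 z₀, ∀ w, HasDerivAt (fun w => powAd w (A z) (phi k A U Φ₀ z m w))
        (powAd w (A z) (ad (A z) (phi k A U Φ₀ z m w) + D z w)) w := by
      filter_upwards [hDz] with z hz w using HasDerivAt.powAd (A z) (hz w)
    -- Equality of mixed derivatives: h' is both the derivative along γ of the w-derivative, and the
    -- w-derivative of G. The rest computes the first one explicitly and undoes the conjugation.
    obtain ⟨h', hh1, hh2⟩ := hG3 m _ hYz w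
    have hH0 : HasTheta 0 (fun t => serH (U (γ t))) (serL (U z₀) U') x := by
      have := hasTheta_serH hU (by rw [hx]; exact hT.commute)
      rwa [hx] at this
    have hD0 := ((hH0.serGen k (-deltaL n k) (hθ0 w)).comm (hθ0 w)) m
    simp only [hx, zero_mul, zero_smul, add_zero] at hD0
    have hD1 := hD0.add ((hφ m w).const_smul (1 * m : ℂ))
    set D' := PowerSeries.coeff m
        (comm (serGen k (-deltaL n k) (serH (U z₀)) (PowerSeries.mk fun m => g m w)
            + serE k (serL (U z₀) U') (ser k A U Φ₀ z₀ w)) (ser k A U Φ₀ z₀ w)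
          + comm (serGen k (-deltaL n k) (serH (U z₀)) (ser k A U Φ₀ z₀ w))
            (PowerSeries.mk fun m => g m w)) + (1 * m : ℂ) • g m w with hD'
    have hA' : HasDerivAt (fun t => ad (A (γ t)) (phi k A U Φ₀ (γ t) m w))
        (ad (ad τ (A z₀)) (phi k A U Φ₀ z₀ m w) + ad (A z₀) (g m w)) x := by
      have h1 := (hA.mul (hφ m w)).sub ((hφ m w).mul hA)
      simp only [hx] at h1
      refine h1.congr_deriv ?_
      simp only [ad]; abel
    have h1 := (hasDerivAt_powAd_curve w hA (hA'.add hD1)).unique hh1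
    simp only [hx, Pi.add_apply, Pi.smul_apply] at h1
    have h2 := (hDz.self_of_nhds w)
    have h3 := hYz.self_of_nhds w
    have h4 := HasDerivAt.powAd_neg (A z₀) (hh2.sub (((adL n τ).hasFDerivAt.comp_hasDerivAt w h3)))
    have h5 := ((adL n τ).hasFDerivAt.comp_hasDerivAt w h2).add h4
    have h6 : (fun w => PowerSeries.coeff m (PowerSeries.mk fun m => g m w)) = g m := by
      funext w; simp
    rw [h6, PowerSeries.coeff_mk, ← hD']
    have hfun : g m = (adL n τ) ∘ (phi k A U Φ₀ z₀ m) + fun w => powAd (-w) (A z₀)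
        ((G m - (adL n τ) ∘ fun w => powAd w (A z₀) (phi k A U Φ₀ z₀ m w)) w) := by
      funext w
      simp [hg]
    have hD2 : D z₀ w = PowerSeries.coeff m
      (comm (serGen k (-deltaL n k) (serH (U z₀)) (ser k A U Φ₀ z₀ w)) (ser k A U Φ₀ z₀ w))
      + (1 * m : ℂ) • phi k A U Φ₀ z₀ m w := rfl
    rw [← hD2] at h1
    rw [hfun]
    refine h5.congr_deriv ?_
    simp only [adL_apply, Pi.sub_apply, Function.comp_apply]
    rw [hGg, ← h1, add_sub_cancel_left]
    have h7 : ad (A z₀) (powAd w (A z₀) (g m w - ad τ (phi k A U Φ₀ z₀ m w)))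
        = powAd w (A z₀) (ad (A z₀) (g m w - ad τ (phi k A U Φ₀ z₀ m w))) := by
      rw [powAd_ad, powAd_commute (Commute.refl (A z₀))]
    rw [h7, ← powAd_sub, powAd_neg_powAd]
    simp only [ad]
    noncomm_ring
  · intro m
    have h1 : OrdLE (diffSet s) m (G m) := (hG1 m).ordLE
    have h2 := ((OrdLE.const τ).ad (H.structure_all m).ordLE : OrdLE _ (0 + m) _)
    rw [zero_add] at h2
    exact (h1.sub h2).congr fun w => (hGg m w).symm
  · intro m hm
    obtain ⟨g', hg1, hg2, -⟩ := (H.logExp_coefX hm fun a _ => H.structure_all a).exists_hasDerivAt_curve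
      hγ hx
    refine hg1.ordLE.congr fun w => ?_
    refine HasDerivAt.unique ?_ (hg2 w)
    refine (((deltaL n k).hasFDerivAt.comp_hasDerivAt x (hφ m w))).congr_of_eventuallyEq ?_
    filter_upwards [hγc.eventually H.eventually] with t ht
    exact (ht.delta_phi m w).symm
  · intro w
    have h1 : G 0 w = ad τ (powAd w (A z₀) (phi k A U Φ₀ z₀ 0 w)) := by
      have h2 := hG2 0 w
      simp only [phi, coefPhi_zero, powAd_powAd_neg] at h2 ⊢
      exact h2.unique hΦ
    simp only [hg, h1, sub_self, powAd_zero, add_zero]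

end BlockData
end Isomonodromy
end

/-! ### Vanishing of the defect in the old directions -/

noncomputable section
namespace Isomonodromy
open Filter Topology
open Finset.HasAntidiagonal (antidiagonal mem_antidiagonal)
open scoped Pointwise

variable {n : ℕ}

theorem coeff_serGen (k : ℕ) (L : Mat n →L[ℂ] Mat n) (K Y : PowerSeries (Mat n)) (m : ℕ) :
    PowerSeries.coeff m (serGen k L K Y) = L (PowerSeries.coeff m Y) + ∑ x ∈ antidiagonal m,
      (PowerSeries.coeff x.1 K * PowerSeries.coeff x.2 Y * unitE n k
        + unitE n k * PowerSeries.coeff x.2 Y * PowerSeries.coeff x.1 K) := by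
  rw [serGen, map_add, coeff_serE, coeff_lmap]

/-- F is the defect of the equation in the old direction. By the Jacobi identity and flatness
everything not containing F cancels, so F satisfies the linearized equation in w; f stands for the
linear part of the generator applied to F. -/
theorem curvature_derivation {R : Type*} [Ring R] {S S' F Y a b L f Y' : R}
    (hF : Y' = F + comm S' Y) (h : a - b + comm S S' = 0) :
    (comm (f + a + L) Y + comm S Y') - (comm (b + L) Y + comm S' (comm S Y))
      = comm S F + comm f Y := by
  obtain rfl : a = b - comm S S' := by
    rw [eq_sub_iff_add_eq]; rw [sub_add_eq_add_sub, sub_eq_zero] at h; exact h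
  rw [hF]
  simp only [comm]
  noncomm_ring

namespace BlockData

variable {Z : Type*} [NormedAddCommGroup Z] [NormedSpace ℂ Z]
variable {k : ℕ} {s : Finset ℂ} {ν : ℕ} {A U Φ₀ : Z → Mat n} {z₀ : Z}

theorem ordLE_powAd_const (H : BlockData k s ν A U Φ₀ z₀) {C : Mat n}
    (hC : projQ n k * C * projQ n k = C) :
    OrdLE (diffSet s) 1 (fun w => powAd w (A z₀) C) := by
  have h := (H.powAd_logExp (LogExp.const (HolNear.const C))
    (Eventually.of_forall fun _ _ => hC)).1
  exact (h.mono (S' := sumSet 1 (diffSet s)) (by simpa using subset_sumSet_one _) le_rfl).ordLE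

theorem ordLE_phi (H : BlockData k s ν A U Φ₀ z₀) (m : ℕ) :
    OrdLE (diffSet s) m (fun w => powAd w (A z₀) (phi k A U Φ₀ z₀ m w)) :=
  (H.structure_all m).ordLE

theorem ordLE_delta_phi (H : BlockData k s ν A U Φ₀ z₀) (m : ℕ) :
    OrdLE (diffSet s) m (fun w => delta k (phi k A U Φ₀ z₀ m w)) := by
  simp only [H.delta_phi]
  rcases Nat.eq_zero_or_pos m with rfl | hm
  · simpa only [coefX, if_true] using OrdLE.const (A z₀)
  · exact (H.logExp_coefX hm fun a _ => H.structure_all a).ordLE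

theorem ordLE_coefV (H : BlockData k s ν A U Φ₀ z₀) (j : ℕ) :
    OrdLE (diffSet s) (j + 1) (fun w => coefV k (phi k A U Φ₀ z₀) j w) := by
  have h1 := H.logExp_powAd_coefV (j := j) fun a _ => H.structure_all a
  have h2 := (H.powAd_logExp h1 ?_).2
  · refine (h2.mono (S' := sumSet (j + 1) (diffSet s)) ?_ le_rfl).ordLE.congr fun w => ?_
    · rw [add_comm j]; exact diffSet_add_sumSet_subset j
    · rw [powAd_neg_powAd]
  · filter_upwards [H.isBlock] with z hz w
    have h1 : powAd w (A z) (projQ n k) = projQ n k := powAd_commute hz.commute_projQ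
    conv_rhs => rw [← coefV_block, powAd_mul, powAd_mul, h1]

variable {T : Mat n →L[ℂ] Mat n} {U' : Mat n}

/-- All positive powers cost one difference, since they are conjugated as a single corner matrix;
the identity costs none. -/
theorem ordLE_powAd_pow (H : BlockData k s ν A U Φ₀ z₀) (i : ℕ) :
    OrdLE (diffSet s) (min i 1) (fun w => powAd w (A z₀) ((-U z₀) ^ i)) := by
  rcases Nat.eq_zero_or_pos i with rfl | hi
  · exact (OrdLE.const (1 : Mat n)).congr fun w => by
      rw [pow_zero, powAd_commute (Commute.one_right _)]
  · rw [min_eq_right hi, ← coefH_of_pos hi]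
    exact H.ordLE_powAd_const (H.coefH_block i).self_of_nhds

theorem corner_of_mul {Q C : Mat n} (h1 : Q * C = C) (h2 : C * Q = C) : Q * C * Q = C := by
  rw [h1, h2]

/-- T does not commute with conjugation by z^A, so it has to be eliminated. The block part of φ_a is
a sum of commutators [U^p, v] up to sign, and [U, Tv] = [U', v]; expanding [U^p, Tv] by the Leibniz
rule leaves only U, U' and v. -/
theorem ordLE_powAd_mult_phi (H : BlockData k s ν A U Φ₀ z₀) (hT : Multiplier k T (U z₀) U')
    {a : ℕ} (ha : 1 ≤ a) :
    OrdLE (diffSet s) a (fun w => powAd w (A z₀) (T (phi k A U Φ₀ z₀ a w))) := by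
  have h1 : ∀ w, T (phi k A U Φ₀ z₀ a w) = ∑ x ∈ antidiagonal a, ad (coefH (U z₀) x.1)
      (T (decaySol a (coefV k (phi k A U Φ₀ z₀) x.2) w)) := fun w => by
    rw [← hT.delta, H.delta_phi, coefX, if_neg (by omega), map_sum]
    simp only [hT.map_ad]
  simp only [h1, powAd_sum]
  refine OrdLE.sum _ fun x hx => ?_
  rw [mem_antidiagonal] at hx
  rcases Nat.eq_zero_or_pos x.1 with h0 | h0
  · simpa [h0, ad] using OrdLE.const (0 : Mat n)
  have hb : ∀ w, IsBlock k (decaySol a (coefV k (phi k A U Φ₀ z₀) x.2) w) := fun w =>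
    isBlock_of_corner ((H.isDecaying_coefV (m := a) (j := x.2) (by omega)).self_of_nhds.2 w)
  have h2 : ∀ w, ad (-U z₀) (T (decaySol a (coefV k (phi k A U Φ₀ z₀) x.2) w))
      = -ad U' (decaySol a (coefV k (phi k A U Φ₀ z₀) x.2) w) := fun w => by
    rw [← hT.ad_eq _ (hb w)]
    simp only [ad]; noncomm_ring
  simp only [coefH_of_pos h0, ad_pow, powAd_sum, powAd_mul, h2, powAd_neg, powAd_ad]
  refine OrdLE.sum _ fun i hi => ?_
  rw [Finset.mem_range] at hi
  have h3 := (H.decaySol_coefV (m := a) (j := x.2) (by omega) fun a _ => H.structure_all a).1.ordLE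
  -- The orders add up to at most i + (1 + j) + (p - 1 - i) = p + j = a, where p = x.1 and j = x.2.
  refine (((H.ordLE_powAd_pow i).mul ((H.ordLE_powAd_const
    (corner_of_mul hT.proj_mul hT.mul_proj)).ad h3).neg).mul
    (H.ordLE_powAd_pow (x.1 - 1 - i))).mono ?_
  omega

theorem ordLE_powAd_gen (H : BlockData k s ν A U Φ₀ z₀) (hT : Multiplier k T (U z₀) U')
    {a : ℕ} (ha : 1 ≤ a) :
    OrdLE (diffSet s) a (fun w => powAd w (A z₀) (PowerSeries.coeff a
      (serGen k T (serK (U z₀) U') (ser k A U Φ₀ z₀ w)))) := by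
  simp only [coeff_serGen, powAd_add, powAd_sum, ser, serPhi, PowerSeries.coeff_mk, serK]
  refine (H.ordLE_powAd_mult_phi hT ha).add (OrdLE.sum _ fun x hx => ?_)
  rw [mem_antidiagonal] at hx
  rcases Nat.eq_zero_or_pos x.1 with h0 | h0
  · simpa [h0, coefK] using OrdLE.const (0 : Mat n)
  have h1 : OrdLE (diffSet s) 1 (fun w => powAd w (A z₀) (coefK (U z₀) U' x.1)) := by
    refine H.ordLE_powAd_const ?_
    obtain ⟨h3, h4⟩ := serK_mul_projQ H.mul_proj.self_of_nhds hT.proj_mul hT.mul_proj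
    have h5 := congrArg (PowerSeries.coeff x.1) h3
    have h6 := congrArg (PowerSeries.coeff x.1) h4
    rw [PowerSeries.coeff_mul_C, serK, PowerSeries.coeff_mk] at h5
    rw [PowerSeries.coeff_C_mul, serK, PowerSeries.coeff_mk] at h6
    exact corner_of_mul h6 h5
  simp only [← powAd_add, powAd_coefE H.isBlock.self_of_nhds]
  have he : OrdLE (diffSet s) 0 (fun _ => unitE n k) := OrdLE.const _
  exact (((h1.mul (H.ordLE_phi x.2)).mul he).mono (by omega)).add
    (((he.mul (H.ordLE_phi x.2)).mul h1).mono (by omega))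

/-- A solution of the linearized equation whose coefficients have the expected orders vanishes. -/
theorem _root_.Isomonodromy.coeff_eq_zero_of_hasTheta {D : Set ℂ} (hD : ∀ d ∈ D, d.re < 1)
    {A U : Mat n} (hA : IsBlock k A) {F S Ψ : ℂ → PowerSeries (Mat n)}
    (hS : ∀ w, PowerSeries.coeff 0 (S w) = -A)
    (hΨ : ∀ w, delta k (PowerSeries.coeff 0 (Ψ w)) = A)
    (hF : ∀ w, HasTheta 1 F (comm (S w) (F w)
      + comm (serGen k (-deltaL n k) (serH U) (F w)) (Ψ w)) w)
    (h0 : ∀ w, PowerSeries.coeff 0 (F w) = 0)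
    (h1 : ∀ m, 1 ≤ m → OrdLE D m (fun w => delta k (PowerSeries.coeff m (F w))))
    (h2 : ∀ m, 1 ≤ m → OrdLE D m (fun w => powAd w A (PowerSeries.coeff m (F w))))
    (m : ℕ) : ∀ w, PowerSeries.coeff m (F w) = 0 := by
  induction m using Nat.strong_induction_on with
  | _ m ih =>
  rcases Nat.eq_zero_or_pos m with rfl | hm
  · exact h0
  have hd : ∀ w, HasDerivAt (fun w => PowerSeries.coeff m (F w))
      ((m : ℂ) • PowerSeries.coeff m (F w) - ad A (PowerSeries.coeff m (F w))
        - ad (delta k (PowerSeries.coeff m (F w))) (PowerSeries.coeff 0 (Ψ w))) w := by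
    intro w
    refine (hF w m).congr_deriv ?_
    have h3 : PowerSeries.coeff m (comm (S w) (F w)) = -ad A (PowerSeries.coeff m (F w)) := by
      rw [coeff_comm, Finset.sum_eq_single (0, m)]
      · rw [hS]; simp only [ad, neg_mul, mul_neg]; abel
      · intro y hy hne
        rw [mem_antidiagonal] at hy
        have h2 : y.2 < m := by
          rcases Nat.eq_zero_or_pos y.1 with h | h
          · exact absurd (Prod.ext h (by simpa [h] using hy)) hne
          · omega
        rw [ih y.2 h2]; simp [ad]
      · intro h; exact absurd (by simp) h
    have h4 : ∀ i ≤ m, PowerSeries.coeff i (serGen k (-deltaL n k) (serH U) (F w))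
        = -delta k (PowerSeries.coeff i (F w)) := by
      intro i hi
      rw [coeff_serGen, Finset.sum_eq_zero, add_zero]
      · simp
      · intro y hy
        rw [mem_antidiagonal] at hy
        rcases Nat.eq_zero_or_pos y.1 with h | h
        · simp [h, serH]
        · rw [ih y.2 (by omega)]; simp
    have h5 : PowerSeries.coeff m (comm (serGen k (-deltaL n k) (serH U) (F w)) (Ψ w))
        = -ad (delta k (PowerSeries.coeff m (F w))) (PowerSeries.coeff 0 (Ψ w)) := by
      rw [coeff_comm, Finset.sum_eq_single (m, 0)]
      · rw [h4 m le_rfl]; simp only [ad, neg_mul, mul_neg]; abel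
      · intro y hy hne
        rw [mem_antidiagonal] at hy
        have h6 : y.1 < m := by
          rcases Nat.eq_zero_or_pos y.2 with h | h
          · exact absurd (Prod.ext (by simpa [h] using hy) h) hne
          · omega
        rw [h4 _ h6.le, ih _ h6]; simp [ad]
      · intro h; exact absurd (by simp) h
    rw [map_add, h3, h5, one_mul]
    abel
  -- Under δ_k the two brackets become -[A, δf] - [δf, A] = 0. So δf satisfies f' = mf, and its
  -- exponents leave only the zero solution.
  have hδ : ∀ w, delta k (PowerSeries.coeff m (F w)) = 0 := by
    have h3 : ∀ w, HasDerivAt (fun w => delta k (PowerSeries.coeff m (F w)))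
        ((m : ℂ) • delta k (PowerSeries.coeff m (F w)) + 0) w := by
      intro w
      refine ((deltaL n k).hasFDerivAt.comp_hasDerivAt w (hd w)).congr_deriv ?_
      rw [map_sub, map_sub, map_smul]
      simp only [deltaL_apply]
      rw [hA.delta_ad, (isBlock_delta k _).delta_ad, hΨ]
      simp only [ad]; abel
    have h4 : IsDecaying m 0 (fun w => delta k (PowerSeries.coeff m (F w))) :=
      ⟨h3, (h1 m hm).tendsto hm hD⟩
    have h5 : IsDecaying m (0 : ℂ → Mat n) 0 := by
      refine ⟨fun w => ?_, by simp⟩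
      simp
    exact fun w => congrFun (h4.unique h5) w
  -- With δf = 0 the remaining equation is f' = mf - [A, f], which is scalar after conjugation.
  refine eq_zero_of_hasDerivAt_ad (m := m) (A := A) (fun w => ?_) ((h2 m hm).tendsto hm hD)
  refine (hd w).congr_deriv ?_
  rw [hδ]; simp [ad]

/-- Here no conjugation is involved, so T is harmless. The block part consists of [Tδφ, δφ] and
[K_p, V_j]; the extra difference in V_j is paid for by p ≥ 1. -/
theorem ordLE_delta_gen (H : BlockData k s ν A U Φ₀ z₀) (hT : Multiplier k T (U z₀) U') (m : ℕ) :
    OrdLE (diffSet s) m (fun w => delta k (PowerSeries.coeff m (comm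
      (serGen k T (serK (U z₀) U') (ser k A U Φ₀ z₀ w)) (ser k A U Φ₀ z₀ w)))) := by
  have h3 : ∀ w, delta k (PowerSeries.coeff m (comm
      (serGen k T (serK (U z₀) U') (ser k A U Φ₀ z₀ w)) (ser k A U Φ₀ z₀ w)))
      = ∑ y ∈ antidiagonal m, ad (T (delta k (phi k A U Φ₀ z₀ y.1 w)))
            (delta k (phi k A U Φ₀ z₀ y.2 w))
          + ∑ y ∈ antidiagonal m, ad (coefK (U z₀) U' y.1)
            (coefV k (phi k A U Φ₀ z₀) y.2 w) := by
    intro w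
    have hK := serK_mul_projQ H.mul_proj.self_of_nhds hT.proj_mul hT.mul_proj
    have h4 := congrArg (PowerSeries.coeff m)
      (Multiplier.delta_comm_gen (Y := ser k A U Φ₀ z₀ w) (L := T) hT.block hK.1 hK.2)
    rw [coeff_lmap, deltaL_apply] at h4
    have h5 : ∀ j, PowerSeries.coeff j (serV k (ser k A U Φ₀ z₀ w))
        = coefV k (phi k A U Φ₀ z₀) j w := fun j => coeff_serV _ _ _ _ _ _
    rw [h4, map_add, coeff_comm, coeff_comm]
    simp only [h5]
    simp only [coeff_lmap, deltaL_apply, serK, PowerSeries.coeff_mk, serPhi, hT.delta]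
  simp only [h3]
  refine (OrdLE.sum _ fun y hy => ?_).add (OrdLE.sum _ fun y hy => ?_)
  · rw [mem_antidiagonal] at hy
    rw [← hy]
    exact ((H.ordLE_delta_phi y.1).map T).ad (H.ordLE_delta_phi y.2)
  · rw [mem_antidiagonal] at hy
    rcases Nat.eq_zero_or_pos y.1 with h | h
    · simpa [h, coefK, ad] using OrdLE.const (0 : Mat n)
    · have h0 : OrdLE (diffSet s) 0 (fun _ => coefK (U z₀) U' y.1) := OrdLE.const _
      exact (h0.ad (H.ordLE_coefV y.2)).mono (by omega)

variable {γ : ℂ → Z} {v : Z} {x : ℂ}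

/-- The series solves the equation in the direction of the curve `γ`. -/
theorem hasTheta_ser_curve (H : BlockData k s ν A U Φ₀ z₀) (hγ : HasDerivAt γ v x)
    (hx : γ x = z₀) (hU : HasDerivAt (fun t => U (γ t)) U' x)
    (hΦ : HasDerivAt (fun t => Φ₀ (γ t)) (ad (T (Φ₀ z₀)) (Φ₀ z₀)) x)
    (hT : Multiplier k T (U z₀) U') (w : ℂ) :
    HasTheta 0 (fun t => ser k A U Φ₀ (γ t) w)
      (comm (serGen k T (serK (U z₀) U') (ser k A U Φ₀ z₀ w)) (ser k A U Φ₀ z₀ w)) x := by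
  obtain ⟨g, hg0, hg1, hg2, hg3, hg4⟩ := H.exists_deriv_ser hγ hx hU hΦ hT
  set Ψ := ser k A U Φ₀ z₀ with hΨ
  set Sj : ℂ → PowerSeries (Mat n) := fun w => serGen k T (serK (U z₀) U') (Ψ w) with hSj
  set Sz : ℂ → PowerSeries (Mat n) := fun w => serGen k (-deltaL n k) (serH (U z₀)) (Ψ w) with hSz
  set F : ℂ → PowerSeries (Mat n) := fun w => (PowerSeries.mk fun m => g m w) - comm (Sj w) (Ψ w)
    with hF
  have hA := H.isBlock.self_of_nhds
  have hδ := H.delta_eq.self_of_nhds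
  have hΨm : ∀ m w, PowerSeries.coeff m (Ψ w) = phi k A U Φ₀ z₀ m w := fun m w => by
    simp only [hΨ, serPhi, PowerSeries.coeff_mk]
  have hφ0 : ∀ w, delta k (phi k A U Φ₀ z₀ 0 w) = A z₀ := fun w => by
    rw [H.delta_phi, coefX, if_pos rfl]
  have hSj0 : ∀ w, PowerSeries.coeff 0 (Sj w) = T (Φ₀ z₀) := fun w => by
    have h2 : T (phi k A U Φ₀ z₀ 0 w) = T (Φ₀ z₀) := by
      rw [← hT.delta, hφ0, ← hδ, hT.delta]
    simp [hSj, coeff_serGen, hΨm, serK, coefK, h2]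
  have hSz0 : ∀ w, PowerSeries.coeff 0 (Sz w) = -A z₀ := fun w => by
    simp [hSz, coeff_serGen, hΨm, serH, hφ0]
  have hFθ : ∀ w, HasTheta 1 F (comm (Sz w) (F w)
      + comm (serGen k (-deltaL n k) (serH (U z₀)) (F w)) (Ψ w)) w := by
    intro w
    have h1 := (hg1 w).sub ((((hasTheta_serK (U z₀) U' w).serGen k T (H.hasTheta_ser w))).comm
      (H.hasTheta_ser w))
    have h2 : (PowerSeries.mk fun m => g m w) = F w + comm (Sj w) (Ψ w) := by
      simp only [hF, sub_add_cancel]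
    have h3 := curvature_derivation (F := F w) (S := Sz w) (S' := Sj w) (Y := Ψ w)
      (L := serE k (serL (U z₀) U') (Ψ w))
      (f := serGen k (-deltaL n k) (serH (U z₀)) (F w)) h2
      (hT.curvature H.proj_mul.self_of_nhds H.mul_proj.self_of_nhds (Ψ w))
    rw [← serGen_add, ← h2] at h3
    rw [← h3]
    exact h1
  have hFm : ∀ m w, PowerSeries.coeff m (F w)
      = g m w - PowerSeries.coeff m (comm (Sj w) (Ψ w)) := fun m w => by
    simp only [hF, map_sub, PowerSeries.coeff_mk]
  have key : ∀ m w, PowerSeries.coeff m (F w) = 0 := by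
    refine coeff_eq_zero_of_hasTheta H.re_lt hA hSz0 (fun w => by rw [hΨm, hφ0]) hFθ
      (fun w => ?_) (fun m hm => ?_) (fun m hm => ?_)
    · rw [hFm, coeff_comm, Finset.Nat.antidiagonal_zero, Finset.sum_singleton, hSj0, hΨm, hg4,
        sub_self]
    · exact ((hg3 m hm).sub (H.ordLE_delta_gen hT m)).congr fun w => by rw [hFm, delta_sub]
    · have h0 : (0, m) ∈ antidiagonal m := by simp
      -- The order of the leading part T(Φ₀) of the generator is not controlled after conjugation.
      -- Its bracket with φ_m is split off and combined with g, and `hg2` covers the difference.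
      have h1 : ∀ w, powAd w (A z₀) (PowerSeries.coeff m (F w))
          = powAd w (A z₀) (g m w - ad (T (Φ₀ z₀)) (phi k A U Φ₀ z₀ m w))
            - ∑ y ∈ (antidiagonal m).erase (0, m), ad (powAd w (A z₀) (PowerSeries.coeff y.1 (Sj w)))
              (powAd w (A z₀) (phi k A U Φ₀ z₀ y.2 w)) := by
        intro w
        simp only [← powAd_ad, ← powAd_sum, ← powAd_sub]
        congr 1
        rw [hFm, coeff_comm, ← Finset.add_sum_erase _ _ h0, hSj0]
        simp only [hΨm]
        abel
      refine OrdLE.congr ((hg2 m).sub (OrdLE.sum _ fun y hy => ?_)) h1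
      rw [Finset.mem_erase, mem_antidiagonal] at hy
      have h3 : 1 ≤ y.1 := by
        rcases Nat.eq_zero_or_pos y.1 with h | h
        · exact absurd (Prod.ext h (by simpa [h] using hy.2)) hy.1
        · exact h
      rw [← hy.2]
      exact (H.ordLE_powAd_gen hT h3).ad (H.ordLE_phi y.2)
  have h1 : (PowerSeries.mk fun m => g m w) = comm (Sj w) (Ψ w) := by
    rw [← sub_eq_zero]
    exact PowerSeries.ext fun m => (key m w).trans (by simp)
  rw [← h1]
  exact hg0 w

end BlockData
end Isomonodromy
end

noncomputable section
namespace Isomonodromy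
open Filter Topology
open Finset.HasAntidiagonal (antidiagonal mem_antidiagonal)

variable {n : ℕ}

/-! ### The majorizing sequence -/

/-- The Taylor coefficients of `(1 - x) ^ (-1/2)`. -/
def majorant : ℕ → ℝ
  | 0 => 1
  | m + 1 => majorant m * ((2 * m + 1) / (2 * (m + 1)))

theorem majorant_succ (m : ℕ) : 2 * (m + 1) * majorant (m + 1) = (2 * m + 1) * majorant m := by
  rw [majorant]
  field_simp

theorem majorant_nonneg (m : ℕ) : 0 ≤ majorant m := by
  induction m with
  | zero => simp [majorant]
  | succ m ih => rw [majorant]; positivity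

theorem majorant_le_one (m : ℕ) : majorant m ≤ 1 := by
  induction m with
  | zero => simp [majorant]
  | succ m ih =>
    rw [majorant]
    refine mul_le_one₀ ih (by positivity) ?_
    rw [div_le_one (by positivity)]
    linarith

/-- For f = (1 - x)^{-1/2} one has 2f' = f/(1 - x); compare the coefficients of x^{m-1}. -/
theorem sum_majorant (m : ℕ) : ∑ b ∈ Finset.range m, majorant b = 2 * m * majorant m := by
  induction m with
  | zero => simp
  | succ m ih =>
    rw [Finset.sum_range_succ, ih]
    have := majorant_succ m
    push_cast
    linarith

/-- The square of (1 - x)^{-1/2} is the geometric series. It makes the quadratic term of the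
recursion purely geometric. -/
theorem sum_majorant_mul (m : ℕ) :
    ∑ x ∈ antidiagonal m, majorant x.1 * majorant x.2 = 1 := by
  induction m with
  | zero => simp [majorant]
  | succ m ih =>
    have h1 : ∀ j : ℕ, ∑ x ∈ antidiagonal j, (x.1 : ℝ) * (majorant x.1 * majorant x.2)
        = ∑ x ∈ antidiagonal j, (x.2 : ℝ) * (majorant x.1 * majorant x.2) := fun j => by
      rw [← Finset.Nat.sum_antidiagonal_swap]
      refine Finset.sum_congr rfl fun x _ => ?_
      simp only [Prod.fst_swap, Prod.snd_swap]
      ring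
    -- By symmetry the weight 2 x.1 may be replaced by x.1 + x.2 = j; this is the relation (f²)' =
    -- 2f f' in coefficients.
    have h2 : ∀ j : ℕ, ∑ x ∈ antidiagonal j, (2 * x.1 : ℝ) * (majorant x.1 * majorant x.2)
        = j * ∑ x ∈ antidiagonal j, majorant x.1 * majorant x.2 := fun j => by
      have : ∀ x ∈ antidiagonal j, (j : ℝ) * (majorant x.1 * majorant x.2)
          = x.1 * (majorant x.1 * majorant x.2) + x.2 * (majorant x.1 * majorant x.2) := by
        intro x hx
        rw [mem_antidiagonal] at hx
        rw [← hx]; push_cast; ring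
      rw [Finset.mul_sum, Finset.sum_congr rfl this, Finset.sum_add_distrib, ← h1,
        ← Finset.sum_add_distrib]
      exact Finset.sum_congr rfl fun x _ => by ring
    have h3 : ∑ x ∈ antidiagonal (m + 1), (2 * x.1 : ℝ) * (majorant x.1 * majorant x.2)
        = ∑ x ∈ antidiagonal m, (2 * x.1 + 1 : ℝ) * (majorant x.1 * majorant x.2) := by
      rw [Finset.Nat.sum_antidiagonal_succ]
      simp only [Nat.cast_zero, mul_zero, zero_mul, zero_add]
      refine Finset.sum_congr rfl fun x _ => ?_
      have := majorant_succ x.1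
      push_cast
      linear_combination this * majorant x.2
    have h4 : ∑ x ∈ antidiagonal m, (2 * x.1 + 1 : ℝ) * (majorant x.1 * majorant x.2) = m + 1 := by
      simp only [add_mul, one_mul, Finset.sum_add_distrib]
      rw [h2, ih]; ring
    have h5 := h2 (m + 1)
    rw [h3, h4] at h5
    push_cast at h5
    have h6 : (m + 1 : ℝ) ≠ 0 := by positivity
    field_simp at h5
    linarith

/-- With c = u(1 + 2γ), the sum of u^p c^{a-p} over p ≥ 1 is at most c^a u/(c - u) = c^a/(2γ). The
induction avoids the division, so u = 0 is allowed. -/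
theorem two_mul_geom_le {u γ : ℝ} (hu : 0 ≤ u) (a : ℕ) :
    2 * γ * ∑ x ∈ antidiagonal a,
      (if x.1 = 0 then 0 else u ^ x.1 * (u * (1 + 2 * γ)) ^ x.2) ≤ (u * (1 + 2 * γ)) ^ a := by
  set c := u * (1 + 2 * γ) with hc
  have hrec : ∀ a, ∑ x ∈ antidiagonal (a + 1), (if x.1 = 0 then 0 else u ^ x.1 * c ^ x.2)
      = u * (c ^ a + ∑ x ∈ antidiagonal a, (if x.1 = 0 then 0 else u ^ x.1 * c ^ x.2)) := by
    intro a
    rw [Finset.Nat.sum_antidiagonal_succ]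
    simp only [if_true, zero_add, Nat.add_eq_zero_iff, one_ne_zero, and_false, if_false]
    rcases a with _ | a
    · simp
    · rw [Finset.Nat.sum_antidiagonal_succ, Finset.Nat.sum_antidiagonal_succ]
      simp only [if_true, zero_add, Nat.add_eq_zero_iff, one_ne_zero, and_false, if_false]
      rw [mul_add, Finset.mul_sum, pow_one]
      congr 1
      exact Finset.sum_congr rfl fun x _ => by ring
  induction a with
  | zero => simp
  | succ a ih =>
    rw [hrec]
    calc 2 * γ * (u * (c ^ a + ∑ x ∈ antidiagonal a, (if x.1 = 0 then 0 else u ^ x.1 * c ^ x.2)))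
        = u * (2 * γ * c ^ a
          + 2 * γ * ∑ x ∈ antidiagonal a, (if x.1 = 0 then 0 else u ^ x.1 * c ^ x.2)) := by ring
      _ ≤ u * (2 * γ * c ^ a + c ^ a) := by gcongr
      _ = c ^ (a + 1) := by rw [pow_succ, hc]; ring

/-! ### Estimates for decaying solutions -/

/-- -g(0) is the integral of g' over the half line; the estimate is made on [0, T] by a comparison
function, and T → ∞. -/
theorem norm_le_of_hasDerivAt_of_tendsto {E : Type*} [NormedAddCommGroup E] [NormedSpace ℝ E]
    {g g' : ℝ → E} {C ω : ℝ} (hω : 0 < ω) (hg : ∀ τ, HasDerivAt g (g' τ) τ)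
    (hg' : ∀ τ, 0 ≤ τ → ‖g' τ‖ ≤ C * Real.exp (-(ω * τ))) (h0 : Tendsto g atTop (𝓝 0)) :
    ‖g 0‖ ≤ C / ω := by
  have hC : 0 ≤ C := by
    have := (norm_nonneg _).trans (hg' 0 le_rfl)
    simpa using this
  have key : ∀ T : ℝ, 0 ≤ T → ‖g T - g 0‖ ≤ C / ω := by
    intro T hT
    have hB : ∀ τ : ℝ, HasDerivAt (fun τ => C / ω * (1 - Real.exp (-(ω * τ))))
        (C * Real.exp (-(ω * τ))) τ := by
      intro τ
      have h1 := ((((hasDerivAt_id τ).const_mul ω).neg.exp).const_sub 1).const_mul (C / ω)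
      refine h1.congr_deriv ?_
      simp only [Pi.neg_apply, id, mul_one]
      field_simp
    have h1 := image_norm_le_of_norm_deriv_right_le_deriv_boundary
      (f := fun τ => g τ - g 0) (f' := g') (a := 0) (b := T)
      (fun τ _ => ((hg τ).sub_const _).continuousAt.continuousWithinAt)
      (fun τ _ => ((hg τ).sub_const _).hasDerivWithinAt) (by simp) hB
      (fun τ hτ => hg' τ hτ.1) (Set.right_mem_Icc.2 hT)
    refine h1.trans ?_
    have h2 := Real.exp_pos (-(ω * T))
    have h3 : 0 ≤ C / ω := by positivity
    nlinarith
  have h1 : Tendsto (fun T => ‖g T - g 0‖) atTop (𝓝 ‖(0 : E) - g 0‖) :=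
    (h0.sub_const _).norm
  rw [zero_sub, norm_neg] at h1
  exact le_of_tendsto h1 (eventually_atTop.2 ⟨0, key⟩)

theorem norm_ad_le (X Y : Mat n) : ‖ad X Y‖ ≤ 2 * ‖X‖ * ‖Y‖ := by
  calc ‖ad X Y‖ ≤ ‖X * Y‖ + ‖Y * X‖ := norm_sub_le _ _
    _ ≤ ‖X‖ * ‖Y‖ + ‖Y‖ * ‖X‖ := add_le_add (norm_mul_le _ _) (norm_mul_le _ _)
    _ = 2 * ‖X‖ * ‖Y‖ := by ring

/-- Estimate for solutions of `f' = m f + h` on a horizontal ray. -/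
theorem norm_powAd_le_of_hasDerivAt {m : ℕ} {A : Mat n} {f h : ℂ → Mat n} {θ L κ K r ω : ℝ}
    (hf : ∀ w, HasDerivAt f ((m : ℂ) • f w + h w) w)
    (hlim : ∀ w₀ : ℂ, Tendsto (fun s : ℝ => Complex.exp (-(m * s)) • f (w₀ + s)) atTop (𝓝 0))
    (hL : 0 ≤ L)
    (hA : ∀ τ s : ℝ, 0 ≤ τ → 0 ≤ s → ‖powAd (-τ) A (powAd (s + τ : ℝ) A (h ((s + τ : ℝ) + θ * Complex.I)))‖
      ≤ L * Real.exp (κ * τ) * ‖powAd (s + τ : ℝ) A (h ((s + τ : ℝ) + θ * Complex.I))‖)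
    (hh : ∀ s : ℝ, 0 ≤ s → ‖powAd s A (h (s + θ * Complex.I))‖ ≤ K * Real.exp (r * s))
    (hω : 0 < ω) (hω' : ω ≤ m - κ - r) {s : ℝ} (hs : 0 ≤ s) :
    ‖powAd s A (f (s + θ * Complex.I))‖ ≤ L * K / ω * Real.exp (r * s) := by
  -- Variation of constants: the factor e^{-mτ} removes the term mf, so g' contains only h, and
  -- decay at infinity fixes g(0).
  set g : ℝ → Mat n := fun τ =>
    Complex.exp (-(m * τ)) • powAd s A (f (s + θ * Complex.I + τ)) with hg
  have hK : 0 ≤ K := by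
    have := (norm_nonneg _).trans (hh 0 le_rfl)
    simpa using this
  have hder : ∀ τ : ℝ, HasDerivAt g
      (Complex.exp (-(m * τ)) • powAd s A (h (s + θ * Complex.I + τ))) τ := by
    intro τ
    have h1 : HasDerivAt (fun t : ℂ => Complex.exp (-(m * t))) (Complex.exp (-(m * τ)) * -m)
        (τ : ℂ) := by
      simpa using ((hasDerivAt_id (τ : ℂ)).const_mul (m : ℂ)).neg.cexp
    have h2 : HasDerivAt (fun t : ℂ => f (s + θ * Complex.I + t))
        ((m : ℂ) • f (s + θ * Complex.I + τ) + h (s + θ * Complex.I + τ)) (τ : ℂ) := by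
      have := (hf (s + θ * Complex.I + τ)).scomp (τ : ℂ) ((hasDerivAt_id (τ : ℂ)).const_add
        (s + θ * Complex.I))
      simpa [Function.comp_def] using this
    have h3 : HasDerivAt (fun t : ℂ => powAd s A (f (s + θ * Complex.I + t)))
        (powAd s A ((m : ℂ) • f (s + θ * Complex.I + τ) + h (s + θ * Complex.I + τ))) (τ : ℂ) :=
      (h2.const_mul _).mul_const _
    have h4 := HasDerivAt.scomp (h := fun t : ℝ => (t : ℂ)) τ (h1.smul h3)
      (Complex.ofRealCLM.hasDerivAt)
    refine h4.congr_deriv ?_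
    rw [powAd_add, powAd_smul]
    simp only [Complex.ofRealCLM_apply, Complex.ofReal_one]
    module
  have hlim' : Tendsto g atTop (𝓝 0) := by
    have h1 := ((hlim (s + θ * Complex.I)).const_mul (NormedSpace.exp ((s : ℂ) • A))).mul_const
      (NormedSpace.exp (-((s : ℂ) • A)))
    rw [mul_zero, zero_mul] at h1
    refine h1.congr fun τ => ?_
    simp only [hg, powAd, mul_smul_comm, smul_mul_assoc]
  have hb : ∀ τ : ℝ, 0 ≤ τ → ‖Complex.exp (-(m * τ)) • powAd s A (h (s + θ * Complex.I + τ))‖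
      ≤ L * K * Real.exp (r * s) * Real.exp (-(ω * τ)) := by
    intro τ hτ
    -- The bound on h at s + τ uses conjugation with s + τ, whereas s is wanted; the difference is a
    -- conjugation by -τ, which costs L e^{κτ}.
    have e1 : powAd s A (h (s + θ * Complex.I + τ))
        = powAd (-τ) A (powAd (s + τ : ℝ) A (h ((s + τ : ℝ) + θ * Complex.I))) := by
      rw [powAd_powAd]
      congr 2
      · push_cast; ring
      · push_cast; ring
    have e2 : ‖Complex.exp (-(m * τ))‖ = Real.exp (-(m * τ)) := by
      rw [Complex.norm_exp]; simp
    rw [norm_smul, e1, e2]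
    calc Real.exp (-(m * τ)) * ‖_‖
        ≤ Real.exp (-(m * τ)) * (L * Real.exp (κ * τ) * (K * Real.exp (r * (s + τ)))) := by
          refine mul_le_mul_of_nonneg_left ((hA τ s hτ hs).trans ?_) (Real.exp_nonneg _)
          exact mul_le_mul_of_nonneg_left (hh _ (by positivity)) (by positivity)
      _ = L * K * Real.exp (r * s) * Real.exp (-((m - κ - r) * τ)) := by
          have : Real.exp (-((m - κ - r) * τ)) * Real.exp (r * s)
              = Real.exp (-(m * τ)) * Real.exp (κ * τ) * Real.exp (r * (s + τ)) := by
            rw [← Real.exp_add, ← Real.exp_add, ← Real.exp_add]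
            congr 1; ring
          linear_combination (-(L * K)) * this
      _ ≤ _ := by
          have : Real.exp (-((m - κ - r) * τ)) ≤ Real.exp (-(ω * τ)) :=
            Real.exp_le_exp.2 (by nlinarith)
          exact mul_le_mul_of_nonneg_left this (by positivity)
  have := norm_le_of_hasDerivAt_of_tendsto hω hder hb hlim'
  have e0 : g 0 = powAd s A (f (s + θ * Complex.I)) := by simp [hg]
  rw [e0] at this
  refine this.trans (le_of_eq ?_)
  ring

end Isomonodromy
end

/-! ### Majorization of the coefficients -/

noncomputable section
namespace Isomonodromy
open Filter Topology
open Finset.HasAntidiagonal (antidiagonal mem_antidiagonal)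

variable {n : ℕ}

theorem norm_projQ_mul_mul_le (k : ℕ) (X Y : Mat n) :
    ‖projQ n k * X * unitE n k * Y * projQ n k‖ ≤ ‖X‖ * ‖Y‖ := by
  have h1 := norm_projQ_le (n := n) k
  have h2 := norm_unitE_le (n := n) k
  calc ‖projQ n k * X * unitE n k * Y * projQ n k‖
      ≤ ‖projQ n k‖ * ‖X‖ * ‖unitE n k‖ * ‖Y‖ * ‖projQ n k‖ :=
        (norm_mul_le _ _).trans (mul_le_mul_of_nonneg_right ((norm_mul_le _ _).trans
          (mul_le_mul_of_nonneg_right ((norm_mul_le _ _).trans (mul_le_mul_of_nonneg_right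
            (norm_mul_le _ _) (norm_nonneg _))) (norm_nonneg _))) (norm_nonneg _))
    _ ≤ 1 * ‖X‖ * 1 * ‖Y‖ * 1 := by gcongr
    _ = ‖X‖ * ‖Y‖ := by ring

theorem norm_corner_le (k : ℕ) (C Y : Mat n) :
    ‖C * Y * unitE n k + unitE n k * Y * C‖ ≤ 2 * ‖C‖ * ‖Y‖ := by
  have h2 := norm_unitE_le (n := n) k
  calc ‖C * Y * unitE n k + unitE n k * Y * C‖
      ≤ ‖C‖ * ‖Y‖ * ‖unitE n k‖ + ‖unitE n k‖ * ‖Y‖ * ‖C‖ :=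
        (norm_add_le _ _).trans (add_le_add ((norm_mul_le _ _).trans
          (mul_le_mul_of_nonneg_right (norm_mul_le _ _) (norm_nonneg _)))
          ((norm_mul_le _ _).trans
          (mul_le_mul_of_nonneg_right (norm_mul_le _ _) (norm_nonneg _))))
    _ ≤ ‖C‖ * ‖Y‖ * 1 + 1 * ‖Y‖ * ‖C‖ := by gcongr
    _ = 2 * ‖C‖ * ‖Y‖ := by ring

/-- Bounds for the operators `powAd s A` on the upper left block. -/
structure BlockBounds (k : ℕ) (A U Φ₀ : Mat n) (θ ε ρ L₀ L₁ u γ B : ℝ) : Prop where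
  ε_pos : 0 < ε
  ε_le : ε ≤ 1
  ρ_pos : 0 < ρ
  L₀_nonneg : 0 ≤ L₀
  L₁_nonneg : 0 ≤ L₁
  u_nonneg : 0 ≤ u
  γ_pos : 0 < γ
  powAd_coefH : ∀ p, 1 ≤ p → ∀ s : ℝ, 0 ≤ s →
    ‖powAd s A (coefH U p)‖ ≤ L₀ * u ^ p * Real.exp ((1 - ε) * s)
  powAd_block : ∀ τ : ℝ, 0 ≤ τ → ∀ C, projQ n k * C * projQ n k = C →
    ‖powAd (-τ) A C‖ ≤ L₁ * Real.exp ((1 - ρ) * τ) * ‖C‖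
  init : ‖powAd (-(θ * Complex.I)) A Φ₀‖ ≤ B
  le_γ : 4 * L₀ * L₁ * B ^ 2 / (ε * ρ) + 4 * L₀ * B / ε ≤ γ

namespace BlockData

variable {Z : Type*} [NormedAddCommGroup Z] [NormedSpace ℂ Z]
variable {k : ℕ} {s : Finset ℂ} {ν : ℕ} {A U Φ₀ : Z → Mat n} {z₀ : Z}
variable {θ ε ρ L₀ L₁ u γ B : ℝ}

/-- The bound for the coefficient of order `m` at the point `x` of the ray. -/
def PhiBound (k : ℕ) (A U Φ₀ : Z → Mat n) (z₀ : Z) (θ ε u γ B : ℝ) (m : ℕ) : Prop :=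
  ∀ x : ℝ, 0 ≤ x → ‖powAd x (A z₀) (phi k A U Φ₀ z₀ m (x + θ * Complex.I))‖
    ≤ B * ((u * (1 + 2 * γ)) ^ m * majorant m) * Real.exp ((1 - ε) * m * x)

theorem norm_powAd_coefV_le (H : BlockData k s ν A U Φ₀ z₀) {j : ℕ}
    (hφ : ∀ i ≤ j, PhiBound k A U Φ₀ z₀ θ ε u γ B i) {x : ℝ} (hx : 0 ≤ x) :
    ‖powAd x (A z₀) (coefV k (phi k A U Φ₀ z₀) j (x + θ * Complex.I))‖
      ≤ B ^ 2 * (u * (1 + 2 * γ)) ^ j * Real.exp ((1 - ε) * j * x) := by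
  rw [powAd_coefV H.isBlock.self_of_nhds]
  have h1 : ∀ y ∈ antidiagonal j,
      ‖projQ n k * powAd x (A z₀) (phi k A U Φ₀ z₀ y.1 (x + θ * Complex.I)) * unitE n k *
        powAd x (A z₀) (phi k A U Φ₀ z₀ y.2 (x + θ * Complex.I)) * projQ n k‖
      ≤ B ^ 2 * (u * (1 + 2 * γ)) ^ j * Real.exp ((1 - ε) * j * x)
        * (majorant y.1 * majorant y.2) := by
    intro y hy
    rw [mem_antidiagonal] at hy
    refine (norm_projQ_mul_mul_le k _ _).trans ?_
    refine (mul_le_mul (hφ y.1 (by omega) x hx) (hφ y.2 (by omega) x hx) (norm_nonneg _)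
      ((norm_nonneg _).trans (hφ y.1 (by omega) x hx))).trans (le_of_eq ?_)
    rw [← hy, pow_add]
    have : Real.exp ((1 - ε) * ((y.1 + y.2 : ℕ) : ℝ) * x)
        = Real.exp ((1 - ε) * y.1 * x) * Real.exp ((1 - ε) * y.2 * x) := by
      rw [← Real.exp_add]; congr 1; push_cast; ring
    rw [this]; ring
  refine (norm_sum_le_of_le _ h1).trans (le_of_eq ?_)
  rw [← Finset.mul_sum, sum_majorant_mul, mul_one]

theorem norm_powAd_decaySol_le (H : BlockData k s ν A U Φ₀ z₀)
    (hb : BlockBounds k (A z₀) (U z₀) (Φ₀ z₀) θ ε ρ L₀ L₁ u γ B) {j a : ℕ} (hja : j < a)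
    (hφ : ∀ i ≤ j, PhiBound k A U Φ₀ z₀ θ ε u γ B i) {x : ℝ} (hx : 0 ≤ x) :
    ‖powAd x (A z₀) (decaySol a (coefV k (phi k A U Φ₀ z₀) j) (x + θ * Complex.I))‖
      ≤ L₁ * (B ^ 2 * (u * (1 + 2 * γ)) ^ j) / ρ * Real.exp ((1 - ε) * j * x) := by
  have h0 := H.decaySol_coefV hja fun a _ => H.structure_all a
  have hsum : ∀ d ∈ sumSet (j + 1) (diffSet s), d.re < a :=
    sumSet_re_lt H.re_lt (by omega) (by omega)
  have hA := H.isBlock.self_of_nhds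
  refine norm_powAd_le_of_hasDerivAt (m := a) (κ := 1 - ρ) (r := (1 - ε) * j) (ω := ρ)
    h0.2.2.self_of_nhds.1.1
    (fun w₀ => (h0.2.1.tendsto a hsum).self_of_nhds w₀) hb.L₁_nonneg (fun τ s hτ _ => ?_)
    (fun s hs => H.norm_powAd_coefV_le hφ hs) hb.ρ_pos ?_ hx
  · refine hb.powAd_block τ hτ _ ?_
    have h1 : powAd ((s + τ : ℝ) : ℂ) (A z₀) (projQ n k) = projQ n k :=
      powAd_commute hA.commute_projQ
    conv_rhs => rw [← coefV_block, powAd_mul, powAd_mul, h1]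
  -- The decay rate is a - (1 - ρ) - (1 - ε)j, and j + 1 ≤ a leaves at least ρ + εj.
  · have h2 : (j : ℝ) + 1 ≤ a := by exact_mod_cast hja
    have := hb.ε_pos
    nlinarith [mul_nonneg this.le (Nat.cast_nonneg (α := ℝ) j)]

theorem norm_powAd_coefS_le (H : BlockData k s ν A U Φ₀ z₀)
    (hb : BlockBounds k (A z₀) (U z₀) (Φ₀ z₀) θ ε ρ L₀ L₁ u γ B) {a : ℕ} (ha : 1 ≤ a)
    (hφ : ∀ i < a, PhiBound k A U Φ₀ z₀ θ ε u γ B i) {x : ℝ} (hx : 0 ≤ x) :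
    ‖powAd x (A z₀) (coefS k (A z₀) (U z₀) (phi k A U Φ₀ z₀) a (x + θ * Complex.I))‖
      ≤ (2 * L₀ * L₁ * B ^ 2 / ρ + 2 * L₀ * B) / (2 * γ) * (u * (1 + 2 * γ)) ^ a
        * Real.exp ((1 - ε) * a * x) := by
  have hγ := hb.γ_pos
  have hu := hb.u_nonneg
  have hL₀ := hb.L₀_nonneg
  have hL₁ := hb.L₁_nonneg
  have hB : 0 ≤ B := (norm_nonneg _).trans hb.init
  set c := u * (1 + 2 * γ) with hc
  have hc0 : 0 ≤ c := by positivity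
  have hgeom := two_mul_geom_le (γ := γ) hu a
  rw [← hc] at hgeom
  set w := ∑ x ∈ antidiagonal a, (if x.1 = 0 then 0 else u ^ x.1 * c ^ x.2) with hw
  -- A coefficient of H contributes e^{(1-ε)x} only once, whatever its order p ≥ 1.
  have hexp : ∀ p j : ℕ, 1 ≤ p → p + j = a →
      Real.exp ((1 - ε) * x) * Real.exp ((1 - ε) * j * x) ≤ Real.exp ((1 - ε) * a * x) := by
    intro p j hp hpj
    rw [← Real.exp_add, Real.exp_le_exp]
    have h1 : (1 : ℝ) + j ≤ a := by exact_mod_cast (by omega : 1 + j ≤ a)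
    have h2 : 0 ≤ (1 - ε) * x := mul_nonneg (by linarith [hb.ε_le]) hx
    nlinarith
  have hX : ‖powAd x (A z₀) (coefX k (A z₀) (U z₀) (phi k A U Φ₀ z₀) a (x + θ * Complex.I))‖
      ≤ 2 * L₀ * L₁ * B ^ 2 / ρ * w * Real.exp ((1 - ε) * a * x) := by
    rw [coefX, if_neg (by omega), powAd_sum]
    have h1 : ∀ y ∈ antidiagonal a, ‖powAd x (A z₀) (ad (coefH (U z₀) y.1)
        (decaySol a (coefV k (phi k A U Φ₀ z₀) y.2) (x + θ * Complex.I)))‖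
        ≤ 2 * L₀ * L₁ * B ^ 2 / ρ * Real.exp ((1 - ε) * a * x)
          * (if y.1 = 0 then 0 else u ^ y.1 * c ^ y.2) := by
      intro y hy
      rw [mem_antidiagonal] at hy
      rcases Nat.eq_zero_or_pos y.1 with h | h
      · simp [h, ad]
      · rw [if_neg (by omega), powAd_ad]
        refine (norm_ad_le _ _).trans ?_
        have h2 := hb.powAd_coefH y.1 h x hx
        have h3 := H.norm_powAd_decaySol_le hb (j := y.2) (a := a) (by omega)
          (fun i hi => hφ i (by omega)) hx
        rw [← hc] at h3
        have h4 := hexp y.1 y.2 h hy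
        have hρ := hb.ρ_pos
        calc _ ≤ 2 * (L₀ * u ^ y.1 * Real.exp ((1 - ε) * x))
              * (L₁ * (B ^ 2 * c ^ y.2) / ρ * Real.exp ((1 - ε) * y.2 * x)) := by gcongr
          _ = 2 * L₀ * L₁ * B ^ 2 / ρ * (u ^ y.1 * c ^ y.2)
              * (Real.exp ((1 - ε) * x) * Real.exp ((1 - ε) * y.2 * x)) := by ring
          _ ≤ 2 * L₀ * L₁ * B ^ 2 / ρ * (u ^ y.1 * c ^ y.2) * Real.exp ((1 - ε) * a * x) := by
            gcongr
          _ = _ := by ring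
    refine (norm_sum_le_of_le _ h1).trans (le_of_eq ?_)
    rw [← Finset.mul_sum, hw]; ring
  have hE : ‖powAd x (A z₀) (∑ y ∈ antidiagonal a,
      (coefH (U z₀) y.1 * phi k A U Φ₀ z₀ y.2 (x + θ * Complex.I) * unitE n k
        + unitE n k * phi k A U Φ₀ z₀ y.2 (x + θ * Complex.I) * coefH (U z₀) y.1))‖
      ≤ 2 * L₀ * B * w * Real.exp ((1 - ε) * a * x) := by
    rw [powAd_sum]
    have h1 : ∀ y ∈ antidiagonal a, ‖powAd x (A z₀)
        (coefH (U z₀) y.1 * phi k A U Φ₀ z₀ y.2 (x + θ * Complex.I) * unitE n k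
        + unitE n k * phi k A U Φ₀ z₀ y.2 (x + θ * Complex.I) * coefH (U z₀) y.1)‖
        ≤ 2 * L₀ * B * Real.exp ((1 - ε) * a * x)
          * (if y.1 = 0 then 0 else u ^ y.1 * c ^ y.2) := by
      intro y hy
      rw [mem_antidiagonal] at hy
      rcases Nat.eq_zero_or_pos y.1 with h | h
      · simp [h]
      · rw [if_neg (by omega), powAd_coefE H.isBlock.self_of_nhds]
        refine (norm_corner_le k _ _).trans ?_
        have h2 := hb.powAd_coefH y.1 h x hx
        have h3 := hφ y.2 (by omega) x hx
        rw [← hc] at h3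
        have h4 := hexp y.1 y.2 h hy
        have h5 := majorant_le_one y.2
        have h6 := majorant_nonneg y.2
        calc _ ≤ 2 * (L₀ * u ^ y.1 * Real.exp ((1 - ε) * x))
              * (B * (c ^ y.2 * majorant y.2) * Real.exp ((1 - ε) * y.2 * x)) := by gcongr
          _ = 2 * L₀ * B * (u ^ y.1 * (c ^ y.2 * majorant y.2))
              * (Real.exp ((1 - ε) * x) * Real.exp ((1 - ε) * y.2 * x)) := by ring
          _ ≤ 2 * L₀ * B * (u ^ y.1 * (c ^ y.2 * 1)) * Real.exp ((1 - ε) * a * x) := by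
            gcongr
          _ = _ := by ring
    refine (norm_sum_le_of_le _ h1).trans (le_of_eq ?_)
    rw [← Finset.mul_sum, hw]; ring
  rw [coefS, if_neg (by omega), powAd_add, powAd_neg]
  refine (norm_add_le _ _).trans ?_
  rw [norm_neg]
  refine (add_le_add hX hE).trans ?_
  have hρ := hb.ρ_pos
  have h7 : w ≤ c ^ a / (2 * γ) := by
    rw [le_div_iff₀ (by positivity)]; linarith
  calc _ = (2 * L₀ * L₁ * B ^ 2 / ρ + 2 * L₀ * B) * w * Real.exp ((1 - ε) * a * x) := by ring
    _ ≤ (2 * L₀ * L₁ * B ^ 2 / ρ + 2 * L₀ * B) * (c ^ a / (2 * γ))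
        * Real.exp ((1 - ε) * a * x) := by gcongr
    _ = _ := by ring

theorem norm_powAd_coefRhs_le (H : BlockData k s ν A U Φ₀ z₀)
    (hb : BlockBounds k (A z₀) (U z₀) (Φ₀ z₀) θ ε ρ L₀ L₁ u γ B) {m : ℕ}
    (hφ : ∀ i < m, PhiBound k A U Φ₀ z₀ θ ε u γ B i) {x : ℝ} (hx : 0 ≤ x) :
    ‖powAd x (A z₀) (coefRhs k (A z₀) (U z₀) (phi k A U Φ₀ z₀) m (x + θ * Complex.I))‖
      ≤ ε * m * (B * ((u * (1 + 2 * γ)) ^ m * majorant m)) * Real.exp ((1 - ε) * m * x) := by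
  have hγ := hb.γ_pos
  have hu := hb.u_nonneg
  have hL₀ := hb.L₀_nonneg
  have hL₁ := hb.L₁_nonneg
  have hε := hb.ε_pos
  have hρ := hb.ρ_pos
  have hB : 0 ≤ B := (norm_nonneg _).trans hb.init
  set c := u * (1 + 2 * γ) with hc
  have hc0 : 0 ≤ c := by positivity
  set Λ := (2 * L₀ * L₁ * B ^ 2 / ρ + 2 * L₀ * B) / (2 * γ) with hΛ
  have hΛ0 : 0 ≤ Λ := by positivity
  -- The lower bound imposed on γ is this inequality in disguise.
  have hΛε : 4 * Λ ≤ ε := by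
    have h1 := hb.le_γ
    have h2 : 4 * L₀ * L₁ * B ^ 2 / (ε * ρ) + 4 * L₀ * B / ε
        = 4 * Λ * γ / ε := by rw [hΛ]; field_simp
    rw [h2, div_le_iff₀ hε, mul_comm γ ε] at h1
    exact le_of_mul_le_mul_right h1 hγ
  have h1 : ∀ y ∈ antidiagonal m, ‖powAd x (A z₀)
      (ad (coefS k (A z₀) (U z₀) (phi k A U Φ₀ z₀) y.1 (x + θ * Complex.I))
        (phi k A U Φ₀ z₀ y.2 (x + θ * Complex.I)))‖
      ≤ 2 * Λ * B * c ^ m * Real.exp ((1 - ε) * m * x)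
        * (if y.1 = 0 then 0 else majorant y.2) := by
    intro y hy
    rw [mem_antidiagonal] at hy
    rcases Nat.eq_zero_or_pos y.1 with h | h
    · simp [h, coefS, ad]
    · rw [if_neg (by omega), powAd_ad]
      refine (norm_ad_le _ _).trans ?_
      have h2 := H.norm_powAd_coefS_le hb h (fun i hi => hφ i (by omega)) hx
      have h3 := hφ y.2 (by omega) x hx
      rw [← hc] at h2 h3
      rw [← hΛ] at h2
      calc _ ≤ 2 * (Λ * c ^ y.1 * Real.exp ((1 - ε) * y.1 * x))
              * (B * (c ^ y.2 * majorant y.2) * Real.exp ((1 - ε) * y.2 * x)) := by gcongr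
        _ = 2 * Λ * B * (c ^ y.1 * c ^ y.2) * (Real.exp ((1 - ε) * y.1 * x)
              * Real.exp ((1 - ε) * y.2 * x)) * majorant y.2 := by ring
        _ = _ := by
          rw [← pow_add, ← Real.exp_add, hy, ← hy]
          push_cast
          ring_nf
  rw [coefRhs, powAd_sum]
  refine (norm_sum_le_of_le _ h1).trans ?_
  rw [← Finset.mul_sum]
  -- Only y.2 < m contributes, so `sum_majorant` applies. It produces the factor m that the
  -- integration with rate εm divides out.
  have h2 : ∑ y ∈ antidiagonal m, (if y.1 = 0 then 0 else majorant y.2)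
      = 2 * m * majorant m := by
    rw [← sum_majorant]
    rw [← Finset.Nat.sum_antidiagonal_swap, Finset.Nat.sum_antidiagonal_eq_sum_range_succ_mk,
      Finset.sum_range_succ]
    simp only [Prod.fst_swap, Prod.snd_swap, Nat.sub_self, if_true, add_zero]
    refine Finset.sum_congr rfl fun i hi => ?_
    rw [Finset.mem_range] at hi
    rw [if_neg (by omega)]
  rw [h2]
  have h3 := majorant_nonneg m
  calc _ = 4 * Λ * (m * (B * (c ^ m * majorant m)) * Real.exp ((1 - ε) * m * x)) := by ring
    _ ≤ ε * (m * (B * (c ^ m * majorant m)) * Real.exp ((1 - ε) * m * x)) := by gcongr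
    _ = _ := by ring

/-- The coefficients are majorized by a geometric series. -/
theorem norm_powAd_phi_le (H : BlockData k s ν A U Φ₀ z₀)
    (hb : BlockBounds k (A z₀) (U z₀) (Φ₀ z₀) θ ε ρ L₀ L₁ u γ B) (m : ℕ) :
    PhiBound k A U Φ₀ z₀ θ ε u γ B m := by
  induction m using Nat.strong_induction_on with
  | _ m ih =>
  rcases Nat.eq_zero_or_pos m with rfl | hm
  · intro x _
    have h1 : powAd x (A z₀) (phi k A U Φ₀ z₀ 0 (x + θ * Complex.I))
        = powAd (-(θ * Complex.I)) (A z₀) (Φ₀ z₀) := by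
      rw [phi, coefPhi_zero, powAd_powAd]
      congr 1
      ring
    rw [h1]
    simpa [majorant] using hb.init
  · intro x hx
    have hε := hb.ε_pos
    have hY := (H.isDecaying_phi hm).self_of_nhds
    have hm' : (0 : ℝ) < m := by exact_mod_cast hm
    have h0 : ∀ d ∈ sumSet m (diffSet s), d.re < m := sumSet_re_lt H.re_lt le_rfl hm
    have hid' : ∀ (y : ℝ) (C : Mat n), powAd y (A z₀) C
        = powAd (-(θ * Complex.I)) (A z₀) (powAd (y + θ * Complex.I) (A z₀) C) := fun y C => by
      rw [powAd_powAd]; congr 1; ring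
    -- The bounds conjugate with the real part of w, the differential equation with all of w. A
    -- constant conjugation by e^{-iθA} passes from one to the other and respects the equation.
    set f : ℂ → Mat n := fun w => powAd (-(θ * Complex.I)) (A z₀)
      (powAd w (A z₀) (phi k A U Φ₀ z₀ m w)) with hf
    set h : ℂ → Mat n := fun w => powAd (-(θ * Complex.I)) (A z₀)
      (powAd w (A z₀) (coefRhs k (A z₀) (U z₀) (phi k A U Φ₀ z₀) m w)) with hh
    have hder : ∀ w, HasDerivAt f ((m : ℂ) • f w + h w) w := by
      intro w
      have := ((hY.1 w).const_mul (NormedSpace.exp ((-(θ * Complex.I)) • A z₀))).mul_const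
        (NormedSpace.exp (-((-(θ * Complex.I)) • A z₀)))
      refine this.congr_deriv ?_
      change powAd (-(θ * Complex.I)) (A z₀) ((m : ℂ) • _ + _) = _
      rw [powAd_add, powAd_smul]
    have hlim : ∀ w₀ : ℂ, Tendsto (fun s : ℝ => Complex.exp (-(m * s)) • f (w₀ + s)) atTop
        (𝓝 0) := by
      intro w₀
      have h1 := (((H.structure_all m).tendsto m h0).self_of_nhds w₀)
      have h2 := (h1.const_mul (NormedSpace.exp ((-(θ * Complex.I)) • A z₀))).mul_const
        (NormedSpace.exp (-((-(θ * Complex.I)) • A z₀)))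
      rw [mul_zero, zero_mul] at h2
      refine h2.congr fun τ => ?_
      exact powAd_smul _ _ _ _
    have hz : ∀ (w : ℂ) (C : Mat n), powAd w 0 C = C := fun w C => by simp [powAd]
    -- The equation is already conjugated, so A = 0 and κ = 0. The rate m - (1 - ε)m = εm cancels
    -- the factor εm in the bound of the right-hand side, and the induction closes with the same
    -- constant.
    have key := norm_powAd_le_of_hasDerivAt (m := m) (A := 0) (f := f) (h := h) (θ := θ) (L := 1)
      (κ := 0) (K := ε * m * (B * ((u * (1 + 2 * γ)) ^ m * majorant m))) (r := (1 - ε) * m)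
      (ω := ε * m) hder hlim zero_le_one (fun τ s _ _ => by simp [hz])
      (fun s hs => by
        rw [hz]
        simp only [hh]
        rw [← hid']
        exact H.norm_powAd_coefRhs_le hb ih hs) (by positivity) (le_of_eq (by ring)) hx
    rw [hz] at key
    simp only [hf] at key
    rw [← hid'] at key
    refine key.trans (le_of_eq ?_)
    field_simp

end BlockData
end Isomonodromy
end

noncomputable section
namespace Isomonodromy
open Filter Topology Polynomial
open Finset.HasAntidiagonal (antidiagonal mem_antidiagonal)

variable {n k : ℕ}

/-! ### The upper left block -/

theorem IsBlock.upperLeft_mul {X : Mat n} (hX : IsBlock k X) (Y : Mat n) :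
    upperLeft k (X * Y) = upperLeft k X * upperLeft k Y := by
  ext i j
  have h1 : (X * Y) i.1 j.1 = ∑ l : {l : Fin n // l.val < k}, X i.1 l.1 * Y l.1 j.1 := by
    rw [Matrix.mul_apply, ← Finset.sum_subtype (Finset.univ.filter fun l : Fin n => l.val < k)
      (by simp) (fun l => X i.1 l * Y l j.1)]
    refine (Finset.sum_filter_of_ne fun l _ hl => ?_).symm
    by_contra hlk
    refine hl ?_
    rw [hX.apply, zero_mul]
    rintro (⟨_, h⟩ | h)
    · exact hlk h
    · exact hlk (h ▸ i.2)
  exact h1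

theorem upperLeft_one : upperLeft k (1 : Mat n) = 1 := by
  ext i j
  simp [upperLeft, Matrix.one_apply, Subtype.ext_iff]

theorem upperLeft_delta (X : Mat n) : upperLeft k (delta k X) = upperLeft k X := by
  ext i j
  simp [upperLeft, delta_apply, i.2, j.2]

theorem IsBlock.upperLeft_pow {X : Mat n} (hX : IsBlock k X) (m : ℕ) :
    upperLeft k (X ^ m) = upperLeft k X ^ m := by
  induction m with
  | zero => rw [pow_zero, pow_zero, upperLeft_one]
  | succ m ih => rw [pow_succ', pow_succ', hX.upperLeft_mul, ih]

theorem upperLeft_add (X Y : Mat n) : upperLeft k (X + Y) = upperLeft k X + upperLeft k Y := rfl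

theorem upperLeft_sub (X Y : Mat n) : upperLeft k (X - Y) = upperLeft k X - upperLeft k Y := rfl

theorem upperLeft_smul (c : ℂ) (X : Mat n) : upperLeft k (c • X) = c • upperLeft k X := rfl

theorem IsBlock.aeval {X : Mat n} (hX : IsBlock k X) (p : ℂ[X]) : IsBlock k (aeval X p) := by
  rw [aeval_eq_sum_range]
  exact Finset.sum_induction _ (IsBlock k) (fun _ _ => IsBlock.add) (isBlock_zero k)
    fun i _ => (hX.pow i).smul _

theorem IsBlock.upperLeft_aeval {X : Mat n} (hX : IsBlock k X) (p : ℂ[X]) :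
    upperLeft k (Polynomial.aeval X p) = Polynomial.aeval (upperLeft k X) p := by
  induction p using Polynomial.induction_on' with
  | add p q hp hq => rw [map_add, map_add, upperLeft_add, hp, hq]
  | monomial m a =>
    rw [aeval_monomial, aeval_monomial, ← Algebra.smul_def, ← Algebra.smul_def, upperLeft_smul,
      hX.upperLeft_pow]

theorem eq_zero_of_upperLeft {X : Mat n} (h1 : projQ n k * X * projQ n k = X)
    (h2 : upperLeft k X = 0) : X = 0 := by
  ext i j
  rw [← h1, mul_projQ_apply, projQ_mul_apply]
  by_cases hi : i.val < k <;> by_cases hj : j.val < k <;> simp [hi, hj]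
  exact congrFun (congrFun h2 ⟨i, hi⟩) ⟨j, hj⟩

/-- The spectrum of the upper left block. -/
def blockSpec (k : ℕ) (A : Mat n) : Finset ℂ := (upperLeft k A).charpoly.roots.toFinset

theorem mem_blockSpec {A : Mat n} {d : ℂ} :
    d ∈ blockSpec k A ↔ d ∈ spectrum ℂ (upperLeft k A) := by
  rw [blockSpec, Multiset.mem_toFinset, mem_roots (Matrix.charpoly_monic _).ne_zero,
    Matrix.mem_spectrum_iff_isRoot_charpoly]

theorem diffSet_blockSpec (A : Mat n) : diffSet (blockSpec k A) = eigDiff k A := by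
  ext d
  simp only [diffSet, eigDiff, mem_blockSpec, Set.mem_ofPred_eq]

/-- Cayley–Hamilton with the crude multiplicity n + 1, which is positive and at least every root
multiplicity. It suffices for holomorphy, where degrees in w do not matter and no spectral data are
given. -/
theorem aeval_rootPoly_mul_projQ {A : Mat n} (hA : IsBlock k A) :
    aeval A (rootPoly (blockSpec k A) (n + 1)) * projQ n k = 0 := by
  have hc := (hA.aeval (rootPoly (blockSpec k A) (n + 1))).commute_projQ
  refine eq_zero_of_upperLeft (k := k) ?_ ?_
  · rw [hc.eq, ← mul_assoc, projQ_mul_self, ← hc.eq, mul_assoc, projQ_mul_self]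
  · rw [(hA.aeval _).upperLeft_mul, hA.upperLeft_aeval]
    have h1 : (upperLeft k A).charpoly ∣ rootPoly (blockSpec k A) (n + 1) := by
      have hs := (IsAlgClosed.splits (upperLeft k A).charpoly).eq_prod_roots_of_monic
        (Matrix.charpoly_monic _)
      rw [hs, Finset.prod_multiset_map_count]
      refine Finset.prod_dvd_prod_of_dvd _ _ fun d _ => pow_dvd_pow _ ?_
      refine (Multiset.count_le_card _ _).trans ((card_roots' _).trans ?_)
      rw [Matrix.charpoly_natDegree_eq_dim]
      refine (Fintype.card_subtype_le _).trans ?_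
      simp
    obtain ⟨q, hq⟩ := h1
    rw [hq, map_mul, Matrix.aeval_self_charpoly, zero_mul, zero_mul]

/-! ### Spectral data -/

namespace IsSpectralData

variable {A : Mat n} {lam : Fin n → ℂ} {P : Fin n → Mat n} {N : Mat n}

theorem sum_mul (h : IsSpectralData k A lam P N) (i : Fin n) :
    (∑ j, lam j • P j) * P i = lam i • P i := by
  rw [Finset.sum_mul, Finset.sum_eq_single i]
  · rw [smul_mul_assoc, h.orthogonal, if_pos rfl]
  · intro j _ hj; rw [smul_mul_assoc, h.orthogonal, if_neg hj, smul_zero]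
  · simp

theorem mul_sum (h : IsSpectralData k A lam P N) (i : Fin n) :
    P i * (∑ j, lam j • P j) = lam i • P i := by
  rw [Finset.mul_sum, Finset.sum_eq_single i]
  · rw [mul_smul_comm, h.orthogonal, if_pos rfl]
  · intro j _ hj; rw [mul_smul_comm, h.orthogonal, if_neg (Ne.symm hj), smul_zero]
  · simp

/-- On the range of P_i the semisimple part is λ_i, and N preserves this picture because it commutes
with the semisimple part. -/
theorem sub_pow_mul (h : IsSpectralData k A lam P N) (i : Fin n) (t : ℕ) :
    (A - lam i • (1 : Mat n)) ^ t * P i = N ^ t * P i := by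
  induction t with
  | zero => simp
  | succ t ih =>
    have h1 : (∑ j, lam j • P j) * N ^ t = N ^ t * ∑ j, lam j • P j := (h.commute.pow_right t).eq
    rw [pow_succ', mul_assoc, ih, pow_succ', h.decomposition, sub_mul, add_mul, ← mul_assoc, h1,
      mul_assoc, h.sum_mul, mul_smul_comm, smul_mul_assoc, one_mul, mul_assoc]
    abel

theorem pow_nilpotencyClass (h : IsSpectralData k A lam P N) : N ^ nilpotencyClass N = 0 :=
  _root_.pow_nilpotencyClass h.nilpotent

theorem nilpotencyClass_pos [NeZero n] (h : IsSpectralData k A lam P N) :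
    1 ≤ nilpotencyClass N := by
  have : Nonempty (Fin n) := ⟨0⟩
  exact pos_nilpotencyClass_iff.2 h.nilpotent

/-- At an index outside the block both A and its semisimple part act on the coordinate line by the
diagonal entry, which leaves nothing for N. -/
theorem tail_mul (h : IsSpectralData k A lam P N) (hA : IsBlock k A) {i : Fin n} (hi : k ≤ i.val) :
    N * P i = 0 ∧ P i * N = 0 := by
  obtain ⟨h1, h2⟩ := h.tail i hi
  have h3 : A * P i = lam i • P i := by
    rw [h1, h2]
    ext a b
    by_cases hb : i = b
    · subst hb
      by_cases ha : i = a
      · subst ha; simp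
      · rw [Matrix.mul_single_apply_same, mul_one, hA.apply]
        · simp [ha]
        · rintro (⟨_, h⟩ | h)
          · omega
          · exact ha h.symm
    · simp [Matrix.mul_apply, hb]
  have h4 : P i * A = lam i • P i := by
    rw [h1, h2]
    ext a b
    by_cases ha : i = a
    · subst ha
      by_cases hb : i = b
      · subst hb; simp
      · rw [Matrix.single_mul_apply_same, one_mul, hA.apply]
        · simp [hb]
        · rintro (⟨h, _⟩ | h)
          · omega
          · exact hb h
    · simp [Matrix.mul_apply, ha]
  constructor
  · have := h.sum_mul i
    rw [h.decomposition, add_mul, this] at h3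
    simpa using h3
  · have := h.mul_sum i
    rw [h.decomposition, mul_add, this] at h4
    simpa using h4

theorem tail_mul_corner (h : IsSpectralData k A lam P N) {C : Mat n}
    (hC : projQ n k * C * projQ n k = C) {i : Fin n} (hi : k ≤ i.val) :
    P i * C = 0 ∧ C * P i = 0 := by
  have h1 := (h.tail i hi).1
  have hi' : ¬ i.val < k := by omega
  constructor <;> rw [h1, ← hC] <;> ext a b
  · by_cases ha : i = a
    · subst ha
      rw [Matrix.single_mul_apply_same, mul_projQ_apply, projQ_mul_apply]
      simp [hi']
    · simp [Matrix.mul_apply, ha]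
  · by_cases hb : i = b
    · subst hb
      rw [Matrix.mul_single_apply_same, mul_projQ_apply, projQ_mul_apply]
      simp [hi']
    · simp [Matrix.mul_apply, hb]

theorem corner (h : IsSpectralData k A lam P N) {i : Fin n} (hi : i.val < k) :
    projQ n k * P i * projQ n k = P i := by
  have h1 : ∀ j : Fin n, k ≤ j.val → ∀ l, P i j l = 0 ∧ P i l j = 0 := by
    intro j hj l
    have hij : i ≠ j := by rintro rfl; omega
    have h2 := h.orthogonal i j
    have h3 := h.orthogonal j i
    rw [if_neg hij, (h.tail j hj).1] at h2
    rw [if_neg hij.symm, (h.tail j hj).1] at h3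
    have h4 := congrFun (congrFun h2 l) j
    have h5 := congrFun (congrFun h3 j) l
    rw [Matrix.mul_single_apply_same, mul_one] at h4
    rw [Matrix.single_mul_apply_same, one_mul] at h5
    exact ⟨h5, h4⟩
  ext a b
  rw [mul_projQ_apply, projQ_mul_apply]
  split_ifs with hb ha
  · rfl
  · exact (h1 a (by omega) b).1.symm
  · exact (h1 b (by omega) a).2.symm

theorem mem_spectrum (h : IsSpectralData k A lam P N) (hA : IsBlock k A) {i : Fin n}
    (hi : i.val < k) (hP : P i ≠ 0) : lam i ∈ spectrum ℂ (upperLeft k A) := by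
  by_contra hs
  rw [spectrum.notMem_iff] at hs
  refine hP (eq_zero_of_upperLeft (h.corner hi) ?_)
  have h1 : (lam i • (1 : Mat n) - A) ^ nilpotencyClass N * P i = 0 := by
    rw [← neg_sub A, neg_pow, mul_assoc, h.sub_pow_mul, h.pow_nilpotencyClass, zero_mul, mul_zero]
  have h2 := congrArg (upperLeft k) h1
  have h3 : IsBlock k (lam i • (1 : Mat n) - A) := ((isBlock_one k).smul _).sub hA
  rw [(h3.pow _).upperLeft_mul, h3.upperLeft_pow, upperLeft_sub, upperLeft_smul, upperLeft_one,
    ← Algebra.algebraMap_eq_smul_one] at h2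
  exact ((hs.pow _).mul_right_eq_zero).1 (h2.trans rfl)

theorem projQ_eq (h : IsSpectralData k A lam P N) :
    projQ n k = ∑ i with i.val < k, P i := by
  have h1 : projQ n k = ∑ i, P i * projQ n k := by
    rw [← Finset.sum_mul, h.sum_eq_one, one_mul]
  rw [h1, Finset.sum_filter]
  refine Finset.sum_congr rfl fun i _ => ?_
  split_ifs with hi
  · conv_lhs => rw [← h.corner hi]
    rw [mul_assoc, projQ_mul_self, h.corner hi]
  · exact (h.tail_mul_corner (C := projQ n k) (by rw [projQ_mul_self, projQ_mul_self])
      (by omega)).1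

/-- On P_i one factor of the polynomial already acts as N^ν = 0. The nilpotency index as
multiplicity is what gives the degree 2(ν - 1)m in the structure statement. -/
theorem annih (h : IsSpectralData k A lam P N) (hA : IsBlock k A) :
    aeval A (rootPoly (blockSpec k A) (nilpotencyClass N)) * projQ n k = 0 := by
  rw [h.projQ_eq, Finset.mul_sum]
  refine Finset.sum_eq_zero fun i hi => ?_
  rw [Finset.mem_filter] at hi
  by_cases hP : P i = 0
  · rw [hP, mul_zero]
  have h1 := mem_blockSpec.2 (h.mem_spectrum hA hi.2 hP)
  obtain ⟨q, hq⟩ : (Polynomial.X - Polynomial.C (lam i)) ^ nilpotencyClass N ∣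
      rootPoly (blockSpec k A) (nilpotencyClass N) := Finset.dvd_prod_of_mem _ h1
  have h2 : aeval A ((Polynomial.X - Polynomial.C (lam i)) ^ nilpotencyClass N)
      = (A - lam i • (1 : Mat n)) ^ nilpotencyClass N := by
    simp [Algebra.algebraMap_eq_smul_one]
  rw [hq, mul_comm, map_mul, mul_assoc, h2, h.sub_pow_mul, h.pow_nilpotencyClass, zero_mul,
    mul_zero]

end IsSpectralData
end Isomonodromy
end

/-! ### Growth of the conjugation flow on the block -/

noncomputable section
namespace Isomonodromy
open Filter Topology
open Finset.HasAntidiagonal (antidiagonal mem_antidiagonal)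

variable {n k : ℕ}

/-- The partial sum of the exponential series. -/
def expPart (ν : ℕ) (x : ℝ) : ℝ := ∑ t ∈ Finset.range ν, x ^ t / t.factorial

theorem expPart_nonneg (ν : ℕ) {x : ℝ} (hx : 0 ≤ x) : 0 ≤ expPart ν x :=
  Finset.sum_nonneg fun t _ => by positivity

theorem norm_one_le : ‖(1 : Mat n)‖ ≤ 1 := by
  rw [← Matrix.diagonal_one]
  exact norm_diagonal_le zero_le_one fun i => by simp

theorem norm_pow_le_pow (N : Mat n) (t : ℕ) : ‖N ^ t‖ ≤ ‖N‖ ^ t := by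
  rcases Nat.eq_zero_or_pos t with rfl | ht
  · simpa using norm_one_le
  · exact norm_pow_le' N ht

/-- The truncated exponential series. -/
def expNil (ν : ℕ) (N : Mat n) (w : ℂ) : Mat n :=
  ∑ t ∈ Finset.range ν, (w ^ t * (t.factorial⁻¹ : ℂ)) • N ^ t

theorem norm_expNil_le (ν : ℕ) (N : Mat n) (w : ℂ) : ‖expNil ν N w‖ ≤ expPart ν (‖N‖ * ‖w‖) := by
  refine norm_sum_le_of_le _ fun t _ => ?_
  rw [norm_smul, norm_mul, norm_pow, norm_inv, Complex.norm_natCast, mul_pow, div_eq_mul_inv]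
  calc ‖w‖ ^ t * (t.factorial : ℝ)⁻¹ * ‖N ^ t‖ ≤ ‖w‖ ^ t * (t.factorial : ℝ)⁻¹ * ‖N‖ ^ t := by
        gcongr; exact norm_pow_le_pow N t
    _ = _ := by ring

/-- Write (ax)^t = (2a/η)^t (ηx/2)^t and bound the remaining truncated series by e^{ηx/2}; squaring
gives e^{ηx}. The maximum with 1 takes care of 2a/η < 1, where the largest factor belongs to t = 0.
-/
theorem expPart_sq_le {ν : ℕ} (hν : 1 ≤ ν) {a η x : ℝ} (ha : 0 ≤ a) (hη : 0 < η) (hx : 0 ≤ x) :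
    expPart ν (a * x) ^ 2 ≤ max 1 ((2 * a / η) ^ (2 * (ν - 1))) * Real.exp (η * x) := by
  have h1 : expPart ν (a * x) ≤ max 1 ((2 * a / η) ^ (ν - 1)) * Real.exp (η / 2 * x) := by
    have h2 : expPart ν (a * x)
        ≤ max 1 ((2 * a / η) ^ (ν - 1)) * ∑ t ∈ Finset.range ν, (η / 2 * x) ^ t / t.factorial := by
      rw [expPart, Finset.mul_sum]
      refine Finset.sum_le_sum fun t ht => ?_
      rw [Finset.mem_range] at ht
      have h3 : (a * x) ^ t = (2 * a / η) ^ t * (η / 2 * x) ^ t := by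
        rw [← mul_pow]; congr 1; field_simp
      rw [h3, mul_div_assoc]
      refine mul_le_mul_of_nonneg_right ?_ (by positivity)
      rcases le_total (2 * a / η) 1 with h | h
      · exact (pow_le_one₀ (by positivity) h).trans (le_max_left _ _)
      · exact (pow_le_pow_right₀ h (by omega)).trans (le_max_right _ _)
    refine h2.trans (mul_le_mul_of_nonneg_left ?_ (by positivity))
    exact Real.sum_le_exp_of_nonneg (by positivity) ν
  have h4 : max 1 ((2 * a / η) ^ (2 * (ν - 1))) = max 1 ((2 * a / η) ^ (ν - 1)) ^ 2 := by
    have h0 : 0 ≤ (2 * a / η) ^ (ν - 1) := by positivity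
    rw [mul_comm 2 (ν - 1), pow_mul]
    rcases le_total ((2 * a / η) ^ (ν - 1)) 1 with h | h
    · rw [max_eq_left h, max_eq_left (pow_le_one₀ h0 h), one_pow]
    · rw [max_eq_right h, max_eq_right (one_le_pow₀ h)]
  calc expPart ν (a * x) ^ 2
      ≤ (max 1 ((2 * a / η) ^ (ν - 1)) * Real.exp (η / 2 * x)) ^ 2 :=
        pow_le_pow_left₀ (expPart_nonneg ν (by positivity)) h1 2
    _ = _ := by
      rw [mul_pow, h4, ← Real.exp_nat_mul]
      congr 2
      push_cast; ring

namespace IsSpectralData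

variable {A : Mat n} {lam : Fin n → ℂ} {P : Fin n → Mat n} {N : Mat n}

theorem exp_mul_proj (h : IsSpectralData k A lam P N) (i : Fin n) (w : ℂ) :
    NormedSpace.exp (w • A) * P i
      = Complex.exp (lam i * w) • (expNil (nilpotencyClass N) N w * P i) := by
  rw [exp_smul_mul_of_pow_mul_eq_zero (ν := nilpotencyClass N) (d := lam i)
    (by rw [h.sub_pow_mul, h.pow_nilpotencyClass, zero_mul]), expNil, Finset.sum_mul,
    Finset.smul_sum]
  refine Finset.sum_congr rfl fun t _ => ?_
  rw [h.sub_pow_mul, smul_mul_assoc]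
  simp only [smul_smul, mul_assoc]

theorem exp_eq (h : IsSpectralData k A lam P N) (w : ℂ) :
    NormedSpace.exp (w • A)
      = ∑ i, Complex.exp (lam i * w) • (expNil (nilpotencyClass N) N w * P i) := by
  rw [← mul_one (NormedSpace.exp (w • A)), ← h.sum_eq_one, Finset.mul_sum]
  exact Finset.sum_congr rfl fun i _ => h.exp_mul_proj i w

theorem expNil_mul_tail (h : IsSpectralData k A lam P N) (hA : IsBlock k A)
    (hν : 1 ≤ nilpotencyClass N) {i : Fin n} (hi : k ≤ i.val) (w : ℂ) :
    expNil (nilpotencyClass N) N w * P i = P i := by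
  obtain ⟨ν, hν'⟩ := Nat.exists_eq_add_of_le' hν
  rw [expNil, hν', Finset.sum_mul, Finset.sum_range_succ', Finset.sum_eq_zero, zero_add]
  · simp
  · intro t _
    rw [smul_mul_assoc, pow_succ N, mul_assoc (N ^ t), (h.tail_mul hA hi).1, mul_zero, smul_zero]

/-- Expand both exponentials along the spectral projections. Because C lies in the corner, the
indices outside the block drop out, and only differences of eigenvalues of the block govern the
growth. -/
theorem norm_powAd_le (h : IsSpectralData k A lam P N) (hA : IsBlock k A)
    (hν : 1 ≤ nilpotencyClass N) {δ : ℝ} (hδ : ∀ d ∈ eigDiff k A, |d.re| ≤ δ) (τ : ℝ) {C : Mat n}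
    (hC : projQ n k * C * projQ n k = C) :
    ‖powAd τ A C‖ ≤ (∑ i, ‖P i‖) ^ 2 * expPart (nilpotencyClass N) (‖N‖ * |τ|) ^ 2
      * Real.exp (δ * |τ|) * ‖C‖ := by
  set ν := nilpotencyClass N with hνd
  set q := expPart ν (‖N‖ * |τ|) with hq
  have hq0 : 0 ≤ q := expPart_nonneg ν (by positivity)
  have h1 : powAd τ A C = ∑ i, ∑ j, (Complex.exp (lam i * τ) • (expNil ν N τ * P i)) * C *
      (Complex.exp (lam j * (-τ)) • (expNil ν N (-τ) * P j)) := by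
    rw [powAd, ← neg_smul, h.exp_eq, h.exp_eq, Finset.sum_mul, Finset.sum_mul]
    refine Finset.sum_congr rfl fun i _ => ?_
    rw [Finset.mul_sum]
  have h2 : ∀ i j, ‖(Complex.exp (lam i * τ) • (expNil ν N τ * P i)) * C *
      (Complex.exp (lam j * (-τ)) • (expNil ν N (-τ) * P j))‖
      ≤ ‖P i‖ * ‖P j‖ * (q ^ 2 * Real.exp (δ * |τ|) * ‖C‖) := by
    intro i j
    have hnn : 0 ≤ ‖P i‖ * ‖P j‖ * (q ^ 2 * Real.exp (δ * |τ|) * ‖C‖) := by positivity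
    by_cases hi : k ≤ i.val
    · have : expNil ν N τ * P i * C = 0 := by rw [mul_assoc, (h.tail_mul_corner hC hi).1, mul_zero]
      rw [smul_mul_assoc, this, smul_zero, zero_mul, norm_zero]; exact hnn
    by_cases hj : k ≤ j.val
    · have : C * (expNil ν N (-τ) * P j) = 0 := by
        rw [h.expNil_mul_tail hA hν hj, (h.tail_mul_corner hC hj).2]
      rw [mul_assoc, mul_smul_comm, this, smul_zero, mul_zero, norm_zero]; exact hnn
    by_cases hPi : P i = 0
    · simp only [hPi, mul_zero, smul_zero, zero_mul, norm_zero, le_refl]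
    by_cases hPj : P j = 0
    · simp only [hPj, mul_zero, smul_zero, zero_mul, norm_zero, le_refl]
    have hmem : lam i - lam j ∈ eigDiff k A :=
      ⟨_, h.mem_spectrum hA (by omega) hPi, _, h.mem_spectrum hA (by omega) hPj, rfl⟩
    have he : ‖Complex.exp (lam i * τ)‖ * ‖Complex.exp (lam j * (-τ))‖
        ≤ Real.exp (δ * |τ|) := by
      rw [← norm_mul, ← Complex.exp_add, Complex.norm_exp, Real.exp_le_exp]
      have : lam i * τ + lam j * (-τ) = (τ : ℂ) * (lam i - lam j) := by ring
      rw [this, Complex.re_ofReal_mul]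
      calc τ * (lam i - lam j).re ≤ |τ * (lam i - lam j).re| := le_abs_self _
        _ = |(lam i - lam j).re| * |τ| := by rw [abs_mul, mul_comm]
        _ ≤ δ * |τ| := by gcongr; exact hδ _ hmem
    have hE : ∀ (w : ℂ) (l : Fin n), ‖w‖ = |τ| → ‖expNil ν N w * P l‖ ≤ q * ‖P l‖ := by
      intro w l hw
      refine (norm_mul_le _ _).trans (mul_le_mul_of_nonneg_right ?_ (norm_nonneg _))
      rw [hq, ← hw]; exact norm_expNil_le ν N w
    have hE1 := hE τ i (by simp)
    have hE2 := hE (-τ) j (by simp)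
    calc _ ≤ ‖Complex.exp (lam i * τ)‖ * ‖expNil ν N τ * P i‖ * ‖C‖
          * (‖Complex.exp (lam j * (-τ))‖ * ‖expNil ν N (-τ) * P j‖) := by
          refine (norm_mul_le _ _).trans ?_
          rw [norm_smul]
          refine mul_le_mul_of_nonneg_right ((norm_mul_le _ _).trans ?_) (by positivity)
          rw [norm_smul]
      _ ≤ ‖Complex.exp (lam i * τ)‖ * (q * ‖P i‖) * ‖C‖
          * (‖Complex.exp (lam j * (-τ))‖ * (q * ‖P j‖)) := by gcongr
      _ = (‖Complex.exp (lam i * τ)‖ * ‖Complex.exp (lam j * (-τ))‖)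
          * (‖P i‖ * ‖P j‖ * (q ^ 2 * ‖C‖)) := by ring
      _ ≤ Real.exp (δ * |τ|) * (‖P i‖ * ‖P j‖ * (q ^ 2 * ‖C‖)) := by gcongr
      _ = _ := by ring
  rw [h1]
  refine (norm_sum_le_of_le _ fun i _ => norm_sum_le_of_le _ fun j _ => h2 i j).trans
    (le_of_eq ?_)
  rw [sq (∑ i, ‖P i‖), Finset.sum_mul_sum]
  simp only [← Finset.sum_mul]
  ring

end IsSpectralData
end Isomonodromy
end

/-! ### Comparison of the majorant constants with R -/

noncomputable section
namespace Isomonodromy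
open Filter Topology
open Finset.HasAntidiagonal (antidiagonal mem_antidiagonal)

variable {n k : ℕ}

theorem finite_eigDiff (k : ℕ) (A : Mat n) : (eigDiff k A).Finite := by
  rw [← diffSet_blockSpec]
  refine (Set.Finite.image2 (fun a b : ℂ => a - b) (blockSpec k A).finite_toSet
    (blockSpec k A).finite_toSet).subset ?_
  rintro d ⟨a, ha, b, hb, rfl⟩
  exact ⟨a, ha, b, hb, rfl⟩

theorem zero_mem_eigDiff (hk : 1 ≤ k) (hkn : k ≤ n) (A : Mat n) : (0 : ℂ) ∈ eigDiff k A := by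
  have : Nonempty {i : Fin n // i.val < k} := ⟨⟨⟨0, by omega⟩, Nat.lt_of_lt_of_le Nat.zero_lt_one hk⟩⟩
  obtain ⟨a, ha⟩ := spectrum.nonempty_of_isAlgClosed_of_finiteDimensional ℂ (upperLeft k A)
  exact ⟨a, ha, a, ha, by simp⟩

theorem le_of_eps0 (ε : ℝ) (A : Mat n) : ∀ d ∈ eigDiff k A, |d.re| ≤ 1 - ε - eps0 k ε A := by
  intro d hd
  have h1 : |d.re| ≤ sSup ((fun d : ℂ => |d.re|) '' eigDiff k A) :=
    le_csSup ((finite_eigDiff k A).image _).bddAbove ⟨d, hd, rfl⟩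
  rw [eps0]; linarith

theorem eps0_pos (hk : 1 ≤ k) (hkn : k ≤ n) {ε : ℝ} {A : Mat n}
    (h : ∀ d ∈ eigDiff k A, |d.re| < 1 - ε) : 0 < eps0 k ε A := by
  have h1 : sSup ((fun d : ℂ => |d.re|) '' eigDiff k A) < 1 - ε := by
    refine (((finite_eigDiff k A).image _).csSup_lt_iff
      ⟨_, 0, zero_mem_eigDiff hk hkn A, rfl⟩).2 ?_
    rintro _ ⟨d, hd, rfl⟩
    exact h d hd
  rw [eps0]; linarith

theorem eps0_le (hk : 1 ≤ k) (hkn : k ≤ n) (ε : ℝ) (A : Mat n) : eps0 k ε A ≤ 1 - ε := by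
  have := le_of_eps0 ε A 0 (zero_mem_eigDiff hk hkn A)
  simp at this
  linarith

/-- The comparison of the constants in the majorant with the constant `R`. -/
theorem constants_le {t x r ε e B c C ρ : ℝ} {μ : ℕ} (ht : 0 < t) (hx : 0 ≤ x) (hr : 1 ≤ r)
    (hε : 0 < ε) (hε1 : ε ≤ 1) (he : 0 < e) (he1 : e ≤ 1) (hB : 0 ≤ B)
    (hc : c = max 1 ((2 * x / e) ^ (2 * μ)))
    (hC : C = max 1 ((4 * x / ε) ^ (2 * μ))) (hρ : ρ = if μ = 0 then ε else ε / 2)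
    {R : ℝ} (hR : R = t * ((μ + 1 : ℝ) - 1 / 2) * (1 + (4 * (μ + 1 : ℝ) * x) ^ (2 * μ)) * r) :
    4 * (t * c) * (t * C) * B ^ 2 / (ε * ρ) + 4 * (t * c) * B / ε
      ≤ (2 * R * B / (ε ^ (μ + 1) * e ^ μ)) ^ 2
        + (2 * R * B / (ε ^ (μ + 1) * e ^ μ)) ^ 2 / (R * B) := by
  have hρ0 : 0 < ρ := by rw [hρ]; split_ifs <;> positivity
  set y := (4 * (μ + 1 : ℝ) * x) ^ (2 * μ) with hy
  have hy0 : 0 ≤ y := by positivity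
  set G := ((μ + 1 : ℝ) - 1 / 2) * (1 + y) with hG
  have hR' : R = t * G * r := by rw [hR, hG]; ring
  have hc0 : 0 < c := by rw [hc]; positivity
  have hC0 : 0 < C := by rw [hC]; positivity
  have hμ0 : (0 : ℝ) ≤ μ := Nat.cast_nonneg μ
  have hp : c * e ^ (2 * μ) ≤ 1 + y := by
    rw [hc, max_mul_of_nonneg _ _ (by positivity), div_pow, one_mul]
    refine max_le ?_ ?_
    · exact (pow_le_one₀ he.le he1).trans (by linarith)
    · rw [div_mul_cancel₀ _ (by positivity)]
      have : (2 * x) ^ (2 * μ) ≤ y := pow_le_pow_left₀ (by positivity) (by nlinarith) _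
      linarith
  have hq : C * ε ^ (2 * μ) ≤ 1 + y := by
    rw [hC, max_mul_of_nonneg _ _ (by positivity), div_pow, one_mul]
    refine max_le ?_ ?_
    · exact (pow_le_one₀ hε.le hε1).trans (by linarith)
    · rw [div_mul_cancel₀ _ (by positivity)]
      have : (4 * x) ^ (2 * μ) ≤ y := pow_le_pow_left₀ (by positivity) (by nlinarith) _
      linarith
  have hG0 : 0 < G := by rw [hG]; exact mul_pos (by linarith) (by linarith)
  -- For μ = 0 all powers with exponent 2μ are 1, so c = 1, y = 1 and G = 1/2 · 2 = 1: the
  -- inequality is sharp.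
  have hpG : c * e ^ (2 * μ) ≤ G := by
    rcases Nat.eq_zero_or_pos μ with rfl | hμ
    · simp [hc, hG, hy]; norm_num
    · have : (1 : ℝ) ≤ μ := by exact_mod_cast hμ
      refine hp.trans ?_
      rw [hG]; nlinarith
  -- For μ ≥ 1 the loss ε/ρ = 2 is covered by G ≥ (3/2)(1 + y), since 2 ≤ 9/4.
  have hpq : ε / ρ * ((c * e ^ (2 * μ)) * (C * ε ^ (2 * μ))) ≤ G ^ 2 := by
    rcases Nat.eq_zero_or_pos μ with rfl | hμ
    · have h1 : ρ = ε := by rw [hρ, if_pos rfl]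
      rw [h1, div_self hε.ne']
      simp [hc, hC, hG, hy]; norm_num
    · have h1 : ρ = ε / 2 := by rw [hρ, if_neg (by omega)]
      have h2 : ε / ρ = 2 := by rw [h1]; field_simp
      have : (1 : ℝ) ≤ μ := by exact_mod_cast hμ
      rw [h2]
      have h3 : (c * e ^ (2 * μ)) * (C * ε ^ (2 * μ)) ≤ (1 + y) * (1 + y) :=
        mul_le_mul hp hq (by positivity) (by positivity)
      have h4 : 3 / 2 * (1 + y) ≤ G := by rw [hG]; nlinarith
      nlinarith [mul_self_le_mul_self (by positivity) h4]
  have hRG : t * G ≤ R := by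
    rw [hR']; exact le_mul_of_one_le_right (by positivity) hr
  have hR0 : 0 < R := lt_of_lt_of_le (by positivity) hRG
  set D := ε ^ (2 * μ + 2) * e ^ (2 * μ) with hD
  have hD0 : 0 < D := by positivity
  have hsq : (2 * R * B / (ε ^ (μ + 1) * e ^ μ)) ^ 2 = 4 * R ^ 2 * B ^ 2 / D := by
    rw [div_pow, hD]
    congr 1 <;> ring
  rw [hsq]
  refine add_le_add ?_ ?_
  · have h1 : 4 * (t * c) * (t * C) * B ^ 2 / (ε * ρ)
        = 4 * (t ^ 2 * (ε / ρ * ((c * e ^ (2 * μ)) * (C * ε ^ (2 * μ))))) * B ^ 2 / D := by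
      rw [hD, pow_add]; field_simp
    rw [h1]
    have h2 : t ^ 2 * (ε / ρ * ((c * e ^ (2 * μ)) * (C * ε ^ (2 * μ)))) ≤ R ^ 2 :=
      calc _ ≤ t ^ 2 * G ^ 2 := by gcongr
        _ = (t * G) ^ 2 := by ring
        _ ≤ R ^ 2 := by gcongr
    gcongr
  · rcases hB.eq_or_lt with h0 | h0
    · rw [← h0]; simp
    · have h1 : 4 * R ^ 2 * B ^ 2 / D / (R * B) = 4 * R * B / D := by field_simp
      have h2 : 4 * (t * c) * B / ε = 4 * (t * (c * e ^ (2 * μ)) * ε ^ (2 * μ + 1)) * B / D := by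
        rw [hD, pow_add, pow_add]; field_simp
      rw [h1, h2]
      have h3 : t * (c * e ^ (2 * μ)) * ε ^ (2 * μ + 1) ≤ R :=
        calc _ ≤ t * G * 1 := by
              gcongr
              exact pow_le_one₀ hε.le hε1
          _ ≤ R := by rwa [mul_one]
      gcongr

namespace IsSpectralData

variable {A : Mat n} {lam : Fin n → ℂ} {P : Fin n → Mat n} {N : Mat n}

theorem one_le_sum_norm [NeZero n] (h : IsSpectralData k A lam P N) : 1 ≤ ∑ i, ‖P i‖ := by
  have : Nonempty (Fin n) := ⟨0⟩
  have h1 : ‖(1 : Mat n)‖ = 1 := norm_one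
  calc 1 = ‖∑ i, P i‖ := by rw [h.sum_eq_one, h1]
    _ ≤ _ := norm_sum_le _ _

theorem log_bound {M : ℝ} {μ : ℕ} (hM : Real.exp (2 * ((μ + 1 : ℝ) - 1)) < M) :
    1 ≤ 1 / (1 - 2 * ((μ + 1 : ℝ) - 1) / Real.log M) := by
  have h0 : 0 < M := (Real.exp_pos _).trans hM
  have h1 : 2 * ((μ + 1 : ℝ) - 1) < Real.log M := (Real.lt_log_iff_exp_lt h0).2 hM
  have h2 : (0 : ℝ) ≤ μ := Nat.cast_nonneg μ
  have h3 : 0 < Real.log M := by nlinarith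
  have h4 : 2 * ((μ + 1 : ℝ) - 1) / Real.log M < 1 := by rwa [div_lt_one h3]
  have h5 : 0 ≤ 2 * ((μ + 1 : ℝ) - 1) / Real.log M := div_nonneg (by nlinarith) h3.le
  rw [le_div_iff₀ (by linarith)]
  linarith

/-- The eigenvalue differences grow at most like e^{(1-ε-ε₀)s}. The polynomial factor from N is
absorbed in e^{ε₀s} for the powers of U, and in e^{(ε-ρ)τ} for the backward conjugation. -/
theorem exists_blockBounds (h : IsSpectralData k A lam P N) (hA : IsBlock k A) (hk : 1 ≤ k)
    (hkn : k ≤ n) {ε M : ℝ} (hε : 0 < ε) (hbound : ∀ d ∈ eigDiff k A, |d.re| < 1 - ε)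
    (hM : Real.exp (2 * ((nilpotencyClass N : ℝ) - 1)) < M) {U : Mat n}
    (hQU : projQ n k * U = U) (hUQ : U * projQ n k = U) (Φ₀ : Mat n) (θ : ℝ) :
    ∃ ρ L₀ L₁ γ, BlockBounds k A U Φ₀ θ ε ρ L₀ L₁ ‖U‖ γ
        ‖powAd (-(θ * Complex.I)) A Φ₀‖ ∧
      ‖U‖ * (1 + 2 * γ) ≤ radiusBound ε (eps0 k ε A) (constR P N M) M ‖U‖
        ‖powAd (-(θ * Complex.I)) A Φ₀‖ (nilpotencyClass N) := by
  have : NeZero n := ⟨by omega⟩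
  have hν := h.nilpotencyClass_pos
  obtain ⟨μ, hμ⟩ := Nat.exists_eq_add_of_le' hν
  set B := ‖powAd (-(θ * Complex.I)) A Φ₀‖ with hB
  set e := eps0 k ε A with he
  have he0 : 0 < e := eps0_pos hk hkn hbound
  have he1 : e ≤ 1 - ε := eps0_le hk hkn ε A
  have hδ := le_of_eps0 (k := k) ε A
  rw [← he] at hδ
  obtain ⟨t, ht⟩ : ∃ t, t = (∑ i, ‖P i‖) ^ 2 := ⟨_, rfl⟩
  have ht0 : 0 < t := by
    have := h.one_le_sum_norm
    rw [ht]; exact pow_pos (by linarith) 2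
  obtain ⟨R, hR⟩ : ∃ R, R = constR P N M := ⟨_, rfl⟩
  rw [← hR]
  rw [hμ] at hM
  push_cast at hM
  have hR' : R = t * ((μ + 1 : ℝ) - 1 / 2) * (1 + (4 * (μ + 1 : ℝ) * ‖N‖) ^ (2 * μ))
      * (1 / (1 - 2 * ((μ + 1 : ℝ) - 1) / Real.log M)) := by
    rw [hR, constR, hμ, ht]; push_cast; rfl
  have hcomp := constants_le (t := t) (x := ‖N‖) (ε := ε) (e := e) (B := B) (μ := μ) (R := R)
    ht0 (norm_nonneg _) (log_bound hM) hε (by linarith) he0 (by linarith) (norm_nonneg _)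
    rfl rfl rfl hR'
  set c := max 1 ((2 * ‖N‖ / e) ^ (2 * μ)) with hc
  set C := max 1 ((4 * ‖N‖ / ε) ^ (2 * μ)) with hC
  set ρ := (if μ = 0 then ε else ε / 2) with hρ
  set αT := (2 * R * B / (ε ^ (μ + 1) * e ^ μ)) ^ 2 with hαT
  have hR0 : 0 ≤ R := by
    rw [hR']
    have := log_bound hM
    have hμ0 : (0 : ℝ) ≤ μ := Nat.cast_nonneg μ
    have h1 : 0 ≤ (μ + 1 : ℝ) - 1 / 2 := by linarith
    positivity
  have hB0 : 0 ≤ B := norm_nonneg _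
  -- The summand 1/2 keeps γ positive when B = 0. It turns 1 + 2γ into 2(1 + αT + αT/(RB)), which is
  -- dominated by 2(1 + αT)(1 + 1/(RB)).
  refine ⟨ρ, t * c, t * C, αT + αT / (R * B) + 1 / 2, ⟨hε, by linarith, ?_, by positivity,
    by positivity, norm_nonneg _, by positivity, ?_, ?_, le_rfl, by linarith⟩, ?_⟩
  · rw [hρ]; split_ifs <;> positivity
  · intro p hp s hs
    have hcor : projQ n k * coefH U p * projQ n k = coefH U p := by
      obtain ⟨h1, h2⟩ := projQ_coefH hQU hUQ p
      rw [h1, h2]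
    have h1 := h.norm_powAd_le hA hν hδ s hcor
    rw [abs_of_nonneg hs, hμ, ← ht] at h1
    have h2 : expPart (μ + 1) (‖N‖ * s) ^ 2 ≤ c * Real.exp (e * s) :=
      expPart_sq_le (by omega) (norm_nonneg _) he0 hs
    have h3 : ‖coefH U p‖ ≤ ‖U‖ ^ p := by
      rw [coefH_of_pos hp, ← norm_neg U]; exact norm_pow_le_pow _ _
    calc _ ≤ t * (c * Real.exp (e * s)) * Real.exp ((1 - ε - e) * s) * ‖U‖ ^ p := by
          refine h1.trans ?_
          gcongr
      _ = t * c * ‖U‖ ^ p * (Real.exp (e * s) * Real.exp ((1 - ε - e) * s)) := by ring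
      _ = _ := by
        rw [← Real.exp_add]; congr 2; ring
  · intro τ hτ X hX
    have h1 := h.norm_powAd_le hA hν hδ (-τ) hX
    rw [abs_neg, abs_of_nonneg hτ, hμ, ← ht] at h1
    push_cast at h1
    have h2 : expPart (μ + 1) (‖N‖ * τ) ^ 2 ≤ C * Real.exp ((ε - ρ) * τ) := by
      -- Without a nilpotent part there is no polynomial factor, and ρ keeps the whole margin ε;
      -- otherwise half of it is spent.
      rcases Nat.eq_zero_or_pos μ with h0 | h0
      · have : ρ = ε := by rw [hρ, if_pos h0]
        rw [this, hC, h0]; simp [expPart]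
      · have h3 : ρ = ε / 2 := by rw [hρ, if_neg (by omega)]
        have h4 := expPart_sq_le (ν := μ + 1) (by omega) (norm_nonneg N) (half_pos hε) hτ
        have h5 : 2 * ‖N‖ / (ε / 2) = 4 * ‖N‖ / ε := by field_simp; ring
        rw [h5] at h4
        rw [h3, show ε - ε / 2 = ε / 2 by ring]
        exact h4
    calc _ ≤ t * (C * Real.exp ((ε - ρ) * τ)) * Real.exp ((1 - ε) * τ) * ‖X‖ := by
          have h4 : Real.exp ((1 - ε - e) * τ) ≤ Real.exp ((1 - ε) * τ) :=
            Real.exp_le_exp.2 (mul_le_mul_of_nonneg_right (by linarith) hτ)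
          refine h1.trans ?_
          gcongr
      _ = t * C * (Real.exp ((ε - ρ) * τ) * Real.exp ((1 - ε) * τ)) * ‖X‖ := by ring
      _ = _ := by
        rw [← Real.exp_add]; congr 3; ring
  · rw [radiusBound, hμ]
    refine le_trans ?_ (le_max_left _ _)
    rw [Nat.add_sub_cancel, ← hαT]
    have hα0 : 0 ≤ αT := by positivity
    have h0 : 0 ≤ 1 / (R * B) := by positivity
    have : ‖U‖ * (1 + 2 * (αT + αT / (R * B) + 1 / 2))
        = 2 * ‖U‖ * (1 + αT + αT * (1 / (R * B))) := by ring
    rw [this, mul_assoc (2 * ‖U‖)]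
    refine mul_le_mul_of_nonneg_left ?_ (mul_nonneg zero_le_two (norm_nonneg U))
    generalize 1 / (R * B) = y at h0 ⊢
    linarith

end IsSpectralData
end Isomonodromy
end

/-! ### Schur multipliers and diagonal matrices -/

noncomputable section
namespace Isomonodromy
open Filter Topology
open Finset.HasAntidiagonal (antidiagonal mem_antidiagonal)

variable {n k : ℕ}

/-- Entrywise multiplication by the matrix `c`. -/
def schurL (c : Fin n → Fin n → ℂ) : Mat n →L[ℂ] Mat n :=
  LinearMap.toContinuousLinearMap
    { toFun := fun X => Matrix.of fun i j => c i j * X i j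
      map_add' := fun X Y => by ext i j; simp [mul_add]
      map_smul' := fun a X => by ext i j; simp; ring }

theorem schurL_apply (c : Fin n → Fin n → ℂ) (X : Mat n) (i j : Fin n) :
    schurL c X i j = c i j * X i j := rfl

theorem ad_diagonal_apply (a : Fin n → ℂ) (X : Mat n) (i j : Fin n) :
    ad (Matrix.diagonal a) X i j = (a i - a j) * X i j := by
  simp [ad, Matrix.diagonal_mul, Matrix.mul_diagonal]; ring

theorem coefH_diagonal (a : Fin n → ℂ) (p : ℕ) :
    coefH (Matrix.diagonal a) p = Matrix.diagonal fun i => if p = 0 then 0 else (-a i) ^ p := by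
  by_cases hp : p = 0
  · subst hp; ext i j; simp [coefH, Matrix.diagonal_apply]
  · rw [coefH, if_neg hp, Matrix.diagonal_neg, Matrix.diagonal_pow]
    simp only [if_neg hp]; rfl

theorem projQ_mul_diagonal {a : Fin n → ℂ} (ha : ∀ i : Fin n, k ≤ i.val → a i = 0) :
    projQ n k * Matrix.diagonal a = Matrix.diagonal a := by
  rw [projQ, Matrix.diagonal_mul_diagonal]
  congr 1; ext i
  split_ifs with h
  · simp
  · simp [ha i (by omega)]

theorem diagonal_mul_projQ {a : Fin n → ℂ} (ha : ∀ i : Fin n, k ≤ i.val → a i = 0) :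
    Matrix.diagonal a * projQ n k = Matrix.diagonal a := by
  rw [projQ, Matrix.diagonal_mul_diagonal]
  congr 1; ext i
  split_ifs with h
  · simp
  · simp [ha i (by omega)]

theorem Multiplier.of_schur {c : Fin n → Fin n → ℂ} {a a' : Fin n → ℂ}
    (hc : ∀ i j : Fin n, ¬((i.val < k ∧ j.val < k) ∨ i = j) → c i j = 0)
    (h : ∀ i j : Fin n, i.val < k → j.val < k → (a i - a j) * c i j = a' i - a' j)
    (ha' : ∀ i : Fin n, k ≤ i.val → a' i = 0) :
    Multiplier k (schurL c) (Matrix.diagonal a) (Matrix.diagonal a') where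
  delta X := by
    ext i j
    rw [schurL_apply, schurL_apply, delta_apply]
    split_ifs with hij
    · rfl
    · rw [hc i j hij]; simp
  block X := by
    rw [IsBlock]
    ext i j
    rw [delta_apply, schurL_apply]
    split_ifs with hij
    · rfl
    · rw [hc i j hij]; simp
  ad_eq X hX := by
    ext i j
    rw [ad_diagonal_apply, ad_diagonal_apply, schurL_apply]
    by_cases hij : (i.val < k ∧ j.val < k) ∨ i = j
    · rcases hij with hij | rfl
      · rw [← h i j hij.1 hij.2]; ring
      · simp
    · rw [hX.apply hij]; simp
  map_ad p X := by
    ext i j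
    rw [schurL_apply, coefH_diagonal, ad_diagonal_apply, ad_diagonal_apply, schurL_apply]
    ring
  commute := Matrix.commute_diagonal _ _
  proj_mul := projQ_mul_diagonal ha'
  mul_proj := diagonal_mul_projQ ha'

/-! ### The coordinates u, their gaps, and the generators of the next equation -/

theorem prod_Iic_castSucc {k : ℕ} (v : Fin (k + 1) → ℂ) (l : Fin k) :
    ∏ m ∈ Finset.Iic l.castSucc, v m = ∏ m ∈ Finset.Iic l, Fin.init v m := by
  rw [← Fin.map_castSuccEmb_Iic, Finset.prod_map]; rfl

theorem prod_Iic_last {k : ℕ} (v : Fin (k + 1) → ℂ) :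
    ∏ m ∈ Finset.Iic (Fin.last k), v m = (∏ m, Fin.init v m) * v (Fin.last k) := by
  rw [show Finset.Iic (Fin.last k) = Finset.univ by ext x; simp [Fin.le_last], Fin.prod_univ_castSucc]
  rfl

theorem uCoord_eq_sum {k : ℕ} (z : Fin k → ℂ) (i : ℕ) :
    uCoord z i = ∑ l : Fin k, if l.val ≤ i then ∏ m ∈ Finset.Iic l, z m else 0 := by
  rw [uCoord, Finset.sum_filter]

theorem uCoord_init {k : ℕ} (v : Fin (k + 1) → ℂ) {i : ℕ} (hi : i < k) :
    uCoord v i = uCoord (Fin.init v) i := by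
  rw [uCoord_eq_sum, uCoord_eq_sum, Fin.sum_univ_castSucc, if_neg (by simpa using hi), add_zero]
  simp only [prod_Iic_castSucc, Fin.val_castSucc]

theorem uCoord_last {k : ℕ} (v : Fin (k + 1) → ℂ) :
    uCoord v k = uCoord (Fin.init v) (k - 1) + (∏ m, Fin.init v m) * v (Fin.last k) := by
  rw [uCoord_eq_sum, uCoord_eq_sum, Fin.sum_univ_castSucc, if_pos (by simp), prod_Iic_last]
  simp only [prod_Iic_castSucc, Fin.val_castSucc]
  congr 1
  refine Finset.sum_congr rfl fun l _ => ?_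
  have := l.isLt
  rw [if_pos (by omega), if_pos (by omega)]

theorem uCoord_sub_uCoord {k : ℕ} (hk : 2 ≤ k) (z : Fin k → ℂ) :
    uCoord z (k - 1) - uCoord z (k - 2) = ∏ m, z m := by
  obtain ⟨j, rfl⟩ := Nat.exists_eq_add_of_le' (show 1 ≤ k by omega)
  have h1 : j + 1 - 1 = j := rfl
  rw [h1, uCoord_last, uCoord_init z (by omega), show j + 1 - 2 = j - 1 by omega,
    Fin.prod_univ_castSucc]
  simp [Fin.init]

/-- The diagonal entries `(u_{k-1} - u_i) / (z_1 ⋯ z_k)` of `matU`. -/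
def gapCoord {k : ℕ} (z : Fin k → ℂ) (i : ℕ) : ℂ :=
  if i < k then (uCoord z (k - 1) - uCoord z i) / ∏ m, z m else 0

theorem matU_eq {k : ℕ} (z : Fin k → ℂ) :
    matU n z = Matrix.diagonal fun i => gapCoord z i.val := by
  rw [matU]
  congr 1; ext i
  rw [gapCoord]
  split_ifs with h1 h2 h2
  · rw [uCoord_sub_uCoord (by omega)]
  · omega
  · rw [show k - 1 = i.val by omega]; simp
  · rfl

theorem differentiable_uCoord {k : ℕ} (i : ℕ) : Differentiable ℂ fun z : Fin k → ℂ => uCoord z i := by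
  unfold uCoord
  fun_prop

theorem differentiable_uCoord_update {k : ℕ} (z : Fin k → ℂ) (j : Fin k) (i : ℕ) :
    Differentiable ℂ fun t => uCoord (Function.update z j t) i :=
  (differentiable_uCoord i).comp fun t => (hasDerivAt_update z j t).differentiableAt

theorem hasDerivAt_uCoord {k : ℕ} (z : Fin k → ℂ) (j : Fin k) (i : ℕ) :
    HasDerivAt (fun t => uCoord (Function.update z j t) i) (uCoordDeriv z j i) (z j) :=
  (differentiable_uCoord_update z j i _).hasDerivAt

theorem hasDerivAt_prod_update {k : ℕ} {z : Fin k → ℂ} {j : Fin k} (hz : z j ≠ 0) :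
    HasDerivAt (fun t => ∏ m, Function.update z j t m) ((∏ m, z m) / z j) (z j) := by
  have h : ∀ t, ∏ m, Function.update z j t m = t * ((∏ m, z m) / z j) := fun t => by
    rw [Finset.prod_update_of_mem (Finset.mem_univ _),
      ← Finset.mul_prod_erase Finset.univ z (Finset.mem_univ j), Finset.sdiff_singleton_eq_erase]
    field_simp
  simp only [h]
  simpa using (hasDerivAt_id (z j)).mul_const ((∏ m, z m) / z j)

/-- `∂_j` of `gapCoord`. -/
def gapDeriv {k : ℕ} (z : Fin k → ℂ) (j : Fin k) (i : ℕ) : ℂ :=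
  if i < k then
    (uCoordDeriv z j (k - 1) - uCoordDeriv z j i) / (∏ m, z m) - gapCoord z i / z j
  else 0

theorem Admissible.prod_ne_zero {k : ℕ} {z : Fin k → ℂ} (h : Admissible z) : ∏ m, z m ≠ 0 :=
  Finset.prod_ne_zero_iff.2 fun j _ => h.1 j

theorem Admissible.hasDerivAt_gapCoord {k : ℕ} {z : Fin k → ℂ} (h : Admissible z) (j : Fin k)
    (i : ℕ) :
    HasDerivAt (fun t => gapCoord (Function.update z j t) i) (gapDeriv z j i) (z j) := by
  simp only [gapCoord, gapDeriv]
  split_ifs with hi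
  · have hP := h.prod_ne_zero
    have h1 := ((hasDerivAt_uCoord z j (k - 1)).sub (hasDerivAt_uCoord z j i)).div
      (hasDerivAt_prod_update (h.1 j)) (by simpa using hP)
    refine h1.congr_deriv ?_
    have := h.1 j
    simp only [Function.update_eq_self, Pi.sub_apply]
    field_simp
  · exact hasDerivAt_const _ _

theorem hasDerivAt_diagonal {f : ℂ → Fin n → ℂ} {f' : Fin n → ℂ} {x : ℂ}
    (h : ∀ i, HasDerivAt (fun t => f t i) (f' i) x) :
    HasDerivAt (fun t => (Matrix.diagonal (f t) : Mat n)) (Matrix.diagonal f') x := by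
  have h1 : HasDerivAt f f' x := hasDerivAt_pi.2 h
  exact (LinearMap.toContinuousLinearMap
    (Matrix.diagonalLinearMap (Fin n) ℂ ℂ)).hasFDerivAt.comp_hasDerivAt x h1

theorem Admissible.hasDerivAt_matU {k : ℕ} {z : Fin k → ℂ} (h : Admissible z) (j : Fin k) :
    HasDerivAt (fun t => matU n (Function.update z j t))
      (Matrix.diagonal fun i => gapDeriv z j i.val) (z j) := by
  simp only [matU_eq]
  exact hasDerivAt_diagonal fun i => h.hasDerivAt_gapCoord j i.val

theorem Admissible.differentiableAt_matU {k : ℕ} {z : Fin k → ℂ} (h : Admissible z) :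
    DifferentiableAt ℂ (matU n) z := by
  have h1 : DifferentiableAt ℂ (fun z : Fin k → ℂ => fun i : Fin n => gapCoord z i.val) z := by
    rw [differentiableAt_pi]
    intro i
    unfold gapCoord
    split_ifs
    · have h2 : DifferentiableAt ℂ (fun z : Fin k → ℂ => ∏ m, z m) z := by fun_prop
      simp only [div_eq_mul_inv]
      exact ((differentiable_uCoord _ z).fun_sub (differentiable_uCoord _ z)).fun_mul
        (h2.fun_inv h.prod_ne_zero)
    · exact differentiableAt_const _
  have := (LinearMap.toContinuousLinearMap
    (Matrix.diagonalLinearMap (Fin n) ℂ ℂ)).differentiableAt.comp z h1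
  refine this.congr_of_eventuallyEq (Eventually.of_forall fun z => ?_)
  rw [matU_eq]; rfl

theorem projQ_mul_matU {k : ℕ} (z : Fin k → ℂ) : projQ n k * matU n z = matU n z := by
  rw [matU_eq]
  exact projQ_mul_diagonal fun i hi => by simp [gapCoord, hi]

theorem matU_mul_projQ {k : ℕ} (z : Fin k → ℂ) : matU n z * projQ n k = matU n z := by
  rw [matU_eq]
  exact diagonal_mul_projQ fun i hi => by simp [gapCoord, hi]

/-- The coefficients of the Schur multiplier `opT`. -/
def coefT (n : ℕ) {k : ℕ} (z : Fin k → ℂ) (j : Fin k) (i l : Fin n) : ℂ :=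
  if i = l then -(z j)⁻¹
  else if i.val < k ∧ l.val < k then
    (uCoordDeriv z j i.val - uCoordDeriv z j l.val) / (uCoord z i.val - uCoord z l.val) - (z j)⁻¹
  else 0

theorem opT_eq {k : ℕ} (z : Fin k → ℂ) (j : Fin k) (X : Mat n) :
    opT z j X = schurL (coefT n z j) X := by
  ext i l
  rw [opT, schurL_apply, coefT]
  simp only [adInv, Matrix.sub_apply, Matrix.of_apply, ad_diagonal_apply, Matrix.smul_apply,
    delta_apply, smul_eq_mul]
  by_cases h1 : i = l
  · simp [h1]
  · by_cases h2 : i.val < k ∧ l.val < k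
    · simp [h1, h2]; ring
    · simp [h1, h2]

/-- The Schur coefficient (∂u_i - ∂u_l)/(u_i - u_l) - 1/z_j is the logarithmic derivative in z_j of
a difference of diagonal entries of U, since these are u-differences divided by the product of all
z. Hence the relation [U, TX] = [U', X] on block matrices. -/
theorem Admissible.multiplier {k : ℕ} {z : Fin k → ℂ} (h : Admissible z) (j : Fin k) :
    Multiplier k (schurL (coefT n z j)) (matU n z)
      (Matrix.diagonal fun i => gapDeriv z j i.val) := by
  rw [matU_eq]
  refine Multiplier.of_schur ?_ ?_ ?_
  · intro i l hil
    push Not at hil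
    rw [coefT, if_neg hil.2, if_neg (fun h => by have := hil.1 h.1; omega)]
  · intro i l hi hl
    rw [coefT]
    by_cases hil : i = l
    · subst hil; simp
    · have h1 := h.2 i.val l.val hi hl (fun h => hil (Fin.ext h))
      have h2 := h.prod_ne_zero
      have h3 := h.1 j
      have h4 : uCoord z i.val - uCoord z l.val ≠ 0 := sub_ne_zero.2 h1
      rw [if_neg hil, if_pos ⟨hi, hl⟩]
      simp only [gapDeriv, gapCoord, if_pos hi, if_pos hl]
      field_simp
      ring
  · intro i hi
    simp [gapDeriv, hi]

theorem uCoordDeriv_castSucc {k : ℕ} (v : Fin (k + 1) → ℂ) (j : Fin k) {i : ℕ} (hi : i < k) :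
    uCoordDeriv v j.castSucc i = uCoordDeriv (Fin.init v) j i := by
  simp only [uCoordDeriv]
  congr 1
  ext t
  rw [uCoord_init _ hi, Fin.init_update_castSucc]

theorem uCoordDeriv_castSucc_last {k : ℕ} (v : Fin (k + 1) → ℂ) (j : Fin k)
    (hj : Fin.init v j ≠ 0) :
    uCoordDeriv v j.castSucc k = uCoordDeriv (Fin.init v) j (k - 1)
      + (∏ m, Fin.init v m) / Fin.init v j * v (Fin.last k) := by
  have h1 := (hasDerivAt_uCoord (Fin.init v) j (k - 1)).add
    ((hasDerivAt_prod_update hj).mul_const (v (Fin.last k)))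
  refine HasDerivAt.deriv (h1.congr_of_eventuallyEq (Eventually.of_forall fun t => ?_))
  simp only
  rw [uCoord_last, Fin.init_update_castSucc, Function.update_of_ne (Fin.castSucc_ne_last j).symm]
  rfl

theorem uCoordDeriv_last {k : ℕ} (v : Fin (k + 1) → ℂ) {i : ℕ} (hi : i < k) :
    uCoordDeriv v (Fin.last k) i = 0 := by
  have : (fun t => uCoord (Function.update v (Fin.last k) t) i)
      = fun _ => uCoord (Fin.init v) i := by
    ext t; rw [uCoord_init _ hi, Fin.init_update_last]
  rw [uCoordDeriv, this, deriv_const]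

theorem uCoordDeriv_last_last {k : ℕ} (v : Fin (k + 1) → ℂ) :
    uCoordDeriv v (Fin.last k) k = ∏ m, Fin.init v m := by
  have h1 := ((hasDerivAt_id (v (Fin.last k))).const_mul (∏ m, Fin.init v m)).const_add
    (uCoord (Fin.init v) (k - 1))
  rw [mul_one] at h1
  refine HasDerivAt.deriv (h1.congr_of_eventuallyEq (Eventually.of_forall fun t => ?_))
  simp only
  rw [uCoord_last, Fin.init_update_last, Function.update_self]
  rfl

/-- The source of U: the new variable enters the new denominators only through z_{k+1} + a_i. -/
theorem uCoord_last_sub {k : ℕ} (v : Fin (k + 1) → ℂ) (hz : Admissible (Fin.init v)) {i : ℕ}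
    (hi : i < k) :
    uCoord v k - uCoord v i
      = (∏ m, Fin.init v m) * (v (Fin.last k) + gapCoord (Fin.init v) i) := by
  have := hz.prod_ne_zero
  rw [uCoord_last, uCoord_init v hi, gapCoord, if_pos hi]
  field_simp
  ring

theorem Admissible.of_init {k : ℕ} {v : Fin (k + 1) → ℂ} (hz : Admissible (Fin.init v))
    (hv : v (Fin.last k) ≠ 0)
    (h : ∀ i < k, v (Fin.last k) + gapCoord (Fin.init v) i ≠ 0) : Admissible v := by
  refine ⟨fun j => Fin.lastCases hv (fun j => hz.1 j) j, ?_⟩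
  have h1 : ∀ i < k, uCoord v k ≠ uCoord v i := fun i hi => by
    rw [← sub_ne_zero, uCoord_last_sub v hz hi]
    exact mul_ne_zero hz.prod_ne_zero (h i hi)
  intro i l hi hl hil
  rcases Nat.lt_succ_iff_lt_or_eq.1 hi with hi | rfl
  · rcases Nat.lt_succ_iff_lt_or_eq.1 hl with hl | rfl
    · rw [uCoord_init v hi, uCoord_init v hl]; exact hz.2 i l hi hl hil
    · exact (h1 i hi).symm
  · exact h1 l (by omega)

/-- The diagonal matrix with entries `b_i / (t + a_i)`. -/
def fracDiag (n : ℕ) (t : ℂ) (a b : ℕ → ℂ) : Mat n := Matrix.diagonal fun i => b i.val / (t + a i.val)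

/-- Inside the old block and on the diagonal nothing changes. In the new row and column the
coefficient is the logarithmic derivative in z_j of z_{k+1} + a_i. -/
theorem opT_castSucc {k : ℕ} {v : Fin (k + 1) → ℂ} (hz : Admissible (Fin.init v))
    (h : ∀ i < k, v (Fin.last k) + gapCoord (Fin.init v) i ≠ 0) (j : Fin k) (X : Mat n) :
    opT v j.castSucc X = schurL (coefT n (Fin.init v) j) X
      + (fracDiag n (v (Fin.last k)) (gapCoord (Fin.init v)) (gapDeriv (Fin.init v) j)
          * X * unitE n k
        + unitE n k * X
          * fracDiag n (v (Fin.last k)) (gapCoord (Fin.init v)) (gapDeriv (Fin.init v) j)) := by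
  rw [opT_eq]
  ext i l
  have hj : (v j.castSucc)⁻¹ = (Fin.init v j)⁻¹ := rfl
  have key : ∀ i < k, (uCoordDeriv v j.castSucc k - uCoordDeriv v j.castSucc i)
      / (uCoord v k - uCoord v i) - (v j.castSucc)⁻¹
      = gapDeriv (Fin.init v) j i / (v (Fin.last k) + gapCoord (Fin.init v) i) := by
    intro i hi
    have h1 := hz.prod_ne_zero
    have h2 := hz.1 j
    have h3 := h i hi
    rw [uCoord_last_sub v hz hi, uCoordDeriv_castSucc v j hi, uCoordDeriv_castSucc_last v j h2, hj,
      gapDeriv, if_pos hi]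
    field_simp
    ring
  have hg : ∀ i, k ≤ i → gapDeriv (Fin.init v) j i = 0 := fun i hi => by
    simp [gapDeriv, hi]
  simp only [schurL_apply, Matrix.add_apply, fracDiag, Matrix.mul_diagonal, unitE,
    Matrix.diagonal_mul, coefT]
  by_cases hil : i = l
  · subst hil
    rw [if_pos rfl, if_pos rfl, hj]
    by_cases hi : i.val = k
    · rw [hg i.val hi.ge]; simp
    · simp [hi]
  · rw [if_neg hil, if_neg hil]
    rcases lt_trichotomy i.val k with hi | hi | hi
    · rcases lt_trichotomy l.val k with hl | hl | hl
      · rw [if_pos ⟨by omega, by omega⟩, if_pos ⟨hi, hl⟩, uCoordDeriv_castSucc v j hi,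
          uCoordDeriv_castSucc v j hl, uCoord_init v hi, uCoord_init v hl, hj]
        simp [hi.ne, hl.ne]
      · rw [if_pos ⟨by omega, by omega⟩, if_neg (by omega), hl, ← key i.val hi,
          ← neg_sub (uCoordDeriv v j.castSucc k), ← neg_sub (uCoord v k), neg_div_neg_eq]
        simp [hi.ne]
      · rw [if_neg (by omega), if_neg (by omega)]
        simp [hi.ne, hl.ne']
    · rcases lt_trichotomy l.val k with hl | hl | hl
      · rw [if_pos ⟨by omega, by omega⟩, if_neg (by omega), hi, ← key l.val hl]
        simp [hl.ne]; ring
      · exact absurd (Fin.ext (hi.trans hl.symm)) hil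
      · rw [if_neg (by omega), if_neg (by omega)]
        simp [hi, hl.ne', hg l.val hl.le]
    · rw [if_neg (by omega), if_neg (by omega)]
      rcases eq_or_ne l.val k with hl | hl
      · simp [hg i.val hi.le, hi.ne']
      · simp [hi.ne', hl]

/-- The old u_i do not depend on t = z_{k+1}, so the block and the diagonal only carry -1/t. In the
new row and column the coefficient is 1/(t + a_i) - 1/t. -/
theorem opT_last {k : ℕ} {v : Fin (k + 1) → ℂ} (hz : Admissible (Fin.init v))
    (hv : v (Fin.last k) ≠ 0)
    (h : ∀ i < k, v (Fin.last k) + gapCoord (Fin.init v) i ≠ 0) (X : Mat n) :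
    opT v (Fin.last k) X = (v (Fin.last k))⁻¹ • (-delta k X
      + (fracDiag n (v (Fin.last k)) (gapCoord (Fin.init v)) (fun i => -gapCoord (Fin.init v) i)
          * X * unitE n k
        + unitE n k * X
          * fracDiag n (v (Fin.last k)) (gapCoord (Fin.init v))
            (fun i => -gapCoord (Fin.init v) i))) := by
  rw [opT_eq]
  ext i l
  have key : ∀ i < k, (uCoordDeriv v (Fin.last k) k - uCoordDeriv v (Fin.last k) i)
      / (uCoord v k - uCoord v i) - (v (Fin.last k))⁻¹
      = (v (Fin.last k))⁻¹
        * (-gapCoord (Fin.init v) i / (v (Fin.last k) + gapCoord (Fin.init v) i)) := by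
    intro i hi
    have h1 := hz.prod_ne_zero
    have h3 := h i hi
    rw [uCoord_last_sub v hz hi, uCoordDeriv_last v hi, uCoordDeriv_last_last v]
    field_simp
    ring
  have hg : ∀ i, k ≤ i → gapCoord (Fin.init v) i = 0 := fun i hi => by
    simp [gapCoord, hi]
  simp only [schurL_apply, Matrix.add_apply, Matrix.smul_apply, Matrix.neg_apply, delta_apply,
    smul_eq_mul, fracDiag, Matrix.mul_diagonal, unitE, Matrix.diagonal_mul, coefT]
  by_cases hil : i = l
  · subst hil
    rw [if_pos rfl, if_pos (Or.inr rfl)]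
    by_cases hi : i.val = k
    · rw [hg i.val hi.ge]; simp
    · simp [hi]
  · rw [if_neg hil]
    rcases lt_trichotomy i.val k with hi | hi | hi
    · rcases lt_trichotomy l.val k with hl | hl | hl
      · rw [if_pos ⟨by omega, by omega⟩, if_pos (Or.inl ⟨hi, hl⟩), uCoordDeriv_last v hi,
          uCoordDeriv_last v hl]
        simp [hi.ne, hl.ne]
      · rw [if_pos ⟨by omega, by omega⟩, if_neg (by omega), hl,
          ← neg_sub (uCoordDeriv v (Fin.last k) k), ← neg_sub (uCoord v k), neg_div_neg_eq,
          key i.val hi]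
        simp [hi.ne]; ring
      · rw [if_neg (by omega), if_neg (by omega)]
        simp [hi.ne, hl.ne']
    · rcases lt_trichotomy l.val k with hl | hl | hl
      · rw [if_pos ⟨by omega, by omega⟩, if_neg (by omega), hi, key l.val hl]
        simp [hl.ne]; ring
      · exact absurd (Fin.ext (hi.trans hl.symm)) hil
      · rw [if_neg (by omega), if_neg (by omega)]
        simp [hi, hl.ne', hg l.val hl.le]
    · rw [if_neg (by omega), if_neg (by omega)]
      rcases eq_or_ne l.val k with hl | hl
      · simp [hg i.val hi.le, hi.ne']
      · simp [hi.ne', hl]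

end Isomonodromy
end

/-! ### Conjugacy of nearby values of a solution -/

noncomputable section
namespace Isomonodromy
open Filter Topology Set
open Finset.HasAntidiagonal (antidiagonal mem_antidiagonal)

variable {n k : ℕ}

section ODE

variable {E : Type*} [NormedAddCommGroup E] [NormedSpace ℝ E]

theorem hasDerivWithinAt_Ici_of_Icc {f : ℝ → E} {f' : E} {t : ℝ} (ht : t ∈ Ico (0 : ℝ) 1)
    (h : HasDerivWithinAt f f' (Icc 0 1) t) : HasDerivWithinAt f f' (Ici t) t :=
  h.mono_of_mem_nhdsWithin (Icc_mem_nhdsGE_of_mem ht)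

theorem norm_le_of_linear_ode {f f' : ℝ → E} {δ c : ℝ}
    (h : ∀ t ∈ Icc (0 : ℝ) 1, HasDerivWithinAt f (f' t) (Icc 0 1) t) (h0 : ‖f 0‖ ≤ δ)
    (hc : ∀ t ∈ Icc (0 : ℝ) 1, ‖f' t‖ ≤ c * ‖f t‖) :
    ∀ t ∈ Icc (0 : ℝ) 1, ‖f t‖ ≤ δ * Real.exp (c * t) := by
  intro t ht
  have := norm_le_gronwallBound_of_norm_deriv_right_le (ε := 0)
    (fun t ht => (h t ht).continuousWithinAt)
    (fun t ht => hasDerivWithinAt_Ici_of_Icc ht (h t (Ico_subset_Icc_self ht))) h0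
    (fun t ht => by simpa using hc t (Ico_subset_Icc_self ht)) t ht
  simpa [gronwallBound_ε0] using this

end ODE

/-- A linear matrix equation with small coefficients on the unit interval. -/
theorem exists_gauge {τ : ℝ → Mat n} (hτ : ContinuousOn τ (Icc 0 1)) {c : ℝ} (hc0 : 0 ≤ c)
    (hc : ∀ t ∈ Icc (0 : ℝ) 1, ‖τ t‖ ≤ c) (hc1 : c ≤ 1 / 2) :
    ∃ G : ℝ → Mat n, G 0 = 1 ∧
      (∀ t ∈ Icc (0 : ℝ) 1, HasDerivWithinAt G (τ t * G t) (Icc 0 1) t) ∧ ‖G 1 - 1‖ ≤ 2 * c := by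
  have hP : IsPicardLindelof (fun t X => τ t * X) (⟨0, by simp⟩ : Icc (0 : ℝ) 1) (1 : Mat n) 1 0
      1 ⟨c, hc0⟩ := by
    refine ⟨fun t ht => ?_, fun x _ => hτ.mul continuousOn_const, fun t ht x hx => ?_, by simp⟩
    · refine LipschitzWith.lipschitzOnWith (LipschitzWith.of_dist_le_mul fun x y => ?_)
      rw [dist_eq_norm, dist_eq_norm, ← mul_sub]
      exact (norm_mul_le _ _).trans (mul_le_mul_of_nonneg_right (hc t ht) (norm_nonneg _))
    · have h1 : ‖x‖ ≤ 2 := by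
        have h2 : ‖x - 1‖ ≤ 1 := by simpa [dist_eq_norm] using hx
        have h3 : ‖(1 : Mat n)‖ ≤ 1 := norm_one_le
        calc ‖x‖ = ‖(x - 1) + 1‖ := by rw [sub_add_cancel]
          _ ≤ _ := norm_add_le _ _
          _ ≤ 2 := by linarith
      calc _ ≤ ‖τ t‖ * ‖x‖ := norm_mul_le _ _
        _ ≤ (1 / 2) * 2 := by gcongr; exact (hc t ht).trans hc1
        _ = _ := by norm_num
  obtain ⟨G, h0, hG⟩ := hP.exists_eq_forall_mem_Icc_hasDerivWithinAt₀
  have hb := norm_le_of_linear_ode (δ := 1) (c := c) hG (by rw [h0]; exact norm_one_le)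
    fun t ht => (norm_mul_le _ _).trans (mul_le_mul_of_nonneg_right (hc t ht) (norm_nonneg _))
  refine ⟨G, h0, hG, ?_⟩
  have h2 : ∀ t ∈ Icc (0 : ℝ) 1, ‖τ t * G t‖ ≤ 2 * c := fun t ht => by
    have h3 : Real.exp (c * t) ≤ 2 := by
      have h4 : Real.exp (c * t) ≤ Real.exp (Real.log 2) := by
        apply Real.exp_le_exp.2
        have := Real.log_two_gt_d9
        nlinarith [ht.1, ht.2]
      rwa [Real.exp_log two_pos] at h4
    calc _ ≤ ‖τ t‖ * ‖G t‖ := norm_mul_le _ _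
      _ ≤ c * 2 := by
          gcongr
          · exact hc t ht
          · have := hb t ht; linarith
      _ = _ := by ring
  have := (convex_Icc (0 : ℝ) 1).norm_image_sub_le_of_norm_hasDerivWithin_le hG h2
    (left_mem_Icc.2 zero_le_one) (right_mem_Icc.2 zero_le_one)
  simpa [h0] using this

/-- The derivative of `Φ` in the direction `v` is `[genT Φ z v, Φ]`. -/
def genT (Φ : (Fin k → ℂ) → Mat n) (z v : Fin k → ℂ) : Mat n := ∑ j, v j • opT z j (Φ z)

theorem isBlock_opT {z : Fin k → ℂ} (hz : Admissible z) (j : Fin k) (X : Mat n) :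
    IsBlock k (opT z j X) := by
  rw [opT_eq]; exact (hz.multiplier j).block X

theorem IsBlock.sum {ι : Type*} {s : Finset ι} {f : ι → Mat n} (h : ∀ i ∈ s, IsBlock k (f i)) :
    IsBlock k (∑ i ∈ s, f i) := by
  rw [IsBlock, delta_sum]; exact Finset.sum_congr rfl h

theorem isBlock_genT {Φ : (Fin k → ℂ) → Mat n} {z : Fin k → ℂ} (hz : Admissible z)
    (v : Fin k → ℂ) : IsBlock k (genT Φ z v) :=
  IsBlock.sum fun j _ => (isBlock_opT hz j _).smul _

theorem uCoordDeriv_eq (z : Fin k → ℂ) (j : Fin k) (i : ℕ) :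
    uCoordDeriv z j i = fderiv ℂ (fun z : Fin k → ℂ => uCoord z i) z (Pi.single j 1) := by
  have h := ((differentiable_uCoord i) (Function.update z j (z j))).hasFDerivAt.comp_hasDerivAt
    (z j) (hasDerivAt_update z j (z j))
  rw [Function.update_eq_self] at h
  exact h.deriv

theorem continuous_uCoordDeriv (j : Fin k) (i : ℕ) :
    Continuous fun z : Fin k → ℂ => uCoordDeriv z j i := by
  simp only [uCoordDeriv_eq]
  have h : ContDiff ℂ 1 fun z : Fin k → ℂ => uCoord z i := by
    unfold uCoord
    refine ContDiff.sum fun l _ => contDiff_prod fun m _ => ?_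
    fun_prop
  exact (h.continuous_fderiv one_ne_zero).clm_apply continuous_const

theorem Admissible.continuousAt_coefT {z : Fin k → ℂ} (hz : Admissible z) (j : Fin k)
    (i l : Fin n) : ContinuousAt (fun z => coefT n z j i l) z := by
  have h1 : ContinuousAt (fun z : Fin k → ℂ => (z j)⁻¹) z :=
    (continuous_apply j).continuousAt.inv₀ (hz.1 j)
  unfold coefT
  split_ifs with h2 h3
  · exact h1.neg
  · refine ContinuousAt.sub (ContinuousAt.div₀ ?_ ?_ ?_) h1
    · exact ((continuous_uCoordDeriv j _).sub (continuous_uCoordDeriv j _)).continuousAt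
    · exact ((differentiable_uCoord _).continuous.sub (differentiable_uCoord _).continuous).continuousAt
    · exact sub_ne_zero.2 (hz.2 _ _ h3.1 h3.2 fun h => h2 (Fin.ext h))
  · exact continuousAt_const

namespace IsSolution

variable {W : Set (Fin k → ℂ)} {Φ : (Fin k → ℂ) → Mat n}

theorem differentiableAt (h : IsSolution n k W Φ) {z : Fin k → ℂ} (hz : z ∈ W) :
    DifferentiableAt ℂ Φ z := (h.holomorphic z hz).differentiableAt (h.isOpen.mem_nhds hz)

theorem continuousAt_opT (h : IsSolution n k W Φ) {z : Fin k → ℂ} (hz : z ∈ W) (j : Fin k) :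
    ContinuousAt (fun z => opT z j (Φ z)) z := by
  simp only [opT_eq]
  refine continuousAt_pi.2 fun i => continuousAt_pi.2 fun l => ?_
  have h1 : ContinuousAt (fun z => Φ z i l) z :=
    continuousAt_pi.1 (continuousAt_pi.1 (h.differentiableAt hz).continuousAt i) l
  exact ((h.admissible z hz).continuousAt_coefT j i l).mul h1

theorem fderiv_apply (h : IsSolution n k W Φ) {z : Fin k → ℂ} (hz : z ∈ W) (v : Fin k → ℂ) :
    fderiv ℂ Φ z v = ad (genT Φ z v) (Φ z) := by
  have h1 : ∀ j, fderiv ℂ Φ z (Pi.single j 1) = ad (opT z j (Φ z)) (Φ z) := fun j => by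
    have h2 : HasFDerivAt Φ (fderiv ℂ Φ z) (Function.update z j (z j)) := by
      rw [Function.update_eq_self]; exact (h.differentiableAt hz).hasFDerivAt
    exact (h2.comp_hasDerivAt (z j) (hasDerivAt_update z j (z j))).unique (h.equation z hz j)
  have h3 : v = ∑ j, v j • (Pi.single j 1 : Fin k → ℂ) := by
    ext i; simp [Finset.sum_apply, Pi.single_apply]
  conv_lhs => rw [h3]
  rw [map_sum]
  simp only [map_smul, h1, genT, ad, Finset.sum_mul, Finset.mul_sum,
    ← Finset.sum_sub_distrib, smul_sub, smul_mul_assoc, mul_smul_comm]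

theorem hasDerivAt_line (h : IsSolution n k W Φ) {z₀ v : Fin k → ℂ} {t : ℝ}
    (hz : z₀ + (t : ℂ) • v ∈ W) :
    HasDerivAt (fun t : ℝ => Φ (z₀ + (t : ℂ) • v))
      (ad (genT Φ (z₀ + (t : ℂ) • v) v) (Φ (z₀ + (t : ℂ) • v))) t := by
  rw [← h.fderiv_apply hz]
  have h1 : HasDerivAt (fun t : ℝ => z₀ + (t : ℂ) • v) v t := by
    simpa using ((Complex.ofRealCLM.hasDerivAt (x := t)).smul_const v).const_add z₀
  exact ((h.differentiableAt hz).hasFDerivAt.restrictScalars ℝ).comp_hasDerivAt t h1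

/-- Nearby values of a solution are conjugate by a block matrix close to the identity. -/
theorem exists_similarity (h : IsSolution n k W Φ) {z₀ : Fin k → ℂ} (hz₀ : z₀ ∈ W) :
    ∃ G : (Fin k → ℂ) → Mat n, Tendsto G (𝓝 z₀) (𝓝 1) ∧
      ∀ᶠ z in 𝓝 z₀, IsBlock k (G z) ∧ Φ z * G z = G z * Φ z₀ := by
  have h1 : ∀ j, ∀ᶠ z in 𝓝 z₀, ‖opT z j (Φ z)‖ ≤ ‖opT z₀ j (Φ z₀)‖ + 1 := fun j =>
    ((h.continuousAt_opT hz₀ j).norm.eventually_lt_const (lt_add_one _)).mono fun _ => le_of_lt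
  obtain ⟨r, hr, hb⟩ := Metric.eventually_nhds_iff_ball.1
    ((eventually_all.2 h1).and (h.isOpen.mem_nhds hz₀))
  set K := ∑ j, (‖opT z₀ j (Φ z₀)‖ + 1) with hK
  have hK0 : 0 ≤ K := Finset.sum_nonneg fun j _ => by positivity
  have hτ : ∀ z ∈ Metric.ball z₀ r, ∀ v, ‖genT Φ z v‖ ≤ K * ‖v‖ := fun z hz v => by
    rw [genT, hK, Finset.sum_mul]
    refine (norm_sum_le _ _).trans (Finset.sum_le_sum fun j _ => ?_)
    rw [norm_smul, mul_comm]
    gcongr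
    · exact (hb z hz).1 j
    · exact norm_le_pi_norm v j
  have key : ∀ z, z ∈ Metric.ball z₀ r → K * ‖z - z₀‖ ≤ 1 / 2 → ∃ G : Mat n,
      ‖G - 1‖ ≤ 2 * (K * ‖z - z₀‖) ∧ IsBlock k G ∧ Φ z * G = G * Φ z₀ := by
    intro z hz hzK
    have hγ : ∀ t ∈ Icc (0 : ℝ) 1, z₀ + (t : ℂ) • (z - z₀) ∈ Metric.ball z₀ r := fun t ht => by
      rw [Metric.mem_ball, dist_eq_norm] at hz ⊢
      rw [add_sub_cancel_left, norm_smul, Complex.norm_real, Real.norm_of_nonneg ht.1]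
      exact (mul_le_of_le_one_left (norm_nonneg _) ht.2).trans_lt hz
    have hγW : ∀ t ∈ Icc (0 : ℝ) 1, z₀ + (t : ℂ) • (z - z₀) ∈ W := fun t ht => (hb _ (hγ t ht)).2
    set τ : ℝ → Mat n := fun t => genT Φ (z₀ + (t : ℂ) • (z - z₀)) (z - z₀) with hτd
    have hτc : ContinuousOn τ (Icc 0 1) := by
      refine continuousOn_finsetSum _ fun j _ => ContinuousOn.fun_const_smul ?_ _
      intro t ht
      have h2 : ContinuousAt (fun t : ℝ => z₀ + (t : ℂ) • (z - z₀)) t := by fun_prop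
      exact (ContinuousAt.comp (f := fun t : ℝ => z₀ + (t : ℂ) • (z - z₀))
        (h.continuousAt_opT (hγW t ht) j) h2).continuousWithinAt
    have hτb : ∀ t ∈ Icc (0 : ℝ) 1, ‖τ t‖ ≤ K * ‖z - z₀‖ := fun t ht => hτ _ (hγ t ht) _
    have hτB : ∀ t ∈ Icc (0 : ℝ) 1, IsBlock k (τ t) := fun t ht =>
      isBlock_genT (h.admissible _ (hγW t ht)) _
    obtain ⟨G, hG0, hG, hG1⟩ := exists_gauge hτc (by positivity) hτb hzK
    have hle : ∀ t ∈ Icc (0 : ℝ) 1, ∀ X : Mat n, ‖τ t * X‖ ≤ K * ‖z - z₀‖ * ‖X‖ := fun t ht X =>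
      (norm_mul_le _ _).trans (mul_le_mul_of_nonneg_right (hτb t ht) (norm_nonneg _))
    have one_mem : (1 : ℝ) ∈ Icc (0 : ℝ) 1 := right_mem_Icc.2 zero_le_one
    refine ⟨G 1, hG1, ?_, ?_⟩
    -- Both remaining claims follow from uniqueness: δ_kG - G here, and ΦG - GΦ(z₀) below, solve f'
    -- = τf with f(0) = 0.
    · have hd : ∀ t ∈ Icc (0 : ℝ) 1, HasDerivWithinAt (fun t => deltaL n k (G t) - G t)
          (τ t * (deltaL n k (G t) - G t)) (Icc 0 1) t := fun t ht => by
        have h2 := (((deltaL n k).restrictScalars ℝ).hasFDerivAt.comp_hasDerivWithinAt t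
          (hG t ht)).sub (hG t ht)
        refine h2.congr_deriv ?_
        simp only [ContinuousLinearMap.coe_restrictScalars', deltaL_apply, mul_sub,
          (hτB t ht).delta_mul]
      have h3 := norm_le_of_linear_ode (δ := 0) hd
        (by simp only [hG0, deltaL_apply]; rw [isBlock_one]; simp)
        (fun t ht => hle t ht _) 1 one_mem
      rw [zero_mul, norm_le_zero_iff, sub_eq_zero] at h3
      exact h3
    · have hd : ∀ t ∈ Icc (0 : ℝ) 1, HasDerivWithinAt
          (fun t : ℝ => Φ (z₀ + (t : ℂ) • (z - z₀)) * G t - G t * Φ z₀)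
          (τ t * (Φ (z₀ + (t : ℂ) • (z - z₀)) * G t - G t * Φ z₀)) (Icc 0 1) t := fun t ht => by
        have h2 := ((h.hasDerivAt_line (hγW t ht)).hasDerivWithinAt.mul (hG t ht)).sub
          ((hG t ht).mul_const (Φ z₀))
        refine h2.congr_deriv ?_
        simp only [ad, hτd]
        noncomm_ring
      have h3 := norm_le_of_linear_ode (δ := 0) hd (by simp [hG0])
        (fun t ht => hle t ht _) 1 one_mem
      rw [zero_mul, norm_le_zero_iff, sub_eq_zero] at h3
      simpa using h3
  have hs : ∀ᶠ z in 𝓝 z₀, z ∈ Metric.ball z₀ r ∧ K * ‖z - z₀‖ ≤ 1 / 2 := by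
    refine Filter.Eventually.and (Metric.ball_mem_nhds z₀ hr) ?_
    have h2 : ContinuousAt (fun z => K * ‖z - z₀‖) z₀ := by fun_prop
    exact (h2.eventually_lt_const (by simp : K * ‖z₀ - z₀‖ < 1 / 2)).mono fun _ => le_of_lt
  classical
  -- The matrices are chosen separately for each z along the segment from z₀; only continuity at z₀
  -- is claimed.
  refine ⟨fun z => if hz : z ∈ Metric.ball z₀ r ∧ K * ‖z - z₀‖ ≤ 1 / 2 then
    (key z hz.1 hz.2).choose else 1, ?_, ?_⟩
  · rw [tendsto_iff_norm_sub_tendsto_zero]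
    have h2 : ContinuousAt (fun z => 2 * (K * ‖z - z₀‖)) z₀ := by fun_prop
    refine squeeze_zero (fun _ => norm_nonneg _) (fun z => ?_) (by simpa using h2.tendsto)
    split_ifs with hz
    · exact (key z hz.1 hz.2).choose_spec.1
    · rw [sub_self, norm_zero]; positivity
  · filter_upwards [hs] with z hz
    rw [dif_pos hz]
    exact (key z hz.1 hz.2).choose_spec.2

end IsSolution
end Isomonodromy
end

/-! ### Locally constant spectra and openness of the region of convergence -/

noncomputable section
namespace Isomonodromy
open Filter Topology
open Finset.HasAntidiagonal (antidiagonal mem_antidiagonal)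

variable {n k : ℕ}

theorem eigDiff_delta (A : Mat n) : eigDiff k (delta k A) = eigDiff k A := by
  simp only [eigDiff, upperLeft_delta]

theorem eps0_delta (ε : ℝ) (A : Mat n) : eps0 k ε (delta k A) = eps0 k ε A := by
  simp only [eps0, eigDiff_delta]

/-- `G` and `G'` are mutually inverse block matrices. -/
structure IsBlockInv (k : ℕ) (G G' : Mat n) : Prop where
  block : IsBlock k G
  block' : IsBlock k G'
  mul_eq : G * G' = 1
  mul_eq' : G' * G = 1

namespace IsBlockInv

variable {G G' : Mat n}

theorem conj_mul (h : IsBlockInv k G G') (X Y : Mat n) :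
    G * X * G' * (G * Y * G') = G * (X * Y) * G' := by
  calc _ = G * X * (G' * G) * Y * G' := by noncomm_ring
    _ = _ := by rw [h.mul_eq']; noncomm_ring

theorem conj_pow (h : IsBlockInv k G G') (X : Mat n) (p : ℕ) :
    (G * X * G') ^ p = G * X ^ p * G' := by
  induction p with
  | zero => simp [h.mul_eq]
  | succ p ih => rw [pow_succ, ih, h.conj_mul, pow_succ]

theorem conj_eq_zero (h : IsBlockInv k G G') {X : Mat n} : G * X * G' = 0 ↔ X = 0 := by
  refine ⟨fun h0 => ?_, fun h0 => by simp [h0]⟩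
  calc X = (G' * G) * X * (G' * G) := by rw [h.mul_eq']; simp
    _ = G' * (G * X * G') * G := by noncomm_ring
    _ = 0 := by rw [h0]; simp

theorem delta_conj (h : IsBlockInv k G G') (X : Mat n) :
    delta k (G * X * G') = G * delta k X * G' := by
  rw [h.block'.delta_mul', h.block.delta_mul]

theorem nilpotencyClass_conj (h : IsBlockInv k G G') (N : Mat n) :
    nilpotencyClass (G * N * G') = nilpotencyClass N := by
  simp only [nilpotencyClass, h.conj_pow, h.conj_eq_zero]

theorem eigDiff_conj (h : IsBlockInv k G G') (X : Mat n) :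
    eigDiff k (G * X * G') = eigDiff k X := by
  have h1 : upperLeft k (delta k (G * X * G'))
      = upperLeft k G * upperLeft k (delta k X) * upperLeft k G' := by
    rw [h.delta_conj, (h.block.mul (isBlock_delta k X)).upperLeft_mul, h.block.upperLeft_mul]
  let u : (Matrix {i : Fin n // i.val < k} {i : Fin n // i.val < k} ℂ)ˣ :=
    ⟨upperLeft k G, upperLeft k G', by rw [← h.block.upperLeft_mul, h.mul_eq, upperLeft_one],
      by rw [← h.block'.upperLeft_mul, h.mul_eq', upperLeft_one]⟩
  have h2 : spectrum ℂ (upperLeft k (delta k (G * X * G')))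
      = spectrum ℂ (upperLeft k (delta k X)) := by
    rw [h1]; exact spectrum.units_conjugate (u := u)
  rw [← eigDiff_delta, ← eigDiff_delta X]
  simp only [eigDiff, h2]

theorem mul_single (h : IsBlock k G) {j : Fin n} (hj : k ≤ j.val) :
    G * Matrix.single j j 1 = G j j • Matrix.single j j 1 := by
  ext a b
  rw [Matrix.smul_apply, Matrix.single_apply]
  by_cases hb : j = b
  · subst hb
    by_cases ha : j = a
    · subst ha; simp
    · rw [Matrix.mul_single_apply_same]
      simp [ha, h.apply (i := a) (j := j) (by
        push Not; exact ⟨fun _ => by omega, fun h => ha h.symm⟩)]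
  · rw [Matrix.mul_single_apply_of_ne (hbj := fun h => hb h.symm)]
    simp [hb]

theorem single_mul (h : IsBlock k G) {j : Fin n} (hj : k ≤ j.val) :
    Matrix.single j j 1 * G = G j j • Matrix.single j j 1 := by
  have := mul_single h.transpose hj
  apply Matrix.transpose_injective
  rw [Matrix.transpose_mul, Matrix.transpose_single, Matrix.transpose_smul, Matrix.transpose_single,
    this]
  rfl

theorem conj_single (h : IsBlockInv k G G') {j : Fin n} (hj : k ≤ j.val) :
    G * Matrix.single j j 1 * G' = Matrix.single j j 1 := by
  rw [mul_single h.block hj, ← single_mul h.block hj, mul_assoc, h.mul_eq, mul_one]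

theorem conj_apply (h : IsBlockInv k G G') {j : Fin n} (hj : k ≤ j.val) (X : Mat n) :
    (G * X * G') j j = X j j := by
  have h1 : G' * Matrix.single j j 1 = Matrix.single j j 1 * G' := by
    rw [mul_single h.block' hj, single_mul h.block' hj]
  have h2 : Matrix.single j j (1 : ℂ) * (G * X * G') * Matrix.single j j 1
      = Matrix.single j j 1 * X * Matrix.single j j 1 := by
    calc _ = (Matrix.single j j 1 * G) * X * (G' * Matrix.single j j 1) := by noncomm_ring
      _ = G * (Matrix.single j j 1 * X * Matrix.single j j 1) * G' := by
        rw [h1, single_mul h.block hj, ← mul_single h.block hj]; noncomm_ring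
      _ = X j j • (G * Matrix.single j j 1 * G') := by
        rw [Matrix.single_mul_mul_single, one_mul, mul_one,
          show Matrix.single j j (X j j) = X j j • Matrix.single j j (1 : ℂ) by simp]
        simp only [mul_smul_comm, smul_mul_assoc]
      _ = _ := by rw [h.conj_single hj, Matrix.single_mul_mul_single]; simp
  rw [Matrix.single_mul_mul_single, Matrix.single_mul_mul_single] at h2
  simpa using congrFun (congrFun h2 j) j

theorem isSpectralData (h : IsBlockInv k G G') {A : Mat n} {lam : Fin n → ℂ}
    {P : Fin n → Mat n} {N : Mat n} (hS : IsSpectralData k A lam P N) :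
    IsSpectralData k (G * A * G') lam (fun i => G * P i * G') (G * N * G') := by
  have hsum : ∑ i, lam i • (G * P i * G') = G * (∑ i, lam i • P i) * G' := by
    simp only [Finset.mul_sum, Finset.sum_mul, mul_smul_comm, smul_mul_assoc]
  refine ⟨fun i j => ?_, ?_, ?_, ?_, ?_, fun j hj => ⟨?_, ?_⟩⟩
  · rw [h.conj_mul, hS.orthogonal]; split_ifs <;> simp
  · rw [← Finset.sum_mul, ← Finset.mul_sum, hS.sum_eq_one, mul_one, h.mul_eq]
  · rw [hsum, ← add_mul, ← mul_add, ← hS.decomposition]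
  · obtain ⟨p, hp⟩ := hS.nilpotent
    exact ⟨p, by rw [h.conj_pow, hp]; simp⟩
  · rw [hsum, Commute, SemiconjBy, h.conj_mul, h.conj_mul, hS.commute.eq]
  · rw [(hS.tail j hj).1, h.conj_single hj]
  · rw [h.conj_apply hj, (hS.tail j hj).2]

end IsBlockInv

namespace IsSolution

variable {W : Set (Fin k → ℂ)} {Φ : (Fin k → ℂ) → Mat n}

theorem exists_conj (h : IsSolution n k W Φ) {z₀ : Fin k → ℂ} (hz₀ : z₀ ∈ W) :
    ∃ G G' : (Fin k → ℂ) → Mat n, Tendsto G (𝓝 z₀) (𝓝 1) ∧ Tendsto G' (𝓝 z₀) (𝓝 1) ∧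
      ∀ᶠ z in 𝓝 z₀, IsBlockInv k (G z) (G' z) ∧ Φ z = G z * Φ z₀ * G' z := by
  obtain ⟨G, hG, hz⟩ := h.exists_similarity hz₀
  have hu : ∀ᶠ z in 𝓝 z₀, IsUnit (G z) :=
    hG.eventually (Units.isOpen.mem_nhds isUnit_one)
  have hi : Tendsto (fun z => Ring.inverse (G z)) (𝓝 z₀) (𝓝 1) := by
    have h1 := (NormedRing.inverse_continuousAt (1 : (Mat n)ˣ)).tendsto
    rw [Units.val_one, Ring.inverse_one] at h1
    exact h1.comp hG
  refine ⟨G, fun z => Ring.inverse (G z), hG, hi, ?_⟩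
  filter_upwards [hz, hu] with z ⟨hB, hz⟩ hu
  have h1 := Ring.mul_inverse_cancel _ hu
  have h2 := Ring.inverse_mul_cancel _ hu
  refine ⟨⟨hB, ?_, h1, h2⟩, by rw [← hz, mul_assoc, h1, mul_one]⟩
  rw [IsBlock]
  calc delta k (Ring.inverse (G z))
      = Ring.inverse (G z) * (G z * delta k (Ring.inverse (G z))) := by
        rw [← mul_assoc, h2, one_mul]
    _ = Ring.inverse (G z) * delta k (G z * Ring.inverse (G z)) := by rw [hB.delta_mul]
    _ = _ := by rw [h1, isBlock_one, mul_one]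

/-- The isomonodromic ingredient: near z₀ the matrix δ_kΦ(z) is conjugate to δ_kΦ(z₀) by a block
matrix, so a polynomial that annihilates the block at z₀ does so nearby. -/
theorem blockData (h : IsSolution n k W Φ) {z₀ : Fin k → ℂ} (hz₀ : z₀ ∈ W) {ν : ℕ} (hν : 1 ≤ ν)
    (hann : Polynomial.aeval (delta k (Φ z₀)) (rootPoly (blockSpec k (delta k (Φ z₀))) ν)
      * projQ n k = 0)
    (hre : ∀ d ∈ eigDiff k (Φ z₀), d.re < 1) :
    BlockData k (blockSpec k (delta k (Φ z₀))) ν (fun z => delta k (Φ z)) (matU n) Φ z₀ where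
  one_le := hν
  holA := by
    filter_upwards [h.isOpen.mem_nhds hz₀] with z hz
    exact (deltaL n k).differentiableAt.comp z (h.differentiableAt hz)
  holU := by
    filter_upwards [h.isOpen.mem_nhds hz₀] with z hz
    exact (h.admissible z hz).differentiableAt_matU
  holΦ := by
    filter_upwards [h.isOpen.mem_nhds hz₀] with z hz using h.differentiableAt hz
  delta_eq := Eventually.of_forall fun _ => rfl
  proj_mul := Eventually.of_forall fun z => projQ_mul_matU z
  mul_proj := Eventually.of_forall fun z => matU_mul_projQ z
  annih := by
    obtain ⟨G, G', -, -, hG⟩ := h.exists_conj hz₀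
    filter_upwards [hG] with z ⟨hB, hz⟩
    have h1 : ∀ q : Polynomial ℂ, Polynomial.aeval (delta k (Φ z)) q
        = G z * Polynomial.aeval (delta k (Φ z₀)) q * G' z := fun q => by
      rw [hz, hB.delta_conj]
      simp only [Polynomial.aeval_eq_sum_range, hB.conj_pow, Finset.mul_sum, Finset.sum_mul,
        mul_smul_comm, smul_mul_assoc]
    rw [h1, mul_assoc, hB.block'.commute_projQ.eq, mul_assoc, ← mul_assoc _ (projQ n k), hann]
    simp
  re_lt := by rw [diffSet_blockSpec, eigDiff_delta]; exact hre

end IsSolution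

theorem constR_pos {P : Fin n → Mat n} {N : Mat n} {M : ℝ} (hν : 1 ≤ nilpotencyClass N)
    (hM : Real.exp (2 * ((nilpotencyClass N : ℝ) - 1)) < M) (hP : 1 ≤ ∑ i, ‖P i‖) :
    0 < constR P N M := by
  obtain ⟨μ, hμ⟩ := Nat.exists_eq_add_of_le' hν
  rw [hμ] at hM
  push_cast at hM
  have h1 := IsSpectralData.log_bound hM
  have h2 : (0 : ℝ) ≤ μ := Nat.cast_nonneg μ
  have h3 : (0 : ℝ) < (∑ i, ‖P i‖) ^ 2 := pow_pos (by linarith) 2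
  rw [constR, hμ]
  push_cast
  have h4 : (0 : ℝ) < (μ + 1) - 1 / 2 := by linarith
  have h5 : (0 : ℝ) < 1 + (4 * (μ + 1) * ‖N‖) ^ (2 * (μ + 1 - 1)) :=
    add_pos_of_pos_of_nonneg one_pos (pow_nonneg (mul_nonneg (by positivity) (norm_nonneg N)) _)
  exact mul_pos (mul_pos (mul_pos h3 h4) h5) (by linarith)

theorem tendsto_constR {ι : Type*} {l : Filter ι} {P : ι → Fin n → Mat n} {N : ι → Mat n}
    {P₀ : Fin n → Mat n} {N₀ : Mat n} (hP : ∀ i, Tendsto (fun p => P p i) l (𝓝 (P₀ i)))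
    (hN : Tendsto N l (𝓝 N₀)) (hν : ∀ᶠ p in l, nilpotencyClass (N p) = nilpotencyClass N₀)
    (M : ℝ) : Tendsto (fun p => constR (P p) (N p) M) l (𝓝 (constR P₀ N₀ M)) := by
  have h1 : Tendsto (fun p => (∑ i, ‖P p i‖) ^ 2 * ((nilpotencyClass N₀ : ℝ) - 1 / 2)
      * (1 + (4 * (nilpotencyClass N₀ : ℝ) * ‖N p‖) ^ (2 * (nilpotencyClass N₀ - 1)))
      * (1 / (1 - 2 * ((nilpotencyClass N₀ : ℝ) - 1) / Real.log M))) l (𝓝 (constR P₀ N₀ M)) := by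
    rw [constR]
    refine Tendsto.mul_const _ (Tendsto.mul (Tendsto.mul_const _ (Tendsto.pow ?_ _)) ?_)
    · exact tendsto_finsetSum _ fun i _ => (hP i).norm
    · exact ((hN.norm.const_mul _).pow _).const_add _
  refine h1.congr' ?_
  filter_upwards [hν] with p hp
  rw [constR, hp]

/-- The term 1/(RB), read as 0 for B = 0, is discontinuous there. Hence the last hypothesis, which
for solutions holds by conjugacy: Φ vanishes near each of its zeros. -/
theorem tendsto_radiusBound {ι : Type*} {l : Filter ι} {R u B : ι → ℝ} {R₀ u₀ B₀ : ℝ}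
    (ε e M : ℝ) (ν : ℕ) (hR : Tendsto R l (𝓝 R₀)) (hR₀ : R₀ ≠ 0) (hu : Tendsto u l (𝓝 u₀))
    (hB : Tendsto B l (𝓝 B₀)) (hB₀ : B₀ = 0 → ∀ᶠ p in l, B p = 0) :
    Tendsto (fun p => radiusBound ε e (R p) M (u p) (B p) ν) l
      (𝓝 (radiusBound ε e R₀ M u₀ B₀ ν)) := by
  by_cases h : B₀ = 0
  · have h1 : Tendsto (fun p => max (2 * u p) M) l (𝓝 (max (2 * u₀) M)) :=
      (hu.const_mul 2).max tendsto_const_nhds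
    have h2 : radiusBound ε e R₀ M u₀ B₀ ν = max (2 * u₀) M := by simp [radiusBound, h]
    rw [h2]
    refine h1.congr' ?_
    filter_upwards [hB₀ h] with p hp
    simp [radiusBound, hp]
  · unfold radiusBound
    refine Tendsto.max (Tendsto.mul (Tendsto.mul (hu.const_mul 2) ?_) ?_) tendsto_const_nhds
    · exact ((((hR.const_mul 2).mul hB).div_const _).pow 2).const_add 1
    · exact (Tendsto.div tendsto_const_nhds (hR.mul hB) (mul_ne_zero hR₀ h)).const_add 1

theorem continuous_exp : Continuous (NormedSpace.exp : Mat n → Mat n) := by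
  let _ : NormedAlgebra ℚ (Mat n) := NormedAlgebra.restrictScalars ℚ ℂ (Mat n)
  exact NormedSpace.exp_continuous

theorem tendsto_powAd {ι : Type*} {l : Filter ι} {w : ι → ℂ} {A X : ι → Mat n} {w₀ : ℂ}
    {A₀ X₀ : Mat n} (hw : Tendsto w l (𝓝 w₀)) (hA : Tendsto A l (𝓝 A₀)) (hX : Tendsto X l (𝓝 X₀)) :
    Tendsto (fun p => powAd (w p) (A p) (X p)) l (𝓝 (powAd w₀ A₀ X₀)) := by
  unfold powAd
  exact (((continuous_exp.tendsto _).comp (hw.smul hA)).mul hX).mul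
    ((continuous_exp.tendsto _).comp (hw.smul hA).neg)

/-- Near a point of the region of convergence the defining inequality holds with a margin. -/
theorem IsSolution.eventually_convRegion {W : Set (Fin k → ℂ)} {Φ : (Fin k → ℂ) → Mat n}
    (h : IsSolution n k W Φ) (hkn : k + 1 ≤ n) {ε : ℝ} {p₀ : (Fin k → ℂ) × ℂ}
    (hp : p₀ ∈ convRegion n k W Φ ε) :
    ∃ q < 1, ∀ᶠ p in 𝓝 p₀, p.1 ∈ W ∧
      ∃ (lam : Fin n → ℂ) (P : Fin n → Mat n) (N : Mat n) (M : ℝ),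
        IsSpectralData k (delta k (Φ p.1)) lam P N ∧
        Real.exp (2 * ((nilpotencyClass N : ℝ) - 1)) < M ∧
        radiusBound ε (eps0 k ε (Φ p.1)) (constR P N M) M ‖matU n p.1‖
            ‖powAd (-((p.2.im : ℂ) * Complex.I)) (delta k (Φ p.1)) (Φ p.1)‖ (nilpotencyClass N)
          < q * Real.exp (ε * p.2.re) := by
  obtain ⟨z₀, w₀⟩ := p₀
  obtain ⟨hz₀, lam, P, N, M, hS, hM, hlt⟩ := hp
  simp only at hz₀ hS hlt
  have : NeZero n := ⟨by omega⟩
  have hR := constR_pos hS.nilpotencyClass_pos hM hS.one_le_sum_norm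
  obtain ⟨q, hq1, hq2⟩ := exists_between ((div_lt_one (Real.exp_pos (ε * w₀.re))).2 hlt)
  rw [div_lt_iff₀ (Real.exp_pos _)] at hq1
  refine ⟨q, hq2, ?_⟩
  obtain ⟨G, G', hG, hG', hz⟩ := h.exists_conj hz₀
  have t1 : Tendsto (fun p : (Fin k → ℂ) × ℂ => p.1) (𝓝 (z₀, w₀)) (𝓝 z₀) :=
    continuous_fst.tendsto _
  have t2 : Tendsto (fun p : (Fin k → ℂ) × ℂ => p.2) (𝓝 (z₀, w₀)) (𝓝 w₀) :=
    continuous_snd.tendsto _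
  have hconj : ∀ X : Mat n, Tendsto (fun p : (Fin k → ℂ) × ℂ => G p.1 * X * G' p.1)
      (𝓝 (z₀, w₀)) (𝓝 X) := fun X => by
    simpa using ((hG.comp t1).mul_const X).mul (hG'.comp t1)
  have hz' := t1.eventually hz
  have tR := tendsto_constR (fun i => hconj (P i)) (hconj N)
    (hz'.mono fun p hp => hp.1.nilpotencyClass_conj N) M
  have tΦ : Tendsto (fun p : (Fin k → ℂ) × ℂ => Φ p.1) (𝓝 (z₀, w₀)) (𝓝 (Φ z₀)) :=
    (h.differentiableAt hz₀).continuousAt.tendsto.comp t1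
  have tU : Tendsto (fun p : (Fin k → ℂ) × ℂ => ‖matU n p.1‖) (𝓝 (z₀, w₀)) (𝓝 ‖matU n z₀‖) :=
    ((h.admissible z₀ hz₀).differentiableAt_matU.continuousAt.tendsto.comp t1).norm
  have tB := (tendsto_powAd (w := fun p : (Fin k → ℂ) × ℂ => -((p.2.im : ℂ) * Complex.I))
    (((((Complex.continuous_ofReal.comp Complex.continuous_im).tendsto w₀).comp t2).mul_const
      Complex.I).neg) (((deltaL n k).continuous.tendsto _).comp tΦ) tΦ).norm
  have tF := tendsto_radiusBound ε (eps0 k ε (Φ z₀)) M (nilpotencyClass N) tR hR.ne' tU tB (by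
    intro h0
    have h1 : Φ z₀ = 0 := by
      rw [← powAd_powAd_neg (((w₀.im : ℂ) * Complex.I)) (delta k (Φ z₀)) (Φ z₀)]
      rw [norm_eq_zero] at h0
      exact (congrArg _ h0).trans (powAd_zero _ _)
    filter_upwards [hz'] with p hp
    rw [hp.2, h1]
    simp)
  have tE : Tendsto (fun p : (Fin k → ℂ) × ℂ => q * Real.exp (ε * p.2.re)) (𝓝 (z₀, w₀))
      (𝓝 (q * Real.exp (ε * w₀.re))) := by
    refine Tendsto.const_mul _ ?_
    exact ((Real.continuous_exp.comp (continuous_const.mul Complex.continuous_re)).tendsto w₀).comp t2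
  filter_upwards [tF.eventually_lt tE hq1, hz', t1.eventually (h.isOpen.mem_nhds hz₀)]
    with p hp hz hpW
  -- Conjugated spectral data with the same λ and M: the nilpotency index and ε₀ do not change, and
  -- the norms vary continuously at the given point.
  refine ⟨hpW, lam, fun i => G p.1 * P i * G' p.1, G p.1 * N * G' p.1, M, ?_, ?_, ?_⟩
  · have := hz.1.isSpectralData hS
    rwa [← hz.1.delta_conj, ← hz.2] at this
  · rwa [hz.1.nilpotencyClass_conj]
  · rw [hz.1.nilpotencyClass_conj]
    have h1 : eps0 k ε (Φ p.1) = eps0 k ε (Φ z₀) := by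
      rw [eps0, eps0, hz.2, hz.1.eigDiff_conj]
    rw [h1]
    exact hp

theorem IsSolution.isOpen_convRegion {W : Set (Fin k → ℂ)} {Φ : (Fin k → ℂ) → Mat n}
    (h : IsSolution n k W Φ) (hkn : k + 1 ≤ n) {ε : ℝ} : IsOpen (convRegion n k W Φ ε) := by
  rw [isOpen_iff_mem_nhds]
  intro p₀ hp₀
  obtain ⟨q, hq, hp⟩ := h.eventually_convRegion hkn hp₀
  filter_upwards [hp] with p hp
  obtain ⟨hW, lam, P, N, M, hS, hM, hlt⟩ := hp
  refine ⟨hW, lam, P, N, M, hS, hM, hlt.trans ?_⟩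
  exact mul_lt_of_lt_one_left (Real.exp_pos _) hq

end Isomonodromy
end

/-! ### Termwise differentiation and evaluation of formal series -/

noncomputable section
namespace Isomonodromy
open Filter Topology
open Finset.HasAntidiagonal (antidiagonal mem_antidiagonal)

variable {n k : ℕ}

section Weierstrass

variable {E F : Type*} [NormedAddCommGroup E] [NormedSpace ℂ E] [NormedAddCommGroup F]
  [NormedSpace ℂ F] [CompleteSpace F]

/-- A locally normally convergent series of holomorphic functions is holomorphic, and it can be
differentiated term by term. -/
theorem exists_hasFDerivAt_tsum {f : ℕ → E → F} {b : ℕ → ℝ} {p₀ : E} (hb : Summable b)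
    (hf : ∀ᶠ p in 𝓝 p₀, ∀ m, DifferentiableAt ℂ (f m) p)
    (hle : ∀ᶠ p in 𝓝 p₀, ∀ m, ‖f m p‖ ≤ b m) :
    ∃ L : E →L[ℂ] F, HasFDerivAt (fun p => ∑' m, f m p) L p₀ ∧
      ∀ v, HasSum (fun m => fderiv ℂ (f m) p₀ v) (L v) := by
  obtain ⟨r, hr, hball⟩ := Metric.eventually_nhds_iff_ball.1 (hf.and hle)
  have hr2 : 0 < r / 2 := half_pos hr
  have hsub : ∀ p ∈ Metric.ball p₀ (r / 2), Metric.ball p (r / 2) ⊆ Metric.ball p₀ r := by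
    intro p hp q hq
    rw [Metric.mem_ball] at *
    linarith [dist_triangle q p p₀]
  -- Cauchy's estimate on the ball of radius r/2 about p, where f m differs from its value at p by
  -- at most 2 b m.
  have hd : ∀ m, ∀ p ∈ Metric.ball p₀ (r / 2), ‖fderiv ℂ (f m) p‖ ≤ 2 * b m / (r / 2) := by
    intro m p hp
    refine Complex.norm_fderiv_le_div_of_mapsTo_ball (R₂ := 2 * b m)
      (fun q hq => ((hball q (hsub p hp hq)).1 m).differentiableWithinAt) ?_ hr2
    intro q hq
    have h1 := (hball q (hsub p hp hq)).2 m
    have h2 := (hball p (hsub p hp (Metric.mem_ball_self hr2))).2 m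
    rw [Metric.mem_closedBall, dist_eq_norm]
    calc _ ≤ ‖f m q‖ + ‖f m p‖ := norm_sub_le _ _
      _ ≤ _ := by linarith
  have hs : Summable fun m => 2 * b m / (r / 2) := (hb.mul_left 2).div_const _
  have hp₀ : p₀ ∈ Metric.ball p₀ (r / 2) := Metric.mem_ball_self hr2
  refine ⟨∑' m, fderiv ℂ (f m) p₀, ?_, fun v => ?_⟩
  · exact hasFDerivAt_tsum_of_isPreconnected (f' := fun m p => fderiv ℂ (f m) p) hs
      Metric.isOpen_ball (Metric.isPreconnected_ball)
      (fun m p hp => ((hball p (Metric.ball_subset_ball (by linarith) hp)).1 m).hasFDerivAt) hd hp₀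
      (Summable.of_norm_bounded hb (hball p₀ (Metric.mem_ball_self hr)).2) hp₀
  · have h1 : Summable fun m => fderiv ℂ (f m) p₀ :=
      Summable.of_norm_bounded hs fun m => hd m p₀ hp₀
    exact h1.hasSum.mapL (ContinuousLinearMap.apply ℂ F v)

end Weierstrass

/-- The formal series `F` converges at the point `x` with the sum `S`. -/
def HasEval (x : ℂ) (F : PowerSeries (Mat n)) (S : Mat n) : Prop :=
  HasSum (fun m => x ^ m • PowerSeries.coeff m F) S

namespace HasEval

variable {x : ℂ} {F G : PowerSeries (Mat n)} {S T : Mat n}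

theorem add (hF : HasEval x F S) (hG : HasEval x G T) : HasEval x (F + G) (S + T) := by
  simpa only [HasEval, map_add, smul_add] using HasSum.add hF hG

theorem sub (hF : HasEval x F S) (hG : HasEval x G T) : HasEval x (F - G) (S - T) := by
  simpa only [HasEval, map_sub, smul_sub] using HasSum.sub hF hG

theorem mul (hF : HasEval x F S) (hG : HasEval x G T) : HasEval x (F * G) (S * T) := by
  have h1 := summable_norm_iff.2 (HasSum.summable hF)
  have h2 := summable_norm_iff.2 (HasSum.summable hG)
  have h3 := summable_norm_sum_mul_antidiagonal_of_summable_norm h1 h2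
  have h4 := tsum_mul_tsum_eq_tsum_sum_antidiagonal_of_summable_norm h1 h2
  rw [HasSum.tsum_eq hF, HasSum.tsum_eq hG] at h4
  rw [HasEval, h4]
  refine (summable_norm_iff.1 h3).hasSum.congr_fun fun m => ?_
  rw [PowerSeries.coeff_mul, Finset.smul_sum]
  refine Finset.sum_congr rfl fun y hy => ?_
  rw [mem_antidiagonal] at hy
  rw [smul_mul_smul_comm, ← pow_add, hy]

theorem comm (hF : HasEval x F S) (hG : HasEval x G T) : HasEval x (comm F G) (ad S T) :=
  (hF.mul hG).sub (hG.mul hF)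

theorem lmap (L : Mat n →L[ℂ] Mat n) (hF : HasEval x F S) : HasEval x (lmap L F) (L S) := by
  simpa only [HasEval, coeff_lmap, map_smul] using HasSum.mapL L hF

theorem C (x : ℂ) (X : Mat n) : HasEval x (PowerSeries.C X) X := by
  have := hasSum_single (f := fun m => x ^ m • PowerSeries.coeff m (PowerSeries.C X)) 0
    (fun m hm => by simp only [PowerSeries.coeff_C, if_neg hm, smul_zero])
  simpa [HasEval] using this

theorem serE (k : ℕ) (hF : HasEval x F S) (hG : HasEval x G T) :
    HasEval x (serE k F G) (S * T * unitE n k + unitE n k * T * S) :=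
  ((hF.mul hG).mul (C x _)).add (((C x _).mul hG).mul hF)

theorem serGen (k : ℕ) (L : Mat n →L[ℂ] Mat n) (hF : HasEval x F S) (hG : HasEval x G T) :
    HasEval x (serGen k L F G) (L T + (S * T * unitE n k + unitE n k * T * S)) :=
  (hG.lmap L).add (hF.serE k hG)

/-- A geometric series in -a_i/t in each diagonal entry; it starts in order 1. -/
theorem serK {t : ℂ} (ht : t ≠ 0) {a b : Fin n → ℂ} (h : ∀ i, ‖a i‖ < ‖t‖) :
    HasEval t⁻¹ (serK (Matrix.diagonal a) (Matrix.diagonal b))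
      (Matrix.diagonal fun i => b i / (t + a i)) := by
  have h1 : ∀ i, HasSum (fun m : ℕ => if m = 0 then 0 else t⁻¹ ^ m * (b i * (-a i) ^ (m - 1)))
      (b i / (t + a i)) := by
    intro i
    have h2 : ‖t⁻¹ * (-a i)‖ < 1 := by
      rw [norm_mul, norm_neg, norm_inv, inv_mul_lt_iff₀ (norm_pos_iff.2 ht), mul_one]
      exact h i
    have h3 := ((hasSum_geometric_of_norm_lt_one h2).mul_left (t⁻¹ * b i))
    have h4 : t + a i ≠ 0 := fun h0 => by
      have := h i
      rw [eq_neg_of_add_eq_zero_left h0, norm_neg] at this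
      exact lt_irrefl _ this
    rw [← hasSum_nat_add_iff' 1]
    have h6 : 1 - t⁻¹ * (-a i) ≠ 0 := by
      intro h0; apply h4; field_simp at h0; linear_combination h0
    have h5 : t⁻¹ * b i * (1 - t⁻¹ * (-a i))⁻¹ = b i / (t + a i) := by
      rw [← div_eq_mul_inv, div_eq_div_iff h6 h4]
      field_simp
      ring
    rw [h5] at h3
    have h7 : (fun m : ℕ => if m + 1 = 0 then 0 else t⁻¹ ^ (m + 1) * (b i * (-a i) ^ (m + 1 - 1)))
        = fun m => t⁻¹ * b i * (t⁻¹ * (-a i)) ^ m := by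
      ext m
      rw [if_neg (by omega), Nat.add_sub_cancel, mul_pow, pow_succ]
      ring
    rw [h7, Finset.sum_range_one, if_pos rfl, sub_zero]
    exact h3
  have h2 := (Pi.hasSum.2 h1).matrix_diagonal
  refine h2.congr_fun fun m => ?_
  rw [Isomonodromy.serK, PowerSeries.coeff_mk, coefK]
  split_ifs with hm
  · simp
  · rw [Matrix.diagonal_neg, Matrix.diagonal_pow, Matrix.diagonal_mul_diagonal,
      ← Matrix.diagonal_smul]
    rfl

theorem serH {t : ℂ} (ht : t ≠ 0) {a : Fin n → ℂ} (h : ∀ i, ‖a i‖ < ‖t‖) :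
    HasEval t⁻¹ (serH (Matrix.diagonal a)) (Matrix.diagonal fun i => -a i / (t + a i)) := by
  have h1 : Isomonodromy.serH (Matrix.diagonal a)
      = Isomonodromy.serK (Matrix.diagonal a) (Matrix.diagonal fun i => -a i) := by
    ext1 m
    rw [Isomonodromy.serH, Isomonodromy.serK, PowerSeries.coeff_mk, PowerSeries.coeff_mk, coefH,
      coefK]
    split_ifs with hm
    · rfl
    · obtain ⟨p, rfl⟩ := Nat.exists_eq_add_of_le' (Nat.one_le_iff_ne_zero.2 hm)
      rw [Nat.add_sub_cancel, pow_succ', Matrix.diagonal_neg]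
  rw [h1]
  exact serK ht h

end HasEval
end Isomonodromy
end

/-! ### Convergence of the series for the next solution -/

noncomputable section
namespace Isomonodromy
open Filter Topology
open Finset.HasAntidiagonal (antidiagonal mem_antidiagonal)

variable {n k : ℕ}

/-- With U = 0 the generator has no terms of positive order and the decaying solution is zero. This
settles k = 0, where the block is empty. -/
theorem coefPhi_of_eq_zero (k : ℕ) (A Φ₀ : Mat n) {m : ℕ} (hm : 1 ≤ m) (w : ℂ) :
    coefPhi k A 0 Φ₀ m w = 0 := by
  have h0 : ∀ p, coefH (0 : Mat n) p = 0 := fun p => by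
    rw [coefH]; split_ifs with h
    · rfl
    · rw [neg_zero, zero_pow h]
  have h1 : ∀ a w, coefS k A 0 (coefPhi k A 0 Φ₀) a w = 0 := fun a w => by
    rw [coefS]
    split_ifs with ha
    · rfl
    · simp [coefX, ha, h0, ad]
  have h2 := powAd_coefPhi k A 0 Φ₀ hm
  have h3 : (fun w => powAd w A (coefRhs k A 0 (coefPhi k A 0 Φ₀) m w)) = fun _ => 0 := by
    ext1 w; simp [coefRhs, h1, ad]
  have h4 : IsDecaying m (fun _ => (0 : Mat n)) (fun _ => 0) :=
    ⟨fun w => by simpa using hasDerivAt_const w (0 : Mat n), by simp⟩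
  rw [h3, h4.decaySol_eq] at h2
  rw [← powAd_neg_powAd w A (coefPhi k A 0 Φ₀ m w), h2 w, powAd_zero]

theorem le_radiusBound (ε e R M u B : ℝ) (ν : ℕ) : M ≤ radiusBound ε e R M u B ν := le_max_right _ _

theorem norm_le_radiusBound {ε e R M u B : ℝ} {ν : ℕ} (hu : 0 ≤ u) (hR : 0 ≤ R) (hB : 0 ≤ B) :
    u ≤ radiusBound ε e R M u B ν := by
  refine le_trans ?_ (le_max_left _ _)
  have h1 : 1 ≤ 1 + (2 * R * B / (ε ^ ν * e ^ (ν - 1))) ^ 2 := by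
    linarith [sq_nonneg (2 * R * B / (ε ^ ν * e ^ (ν - 1)))]
  have h2 : 1 ≤ 1 + 1 / (R * B) := by
    have : 0 ≤ 1 / (R * B) := by positivity
    linarith
  calc u ≤ 2 * u * 1 * 1 := by linarith
    _ ≤ _ := by gcongr

theorem matU_of_eq_zero (hk : k = 0) (z : Fin k → ℂ) : matU n z = 0 := by
  rw [matU_eq, ← Matrix.diagonal_zero]
  congr 1; ext i
  simp [gapCoord, hk]

theorem norm_powAd_neg_le (x : ℂ) (A X : Mat n) :
    ‖powAd (-x) A X‖ ≤ ‖NormedSpace.exp (-(x • A))‖ * ‖X‖ * ‖NormedSpace.exp (x • A)‖ := by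
  rw [powAd, neg_smul, neg_neg]
  exact (norm_mul_le _ _).trans (mul_le_mul_of_nonneg_right (norm_mul_le _ _) (norm_nonneg _))

theorem differentiableAt_exp (X : Mat n) : DifferentiableAt ℂ (NormedSpace.exp : Mat n → Mat n) X :=
  (NormedSpace.exp_analytic (𝕂 := ℂ) X).differentiableAt

/-- The coefficients `φ_m` of the solution of the `(k+1,n)`-equation with the initial value `Φ`. -/
abbrev nextCoef (Φ : (Fin k → ℂ) → Mat n) (m : ℕ) (z : Fin k → ℂ) (w : ℂ) : Mat n :=
  BlockData.phi k (fun z => delta k (Φ z)) (matU n) Φ z m w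

/-- The terms of the series for the solution of the `(k+1,n)`-equation. -/
def nextTerm (Φ : (Fin k → ℂ) → Mat n) (m : ℕ) (p : (Fin k → ℂ) × ℂ) : Mat n :=
  Complex.exp (-(m * p.2)) • nextCoef Φ m p.1 p.2

/-- The formal series of the coefficients `φ_m`. -/
abbrev nextSer (Φ : (Fin k → ℂ) → Mat n) (z : Fin k → ℂ) (w : ℂ) : PowerSeries (Mat n) :=
  BlockData.ser k (fun z => delta k (Φ z)) (matU n) Φ z w

/-- The sum of the series. -/
def nextSum (Φ : (Fin k → ℂ) → Mat n) (z : Fin k → ℂ) (w : ℂ) : Mat n := ∑' m, nextTerm Φ m (z, w)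

theorem exp_neg_mul_eq (m : ℕ) (w : ℂ) : Complex.exp (-(m * w)) = (Complex.exp w)⁻¹ ^ m := by
  rw [Complex.exp_neg, Complex.exp_nat_mul, inv_pow]

theorem nextTerm_eq (Φ : (Fin k → ℂ) → Mat n) (m : ℕ) (z : Fin k → ℂ) (w : ℂ) :
    nextTerm Φ m (z, w) = (Complex.exp w)⁻¹ ^ m • PowerSeries.coeff m (nextSer Φ z w) := by
  rw [nextTerm, exp_neg_mul_eq]
  simp only [serPhi, PowerSeries.coeff_mk]

namespace IsSolution

variable {W : Set (Fin k → ℂ)} {Φ : (Fin k → ℂ) → Mat n} {ε : ℝ}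

theorem blockData_general (h : IsSolution n k W Φ) (hε : 0 < ε)
    (hbound : ∀ z ∈ W, ∀ d ∈ eigDiff k (Φ z), |d.re| < 1 - ε) {z : Fin k → ℂ} (hz : z ∈ W) :
    BlockData k (blockSpec k (delta k (Φ z))) (n + 1) (fun z => delta k (Φ z)) (matU n) Φ z :=
  h.blockData hz (by omega) (aeval_rootPoly_mul_projQ (isBlock_delta k _)) fun d hd => by
    have := hbound z hz d hd
    linarith [le_abs_self d.re]

theorem blockData_spectral [NeZero n] (h : IsSolution n k W Φ) (hε : 0 < ε)
    (hbound : ∀ z ∈ W, ∀ d ∈ eigDiff k (Φ z), |d.re| < 1 - ε) {z : Fin k → ℂ} (hz : z ∈ W)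
    {lam : Fin n → ℂ} {P : Fin n → Mat n} {N : Mat n}
    (hS : IsSpectralData k (delta k (Φ z)) lam P N) :
    BlockData k (blockSpec k (delta k (Φ z))) (nilpotencyClass N) (fun z => delta k (Φ z))
      (matU n) Φ z :=
  h.blockData hz hS.nilpotencyClass_pos (hS.annih (isBlock_delta k _)) fun d hd => by
    have := hbound z hz d hd
    linarith [le_abs_self d.re]

theorem differentiableAt_nextCoef (h : IsSolution n k W Φ) (hε : 0 < ε)
    (hbound : ∀ z ∈ W, ∀ d ∈ eigDiff k (Φ z), |d.re| < 1 - ε) (m : ℕ)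
    {p : (Fin k → ℂ) × ℂ} (hp : p.1 ∈ W) :
    DifferentiableAt ℂ (fun q : (Fin k → ℂ) × ℂ => nextCoef Φ m q.1 q.2) p := by
  have h1 := ((h.blockData_general hε hbound hp).structure_all m).differentiableAt p.2
  have hA : DifferentiableAt ℂ (fun q : (Fin k → ℂ) × ℂ => delta k (Φ q.1)) p :=
    ((deltaL n k).differentiableAt.comp p.1 (h.differentiableAt hp)).comp p differentiableAt_fst
  have h2 : DifferentiableAt ℂ (fun q : (Fin k → ℂ) × ℂ => q.2 • delta k (Φ q.1)) p :=
    differentiableAt_snd.smul hA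
  have h3 : DifferentiableAt ℂ (fun q : (Fin k → ℂ) × ℂ =>
      NormedSpace.exp (q.2 • delta k (Φ q.1))) p := (differentiableAt_exp _).comp p h2
  have h4 : DifferentiableAt ℂ (fun q : (Fin k → ℂ) × ℂ =>
      NormedSpace.exp (-(q.2 • delta k (Φ q.1)))) p := (differentiableAt_exp _).comp p h2.fun_neg
  refine ((h4.fun_mul h1).fun_mul h3).congr_of_eventuallyEq (Eventually.of_forall fun q => ?_)
  simp only
  conv_lhs => rw [← powAd_neg_powAd q.2 (delta k (Φ q.1)) (nextCoef Φ m q.1 q.2)]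
  rw [powAd, neg_smul, neg_neg]

theorem differentiableAt_nextTerm (h : IsSolution n k W Φ) (hε : 0 < ε)
    (hbound : ∀ z ∈ W, ∀ d ∈ eigDiff k (Φ z), |d.re| < 1 - ε) (m : ℕ)
    {p : (Fin k → ℂ) × ℂ} (hp : p.1 ∈ W) : DifferentiableAt ℂ (nextTerm Φ m) p := by
  unfold nextTerm
  refine DifferentiableAt.fun_smul ?_ (h.differentiableAt_nextCoef hε hbound m hp)
  fun_prop

theorem hasLogExpansion [NeZero n] (h : IsSolution n k W Φ) (hε : 0 < ε)
    (hbound : ∀ z ∈ W, ∀ d ∈ eigDiff k (Φ z), |d.re| < 1 - ε) {z : Fin k → ℂ} (hz : z ∈ W)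
    {lam : Fin n → ℂ} {P : Fin n → Mat n} {N : Mat n}
    (hS : IsSpectralData k (delta k (Φ z)) lam P N) (m : ℕ) :
    HasLogExpansion (sumSet m (eigDiff k (Φ z))) (2 * (nilpotencyClass N - 1) * m)
        (fun w => delta k (nextCoef Φ m z w)) ∧
      HasLogExpansion (sumSet m (eigDiff k (Φ z))) (2 * (nilpotencyClass N - 1) * m)
        (fun w => powAd w (delta k (Φ z)) (nextCoef Φ m z w)) := by
  have H := h.blockData_spectral hε hbound hz hS
  have hs : diffSet (blockSpec k (delta k (Φ z))) = eigDiff k (Φ z) := by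
    rw [diffSet_blockSpec, eigDiff_delta]
  rw [← hs]
  refine ⟨?_, (H.structure_all m).hasLogExpansion⟩
  rw [funext fun w => H.delta_phi m w]
  rcases Nat.eq_zero_or_pos m with rfl | hm
  · refine LogExp.hasLogExpansion (z₀ := z) (f := fun z w => coefX k (delta k (Φ z)) (matU n z)
      (BlockData.phi k (fun z => delta k (Φ z)) (matU n) Φ z) 0 w) ?_
    exact (LogExp.const H.holA).mono (by simp [sumSet_zero]) (by simp)
  · exact (H.logExp_coefX hm fun a _ => H.structure_all a).hasLogExpansion

theorem one_lt_of_exp_lt [NeZero n] {A : Mat n} {lam : Fin n → ℂ} {P : Fin n → Mat n} {N : Mat n}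
    {M : ℝ} (hS : IsSpectralData k A lam P N)
    (hM : Real.exp (2 * ((nilpotencyClass N : ℝ) - 1)) < M) : 1 < M := by
  refine lt_of_le_of_lt (Real.one_le_exp ?_) hM
  have : (1 : ℝ) ≤ nilpotencyClass N := by exact_mod_cast hS.nilpotencyClass_pos
  linarith

/-- The majorant constant c stays below q e^{ε Re w}, so c^m e^{(1-ε)m Re w} ≤ q^m e^{m Re w}; the
last factor is cancelled by the norm of e^{-mw}. The norms of the exponentials come from undoing the
conjugation and do not depend on m. -/
theorem norm_nextTerm_le (h : IsSolution n k W Φ) (hkn : k + 1 ≤ n) (hε : 0 < ε)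
    (hbound : ∀ z ∈ W, ∀ d ∈ eigDiff k (Φ z), |d.re| < 1 - ε) {p : (Fin k → ℂ) × ℂ}
    (hp : p.1 ∈ W) {lam : Fin n → ℂ} {P : Fin n → Mat n} {N : Mat n} {M q : ℝ}
    (hS : IsSpectralData k (delta k (Φ p.1)) lam P N)
    (hM : Real.exp (2 * ((nilpotencyClass N : ℝ) - 1)) < M) (hq : q < 1)
    (hlt : radiusBound ε (eps0 k ε (Φ p.1)) (constR P N M) M ‖matU n p.1‖
      ‖powAd (-((p.2.im : ℂ) * Complex.I)) (delta k (Φ p.1)) (Φ p.1)‖ (nilpotencyClass N)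
        < q * Real.exp (ε * p.2.re)) (m : ℕ) :
    ‖nextTerm Φ m p‖ ≤ ‖NormedSpace.exp (-((p.2.re : ℂ) • delta k (Φ p.1)))‖
      * ‖powAd (-((p.2.im : ℂ) * Complex.I)) (delta k (Φ p.1)) (Φ p.1)‖
      * ‖NormedSpace.exp ((p.2.re : ℂ) • delta k (Φ p.1))‖ * q ^ m := by
  have : NeZero n := ⟨by omega⟩
  obtain ⟨z, w⟩ := p
  simp only at hp hS hlt ⊢
  have hM1 := one_lt_of_exp_lt hS hM
  have hMr := (le_radiusBound ε (eps0 k ε (Φ z)) (constR P N M) M ‖matU n z‖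
      ‖powAd (-((w.im : ℂ) * Complex.I)) (delta k (Φ z)) (Φ z)‖ (nilpotencyClass N)).trans_lt hlt
  have hq0 : 0 < q := by
    by_contra hq0
    have := mul_nonpos_of_nonpos_of_nonneg (not_lt.1 hq0) (Real.exp_pos (ε * w.re)).le
    linarith
  have key : ‖powAd w.re (delta k (Φ z)) (nextCoef Φ m z w)‖
      ≤ ‖powAd (-((w.im : ℂ) * Complex.I)) (delta k (Φ z)) (Φ z)‖ * q ^ m
        * Real.exp (m * w.re) := by
    -- For k = 0 there are no eigenvalue differences and ε is not bounded by 1, so the block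
    -- estimates do not apply; only the term of order 0 is nonzero.
    rcases Nat.eq_zero_or_pos k with hk | hk
    · rcases Nat.eq_zero_or_pos m with rfl | hm
      · have h1 : (w.re : ℂ) + -w = -((w.im : ℂ) * Complex.I) := by
          nth_rewrite 2 [← Complex.re_add_im w]; ring
        rw [nextCoef, BlockData.phi, coefPhi_zero, powAd_powAd, h1]
        simp
      · rw [nextCoef, BlockData.phi, matU_of_eq_zero hk, coefPhi_of_eq_zero _ _ _ hm, powAd_zero,
          norm_zero]
        positivity
    -- M > 1 forces e^{ε Re w} > 1, so the point lies on the part of the ray covered by the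
    -- estimates.
    · have hx : 0 ≤ w.re := by
        have h1 : 1 < Real.exp (ε * w.re) := by nlinarith [Real.exp_pos (ε * w.re)]
        rw [Real.one_lt_exp_iff] at h1
        exact (pos_of_mul_pos_right h1 hε.le).le
      have hb' : ∀ d ∈ eigDiff k (delta k (Φ z)), |d.re| < 1 - ε := by
        rw [eigDiff_delta]; exact hbound z hp
      obtain ⟨ρ, L₀, L₁, γ, hb, hle⟩ := hS.exists_blockBounds (isBlock_delta k _) hk (by omega) hε
        hb' hM (projQ_mul_matU z) (matU_mul_projQ z) (Φ z) w.im
      rw [eps0_delta] at hle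
      have h1 := (h.blockData_spectral hε hbound hp hS).norm_powAd_phi_le hb m w.re hx
      rw [Complex.re_add_im] at h1
      refine h1.trans ?_
      rw [mul_assoc ‖powAd (-((w.im : ℂ) * Complex.I)) (delta k (Φ z)) (Φ z)‖,
        mul_assoc ‖powAd (-((w.im : ℂ) * Complex.I)) (delta k (Φ z)) (Φ z)‖]
      refine mul_le_mul_of_nonneg_left ?_
        (norm_nonneg (powAd (-((w.im : ℂ) * Complex.I)) (delta k (Φ z)) (Φ z)))
      have hγ := hb.γ_pos
      have hc0 : 0 ≤ ‖matU n z‖ * (1 + 2 * γ) := by positivity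
      calc _ ≤ ((q * Real.exp (ε * w.re)) ^ m * 1) * Real.exp ((1 - ε) * m * w.re) := by
            have hcq := hle.trans hlt.le
            have hm1 := majorant_le_one m
            have hm0 := majorant_nonneg m
            generalize ‖matU n z‖ * (1 + 2 * γ) = c at hc0 hcq ⊢
            gcongr
        _ = q ^ m * (Real.exp (ε * w.re) ^ m * Real.exp ((1 - ε) * m * w.re)) := by
            rw [mul_pow]; ring
        _ = _ := by
            rw [← Real.exp_nat_mul, ← Real.exp_add]; congr 2; ring
  have h2 := norm_powAd_neg_le w.re (delta k (Φ z)) (powAd w.re (delta k (Φ z)) (nextCoef Φ m z w))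
  rw [powAd_neg_powAd] at h2
  have h3 : ‖Complex.exp (-(m * w))‖ = Real.exp (-(m * w.re)) := by
    rw [Complex.norm_exp]; simp
  have h4 : Real.exp (-(m * w.re)) * Real.exp (m * w.re) = 1 := by
    rw [← Real.exp_add]; simp
  rw [nextTerm, norm_smul, h3]
  simp only
  calc _ ≤ Real.exp (-(m * w.re)) * (‖NormedSpace.exp (-((w.re : ℂ) • delta k (Φ z)))‖
        * (‖powAd (-((w.im : ℂ) * Complex.I)) (delta k (Φ z)) (Φ z)‖ * q ^ m
          * Real.exp (m * w.re)) * ‖NormedSpace.exp ((w.re : ℂ) • delta k (Φ z))‖) := by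
        refine mul_le_mul_of_nonneg_left (h2.trans ?_) (Real.exp_pos _).le
        gcongr
    _ = ‖NormedSpace.exp (-((w.re : ℂ) • delta k (Φ z)))‖
        * ‖powAd (-((w.im : ℂ) * Complex.I)) (delta k (Φ z)) (Φ z)‖
        * ‖NormedSpace.exp ((w.re : ℂ) • delta k (Φ z))‖ * q ^ m
        * (Real.exp (-(m * w.re)) * Real.exp (m * w.re)) := by ring
    _ = _ := by rw [h4, mul_one]

/-- Near a point of the region of convergence the series has a geometric majorant. -/
theorem exists_majorant (h : IsSolution n k W Φ) (hkn : k + 1 ≤ n) (hε : 0 < ε)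
    (hbound : ∀ z ∈ W, ∀ d ∈ eigDiff k (Φ z), |d.re| < 1 - ε) {p₀ : (Fin k → ℂ) × ℂ}
    (hp₀ : p₀ ∈ convRegion n k W Φ ε) :
    ∃ b : ℕ → ℝ, Summable b ∧ ∀ᶠ p in 𝓝 p₀, ∀ m, ‖nextTerm Φ m p‖ ≤ b m := by
  obtain ⟨q, hq, hev⟩ := h.eventually_convRegion hkn hp₀
  have hΦc : Tendsto (fun p : (Fin k → ℂ) × ℂ => Φ p.1) (𝓝 p₀) (𝓝 (Φ p₀.1)) :=
    (h.differentiableAt hp₀.1).continuousAt.tendsto.comp (continuous_fst.tendsto _)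
  have hAc := ((deltaL n k).continuous.tendsto _).comp hΦc
  have hre : Tendsto (fun p : (Fin k → ℂ) × ℂ => (p.2.re : ℂ)) (𝓝 p₀) (𝓝 (p₀.2.re : ℂ)) := by
    have : Continuous fun p : (Fin k → ℂ) × ℂ => (p.2.re : ℂ) := by fun_prop
    exact this.tendsto _
  have him : Tendsto (fun p : (Fin k → ℂ) × ℂ => -((p.2.im : ℂ) * Complex.I)) (𝓝 p₀)
      (𝓝 (-((p₀.2.im : ℂ) * Complex.I))) := by
    have : Continuous fun p : (Fin k → ℂ) × ℂ => -((p.2.im : ℂ) * Complex.I) := by fun_prop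
    exact this.tendsto _
  have ht := ((((continuous_exp.tendsto _).comp (hre.smul hAc).neg).norm.mul
    (tendsto_powAd him hAc hΦc).norm).mul ((continuous_exp.tendsto _).comp (hre.smul hAc)).norm)
  obtain ⟨C, hC⟩ := exists_gt (‖NormedSpace.exp (-((p₀.2.re : ℂ) • deltaL n k (Φ p₀.1)))‖
    * ‖powAd (-((p₀.2.im : ℂ) * Complex.I)) (deltaL n k (Φ p₀.1)) (Φ p₀.1)‖
    * ‖NormedSpace.exp ((p₀.2.re : ℂ) • deltaL n k (Φ p₀.1))‖)
  have hC0 : 0 ≤ C := le_trans (by positivity) hC.le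
  refine ⟨fun m => C * |q| ^ m, ?_, ?_⟩
  · by_cases hq0 : 0 ≤ q
    · rw [abs_of_nonneg hq0]
      exact (summable_geometric_of_lt_one hq0 hq).mul_left C
    · exfalso
      obtain ⟨-, lam, P, N, M, hS, hM, hlt⟩ := hev.self_of_nhds
      have : NeZero n := ⟨by omega⟩
      have h1 := one_lt_of_exp_lt hS hM
      have h2 := (le_radiusBound _ _ _ _ _ _ _).trans_lt hlt
      have := mul_nonpos_of_nonpos_of_nonneg (not_le.1 hq0).le (Real.exp_pos (ε * p₀.2.re)).le
      linarith
  · filter_upwards [hev, ht.eventually_lt_const hC] with p hp hpC m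
    obtain ⟨hW, lam, P, N, M, hS, hM, hlt⟩ := hp
    refine (h.norm_nextTerm_le hkn hε hbound hW hS hM hq hlt m).trans ?_
    refine (le_abs_self _).trans ?_
    rw [abs_mul, abs_pow, abs_of_nonneg (by positivity)]
    exact mul_le_mul_of_nonneg_right hpC.le (by positivity)

theorem summable_nextTerm (h : IsSolution n k W Φ) (hkn : k + 1 ≤ n) (hε : 0 < ε)
    (hbound : ∀ z ∈ W, ∀ d ∈ eigDiff k (Φ z), |d.re| < 1 - ε) {p₀ : (Fin k → ℂ) × ℂ}
    (hp₀ : p₀ ∈ convRegion n k W Φ ε) : Summable fun m => ‖nextTerm Φ m p₀‖ := by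
  obtain ⟨b, hb, hle⟩ := h.exists_majorant hkn hε hbound hp₀
  exact Summable.of_nonneg_of_le (fun _ => norm_nonneg _) hle.self_of_nhds hb

theorem hasSum_nextSum (h : IsSolution n k W Φ) (hkn : k + 1 ≤ n) (hε : 0 < ε)
    (hbound : ∀ z ∈ W, ∀ d ∈ eigDiff k (Φ z), |d.re| < 1 - ε) {z : Fin k → ℂ} {w : ℂ}
    (hp₀ : (z, w) ∈ convRegion n k W Φ ε) :
    HasSum (fun m => nextTerm Φ m (z, w)) (nextSum Φ z w) :=
  (h.summable_nextTerm hkn hε hbound hp₀).of_norm.hasSum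

theorem hasEval_nextSer (h : IsSolution n k W Φ) (hkn : k + 1 ≤ n) (hε : 0 < ε)
    (hbound : ∀ z ∈ W, ∀ d ∈ eigDiff k (Φ z), |d.re| < 1 - ε) {z : Fin k → ℂ} {w : ℂ}
    (hp₀ : (z, w) ∈ convRegion n k W Φ ε) :
    HasEval (Complex.exp w)⁻¹ (nextSer Φ z w) (nextSum Φ z w) := by
  have := h.hasSum_nextSum hkn hε hbound hp₀
  simp only [nextTerm_eq] at this
  exact this

theorem exists_hasFDerivAt_nextSum (h : IsSolution n k W Φ) (hkn : k + 1 ≤ n) (hε : 0 < ε)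
    (hbound : ∀ z ∈ W, ∀ d ∈ eigDiff k (Φ z), |d.re| < 1 - ε) {p₀ : (Fin k → ℂ) × ℂ}
    (hp₀ : p₀ ∈ convRegion n k W Φ ε) :
    ∃ L : (Fin k → ℂ) × ℂ →L[ℂ] Mat n, HasFDerivAt (fun p => nextSum Φ p.1 p.2) L p₀ ∧
      ∀ v, HasSum (fun m => fderiv ℂ (nextTerm Φ m) p₀ v) (L v) := by
  obtain ⟨b, hb, hle⟩ := h.exists_majorant hkn hε hbound hp₀
  refine exists_hasFDerivAt_tsum hb ?_ hle
  filter_upwards [(h.isOpen.preimage continuous_fst).mem_nhds hp₀.1] with p hp m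
  exact h.differentiableAt_nextTerm hε hbound m hp

/-- Termwise differentiation along a curve. -/
theorem hasDerivAt_nextSum_comp (h : IsSolution n k W Φ) (hkn : k + 1 ≤ n) (hε : 0 < ε)
    (hbound : ∀ z ∈ W, ∀ d ∈ eigDiff k (Φ z), |d.re| < 1 - ε) {p₀ : (Fin k → ℂ) × ℂ}
    (hp₀ : p₀ ∈ convRegion n k W Φ ε) {c : ℂ → (Fin k → ℂ) × ℂ} {v : (Fin k → ℂ) × ℂ} {x : ℂ}
    (hc : HasDerivAt c v x) (hx : c x = p₀) {d : ℕ → Mat n} {D : Mat n}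
    (hd : ∀ m, HasDerivAt (fun t => nextTerm Φ m (c t)) (d m) x) (hD : HasSum d D) :
    HasDerivAt (fun t => nextSum Φ (c t).1 (c t).2) D x := by
  subst hx
  obtain ⟨L, hL, hs⟩ := h.exists_hasFDerivAt_nextSum hkn hε hbound hp₀
  have h1 : ∀ m, fderiv ℂ (nextTerm Φ m) (c x) v = d m := fun m =>
    ((h.differentiableAt_nextTerm hε hbound m hp₀.1).hasFDerivAt.comp_hasDerivAt x hc).unique (hd m)
  have h2 : L v = D := by
    have := hs v
    simp only [h1] at this
    exact this.unique hD
  rw [← h2]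
  exact hL.comp_hasDerivAt x hc

/-- Keeps z_{k+1} outside the disc containing the poles -a_i. For k ≥ 1 the zero difference gives ε
< 1, so the bound on |z_{k+1}|^ε also bounds |z_{k+1}|. -/
theorem norm_matU_lt (hkn : k + 1 ≤ n) (hε : 0 < ε)
    (hbound : ∀ z ∈ W, ∀ d ∈ eigDiff k (Φ z), |d.re| < 1 - ε) {z : Fin k → ℂ} {w : ℂ}
    (hp : (z, w) ∈ convRegion n k W Φ ε) : ‖matU n z‖ < ‖Complex.exp w‖ := by
  have : NeZero n := ⟨by omega⟩
  obtain ⟨hz, lam, P, N, M, hS, hM, hlt⟩ := hp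
  simp only at hz hS hlt
  rw [Complex.norm_exp]
  rcases Nat.eq_zero_or_pos k with hk | hk
  · rw [matU_of_eq_zero hk, norm_zero]; exact Real.exp_pos _
  · have hM1 := one_lt_of_exp_lt hS hM
    have h1 := (le_radiusBound _ _ _ _ _ _ _).trans_lt hlt
    have h2 : 1 < Real.exp (ε * w.re) := hM1.trans h1
    rw [Real.one_lt_exp_iff] at h2
    have hx : 0 < w.re := pos_of_mul_pos_right h2 hε.le
    have hε1 : 0 < 1 - ε := by
      have := hbound z hz 0 (zero_mem_eigDiff hk (by omega) _)
      simpa using this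
    have hR := constR_pos hS.nilpotencyClass_pos hM hS.one_le_sum_norm
    refine ((norm_le_radiusBound (norm_nonneg _) hR.le (norm_nonneg _)).trans_lt hlt).trans_le ?_
    exact Real.exp_le_exp.2 (by nlinarith)

end IsSolution
end Isomonodromy
end

/-! ### The differential equations for branches of the sum -/

noncomputable section
namespace Isomonodromy
open Filter Topology
open Finset.HasAntidiagonal (antidiagonal mem_antidiagonal)

variable {n k : ℕ}

/-- A continuous logarithm is locally given by the principal branch. -/
theorem eventually_eq_log {X : Type*} [TopologicalSpace X] {ℓ f : X → ℂ} {x₀ : X}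
    (hℓ : ContinuousAt ℓ x₀) (h : ∀ᶠ x in 𝓝 x₀, Complex.exp (ℓ x) = f x) :
    ∀ᶠ x in 𝓝 x₀, ℓ x = ℓ x₀ + Complex.log (f x / f x₀) := by
  have h1 : ContinuousAt (fun x => |(ℓ x - ℓ x₀).im|) x₀ :=
    (Complex.continuous_im.continuousAt.comp (hℓ.sub continuousAt_const)).abs
  have h2 := h1.eventually_lt_const (show |(ℓ x₀ - ℓ x₀).im| < Real.pi by simpa using Real.pi_pos)
  filter_upwards [h, h2] with x hx hlt
  rw [abs_lt] at hlt
  rw [← hx, ← h.self_of_nhds, ← Complex.exp_sub, Complex.log_exp hlt.1 hlt.2.le]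
  ring

namespace IsSolution

variable {W : Set (Fin k → ℂ)} {Φ : (Fin k → ℂ) → Mat n} {ε : ℝ}

theorem norm_gapCoord_lt (hkn : k + 1 ≤ n) (hε : 0 < ε)
    (hbound : ∀ z ∈ W, ∀ d ∈ eigDiff k (Φ z), |d.re| < 1 - ε) {z : Fin k → ℂ} {w : ℂ}
    (hp : (z, w) ∈ convRegion n k W Φ ε) (i : Fin n) : ‖gapCoord z i.val‖ < ‖Complex.exp w‖ := by
  refine lt_of_le_of_lt ?_ (norm_matU_lt hkn hε hbound hp)
  rw [matU_eq, Matrix.l2_opNorm_diagonal]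
  exact norm_le_pi_norm (fun i : Fin n => gapCoord z i.val) i

theorem hasDerivAt_nextSum_log (h : IsSolution n k W Φ) (hkn : k + 1 ≤ n) (hε : 0 < ε)
    (hbound : ∀ z ∈ W, ∀ d ∈ eigDiff k (Φ z), |d.re| < 1 - ε) {z : Fin k → ℂ} {w : ℂ}
    (hp : (z, w) ∈ convRegion n k W Φ ε) :
    HasDerivAt (fun w => nextSum Φ z w)
      (ad (-delta k (nextSum Φ z w)
        + (fracDiag n (Complex.exp w) (gapCoord z) (fun i => -gapCoord z i) * nextSum Φ z w
            * unitE n k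
          + unitE n k * nextSum Φ z w
            * fracDiag n (Complex.exp w) (gapCoord z) (fun i => -gapCoord z i)))
        (nextSum Φ z w)) w := by
  have H := h.blockData_general hε hbound hp.1
  have hS := h.hasEval_nextSer hkn hε hbound hp
  have hH : HasEval (Complex.exp w)⁻¹ (serH (matU n z))
      (fracDiag n (Complex.exp w) (gapCoord z) (fun i => -gapCoord z i)) := by
    rw [matU_eq]
    exact HasEval.serH (Complex.exp_ne_zero w) (norm_gapCoord_lt hkn hε hbound hp)
  have hE := (hH.serGen k (-deltaL n k) hS).comm hS
  have hc : HasDerivAt (fun t : ℂ => (z, t)) (0, 1) w :=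
    (hasDerivAt_const w z).prodMk (hasDerivAt_id w)
  refine h.hasDerivAt_nextSum_comp hkn hε hbound hp hc rfl (fun m => ?_) hE
  have h1 := H.hasTheta_ser w m
  have h2 : HasDerivAt (fun t : ℂ => Complex.exp (-(m * t))) (Complex.exp (-(m * w)) * -m) w := by
    simpa using ((hasDerivAt_id w).const_mul (m : ℂ)).neg.cexp
  -- The factor e^{-mw} = x^m turns the derivation d/dw - x d/dx of formal series into the ordinary
  -- derivative.
  have h3 := h2.smul h1
  rw [← exp_neg_mul_eq]
  refine (h3.congr_deriv ?_).congr_of_eventuallyEq (Eventually.of_forall fun t => ?_)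
  · simp only [one_mul, smul_add, mul_smul]
    module
  · simp only [nextTerm, serPhi, PowerSeries.coeff_mk, Pi.smul_apply']

theorem hasDerivAt_nextSum_update (h : IsSolution n k W Φ) (hkn : k + 1 ≤ n) (hε : 0 < ε)
    (hbound : ∀ z ∈ W, ∀ d ∈ eigDiff k (Φ z), |d.re| < 1 - ε) {z : Fin k → ℂ} {w : ℂ}
    (hp : (z, w) ∈ convRegion n k W Φ ε) (j : Fin k) :
    HasDerivAt (fun t => nextSum Φ (Function.update z j t) w)
      (ad (schurL (coefT n z j) (nextSum Φ z w)
        + (fracDiag n (Complex.exp w) (gapCoord z) (gapDeriv z j) * nextSum Φ z w * unitE n k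
          + unitE n k * nextSum Φ z w * fracDiag n (Complex.exp w) (gapCoord z) (gapDeriv z j)))
        (nextSum Φ z w)) (z j) := by
  have H := h.blockData_general hε hbound hp.1
  have hS := h.hasEval_nextSer hkn hε hbound hp
  have hz := h.admissible z hp.1
  have hK : HasEval (Complex.exp w)⁻¹ (serK (matU n z) (Matrix.diagonal fun i => gapDeriv z j i.val))
      (fracDiag n (Complex.exp w) (gapCoord z) (gapDeriv z j)) := by
    rw [matU_eq]
    exact HasEval.serK (Complex.exp_ne_zero w) (norm_gapCoord_lt hkn hε hbound hp)
  have hE := (hK.serGen k (schurL (coefT n z j)) hS).comm hS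
  have hγ := hasDerivAt_update z j (z j)
  have hc : HasDerivAt (fun t : ℂ => (Function.update z j t, w)) (Pi.single j 1, 0) (z j) :=
    hγ.prodMk (hasDerivAt_const _ w)
  refine h.hasDerivAt_nextSum_comp hkn hε hbound hp hc (by rw [Function.update_eq_self])
    (fun m => ?_) hE
  have hΦ := h.equation z hp.1 j
  rw [opT_eq] at hΦ
  have h1 := H.hasTheta_ser_curve hγ (Function.update_eq_self _ _) (hz.hasDerivAt_matU j) hΦ
    (hz.multiplier j) w m
  have h3 := h1.const_smul ((Complex.exp w)⁻¹ ^ m)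
  refine (h3.congr_deriv ?_).congr_of_eventuallyEq (Eventually.of_forall fun t => ?_)
  · simp only [zero_mul, zero_smul, add_zero]
  · simp only [nextTerm_eq]; rfl

/-- A branch of the sum of the series. -/
def nextBranch (Φ : (Fin k → ℂ) → Mat n) (ℓ : (Fin (k + 1) → ℂ) → ℂ) (v : Fin (k + 1) → ℂ) : Mat n :=
  nextSum Φ (Fin.init v) (ℓ v)

theorem differentiableAt_nextBranch (h : IsSolution n k W Φ) (hkn : k + 1 ≤ n) (hε : 0 < ε)
    (hbound : ∀ z ∈ W, ∀ d ∈ eigDiff k (Φ z), |d.re| < 1 - ε)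
    {ℓ : (Fin (k + 1) → ℂ) → ℂ} {v : Fin (k + 1) → ℂ} (hv : v (Fin.last k) ≠ 0)
    (hp : (Fin.init v, ℓ v) ∈ convRegion n k W Φ ε)
    (hlog : ∀ᶠ u in 𝓝 v, ℓ u = ℓ v + Complex.log (u (Fin.last k) / v (Fin.last k))) :
    DifferentiableAt ℂ (nextBranch Φ ℓ) v := by
  obtain ⟨L, hL, -⟩ := h.exists_hasFDerivAt_nextSum hkn hε hbound hp
  have hd : DifferentiableAt ℂ ℓ v := by
    refine DifferentiableAt.congr_of_eventuallyEq ?_ hlog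
    refine (DifferentiableAt.clog ?_ ?_).const_add _
    · simp only [div_eq_mul_inv]
      exact (differentiableAt_apply (Fin.last k) v).mul_const _
    · rw [div_self hv]; exact Complex.one_mem_slitPlane
  have hi : DifferentiableAt ℂ (fun v : Fin (k + 1) → ℂ => Fin.init v) v := by
    rw [differentiableAt_pi]
    exact fun i => differentiableAt_apply _ _
  exact hL.differentiableAt.comp (f := fun v => (Fin.init v, ℓ v)) v (hi.prodMk hd)

theorem tendsto_update {ι : Type*} [DecidableEq ι] (v : ι → ℂ) (j : ι) :
    Tendsto (fun t => Function.update v j t) (𝓝 (v j)) (𝓝 v) := by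
  have : ContinuousAt (fun t => Function.update v j t) (v j) :=
    (continuous_const.update j continuous_id).continuousAt
  simpa only [ContinuousAt, Function.update_eq_self] using this

theorem hasDerivAt_nextBranch_last (h : IsSolution n k W Φ) (hkn : k + 1 ≤ n) (hε : 0 < ε)
    (hbound : ∀ z ∈ W, ∀ d ∈ eigDiff k (Φ z), |d.re| < 1 - ε)
    {ℓ : (Fin (k + 1) → ℂ) → ℂ} {v : Fin (k + 1) → ℂ} (hw : Complex.exp (ℓ v) = v (Fin.last k))
    (hgap : ∀ i < k, v (Fin.last k) + gapCoord (Fin.init v) i ≠ 0)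
    (hp : (Fin.init v, ℓ v) ∈ convRegion n k W Φ ε)
    (hlog : ∀ᶠ u in 𝓝 v, ℓ u = ℓ v + Complex.log (u (Fin.last k) / v (Fin.last k))) :
    HasDerivAt (fun t => nextBranch Φ ℓ (Function.update v (Fin.last k) t))
      (ad (opT v (Fin.last k) (nextBranch Φ ℓ v)) (nextBranch Φ ℓ v)) (v (Fin.last k)) := by
  have hv : v (Fin.last k) ≠ 0 := by rw [← hw]; exact Complex.exp_ne_zero _
  have h1 := h.hasDerivAt_nextSum_log hkn hε hbound hp
  rw [hw] at h1
  have h2 : HasDerivAt (fun t => ℓ v + Complex.log (t / v (Fin.last k)))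
      (v (Fin.last k))⁻¹ (v (Fin.last k)) := by
    have h3 := (((hasDerivAt_id (v (Fin.last k))).div_const (v (Fin.last k))).clog
      (by simpa only [id, div_self hv] using Complex.one_mem_slitPlane)).const_add (ℓ v)
    refine h3.congr_deriv ?_
    simp [div_self hv]
  have h4 : ℓ v + Complex.log (v (Fin.last k) / v (Fin.last k)) = ℓ v := by
    rw [div_self hv, Complex.log_one, add_zero]
  have h5 := HasDerivAt.scomp_of_eq (v (Fin.last k)) h1 h2 h4.symm
  rw [opT_last (h.admissible _ hp.1) hv hgap]
  have h6 : (fun t => nextBranch Φ ℓ (Function.update v (Fin.last k) t)) =ᶠ[𝓝 (v (Fin.last k))]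
      (fun w => nextSum Φ (Fin.init v) w) ∘ fun t => ℓ v + Complex.log (t / v (Fin.last k)) := by
    filter_upwards [(tendsto_update v (Fin.last k)).eventually hlog] with t ht
    rw [nextBranch, ht, Fin.init_update_last, Function.update_self]
    rfl
  have h7 := h5.congr_of_eventuallyEq h6
  have h8 : ∀ (c : ℂ) (X Y : Mat n), ad (c • X) Y = c • ad X Y := fun c X Y => by
    simp only [ad, smul_mul_assoc, mul_smul_comm, smul_sub]
  rw [h8]
  exact h7

theorem hasDerivAt_nextBranch_castSucc (h : IsSolution n k W Φ) (hkn : k + 1 ≤ n) (hε : 0 < ε)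
    (hbound : ∀ z ∈ W, ∀ d ∈ eigDiff k (Φ z), |d.re| < 1 - ε)
    {ℓ : (Fin (k + 1) → ℂ) → ℂ} {v : Fin (k + 1) → ℂ} (hw : Complex.exp (ℓ v) = v (Fin.last k))
    (hgap : ∀ i < k, v (Fin.last k) + gapCoord (Fin.init v) i ≠ 0)
    (hp : (Fin.init v, ℓ v) ∈ convRegion n k W Φ ε)
    (hlog : ∀ᶠ u in 𝓝 v, ℓ u = ℓ v + Complex.log (u (Fin.last k) / v (Fin.last k))) (j : Fin k) :
    HasDerivAt (fun t => nextBranch Φ ℓ (Function.update v j.castSucc t))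
      (ad (opT v j.castSucc (nextBranch Φ ℓ v)) (nextBranch Φ ℓ v)) (v j.castSucc) := by
  have hv : v (Fin.last k) ≠ 0 := by rw [← hw]; exact Complex.exp_ne_zero _
  have h1 := h.hasDerivAt_nextSum_update hkn hε hbound hp j
  rw [hw] at h1
  rw [opT_castSucc (h.admissible _ hp.1) hgap]
  have h6 : (fun t => nextBranch Φ ℓ (Function.update v j.castSucc t)) =ᶠ[𝓝 (v j.castSucc)]
      fun t => nextSum Φ (Function.update (Fin.init v) j t) (ℓ v) := by
    -- Moving an old coordinate leaves z_{k+1} fixed, so a continuous logarithm is locally constant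
    -- along this line.
    filter_upwards [(tendsto_update v j.castSucc).eventually hlog] with t ht
    rw [nextBranch, ht, Fin.init_update_castSucc, Function.update_of_ne (Fin.castSucc_ne_last j).symm,
      div_self hv, Complex.log_one, add_zero]
  exact HasDerivAt.congr_of_eventuallyEq h1 h6

/-- A continuous logarithm is locally a shift of the principal one, hence holomorphic. Admissibility
for the new variable comes from |a_i| < |z_{k+1}|. -/
theorem isSolution_nextBranch (h : IsSolution n k W Φ) (hkn : k + 1 ≤ n) (hε : 0 < ε)
    (hbound : ∀ z ∈ W, ∀ d ∈ eigDiff k (Φ z), |d.re| < 1 - ε)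
    {V : Set (Fin (k + 1) → ℂ)} {ℓ : (Fin (k + 1) → ℂ) → ℂ} (hV : IsOpen V)
    (hℓ : ContinuousOn ℓ V) (hV' : ∀ v ∈ V, Complex.exp (ℓ v) = v (Fin.last k) ∧
      (Fin.init v, ℓ v) ∈ convRegion n k W Φ ε) :
    IsSolution n (k + 1) V (nextBranch Φ ℓ) := by
  have hne : ∀ v ∈ V, v (Fin.last k) ≠ 0 := fun v hv => by
    rw [← (hV' v hv).1]; exact Complex.exp_ne_zero _
  have hgap : ∀ v ∈ V, ∀ i < k, v (Fin.last k) + gapCoord (Fin.init v) i ≠ 0 := by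
    intro v hv i hi h0
    have := norm_gapCoord_lt hkn hε hbound (hV' v hv).2 ⟨i, by omega⟩
    rw [(hV' v hv).1, eq_neg_of_add_eq_zero_left h0, norm_neg] at this
    exact lt_irrefl _ this
  have hlog : ∀ v ∈ V, ∀ᶠ u in 𝓝 v,
      ℓ u = ℓ v + Complex.log (u (Fin.last k) / v (Fin.last k)) := fun v hv => by
    have h1 : ∀ᶠ u in 𝓝 v, Complex.exp (ℓ u) = u (Fin.last k) := by
      filter_upwards [hV.mem_nhds hv] with u hu
      exact (hV' u hu).1
    exact eventually_eq_log (hℓ.continuousAt (hV.mem_nhds hv)) h1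
  refine ⟨hV, fun v hv => (h.admissible _ (hV' v hv).2.1).of_init (hne v hv) (hgap v hv),
    fun v hv => (h.differentiableAt_nextBranch hkn hε hbound (hne v hv) (hV' v hv).2
      (hlog v hv)).differentiableWithinAt, fun v hv j => ?_⟩
  induction j using Fin.lastCases with
  | last =>
    exact h.hasDerivAt_nextBranch_last hkn hε hbound (hV' v hv).1 (hgap v hv) (hV' v hv).2
      (hlog v hv)
  | cast j =>
    exact h.hasDerivAt_nextBranch_castSucc hkn hε hbound (hV' v hv).1 (hgap v hv) (hV' v hv).2
      (hlog v hv) j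

end IsSolution
end Isomonodromy
end

/-- From the `(k,n)`-equation to the `(k+1,n)`-equation, `0 ≤ k < n`. The new variable `z_{k+1}`
ranges over the Riemann surface of the logarithm and is given by `w = ln z_{k+1}`. -/
theorem theorem2p1 (n k : ℕ) (hk : k + 1 ≤ n) (W : Set (Fin k → ℂ))
    (Φ : (Fin k → ℂ) → Isomonodromy.Mat n) (hΦ : Isomonodromy.IsSolution n k W Φ)
    (ε : ℝ) (hε : 0 < ε)
    (hbound : ∀ z ∈ W, ∀ d ∈ Isomonodromy.eigDiff k (Φ z), |d.re| < 1 - ε) :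
    ∃ (φ : ℕ → (Fin k → ℂ) → ℂ → Isomonodromy.Mat n)
      (Ψ : (Fin k → ℂ) → ℂ → Isomonodromy.Mat n),
      -- the coefficients are holomorphic, and the leading one is given by `Φ`
      (∀ m, DifferentiableOn ℂ (fun q : (Fin k → ℂ) × ℂ => φ m q.1 q.2) (W ×ˢ Set.univ)) ∧
      (∀ z ∈ W, ∀ w : ℂ,
        φ 0 z w = Isomonodromy.powAd (-w) (Isomonodromy.delta k (Φ z)) (Φ z)) ∧
      -- structure of the coefficients
      (∀ z ∈ W, ∀ (lam : Fin n → ℂ) (P : Fin n → Isomonodromy.Mat n) (N : Isomonodromy.Mat n),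
        Isomonodromy.IsSpectralData k (Isomonodromy.delta k (Φ z)) lam P N → ∀ m : ℕ,
          Isomonodromy.HasLogExpansion
            (Isomonodromy.sumSet m (Isomonodromy.eigDiff k (Φ z)))
            (2 * (nilpotencyClass N - 1) * m)
            (fun w => Isomonodromy.delta k (φ m z w)) ∧
          Isomonodromy.HasLogExpansion
            (Isomonodromy.sumSet m (Isomonodromy.eigDiff k (Φ z)))
            (2 * (nilpotencyClass N - 1) * m)
            (fun w => Isomonodromy.powAd w (Isomonodromy.delta k (Φ z)) (φ m z w))) ∧
      -- absolute convergence in the explicit region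
      IsOpen (Isomonodromy.convRegion n k W Φ ε) ∧
      (∀ z w, (z, w) ∈ Isomonodromy.convRegion n k W Φ ε →
        Summable (fun m : ℕ => ‖Complex.exp (-(m * w)) • φ m z w‖) ∧
        HasSum (fun m : ℕ => Complex.exp (-(m * w)) • φ m z w) (Ψ z w)) ∧
      -- every branch of the sum solves the next equation
      (∀ (V : Set (Fin (k + 1) → ℂ)) (logBranch : (Fin (k + 1) → ℂ) → ℂ), IsOpen V →
        ContinuousOn logBranch V →
        (∀ v ∈ V, Complex.exp (logBranch v) = v (Fin.last k) ∧
          (Fin.init v, logBranch v) ∈ Isomonodromy.convRegion n k W Φ ε) →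
        Isomonodromy.IsSolution n (k + 1) V (fun v => Ψ (Fin.init v) (logBranch v))) := by
  have : NeZero n := ⟨by omega⟩
  refine ⟨Isomonodromy.nextCoef Φ, Isomonodromy.nextSum Φ, fun m q hq => ?_, fun z _ w => ?_,
    fun z hz lam P N hS m => hΦ.hasLogExpansion hε hbound hz hS m, hΦ.isOpen_convRegion hk,
    fun z w hp => ⟨?_, ?_⟩,
    fun V ℓ hV hℓ hV' => hΦ.isSolution_nextBranch hk hε hbound hV hℓ hV'⟩
  · exact (hΦ.differentiableAt_nextCoef hε hbound m hq.1).differentiableWithinAt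
  · exact Isomonodromy.coefPhi_zero _ _ _ _ _
  · have h := hΦ.summable_nextTerm hk hε hbound hp
    simp only [Isomonodromy.nextTerm] at h
    exact h
  · have h := hΦ.hasSum_nextSum hk hε hbound hp
    simp only [Isomonodromy.nextTerm] at h
    exact h
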